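/- **Setting.** Let $M'$ be a (Hausdorff, second countable) complex manifold of dimension $n$ with complex structure tensor $J$, equipped with a holomorphic $S^1$-action $x\mapsto e^{i\theta}\circ x$, and let $T$ be the real vector field generating the action. Let $\rho\in C^\infty(M',\mathbb R)$ be $S^1$-invariant, put $M=\{\rho<0\}$ and $X=\{\rho=0\}$, and assume that $d\rho\neq0$ at every point of $X$, that $\overline M$ is compact, that $X$ is connected, and that some $x\in X$ satisfies $e^{i\theta}\circ x\neq x$ for all $\theta\in(0,2\pi)$. Put $T^{1,0}X=T^{1,0}M'|_X\cap\mathbb CTX$ and $T^{0,1}X=\overline{T^{1,0}X}$, and assume that $$\mathbb CT(x)\oplus T^{1,0}_xX\oplus T^{0,1}_xX=\mathbb CT_xX\quad\text{and}\quad d\rho(JT)(x)<0\qquad\text{for all }x\in X .$$ Fix an $S^1$-invariant Hermitian metric on $M'$ such that on $X$ one has $T\perp T^{1,0}X\oplus T^{0,1}X$ and $|T|=1$. Let $dv_{M'}$ be its volume form, $(\,\cdot\,|\,\cdot\,)_M$ the induced $L^2$ inner product of $(0,q)$ forms on $M$, and $\|\cdot\|_M$ its norm. For $m\in\mathbb Z$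 let $\Omega^{0,q}_m(\overline M)$ be the space of restrictions to $M$ of smooth $(0,q)$ forms $u$ on $M'$ with $\mathcal L_Tu=imu$, and let $L^2_{(0,q),m}(M)$ be its $L^2$ completion. Let $\overline\partial_m:\mathrm{Dom}\,\overline\partial_m\subset L^2_{(0,q),m}(M)\to L^2_{(0,q+1),m}(M)$ be the (distributional) Cauchy-Riemann operator with domain $\{u\in L^2_{(0,q),m}(M):\overline\partial u\in L^2_{(0,q+1),m}(M)\}$, let $\overline\partial_m^\star$ be its Hilbert space adjoint, and let $\Box^{(q)}_m=\overline\partial_m\overline\partial_m^\star+\overline\partial_m^\star\overline\partial_m$ with domain $$\mathrm{Dom}\,\Box^{(q)}_m=\{u\in L^2_{(0,q),m}(M):\ u\in\mathrm{Dom}\,\overline\partial_m\cap\mathrm{Dom}\,\overline\partial_m^\star,\ \overline\partial_mu\in\mathrm{Dom}\,\overline\partial_m^\star,\ \overline\partial_m^\star u\in\mathrm{Dom}\,\overline\partial_m\}$$ (for $q=0$ the term $\overline\partial_m\overline\partial_m^\star$ and the conditions involving $\overline\partial_m^\star u$ are absent). Let $\|\cdot\|_{1,\overline M}$ be the Sobolev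 norm of order $1$ on $\overline M$, computed with a finite family of holomorphic coordinate patches of the given atlas covering $\overline M$ and a subordinate smooth partition of unity $(\chi_i)$: $\|u\|_{1,\overline M}^2$ is the sum over $i$, over the coefficients $(\chi_iu)_I$ of $\chi_iu$ in the coordinates, and over $|\alpha|\le1$, of $\int_M|\partial_x^\alpha(\chi_iu)_I|^2dv_{M'}$. **Theorem.** Let $q\in\{0,1,\dots,n-1\}$ and $m\in\mathbb Z$. There exists $C_m>0$ such that for every $u\in\mathrm{Dom}\,\Box^{(q)}_m\cap\Omega^{0,q}_m(\overline M)$, $$\|u\|_{1,\overline M}\leq C_m\bigl(\|\Box^{(q)}_mu\|_M+\|u\|_M\bigr).$$ -/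

import Mathlib

open scoped Manifold ContDiff
open MeasureTheory

noncomputable section

namespace DbarNeumann

/-- The model space `ℂⁿ`. -/
abbrev Cn (n : ℕ) : Type := EuclideanSpace ℂ (Fin n)

/-- The real tangent space `T_x M'` of a manifold modelled on `ℂⁿ`. As in Mathlib it is a copy of
`ℂⁿ`, identified with it through the preferred chart at `x`. -/
abbrev TS (n : ℕ) {M' : Type*} [TopologicalSpace M'] [ChartedSpace (Cn n) M'] (x : M') : Type :=
  TangentSpace 𝓘(ℝ, Cn n) x

/-- The space `Λ^q ℂT*_x M'` of complex valued alternating `ℝ`-multilinear `q`-forms on `T_x M'`. -/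
abbrev AltForm (n q : ℕ) {M' : Type*} [TopologicalSpace M'] [ChartedSpace (Cn n) M'] (x : M') :
    Type :=
  TS n x [⋀^Fin q]→L[ℝ] ℂ

/-- The real basis `e₁, i e₁, …, eₙ, i eₙ` of `ℂⁿ`, giving the real coordinates `x₁, …, x₂ₙ` with
`z_j = x_{2j-1} + i x_{2j}`. -/
def rb (n : ℕ) (a : Fin n × Fin 2) : Cn n :=
  (if a.2 = 0 then (1 : ℂ) else Complex.I) • EuclideanSpace.single a.1 (1 : ℂ)

/-- A complex manifold is a smooth real manifold. -/
instance realManifold (n : ℕ) (M' : Type*) [TopologicalSpace M'] [ChartedSpace (Cn n) M']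
    [h : IsManifold 𝓘(ℂ, Cn n) ω M'] : IsManifold 𝓘(ℝ, Cn n) ∞ M' := by
  refine isManifold_of_contDiffOn _ _ _ fun e e' he he' => ?_
  have h1 := (contDiffGroupoid ω 𝓘(ℂ, Cn n)).compatible he he'
  rw [contDiffGroupoid, mem_groupoid_of_pregroupoid] at h1
  have h2 : ContDiffOn ℂ ω (e.symm ≫ₕ e') (e.symm ≫ₕ e').source := by
    simpa [contDiffPregroupoid] using h1.1
  simpa using (h2.restrict_scalars ℝ).of_le le_top

section Geometry

variable (n : ℕ) {M' : Type*} [TopologicalSpace M'] [ChartedSpace (Cn n) M']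

/-- The complex structure tensor `J` of `M'` at `x`: multiplication by `i` in a holomorphic
chart. -/
def J (x : M') : TS n x →L[ℝ] TS n x :=
  (Complex.I • ContinuousLinearMap.id ℝ (Cn n) : Cn n →L[ℝ] Cn n)

/-- A holomorphic `S¹`-action on `M'`: it is jointly smooth and every `e^{iθ}` acts by a holomorphic
map. -/
structure IsHolomorphicCircleAction (M' : Type*) [TopologicalSpace M'] [ChartedSpace (Cn n) M']
    [MulAction Circle M'] : Prop where
  smooth : ContMDiff (𝓘(ℝ, ℝ).prod 𝓘(ℝ, Cn n)) 𝓘(ℝ, Cn n) ∞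
    (fun p : ℝ × M' => Circle.exp p.1 • p.2)
  holomorphic : ∀ c : Circle, MDifferentiable 𝓘(ℂ, Cn n) 𝓘(ℂ, Cn n) (fun x : M' => c • x)

/-- The differential at `x` of the map `e^{iθ}`. -/
def actDeriv [MulAction Circle M'] (c : Circle) (x : M') : TS n x →L[ℝ] TS n (c • x) :=
  mfderiv 𝓘(ℝ, Cn n) 𝓘(ℝ, Cn n) (fun y : M' => c • y) x

/-- The real vector field `T` generating the `S¹`-action, `T(x) = ∂/∂θ (e^{iθ} ∘ x)` at `θ = 0`. -/
def T [MulAction Circle M'] (x : M') : TS n x :=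
  (mfderiv 𝓘(ℝ, ℝ) 𝓘(ℝ, Cn n) (fun θ : ℝ => Circle.exp θ • x) 0 (1 : ℝ) : Cn n)

/-- The differential `dρ(x)` of a real function. -/
def dfun (ρ : M' → ℝ) (x : M') : TS n x →L[ℝ] ℝ :=
  mfderiv 𝓘(ℝ, Cn n) 𝓘(ℝ, ℝ) ρ x

/-- The domain `M = {ρ < 0}`. -/
def dom (ρ : M' → ℝ) : Set M' := {x | ρ x < 0}

/-- The boundary `X = {ρ = 0}`. -/
def bdry (ρ : M' → ℝ) : Set M' := {x | ρ x = 0}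

/-- The tangent space `T_x X = ker dρ(x)` of the boundary. -/
def tangentX (ρ : M' → ℝ) (x : M') : Submodule ℝ (TS n x) :=
  LinearMap.ker (dfun n ρ x : TS n x →ₗ[ℝ] ℝ)

/-- The complex tangent space `T_x X ∩ J T_x X` of the boundary, that is, the real subspace of
`T_x X` whose complexification is `T^{1,0}_x X ⊕ T^{0,1}_x X`. -/
def holTangentX (ρ : M' → ℝ) (x : M') : Submodule ℝ (TS n x) :=
  tangentX n ρ x ⊓ (tangentX n ρ x).comap (J n x : TS n x →ₗ[ℝ] TS n x)

/-- `ρ` is an `S¹`-invariant smooth real defining function (of `M = {ρ < 0}` and its boundary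
`X = {ρ = 0}`). -/
structure IsInvariantDefiningFunction [MulAction Circle M'] (ρ : M' → ℝ) : Prop where
  smooth : ContMDiff 𝓘(ℝ, Cn n) 𝓘(ℝ, ℝ) ∞ ρ
  regular : ∀ x ∈ bdry ρ, dfun n ρ x ≠ 0
  invariant : ∀ (c : Circle) (x : M'), ρ (c • x) = ρ x

/-- `ℝ T(x) ⊕ (T_x X ∩ J T_x X) = T_x X` for all `x ∈ X`; complexified, this is
`ℂ T(x) ⊕ T^{1,0}_x X ⊕ T^{0,1}_x X = ℂ T_x X`. -/
def IsTransversal [MulAction Circle M'] (ρ : M' → ℝ) : Prop :=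
  ∀ x ∈ bdry ρ, Disjoint (Submodule.span ℝ {T n x}) (holTangentX n ρ x) ∧
    Submodule.span ℝ {T n x} ⊔ holTangentX n ρ x = tangentX n ρ x

end Geometry

section Forms

variable {n : ℕ} {M' : Type*} [TopologicalSpace M'] [ChartedSpace (Cn n) M']

/-- The expression of a `q`-form in the coordinates given by `e`, i.e. its pullback under
`e⁻¹`. -/
def inChart {q : ℕ} (e : OpenPartialHomeomorph M' (Cn n)) (u : (x : M') → AltForm n q x)
    (y : Cn n) : Cn n [⋀^Fin q]→L[ℝ] ℂ :=
  (u (e.symm y)).compContinuousLinearMap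
    (mfderiv 𝓘(ℝ, Cn n) 𝓘(ℝ, Cn n) e.symm y : Cn n →L[ℝ] TS n (e.symm y))

/-- `α` is of type `(0,q)`: it is conjugate linear in every argument. -/
def IsType0 {q : ℕ} {x : M'} (α : AltForm n q x) : Prop :=
  ∀ (v : Fin q → TS n x) (i : Fin q),
    α (Function.update v i (J n x (v i))) = -Complex.I * α v

/-- `u ∈ Ω^{0,q}(M')`: smooth `(0,q)` forms on `M'`. -/
structure IsSmoothForm {q : ℕ} (u : (x : M') → AltForm n q x) : Prop where
  type0 : ∀ x, IsType0 (u x)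
  smooth : ∀ e ∈ atlas (Cn n) M', ContDiffOn ℝ ∞ (inChart e u) e.target

/-- `(e^{iθ})^* u` at the point `x`. -/
def actPullback [MulAction Circle M'] {q : ℕ} (c : Circle) (u : (x : M') → AltForm n q x) (x : M') :
    AltForm n q x :=
  (u (c • x)).compContinuousLinearMap (actDeriv n c x)

/-- `u ∈ Ω^{0,q}_m(M')`: smooth `(0,q)` forms with `L_T u = i m u`, where the Lie derivative `L_T u`
is the derivative of `(e^{iθ})^* u` at `θ = 0`. -/
structure IsFourierForm [MulAction Circle M'] {q : ℕ} (m : ℤ) (u : (x : M') → AltForm n q x) :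
    Prop extends IsSmoothForm u where
  lie : ∀ x, HasDerivAt (fun θ : ℝ => actPullback (Circle.exp θ) u x)
    ((Complex.I * (m : ℂ)) • u x) 0

end Forms

section Metric

variable {n : ℕ} {M' : Type*} [TopologicalSpace M'] [ChartedSpace (Cn n) M']
  [IsManifold 𝓘(ℂ, Cn n) ω M']

variable (n M') in
/-- Smooth Riemannian metrics on `M'`. -/
abbrev RMetric : Type _ :=
  Bundle.ContMDiffRiemannianMetric 𝓘(ℝ, Cn n) ∞ (Cn n) (fun x : M' => TangentSpace 𝓘(ℝ, Cn n) x)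

/-- `g` is Hermitian (`J` is orthogonal for `g`), i.e. `g` is the restriction to `TM'` of a Hermitian
metric on `ℂTM'`. -/
def IsHermitianMetric (g : RMetric n M') : Prop :=
  ∀ (x : M') (v w : TS n x), g.inner x (J n x v) (J n x w) = g.inner x v w

/-- `g` is invariant under the `S¹`-action. -/
def IsInvariantMetric [MulAction Circle M'] (g : RMetric n M') : Prop :=
  ∀ (c : Circle) (x : M') (v w : TS n x),
    g.inner (c • x) (actDeriv n c x v) (actDeriv n c x w) = g.inner x v w

/-- On `X`, the field `T` has length one and is orthogonal to `T^{1,0}X ⊕ T^{0,1}X`. -/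
def IsAdaptedMetric [MulAction Circle M'] (g : RMetric n M') (ρ : M' → ℝ) : Prop :=
  ∀ x ∈ bdry ρ, g.inner x (T n x) (T n x) = 1 ∧
    ∀ v ∈ holTangentX n ρ x, g.inner x (T n x) v = 0

/-- The matrix of `g` at `x` in the real basis `rb n` of `T_x M'`. -/
def gram (g : RMetric n M') (x : M') : Matrix (Fin n × Fin 2) (Fin n × Fin 2) ℝ :=
  Matrix.of fun a b => g.inner x (rb n a : Cn n) (rb n b : Cn n)

/-- The Hermitian inner product on `Λ^q ℂT*_x M'` induced by `g` (conjugate linear in the second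
variable): `⟨α|β⟩ = (1/q!) ∑ g^{i₁k₁} ⋯ g^{i_q k_q} α_{i₁…i_q} conj β_{k₁…k_q}`. For an orthonormal
coframe `ωʲ` the forms `ω^{j₁} ∧ ⋯ ∧ ω^{j_q}`, `j₁ < ⋯ < j_q`, are orthonormal. -/
def formInner {q : ℕ} (g : RMetric n M') {x : M'} (α β : AltForm n q x) : ℂ :=
  ((q.factorial : ℂ))⁻¹ * ∑ I : Fin q → Fin n × Fin 2, ∑ K : Fin q → Fin n × Fin 2,
    ((∏ s, (gram g x)⁻¹ (I s) (K s) : ℝ) : ℂ) *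
      (α (fun s => (rb n (I s) : Cn n)) * (starRingEnd ℂ) (β (fun s => (rb n (K s) : Cn n))))

/-- `|α|²` for the induced Hermitian inner product. -/
def formNormSq {q : ℕ} (g : RMetric n M') {x : M'} (α : AltForm n q x) : ℝ :=
  (formInner g α α).re

/-- The matrix of `g` in the real coordinates given by `e`, as a function on the chart. -/
def gramInChart (g : RMetric n M') (e : OpenPartialHomeomorph M' (Cn n)) (y : Cn n) :
    Matrix (Fin n × Fin 2) (Fin n × Fin 2) ℝ :=
  Matrix.of fun a b => g.inner (e.symm y)
    ((mfderiv 𝓘(ℝ, Cn n) 𝓘(ℝ, Cn n) e.symm y : Cn n →L[ℝ] TS n (e.symm y)) (rb n a))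
    ((mfderiv 𝓘(ℝ, Cn n) 𝓘(ℝ, Cn n) e.symm y : Cn n →L[ℝ] TS n (e.symm y)) (rb n b))

variable [MeasurableSpace M']

/-- The measure `√(det g) dx₁ ⋯ dx₂ₙ` of the coordinate patch `e`, as a measure on `M'` (zero outside
the patch). -/
def chartVolume (g : RMetric n M') (e : OpenPartialHomeomorph M' (Cn n)) : Measure M' :=
  (((volume : Measure (Cn n)).restrict e.target).withDensity
    (fun y => ENNReal.ofReal (Real.sqrt (gramInChart g e y).det))).map e.symm

/-- The Riemannian volume measure `dv_{M'}`. The measures `chartVolume g e` agree on the overlaps of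
the coordinate patches by the change of variables formula, and `dv_{M'}` is the measure obtained by
gluing them, which is their least upper bound. -/
def vol (g : RMetric n M') : Measure M' :=
  sSup (chartVolume g '' atlas (Cn n) M')

end Metric

section L2

variable {n : ℕ} {M' : Type*} [TopologicalSpace M'] [ChartedSpace (Cn n) M']
  [IsManifold 𝓘(ℂ, Cn n) ω M'] [MeasurableSpace M']

/-- `u` is (a representative of) an element of `L²_{(0,q)}(M)`: a measurable section over `M` of the
bundle of `(0,q)` forms with `∫_M |u|² dv < ∞`. (Values outside `M` play no role.) -/
structure IsL2Form {q : ℕ} (g : RMetric n M') (M : Set M') (u : (x : M') → AltForm n q x) :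
    Prop where
  type0 : ∀ x ∈ M, IsType0 (u x)
  measurable : ∀ e ∈ atlas (Cn n) M', AEStronglyMeasurable (inChart e u)
    ((volume : Measure (Cn n)).restrict (e.target ∩ e.symm ⁻¹' M))
  integrable : IntegrableOn (fun x => formNormSq g (u x)) M (vol g)

/-- `(u | v)_M = ∫_M ⟨u|v⟩ dv`. -/
def l2Inner {q : ℕ} (g : RMetric n M') (M : Set M') (u v : (x : M') → AltForm n q x) : ℂ :=
  ∫ x in M, formInner g (u x) (v x) ∂(vol g)

/-- The norm `‖u‖_M` of `L²_{(0,q)}(M)`. -/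
def l2Norm {q : ℕ} (g : RMetric n M') (M : Set M') (u : (x : M') → AltForm n q x) : ℝ :=
  Real.sqrt (∫ x in M, formNormSq g (u x) ∂(vol g))

/-- `u ∈ L²_{(0,q),m}(M)`: the closure of `Ω^{0,q}_m(M̄)`, the space of restrictions to `M` of elements
of `Ω^{0,q}_m(M')`, in `L²_{(0,q)}(M)`. -/
structure IsL2Fourier [MulAction Circle M'] {q : ℕ} (g : RMetric n M') (M : Set M') (m : ℤ)
    (u : (x : M') → AltForm n q x) : Prop extends IsL2Form g M u where
  approx : ∀ ε > 0, ∃ w : (x : M') → AltForm n q x,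
    IsFourierForm m w ∧ l2Norm g M (fun x => u x - w x) < ε

/-- `∂̄_v φ = (D_v φ + i D_{iv} φ) / 2` for a function `φ` on `ℂⁿ`; for `v = e_j` this is
`∂φ/∂z̄_j`. -/
def dbarDir {n : ℕ} (φ : Cn n → ℂ) (y v : Cn n) : ℂ :=
  (1 / 2 : ℂ) * (fderiv ℝ φ y v + Complex.I * fderiv ℝ φ y (Complex.I • v))

/-- `f = ∂̄u` on the open set `M` in the sense of distributions, for `(0,q)` forms `u` with locally
integrable coefficients. In a holomorphic chart, `∂̄u (v₀, …, v_q) =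
∑ⱼ (-1)ʲ ∂̄_{vⱼ} (u (v₀, …, v̂ⱼ, …, v_q))` for constant vectors `v₀, …, v_q`; the derivatives are moved
to test functions supported in the part of `M` covered by the chart. -/
def IsWeakDbar {q : ℕ} (M : Set M') (u : (x : M') → AltForm n q x)
    (f : (x : M') → AltForm n (q + 1) x) : Prop :=
  ∀ e ∈ atlas (Cn n) M', ∀ φ : Cn n → ℂ, ContDiff ℝ ∞ φ → HasCompactSupport φ →
    tsupport φ ⊆ e.target ∩ e.symm ⁻¹' M → ∀ v : Fin (q + 1) → Cn n,
      ∫ y, inChart e f y v * φ y =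
        -∑ j : Fin (q + 1), (-1 : ℂ) ^ (j : ℕ) *
          ∫ y, inChart e u y (j.removeNth v) * dbarDir φ y (v j)

variable [MulAction Circle M']

/-- The graph of `∂̄_m : Dom ∂̄_m ⊂ L²_{(0,q),m}(M) → L²_{(0,q+1),m}(M)`, where `u ∈ Dom ∂̄_m` means that
`u ∈ L²_{(0,q),m}(M)` and `∂̄u ∈ L²_{(0,q+1),m}(M)`. -/
def DbarGraph {q : ℕ} (g : RMetric n M') (M : Set M') (m : ℤ) (u : (x : M') → AltForm n q x)
    (f : (x : M') → AltForm n (q + 1) x) : Prop :=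
  IsL2Fourier g M m u ∧ IsL2Fourier g M m f ∧ IsWeakDbar M u f

/-- The graph of the Hilbert space adjoint
`∂̄_m^* : Dom ∂̄_m^* ⊂ L²_{(0,q+1),m}(M) → L²_{(0,q),m}(M)` of `∂̄_m`. -/
def DbarStarGraph {q : ℕ} (g : RMetric n M') (M : Set M') (m : ℤ)
    (u : (x : M') → AltForm n (q + 1) x) (w : (x : M') → AltForm n q x) : Prop :=
  IsL2Fourier g M m u ∧ IsL2Fourier g M m w ∧
    ∀ (v : (x : M') → AltForm n q x) (v' : (x : M') → AltForm n (q + 1) x),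
      DbarGraph g M m v v' → l2Inner g M v' u = l2Inner g M v w

/-- The graph of `□_m^{(q)} = ∂̄_m ∂̄_m^* + ∂̄_m^* ∂̄_m`: `BoxGraph g M m q u f` says that `u ∈ Dom □_m^{(q)}`,
i.e. `u ∈ Dom ∂̄_m ∩ Dom ∂̄_m^*`, `∂̄_m u ∈ Dom ∂̄_m^*`, `∂̄_m^* u ∈ Dom ∂̄_m`, and that `□_m^{(q)} u = f`
almost everywhere on `M`. In degree `q = 0` the term `∂̄_m ∂̄_m^*` is absent. -/
def BoxGraph (g : RMetric n M') (M : Set M') (m : ℤ) :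
    (q : ℕ) → (u f : (x : M') → AltForm n q x) → Prop
  | 0, u, f => ∃ (a : (x : M') → AltForm n 1 x) (b : (x : M') → AltForm n 0 x),
      DbarGraph g M m u a ∧ DbarStarGraph g M m a b ∧
      ∀ᵐ x ∂((vol g).restrict M), f x = b x
  | q + 1, u, f => ∃ (a : (x : M') → AltForm n (q + 2) x) (b : (x : M') → AltForm n (q + 1) x)
      (c : (x : M') → AltForm n q x) (d : (x : M') → AltForm n (q + 1) x),
      DbarGraph g M m u a ∧ DbarStarGraph g M m a b ∧
      DbarStarGraph g M m u c ∧ DbarGraph g M m c d ∧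
      ∀ᵐ x ∂((vol g).restrict M), f x = d x + b x

end L2

section Sobolev

variable {n : ℕ} {M' : Type*} [TopologicalSpace M'] [ChartedSpace (Cn n) M']
  [IsManifold 𝓘(ℂ, Cn n) ω M'] [MeasurableSpace M']

/-- The coefficient functions, in the coordinates given by `e`, of the form `χ u`. -/
def localCoeff {q : ℕ} (e : OpenPartialHomeomorph M' (Cn n)) (χ : M' → ℝ)
    (u : (x : M') → AltForm n q x) (I : Fin q → Fin n × Fin 2) (y : Cn n) : ℂ :=
  (χ (e.symm y) : ℂ) * inChart e u y (fun s => rb n (I s))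

/-- `∑_{|α| ≤ 1} ∑_I ∫_M |∂_x^α (χ u)_I|² dv` for one coordinate patch `e`. -/
def localSobolevSq {q : ℕ} (g : RMetric n M') (M : Set M') (e : OpenPartialHomeomorph M' (Cn n))
    (χ : M' → ℝ) (u : (x : M') → AltForm n q x) : ℝ :=
  ∑ I : Fin q → Fin n × Fin 2, ∫ x in M ∩ e.source,
    (‖localCoeff e χ u I (e x)‖ ^ 2 +
      ∑ a : Fin n × Fin 2, ‖fderiv ℝ (localCoeff e χ u I) (e x) (rb n a)‖ ^ 2) ∂(vol g)

/-- The Sobolev norm `‖u‖_{1,M̄}` of a smooth form, computed with finitely many coordinate patches `e i`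
and a partition of unity `χ i` subordinate to them. -/
def sobolevNorm {ι : Type} [Fintype ι] {q : ℕ} (g : RMetric n M') (M : Set M')
    (e : ι → OpenPartialHomeomorph M' (Cn n)) (χ : ι → M' → ℝ)
    (u : (x : M') → AltForm n q x) : ℝ :=
  Real.sqrt (∑ i, localSobolevSq g M (e i) (χ i) u)

end Sobolev

end DbarNeumann

end

set_option linter.unusedSectionVars false

noncomputable section

namespace DbarNeumann

open Filter Topology ComplexConjugate
open Finset (sum_congr mul_sum sum_nonneg sum_mul sum_le_sum sum_add_distrib sum_sub_distrib sum_comm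
  sum_mul_sum single_le_sum sum_neg_distrib sum_eq_zero card_univ sum_const mem_univ)
open Complex (ofRealCLM norm_real real_smul norm_I conjCLE ofReal_re continuous_re re_ofReal_mul
  ofReal_sum continuous_ofReal continuous_conj add_re I_sq I_mul_I ofReal_zero conj_re
  conj_ofReal conj_conj conj_I)
open Set (inter_subset_left inter_subset_right indicator_of_mem indicator_of_notMem mem_preimage
  inter_subset_inter_left)
open Real (norm_of_nonneg norm_eq_abs sqrt_nonneg sq_sqrt sqrt_pos)

variable {n q : ℕ}

/-- The real Fréchet derivative. -/
notation "ð" => fderiv ℝ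

/-- Real smooth functions. -/
notation "Smooth" => ContDiff ℝ ∞

/-- Functions which are real smooth on a set. -/
notation "SmoothOn" => ContDiffOn ℝ ∞

/-- The imaginary unit. -/
notation "î" => Complex.I

/-- Evaluation of forms at a tuple of vectors. -/
notation "evL" => ContinuousAlternatingMap.apply ℝ (Cn _) ℂ

/-- Real bilinear forms on `ℂⁿ`. -/
notation "Bil" n:max => Cn n →L[ℝ] Cn n →L[ℝ] ℝ

/-! ### Alternating forms on `ℂⁿ` -/

/-- Complex valued real alternating forms on `ℂⁿ`. -/
abbrev Form (n q : ℕ) : Type := Cn n [⋀^Fin q]→L[ℝ] ℂ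

/-- Forms of type `(0,q)` on `ℂⁿ`. -/
def IsT0 (α : Form n q) : Prop :=
  ∀ (v : Fin q → Cn n) (i : Fin q), α (Function.update v i (î • v i)) = -î * α v

lemma rb_zero (n : ℕ) (a : Fin n) : rb n (a, 0) = EuclideanSpace.single a (1 : ℂ) := by
  simp [rb]

lemma rb_one (n : ℕ) (a : Fin n) : rb n (a, 1) = î • EuclideanSpace.single a (1 : ℂ) := by
  simp [rb]

/-- The `j`-th real coordinate. -/
def rc (n : ℕ) (a : Fin n × Fin 2) (v : Cn n) : ℝ :=
  if a.2 = 0 then (v a.1).re else (v a.1).im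

lemma sum_rc_rb (n : ℕ) (v : Cn n) : ∑ a, rc n a v • rb n a = v := by
  rw [Fintype.sum_prod_type]
  simp only [Fin.sum_univ_two, rb_zero, rb_one, rc]
  ext i
  simp only [PiLp.add_apply, PiLp.smul_apply, WithLp.ofLp_sum, Finset.sum_apply]
  simp [sum_add_distrib]

lemma rc_rb (n : ℕ) (a b : Fin n × Fin 2) : rc n a (rb n b) = if b = a then 1 else 0 := by
  obtain ⟨a, i⟩ := a
  obtain ⟨b, j⟩ := b
  by_cases h : a = b
  · subst h
    fin_cases i <;> fin_cases j <;> simp [rc, rb]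
  · have h' : ¬ b = a := fun h2 => h h2.symm
    fin_cases i <;> fin_cases j <;> simp [rc, rb, h, h']

lemma linearIndependent_rb (n : ℕ) : LinearIndependent ℝ (rb n) := by
  rw [Fintype.linearIndependent_iff]
  intro c hc b
  have hadd : ∀ x : Fin n × Fin 2 → ℝ, rc n b (∑ a, x a • rb n a) = x b := by
    intro x
    have h1 : rc n b (∑ a, x a • rb n a) = ∑ a, x a * rc n b (rb n a) := by
      simp only [rc]
      split_ifs <;> simp
    rw [h1]
    simp [rc_rb]
  rw [← hadd c, hc]
  simp [rc]

/-- The vectors `rb n` as a real basis of `ℂⁿ`. -/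
def rbB (n : ℕ) : Module.Basis (Fin n × Fin 2) ℝ (Cn n) :=
  Module.Basis.mk (linearIndependent_rb n) (by
    intro v _
    rw [← sum_rc_rb n v]
    exact Submodule.sum_mem _ fun a _ => Submodule.smul_mem _ _ (Submodule.subset_span ⟨a, rfl⟩))

@[simp] lemma rbB_apply (n : ℕ) (a : Fin n × Fin 2) : rbB n a = rb n a := by simp [rbB]

/-- The components of a form in a family of vectors. -/
def comps {ι : Type*} (f : ι → Cn n) (α : Form n q) (I : Fin q → ι) : ℂ :=
  α (fun s => f (I s))

/-- The `q`-fold tensor power of a real matrix. -/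
def tp {ι κ : Type*} (q : ℕ) (P : Matrix ι κ ℝ) : Matrix (Fin q → ι) (Fin q → κ) ℂ :=
  Matrix.of fun I K => ((∏ s, P (I s) (K s) : ℝ) : ℂ)

lemma tp_mul {ι κ μ : Type*} [Fintype κ] (q : ℕ) (P : Matrix ι κ ℝ) (Q : Matrix κ μ ℝ) :
    tp q (P * Q) = tp q P * tp q Q := by
  classical
  ext I K
  simp only [tp, Matrix.of_apply, Matrix.mul_apply]
  rw [Finset.prod_univ_sum, Fintype.piFinset_univ]
  push_cast
  refine sum_congr rfl fun J _ => ?_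
  rw [Finset.prod_mul_distrib]

lemma tp_one {ι : Type*} [DecidableEq ι] (q : ℕ) : tp q (1 : Matrix ι ι ℝ) = 1 := by
  ext I K
  simp only [tp, Matrix.of_apply, Matrix.one_apply]
  by_cases h : I = K
  · subst h; simp
  · obtain ⟨s, hs⟩ := Function.ne_iff.1 h
    rw [if_neg h, Finset.prod_eq_zero (mem_univ s) (by simp [hs])]
    simp

lemma tp_transpose {ι κ : Type*} (q : ℕ) (P : Matrix ι κ ℝ) :
    tp q P.transpose = (tp q P).transpose := by
  ext I K
  simp [tp]

/-- The inner product of forms attached to a Gram matrix. -/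
def fInner (G : Matrix (Fin n × Fin 2) (Fin n × Fin 2) ℝ) (α β : Form n q) : ℂ :=
  ((q.factorial : ℂ))⁻¹ * ∑ I : Fin q → Fin n × Fin 2, ∑ K : Fin q → Fin n × Fin 2,
    ((∏ s, G⁻¹ (I s) (K s) : ℝ) : ℂ) * (α (fun s => rb n (I s)) * conj (β (fun s => rb n (K s))))

lemma fInner_eq (G : Matrix (Fin n × Fin 2) (Fin n × Fin 2) ℝ) (α β : Form n q) :
    fInner G α β = ((q.factorial : ℂ))⁻¹ *
      (comps (rb n) α ⬝ᵥ (tp q G⁻¹).mulVec (star (comps (rb n) β))) := by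
  simp only [fInner, dotProduct, Matrix.mulVec, comps, tp, Matrix.of_apply, Pi.star_apply, mul_sum]
  refine sum_congr rfl fun I _ => sum_congr rfl fun K _ => ?_
  simp only [Complex.star_def]
  ring

/-- Change of frame for the components of a form. -/
lemma comps_comp {ι κ : Type*} [Fintype κ] (f : ι → Cn n) (b : κ → Cn n)
    (P : Matrix κ ι ℝ) (h : ∀ i, f i = ∑ k, P k i • b k) (α : Form n q) :
    comps f α = Matrix.vecMul (comps b α) (tp q P) := by
  classical
  ext I
  simp only [comps, Matrix.vecMul, dotProduct, tp, Matrix.of_apply]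
  simp_rw [h]
  have h2 : α (fun s => ∑ k, P k (I s) • b k) =
      ∑ J : Fin q → κ, α (fun s => P (J s) (I s) • b (J s)) :=
    α.toMultilinearMap.map_sum (fun s k => P k (I s) • b k)
  rw [h2]
  refine sum_congr rfl fun J _ => ?_
  have h3 : α (fun s => P (J s) (I s) • b (J s)) = (∏ s, P (J s) (I s)) • α (fun s => b (J s)) :=
    α.toMultilinearMap.map_smul_univ (fun s => P (J s) (I s)) (fun s => b (J s))
  rw [h3]
  simp [mul_comm]

/-- The Gram matrix of a bilinear form in the basis `rb n`. -/
def gramB (B : Bil n) : Matrix (Fin n × Fin 2) (Fin n × Fin 2) ℝ :=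
  Matrix.of fun a b => B (rb n a) (rb n b)

/-- The pullback of a bilinear form. -/
def pullB (B : Bil n) (A : Cn n →L[ℝ] Cn n) : Bil n :=
  B.bilinearComp A A

@[simp] lemma pullB_apply (B : Bil n) (A : Cn n →L[ℝ] Cn n) (v w) :
    pullB B A v w = B (A v) (A w) := rfl

/-- The matrix of a real linear map in the basis `rb n`. -/
def matA (A : Cn n →L[ℝ] Cn n) : Matrix (Fin n × Fin 2) (Fin n × Fin 2) ℝ :=
  LinearMap.toMatrix (rbB n) (rbB n) (A : Cn n →ₗ[ℝ] Cn n)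

lemma apply_rb (A : Cn n →L[ℝ] Cn n) (i : Fin n × Fin 2) :
    A (rb n i) = ∑ k, matA A k i • rb n k := by
  have h := (rbB n).sum_repr (A (rb n i))
  simp only [rbB_apply] at h
  conv_lhs => rw [← h]
  refine sum_congr rfl fun k _ => ?_
  simp [matA, LinearMap.toMatrix_apply]

lemma det_matA (A : Cn n →L[ℝ] Cn n) : (matA A).det = A.det := by
  rw [matA, LinearMap.det_toMatrix]

lemma gramB_pullB (B : Bil n) (A : Cn n →L[ℝ] Cn n) :
    gramB (pullB B A) = (matA A).transpose * gramB B * matA A := by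
  ext a b
  simp only [gramB, Matrix.of_apply, pullB_apply, apply_rb, Matrix.mul_apply,
    Matrix.transpose_apply, map_sum, map_smul, sum_apply, smul_apply, smul_eq_mul, sum_mul, mul_sum]
  refine sum_congr rfl fun k _ => sum_congr rfl fun l _ => by ring

/-- The inner product of forms is invariant under pullback. -/
lemma fInner_pullback (B : Bil n) (A : Cn n →L[ℝ] Cn n) (hA : A.det ≠ 0) (α β : Form n q) :
    fInner (gramB (pullB B A)) (α.compContinuousLinearMap A) (β.compContinuousLinearMap A) =
      fInner (gramB B) α β := by
  rw [fInner_eq, fInner_eq]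
  congr 1
  have hc : ∀ γ : Form n q, comps (rb n) (γ.compContinuousLinearMap A) =
      Matrix.vecMul (comps (rb n) γ) (tp q (matA A)) := by
    intro γ
    have := comps_comp (fun i => A (rb n i)) (rb n) (matA A) (apply_rb A) γ
    rw [← this]
    rfl
  have hu : IsUnit (matA A).det := by rw [det_matA]; exact hA.isUnit
  have hs : star (Matrix.vecMul (comps (rb n) β) (tp q (matA A))) =
      (tp q (matA A).transpose).mulVec (star (comps (rb n) β)) := by
    rw [tp_transpose, Matrix.mulVec_transpose]
    ext K
    simp [Matrix.vecMul, dotProduct, tp]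
  rw [hc, hc, hs, Matrix.mulVec_mulVec, ← Matrix.dotProduct_mulVec, Matrix.mulVec_mulVec,
    ← tp_mul, ← tp_mul, gramB_pullB]
  congr 3
  rw [Matrix.mul_inv_rev, Matrix.mul_inv_rev]
  have h1 : (matA A) * (matA A)⁻¹ = 1 := Matrix.mul_nonsing_inv _ hu
  have h2 : ((matA A).transpose)⁻¹ * (matA A).transpose = 1 :=
    Matrix.nonsing_inv_mul _ (by rwa [Matrix.det_transpose])
  rw [← mul_assoc, ← mul_assoc, h1, one_mul, mul_assoc, h2, mul_one]

/-- The Riemannian density of a bilinear form. -/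
def dens (B : Bil n) : ℝ := Real.sqrt (gramB B).det

lemma dens_pullB (B : Bil n) (A : Cn n →L[ℝ] Cn n) : dens (pullB B A) = |A.det| * dens B := by
  rw [dens, dens, gramB_pullB, Matrix.det_mul, Matrix.det_mul, Matrix.det_transpose, det_matA,
    mul_comm, ← mul_assoc, Real.sqrt_mul (mul_self_nonneg _), Real.sqrt_mul_self_eq_abs]

/-- Hermitian inner products on `ℂⁿ`, as real bilinear forms. -/
structure IsHerm (B : Bil n) : Prop where
  symm : ∀ v w, B v w = B w v
  pos : ∀ v, v ≠ 0 → 0 < B v v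
  herm : ∀ v w, B (î • v) (î • w) = B v w

/-- `E` is a unitary frame. -/
def IsUnitary {ι : Type*} [DecidableEq ι] (B : Bil n) (E : ι → Cn n) : Prop :=
  ∀ a b, B (E a) (E b) = (if a = b then 1 else 0) ∧ B (E a) (î • E b) = 0

/-- The real frame `E₁, i E₁, …` of a unitary frame. -/
def rf {ι : Type*} (E : ι → Cn n) (a : ι × Fin 2) : Cn n :=
  if a.2 = 0 then E a.1 else î • E a.1

lemma IsUnitary.inner_rf {ι : Type*} [DecidableEq ι] {B : Bil n}
    (hB : IsHerm B) {E : ι → Cn n} (hE : IsUnitary B E) (a b : ι × Fin 2) :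
    B (rf E a) (rf E b) = if a = b then 1 else 0 := by
  obtain ⟨a, i⟩ := a
  obtain ⟨b, j⟩ := b
  have h1 := hE a b
  have h2 := hE b a
  fin_cases i <;> fin_cases j <;> simp [rf, h1, hB.herm]
  rw [hB.symm, h2.2]

/-- A unitary frame is a basis: coordinates are inner products. -/
lemma IsUnitary.sum_rf {B : Bil n}
    (hB : IsHerm B) {E : Fin n → Cn n} (hE : IsUnitary B E) (v : Cn n) :
    ∑ a, B (rf E a) v • rf E a = v := by
  have hli : LinearIndependent ℝ (rf E) := by
    rw [Fintype.linearIndependent_iff]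
    intro c hc b
    have := congrArg (fun w => B (rf E b) w) hc
    simpa [map_sum, hE.inner_rf hB] using this
  have hcard : Fintype.card (Fin n × Fin 2) = Module.finrank ℝ (Cn n) := by
    rw [Module.finrank_eq_card_basis (rbB n)]
  let bb := Module.Basis.mk hli (hli.span_eq_top_of_card_eq_finrank' hcard).ge
  have hbb : ⇑bb = rf E := Module.Basis.coe_mk _ _
  have h := bb.sum_repr v
  rw [hbb] at h
  conv_rhs => rw [← h]
  refine sum_congr rfl fun a _ => ?_
  congr 1
  conv_lhs => rw [← h]
  simp [map_sum, hE.inner_rf hB]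

/-- In an orthonormal frame the inner product of forms is the standard one. -/
lemma fInner_unitary_real {B : Bil n}
    (hB : IsHerm B) {E : Fin n → Cn n} (hE : IsUnitary B E) (α β : Form n q) :
    fInner (gramB B) α β = ((q.factorial : ℂ))⁻¹ *
      ∑ I : Fin q → Fin n × Fin 2, α (fun s => rf E (I s)) * conj (β (fun s => rf E (I s))) := by
  let A : Cn n →L[ℝ] Cn n := LinearMap.toContinuousLinearMap ((rbB n).constr ℝ (rf E))
  have hA : ∀ a, A (rb n a) = rf E a := by
    intro a
    have := (rbB n).constr_basis ℝ (rf E) a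
    simpa [A] using this
  have hG : gramB (pullB B A) = 1 := by
    ext a b
    simp [gramB, hA, hE.inner_rf hB, Matrix.one_apply]
  have hdet : A.det ≠ 0 := by
    intro h0
    have := congrArg Matrix.det (gramB_pullB B A)
    rw [hG, Matrix.det_mul, Matrix.det_mul, det_matA, h0] at this
    simp at this
  rw [← fInner_pullback B A hdet, hG, fInner_eq, inv_one, tp_one, Matrix.one_mulVec]
  simp only [dotProduct, comps, Pi.star_apply, Complex.star_def,
    ContinuousAlternatingMap.compContinuousLinearMap_apply, Function.comp_def, hA]

lemma IsT0.apply_rf {ι : Type*} {α : Form n q} (hα : IsT0 α) (E : ι → Cn n)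
    (I : Fin q → ι × Fin 2) : α (fun s => rf E (I s)) = (∏ s, if (I s).2 = 0 then 1 else -î) *
      α (fun s => E (I s).1) := by
  classical
  have key : ∀ S : Finset (Fin q), α (fun s => if s ∈ S then rf E (I s) else E (I s).1) =
      (∏ s ∈ S, if (I s).2 = 0 then 1 else -î) * α (fun s => E (I s).1) := by
    intro S
    induction S using Finset.induction_on with
    | empty => simp
    | insert a S ha ih =>
      rw [Finset.prod_insert ha, mul_assoc, ← ih]
      by_cases h : (I a).2 = 0
      · rw [if_pos h, one_mul]
        congr 1
        ext s : 1
        by_cases hs : s = a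
        · subst hs; simp [ha, rf, h]
        · simp [hs]
      · rw [if_neg h, ← hα _ a]
        congr 1
        ext s : 1
        by_cases hs : s = a
        · subst hs; simp [ha, rf, h]
        · simp [hs]
  simpa using key Finset.univ

/-- In a unitary frame the inner product of `(0,q)` forms is the standard one. -/
lemma fInner_unitary {B : Bil n}
    (hB : IsHerm B) {E : Fin n → Cn n} (hE : IsUnitary B E) {α β : Form n q} (hα : IsT0 α)
    (hβ : IsT0 β) : fInner (gramB B) α β = ((q.factorial : ℂ))⁻¹ * 2 ^ q *
      ∑ I : Fin q → Fin n, α (fun s => E (I s)) * conj (β (fun s => E (I s))) := by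
  rw [fInner_unitary_real hB hE, mul_assoc]
  congr 1
  have h1 : ∀ I : Fin q → Fin n × Fin 2, α (fun s => rf E (I s)) * conj (β (fun s => rf E (I s))) =
      α (fun s => E (I s).1) * conj (β (fun s => E (I s).1)) := by
    intro I
    rw [hα.apply_rf, hβ.apply_rf, map_mul, map_prod]
    have : (∏ s, if (I s).2 = 0 then (1 : ℂ) else -î) *
        ∏ s, conj (if (I s).2 = 0 then (1 : ℂ) else -î) = 1 := by
      rw [← Finset.prod_mul_distrib]
      refine Finset.prod_eq_one fun s _ => ?_
      split_ifs <;> simp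
    calc _ = ((∏ s, if (I s).2 = 0 then (1 : ℂ) else -î) *
        ∏ s, conj (if (I s).2 = 0 then (1 : ℂ) else -î)) * 
        (α (fun s => E (I s).1) * conj (β (fun s => E (I s).1))) := by ring
      _ = _ := by rw [this, one_mul]
  simp_rw [h1]
  rw [← (Equiv.arrowProdEquivProdArrow (Fin q) (fun _ => Fin n) (fun _ => Fin 2)).symm.sum_comp,
    Fintype.sum_prod_type]
  simp [Equiv.arrowProdEquivProdArrow, mul_sum]

/-! ### The symbol of `∂̄` -/

/-- The conjugate linear part `(f v + i f (i v)) / 2` of a real linear map. -/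
def conjPart : (Cn n →L[ℝ] Form n q) →L[ℝ] (Cn n →L[ℝ] Form n q) :=
  ((1 / 2 : ℝ) • ContinuousLinearMap.id ℝ _) +
    (ContinuousLinearMap.compL ℝ (Cn n) (Form n q) (Form n q)
      ((î / 2 : ℂ) • ContinuousLinearMap.id ℝ (Form n q))).comp
    ((ContinuousLinearMap.compL ℝ (Cn n) (Cn n) (Form n q)).flip
      (î • ContinuousLinearMap.id ℝ (Cn n)))

lemma conjPart_apply (f : Cn n →L[ℝ] Form n q) (v : Cn n) :
    conjPart f v = (1 / 2 : ℂ) • (f v + î • f (î • v)) := by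
  ext w
  simp [conjPart]
  ring

/-- The symbol of `∂̄`, acting on the derivative of a form. -/
def dbarL : (Cn n →L[ℝ] Form n q) →L[ℝ] Form n (q + 1) :=
  (ContinuousAlternatingMap.alternatizeUncurryFinCLM ℝ (Cn n) ℂ).comp conjPart

lemma dbarL_apply (f : Cn n →L[ℝ] Form n q) (v : Fin (q + 1) → Cn n) :
    dbarL f v = ∑ j : Fin (q + 1), (-1 : ℂ) ^ (j : ℕ) * ((1 / 2 : ℂ) * (f (v j) (j.removeNth v) +
        î * f (î • v j) (j.removeNth v))) := by
  simp [dbarL, ContinuousAlternatingMap.alternatizeUncurryFin_apply, conjPart_apply, mul_add]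

lemma dbarL_smul (c : ℂ) (f : Cn n →L[ℝ] Form n q) : dbarL (c • f) = c • dbarL f := by
  ext v
  simp only [dbarL_apply, smul_apply, ContinuousAlternatingMap.smul_apply, smul_eq_mul, mul_sum]
  refine sum_congr rfl fun j _ => by ring

lemma isT0_dbarL (f : Cn n →L[ℝ] Form n q) (hf : ∀ v, IsT0 (f v)) : IsT0 (dbarL f) := by
  intro v i
  rw [dbarL_apply, dbarL_apply, mul_sum]
  refine sum_congr rfl fun j _ => ?_
  rcases eq_or_ne j i with rfl | hji
  · rw [Fin.removeNth_update, Function.update_self, smul_smul, I_mul_I, neg_one_smul,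
      map_neg, ContinuousAlternatingMap.neg_apply]
    linear_combination (1 / 2 : ℂ) * (-1) ^ (j : ℕ) * (f (î • v j) (j.removeNth v)) * I_sq
  · obtain ⟨k, rfl⟩ := Fin.exists_succAbove_eq hji.symm
    rw [Fin.removeNth_update_succAbove, Function.update_of_ne hji]
    have h1 := hf (v j) (j.removeNth v) k
    have h2 := hf (î • v j) (j.removeNth v) k
    simp only [Fin.removeNth] at h1 h2 ⊢
    rw [h1, h2]
    ring

/-! ### Algebra of the symbol of `∂̄` in a frame -/

lemma form_insertNth {ι : Type*} (U : Form n (q + 1)) (E : ι → Cn n) (j : Fin (q + 1))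
    (a : ι) (K : Fin q → ι) : U (fun s => E (j.insertNth (α := fun _ => ι) a K s)) =
      (-1) ^ (j : ℕ) * U (Fin.cons (E a) fun s => E (K s)) := by
  have h : (fun s => E (j.insertNth (α := fun _ => ι) a K s)) =
      j.insertNth (α := fun _ => Cn n) (E a) (fun s => E (K s)) := by
    ext s : 1
    refine Fin.succAboveCases j ?_ (fun t => ?_) s <;> simp
  rw [h, ContinuousAlternatingMap.map_insertNth]
  simp [Matrix.vecCons]

lemma neg_one_pow_mul_self (j : ℕ) (z : ℂ) : (-1) ^ j * ((-1) ^ j * z) = z := by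
  rw [← mul_assoc, ← mul_pow]
  simp

/-- The adjoint of the symbol of `∂̄` in a frame. -/
lemma sum_dbarL_mul_conj {ι : Type*} [Fintype ι] (f : Cn n →L[ℝ] Form n q)
    (U : Form n (q + 1)) (E : ι → Cn n) : ∑ I : Fin (q + 1) → ι, dbarL f (fun s => E (I s)) *
        conj (U fun s => E (I s)) =
      (q + 1) * ∑ a : ι, ∑ K : Fin q → ι, conjPart f (E a) (fun s => E (K s)) *
        conj (U (Fin.cons (E a) fun s => E (K s))) := by
  have h1 : ∀ I : Fin (q + 1) → ι, dbarL f (fun s => E (I s)) = ∑ j : Fin (q + 1), (-1) ^ (j : ℕ) *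
        conjPart f (E (I j)) (fun s => E (j.removeNth I s)) := by
    intro I
    rw [dbarL_apply]
    refine sum_congr rfl fun j _ => ?_
    rw [conjPart_apply]
    rfl
  simp_rw [h1, sum_mul]
  rw [sum_comm]
  have h2 : ∀ j : Fin (q + 1), ∑ I : Fin (q + 1) → ι, (-1) ^ (j : ℕ) *
        conjPart f (E (I j)) (fun s => E (j.removeNth I s)) * conj (U fun s => E (I s)) =
      ∑ a : ι, ∑ K : Fin q → ι, conjPart f (E a) (fun s => E (K s)) *
        conj (U (Fin.cons (E a) fun s => E (K s))) := by
    intro j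
    rw [← (Fin.insertNthEquiv (fun _ => ι) j).sum_comp, Fintype.sum_prod_type]
    refine sum_congr rfl fun a _ => sum_congr rfl fun K _ => ?_
    have hr : j.removeNth ((Fin.insertNthEquiv (fun _ => ι) j) (a, K)) = K :=
      Fin.removeNth_insertNth _ _ _
    rw [hr]
    simp only [Fin.insertNthEquiv_apply, Fin.insertNth_apply_same, form_insertNth, map_mul, map_pow, map_neg, map_one]
    rw [← neg_one_pow_mul_self (j : ℕ) (conjPart f (E a) (fun s => E (K s)) * _)]
    ring
  simp_rw [h2]
  simp

/-- The basic algebraic identity of the `∂̄`-Neumann problem. -/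
lemma sum_dbarL_sq {n p : ℕ} {ι : Type*} [Fintype ι] (f : Cn n →L[ℝ] Form n (p + 1))
    (E : ι → Cn n) : ∑ I : Fin (p + 2) → ι, dbarL f (fun s => E (I s)) *
        conj (dbarL f fun s => E (I s)) =
      (p + 2) * (∑ a : ι, ∑ K : Fin (p + 1) → ι, conjPart f (E a) (fun s => E (K s)) *
          conj (conjPart f (E a) (fun s => E (K s))) - (p + 1) * ∑ a : ι, ∑ b : ι, ∑ K : Fin p → ι,
          conjPart f (E a) (Fin.cons (E b) fun s => E (K s)) *
          conj (conjPart f (E b) (Fin.cons (E a) fun s => E (K s)))) := by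
  rw [sum_dbarL_mul_conj]
  push_cast
  rw [show ((p : ℂ) + 1 + 1) = p + 2 by ring]
  congr 1
  have h1 : ∀ (a : ι) (K : Fin (p + 1) → ι),
      dbarL f (Fin.cons (E a) fun s => E (K s)) = conjPart f (E a) (fun s => E (K s)) -
        ∑ j : Fin (p + 1), (-1) ^ (j : ℕ) *
          conjPart f (E (K j)) (Fin.cons (E a) fun s => E (j.removeNth K s)) := by
    intro a K
    have h0 : ∀ v : Fin (p + 2) → Cn n, dbarL f v = ∑ j : Fin (p + 2), (-1 : ℂ) ^ (j : ℕ) *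
        conjPart f (v j) (j.removeNth v) := by
      intro v
      rw [dbarL_apply]
      refine sum_congr rfl fun j _ => ?_
      rw [conjPart_apply]
      rfl
    rw [h0, Fin.sum_univ_succ, sub_eq_add_neg, ← sum_neg_distrib]
    congr 1
    · simp [Fin.removeNth_zero]
    · refine sum_congr rfl fun j _ => ?_
      have : (j.succ).removeNth (α := fun _ => Cn n) (Fin.cons (E a) fun s => E (K s)) =
          Fin.cons (E a) fun s => E (j.removeNth K s) := by
        ext s : 1
        refine Fin.cases ?_ (fun t => ?_) s
        · simp [Fin.removeNth]
        · simp [Fin.removeNth]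
      rw [this]
      simp [pow_succ]
  simp_rw [h1, map_sub, mul_sub, sum_sub_distrib]
  congr 1
  have h2 : ∀ a : ι, ∑ K : Fin (p + 1) → ι, conjPart f (E a) (fun s => E (K s)) *
      conj (∑ j : Fin (p + 1), (-1) ^ (j : ℕ) *
          conjPart f (E (K j)) (Fin.cons (E a) fun s => E (j.removeNth K s))) =
      (p + 1) * ∑ b : ι, ∑ K : Fin p → ι, conjPart f (E a) (Fin.cons (E b) fun s => E (K s)) *
          conj (conjPart f (E b) (Fin.cons (E a) fun s => E (K s))) := by
    intro a
    simp_rw [map_sum, mul_sum]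
    rw [sum_comm]
    have h3 : ∀ j : Fin (p + 1), ∑ K : Fin (p + 1) → ι, conjPart f (E a) (fun s => E (K s)) *
        conj ((-1) ^ (j : ℕ) * conjPart f (E (K j)) (Fin.cons (E a) fun s => E (j.removeNth K s))) =
        ∑ b : ι, ∑ K : Fin p → ι, conjPart f (E a) (Fin.cons (E b) fun s => E (K s)) *
          conj (conjPart f (E b) (Fin.cons (E a) fun s => E (K s))) := by
      intro j
      rw [← (Fin.insertNthEquiv (fun _ => ι) j).sum_comp, Fintype.sum_prod_type]
      refine sum_congr rfl fun b _ => sum_congr rfl fun K _ => ?_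
      have hr : j.removeNth ((Fin.insertNthEquiv (fun _ => ι) j) (b, K)) = K :=
        Fin.removeNth_insertNth _ _ _
      rw [hr]
      simp only [Fin.insertNthEquiv_apply, Fin.insertNth_apply_same, form_insertNth, map_mul, map_pow, map_neg, map_one]
      rw [← neg_one_pow_mul_self (j : ℕ)
        (conjPart f (E a) (Fin.cons (E b) fun s => E (K s)) * _)]
      ring
    simp_rw [h3]
    simp [mul_sum]
  simp_rw [h2]
  rw [← mul_sum]

/-! ### Unitary frames -/

lemma IsHerm.inner_I_smul_self {B : Bil n} (hB : IsHerm B) (v : Cn n) : B v (î • v) = 0 := by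
  have h1 := hB.herm v (î • v)
  rw [smul_smul, I_mul_I, neg_one_smul, map_neg, hB.symm] at h1
  linarith

lemma IsHerm.inner_I_smul_left {B : Bil n} (hB : IsHerm B) (v w : Cn n) :
    B (î • v) w = - B v (î • w) := by
  have h1 := hB.herm v (î • w)
  rw [smul_smul, I_mul_I, neg_one_smul, map_neg] at h1
  linarith

lemma exists_unitary_extension {n k : ℕ} (hk : k < n) {B : Cn n → Bil n}
    {V : Set (Cn n)} (hV : IsOpen V) (hBs : SmoothOn B V) (hB : ∀ y ∈ V, IsHerm (B y))
    {p : Cn n} (hp : p ∈ V) (E : Fin k → Cn n → Cn n) (hE : ∀ i, SmoothOn (E i) V)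
    (hu : ∀ y ∈ V, IsUnitary (B y) fun i => E i y) :
    ∃ (W : Set (Cn n)) (e : Cn n → Cn n), IsOpen W ∧ p ∈ W ∧ W ⊆ V ∧ SmoothOn e W ∧
      ∀ y ∈ W, IsUnitary (B y) (fun i => Fin.snoc (α := fun _ => Cn n → Cn n) E e i y) := by
  have hfin : (Submodule.span ℝ (Set.range (rf fun i => E i p))) ≠ ⊤ := by
    intro htop
    have h1 := finrank_range_le_card (R := ℝ) (rf fun i => E i p)
    rw [Set.finrank, htop, finrank_top, Module.finrank_eq_card_basis (rbB n)] at h1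
    simp at h1
    omega
  obtain ⟨v, hv⟩ : ∃ v, v ∉ Submodule.span ℝ (Set.range (rf fun i => E i p)) := by
    by_contra! h
    exact hfin (Submodule.eq_top_iff'.2 h)
  let w : Cn n → Cn n := fun y => v - ∑ a, B y (rf (fun i => E i y) a) v • rf (fun i => E i y) a
  have hrf : ∀ a, SmoothOn (fun y => rf (fun i => E i y) a) V := by
    intro a
    unfold rf
    split_ifs
    · exact hE _
    · exact (hE _).const_smul _
  have hw : SmoothOn w V := by
    refine contDiffOn_const.sub (ContDiffOn.sum fun a _ => ?_)
    exact ((hBs.clm_apply (hrf a)).clm_apply contDiffOn_const).smul (hrf a)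
  have hwp : w p ≠ 0 := by
    intro h0
    refine hv ?_
    rw [sub_eq_zero.1 h0]
    exact Submodule.sum_mem _ fun a _ => Submodule.smul_mem _ _ (Submodule.subset_span ⟨a, rfl⟩)
  obtain ⟨W, hWV, hWo, hpW⟩ : ∃ W ⊆ V, IsOpen W ∧ p ∈ W ∧ ∀ y ∈ W, w y ≠ 0 := by
    refine ⟨V ∩ w ⁻¹' {0}ᶜ, inter_subset_left,
      hw.continuousOn.isOpen_inter_preimage hV isOpen_compl_singleton, ⟨hp, hwp⟩, ?_⟩
    intro y hy
    exact hy.2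
  have horth : ∀ y ∈ V, ∀ b, B y (rf (fun i => E i y) b) (w y) = 0 := by
    intro y hy b
    simp [w, map_sum, (hu y hy).inner_rf (hB y hy)]
  have hpos : ∀ y ∈ W, 0 < B y (w y) (w y) := fun y hy => (hB y (hWV hy)).pos _ (hpW.2 y hy)
  obtain ⟨e, he⟩ : ∃ e : Cn n → Cn n, ∀ y, e y = (Real.sqrt (B y (w y) (w y)))⁻¹ • w y :=
    ⟨_, fun _ => rfl⟩
  refine ⟨W, e, hWo, hpW.1, hWV, ?_, ?_⟩
  · have hw' := hw.mono hWV
    have h1 : SmoothOn (fun y => B y (w y) (w y)) W :=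
      ((hBs.mono hWV).clm_apply hw').clm_apply hw'
    have h2 : SmoothOn (fun y => Real.sqrt (B y (w y) (w y))) W :=
      h1.sqrt fun y hy => (hpos y hy).ne'
    rw [funext he]
    exact (h2.inv fun y hy => (sqrt_pos.2 (hpos y hy)).ne').smul hw'
  · intro y hy
    have hB' := hB y (hWV hy)
    have hu' := hu y (hWV hy)
    obtain ⟨c, hc⟩ : ∃ c, c = (Real.sqrt (B y (w y) (w y)))⁻¹ := ⟨_, rfl⟩
    have hey : e y = c • w y := by rw [hc, he]
    have hcc : c * (c * B y (w y) (w y)) = 1 := by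
      have := Real.mul_self_sqrt (hpos y hy).le
      rw [← mul_assoc, hc, ← mul_inv, this, inv_mul_cancel₀ (hpos y hy).ne']
    have h0 : ∀ i, B y (E i y) (w y) = 0 := fun i => by
      simpa [rf] using horth y (hWV hy) (i, 0)
    have h1 : ∀ i, B y (î • E i y) (w y) = 0 := fun i => by
      simpa [rf] using horth y (hWV hy) (i, 1)
    have h2 : ∀ i, B y (E i y) (î • w y) = 0 := fun i => by
      have := hB'.inner_I_smul_left (E i y) (w y)
      rw [h1] at this
      linarith
    have hIc : ∀ v : Cn n, î • c • v = c • î • v := fun v => smul_comm _ _ _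
    intro a b
    refine Fin.lastCases ?_ (fun a => ?_) a <;> refine Fin.lastCases ?_ (fun b => ?_) b
    · simp only [Fin.snoc_last, hey, hIc, map_smul, smul_apply, smul_eq_mul, hcc, if_true,
        hB'.inner_I_smul_self, mul_zero, and_self]
    · have hne : Fin.last k ≠ b.castSucc := (Fin.castSucc_lt_last b).ne'
      simp only [Fin.snoc_last, Fin.snoc_castSucc, hey, map_smul, smul_apply, smul_eq_mul, if_neg hne]
      rw [hB'.symm (w y), hB'.symm (w y), h0, h1]
      simp
    · have hne : a.castSucc ≠ Fin.last k := (Fin.castSucc_lt_last a).ne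
      simp only [Fin.snoc_last, Fin.snoc_castSucc, hey, hIc, map_smul, smul_eq_mul,
        if_neg hne, h0, h2, mul_zero, and_self]
    · simp only [Fin.snoc_castSucc, Fin.castSucc_inj]
      exact hu' a b

/-- Local smooth unitary frames, starting with the normalization of a given vector field. -/
lemma exists_unitary_frame (hn : 0 < n) {B : Cn n → Bil n}
    {V : Set (Cn n)} (hV : IsOpen V) (hBs : SmoothOn B V) (hB : ∀ y ∈ V, IsHerm (B y))
    {p : Cn n} (hp : p ∈ V) (τ : Cn n → Cn n) (hτ : SmoothOn τ V) (hτp : τ p ≠ 0) :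
    ∃ (W : Set (Cn n)) (E : Fin n → Cn n → Cn n), IsOpen W ∧ p ∈ W ∧ W ⊆ V ∧
      (∀ i, SmoothOn (E i) W) ∧ (∀ y ∈ W, IsUnitary (B y) fun i => E i y) ∧
      ∀ y ∈ W, E ⟨0, hn⟩ y = (Real.sqrt (B y (τ y) (τ y)))⁻¹ • τ y := by
  obtain ⟨W, hWV, hWo, hpW⟩ : ∃ W ⊆ V, IsOpen W ∧ p ∈ W ∧ ∀ y ∈ W, τ y ≠ 0 := by
    refine ⟨V ∩ τ ⁻¹' {0}ᶜ, inter_subset_left,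
      hτ.continuousOn.isOpen_inter_preimage hV isOpen_compl_singleton, ⟨hp, hτp⟩, ?_⟩
    intro y hy
    exact hy.2
  have hpos : ∀ y ∈ W, 0 < B y (τ y) (τ y) := fun y hy => (hB y (hWV hy)).pos _ (hpW.2 y hy)
  have key : ∀ k (hk : 0 < k), k ≤ n → ∃ (W : Set (Cn n)) (E : Fin k → Cn n → Cn n), IsOpen W ∧
      p ∈ W ∧ W ⊆ V ∧ (∀ i, SmoothOn (E i) W) ∧ (∀ y ∈ W, IsUnitary (B y) fun i => E i y) ∧
      ∀ y ∈ W, E ⟨0, hk⟩ y = (Real.sqrt (B y (τ y) (τ y)))⁻¹ • τ y := by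
    intro k hk
    induction k, hk using Nat.le_induction with
    | base =>
      intro _
      refine ⟨W, fun _ y => (Real.sqrt (B y (τ y) (τ y)))⁻¹ • τ y, hWo, hpW.1, hWV, ?_, ?_,
        fun _ _ => rfl⟩
      · intro _
        have hw' := hτ.mono hWV
        have h1 : SmoothOn (fun y => B y (τ y) (τ y)) W :=
          ((hBs.mono hWV).clm_apply hw').clm_apply hw'
        have h2 : SmoothOn (fun y => Real.sqrt (B y (τ y) (τ y))) W :=
          h1.sqrt fun y hy => (hpos y hy).ne'
        exact (h2.inv fun y hy => (sqrt_pos.2 (hpos y hy)).ne').smul hw'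
      · intro y hy a b
        have hcc : ∀ c, c = (Real.sqrt (B y (τ y) (τ y)))⁻¹ → c * (c * B y (τ y) (τ y)) = 1 := by
          intro c hc
          have := Real.mul_self_sqrt (hpos y hy).le
          rw [← mul_assoc, hc, ← mul_inv, this, inv_mul_cancel₀ (hpos y hy).ne']
        rw [Subsingleton.elim a b, if_pos rfl]
        refine ⟨?_, (hB y (hWV hy)).inner_I_smul_self _⟩
        simp only [map_smul, smul_apply, smul_eq_mul]
        exact hcc _ rfl
    | succ k hk ih =>
      intro hkn
      obtain ⟨W1, E, hW1, hpW1, hW1V, hEs, hEu, hE0⟩ := ih (by omega)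
      obtain ⟨W2, e, hW2, hpW2, hW21, hes, heu⟩ := exists_unitary_extension (by omega) hW1
        (hBs.mono hW1V) (fun y hy => hB y (hW1V hy)) hpW1 E hEs hEu
      refine ⟨W2, Fin.snoc (α := fun _ => Cn n → Cn n) E e, hW2, hpW2, hW21.trans hW1V, ?_, heu, ?_⟩
      · intro i
        refine Fin.lastCases ?_ (fun i => ?_) i
        · simpa using hes
        · simpa using (hEs i).mono hW21
      · intro y hy
        have : (⟨0, Nat.succ_pos k⟩ : Fin (k + 1)) = Fin.castSucc ⟨0, hk⟩ := rfl
        rw [this, Fin.snoc_castSucc]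
        exact hE0 y (hW21 hy)
  exact key n hn le_rfl

/-! ### Cutoff functions near the boundary -/

/-- A smooth cutoff function: it vanishes for `t ≤ -2ε` and equals one for `t ≥ -ε`. -/
def chiE (ε t : ℝ) : ℝ := Real.smoothTransition (t / ε + 2)

/-- The derivative of `chiE ε`. -/
def bl (ε t : ℝ) : ℝ := deriv (chiE ε) t

lemma contDiff_chiE (ε : ℝ) : Smooth (chiE ε) := by
  have h : Smooth Real.smoothTransition := Real.smoothTransition.contDiff (n := ⊤)
  exact h.comp ((contDiff_id.div_const ε).add contDiff_const)

lemma chiE_nonneg (ε t : ℝ) : 0 ≤ chiE ε t := Real.smoothTransition.nonneg _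

lemma chiE_le_one (ε t : ℝ) : chiE ε t ≤ 1 := Real.smoothTransition.le_one _

lemma chiE_eq_zero {ε t : ℝ} (hε : 0 < ε) (h : t ≤ -2 * ε) : chiE ε t = 0 := by
  apply Real.smoothTransition.zero_of_nonpos
  have : t / ε ≤ -2 := by rw [div_le_iff₀ hε]; exact h
  linarith

lemma chiE_eq_one {ε t : ℝ} (hε : 0 < ε) (h : -ε ≤ t) : chiE ε t = 1 := by
  apply Real.smoothTransition.one_of_one_le
  have : -1 ≤ t / ε := by rw [le_div_iff₀ hε]; linarith
  linarith

lemma hasDerivAt_chiE (ε t : ℝ) : HasDerivAt (chiE ε) (bl ε t) t :=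
  ((contDiff_chiE ε).differentiable (by simp) t).hasDerivAt

lemma contDiff_bl (ε : ℝ) : Smooth (bl ε) :=
  ((contDiff_infty_iff_deriv (𝕜 := ℝ)).1 (contDiff_chiE ε)).2

lemma bl_nonneg {ε : ℝ} (hε : 0 < ε) (t : ℝ) : 0 ≤ bl ε t := by
  have hm : Monotone (chiE ε) := by
    intro s t h
    exact Real.smoothTransition.monotone (by gcongr)
  exact hm.deriv_nonneg

lemma bl_eq_zero_of_lt {ε t : ℝ} (hε : 0 < ε) (h : t < -2 * ε) : bl ε t = 0 := by
  have : chiE ε =ᶠ[𝓝 t] fun _ => 0 := by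
    filter_upwards [Iio_mem_nhds h] with s hs
    exact chiE_eq_zero hε (le_of_lt hs)
  rw [bl, this.deriv_eq, deriv_const]

lemma bl_eq_zero_of_gt {ε t : ℝ} (hε : 0 < ε) (h : -ε < t) : bl ε t = 0 := by
  have : chiE ε =ᶠ[𝓝 t] fun _ => 1 := by
    filter_upwards [Ioi_mem_nhds h] with s hs
    exact chiE_eq_one hε (le_of_lt hs)
  rw [bl, this.deriv_eq, deriv_const]

lemma exists_bl_mul_abs_le : ∃ C, 0 ≤ C ∧ ∀ ε, 0 < ε → ∀ t, bl ε t * |t| ≤ C := by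
  have hc : Continuous (deriv Real.smoothTransition) :=
    ((contDiff_infty_iff_deriv (𝕜 := ℝ)).1
      (Real.smoothTransition.contDiff (n := ⊤))).2.continuous
  obtain ⟨C, hC⟩ := (isCompact_Icc (a := (0 : ℝ)) (b := 1)).exists_bound_of_continuousOn
    hc.continuousOn
  have hC0 : 0 ≤ C := (norm_nonneg _).trans (hC 0 (by simp))
  refine ⟨2 * C, by positivity, fun ε hε t => ?_⟩
  by_cases h1 : t < -2 * ε
  · rw [bl_eq_zero_of_lt hε h1]; simpa using hC0
  by_cases h2 : -ε < t
  · rw [bl_eq_zero_of_gt hε h2]; simpa using hC0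
  push Not at h1 h2
  have hd : bl ε t = deriv Real.smoothTransition (t / ε + 2) * (1 / ε) := by
    have h3 : HasDerivAt (fun s : ℝ => s / ε + 2) (1 / ε) t :=
      ((hasDerivAt_id t).div_const ε).add_const 2
    have h4 : HasDerivAt Real.smoothTransition (deriv Real.smoothTransition (t / ε + 2))
        (t / ε + 2) :=
      ((Real.smoothTransition.contDiff (n := ⊤)).differentiable (by simp) _).hasDerivAt
    exact (h4.comp t h3).deriv
  have hmem : t / ε + 2 ∈ Set.Icc (0 : ℝ) 1 := by
    constructor
    · have : -2 ≤ t / ε := by rw [le_div_iff₀ hε]; exact h1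
      linarith
    · have : t / ε ≤ -1 := by rw [div_le_iff₀ hε]; linarith
      linarith
  have h5 := (norm_eq_abs _ ▸ le_abs_self _).trans (hC _ hmem)
  have h6 : |t| ≤ 2 * ε := by rw [abs_le]; constructor <;> linarith
  have h7 : (1 / ε) * |t| ≤ 2 := by
    rw [one_div, inv_mul_le_iff₀ hε]; linarith
  calc bl ε t * |t| = deriv Real.smoothTransition (t / ε + 2) * ((1 / ε) * |t|) := by
        rw [hd]; ring
    _ ≤ C * ((1 / ε) * |t|) := by gcongr
    _ ≤ C * 2 := by gcongr
    _ = 2 * C := by ring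

lemma tendsto_chiE_of_neg {t : ℝ} (ht : t < 0) : Tendsto (fun ε => chiE ε t) (𝓝[>] 0) (𝓝 0) := by
  refine tendsto_const_nhds.congr' ?_
  filter_upwards [Ioo_mem_nhdsGT (show (0 : ℝ) < -t / 2 by linarith)] with ε hε
  exact (chiE_eq_zero hε.1 (by linarith [hε.2])).symm

lemma tendsto_bl_of_ne {t : ℝ} (ht : t ≠ 0) : Tendsto (fun ε => bl ε t) (𝓝[>] 0) (𝓝 0) := by
  refine tendsto_const_nhds.congr' ?_
  rcases lt_or_gt_of_ne ht with h | h
  · filter_upwards [Ioo_mem_nhdsGT (show (0 : ℝ) < -t / 2 by linarith)] with ε hε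
    exact (bl_eq_zero_of_lt hε.1 (by linarith [hε.2])).symm
  · filter_upwards [self_mem_nhdsWithin] with ε hε
    exact (bl_eq_zero_of_gt hε (by linarith [Set.mem_Ioi.1 hε])).symm

/-! ### Integration by parts on sublevel sets -/

/-- The part of the domain `{r < 0}` seen by the cutoff function `φ`. -/
def reg (φ r : Cn n → ℝ) : Set (Cn n) := {y | r y < 0} ∩ tsupport φ

lemma measurableSet_reg {φ r : Cn n → ℝ} (hr : Continuous r) : MeasurableSet (reg φ r) :=
  (isOpen_lt hr continuous_const).measurableSet.inter (isClosed_tsupport φ).measurableSet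

lemma integrableOn_reg {F : Type*} [NormedAddCommGroup F] {φ r : Cn n → ℝ}
    (hφ : HasCompactSupport φ) {h : Cn n → F} (hh : Continuous h) : IntegrableOn h (reg φ r) :=
  (hh.continuousOn.integrableOn_compact hφ.isCompact).mono_set inter_subset_right

lemma exists_bound_tsupport {F : Type*} [NormedAddCommGroup F] {φ : Cn n → ℝ}
    (hφ : HasCompactSupport φ) {c : Cn n → F} (hc : Continuous c) :
    ∃ C, 0 ≤ C ∧ ∀ y ∈ tsupport φ, ‖c y‖ ≤ C := by
  obtain ⟨C, hC⟩ := hφ.isCompact.exists_bound_of_continuousOn hc.continuousOn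
  exact ⟨max C 0, le_max_right _ _, fun y hy => (hC y hy).trans (le_max_left _ _)⟩

/-- `h` has vanishing (weighted) trace on `{r = 0}`. -/
def BNull (φ r h : Cn n → ℝ) : Prop :=
  Tendsto (fun ε => ∫ y, bl ε (r y) * (φ y) ^ 2 * h y) (𝓝[>] 0) (𝓝 0)

lemma integrable_bl {φ r h : Cn n → ℝ} (hφ : HasCompactSupport φ) (hφc : Continuous φ)
    (hr : Continuous r) (hh : Continuous h) (ε : ℝ) :
    Integrable fun y => bl ε (r y) * (φ y) ^ 2 * h y := by
  refine Continuous.integrable_of_hasCompactSupport ?_ ?_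
  · have := (contDiff_bl ε).continuous
    fun_prop
  · refine HasCompactSupport.mono hφ fun y hy => ?_
    exact fun h => hy (by simp [h])

lemma BNull.mono {φ r h h' : Cn n → ℝ} (hφ : HasCompactSupport φ) (hφc : Continuous φ)
    (hr : Continuous r) (hh : Continuous h) (hh' : Continuous h') (h0 : ∀ y, 0 ≤ h y)
    (hle : ∀ y ∈ tsupport φ, h y ≤ h' y) (hn : BNull φ r h') : BNull φ r h := by
  refine squeeze_zero' ?_ ?_ hn
  · filter_upwards [self_mem_nhdsWithin] with ε hε
    exact integral_nonneg fun y =>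
      mul_nonneg (mul_nonneg (bl_nonneg hε _) (sq_nonneg _)) (h0 y)
  · filter_upwards [self_mem_nhdsWithin] with ε hε
    refine integral_mono (integrable_bl hφ hφc hr hh ε) (integrable_bl hφ hφc hr hh' ε) fun y => ?_
    by_cases hy : y ∈ tsupport φ
    · exact mul_le_mul_of_nonneg_left (hle y hy) (mul_nonneg (bl_nonneg hε _) (sq_nonneg _))
    · simp [image_eq_zero_of_notMem_tsupport hy]

lemma BNull.const_mul {φ r h : Cn n → ℝ} (c : ℝ) (hn : BNull φ r h) :
    BNull φ r fun y => c * h y := by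
  have := Tendsto.const_mul c hn
  rw [mul_zero] at this
  refine this.congr fun ε => ?_
  rw [← integral_const_mul]
  congr 1 with y
  ring

lemma BNull.add {φ r h h' : Cn n → ℝ} (hφ : HasCompactSupport φ) (hφc : Continuous φ)
    (hr : Continuous r) (hh : Continuous h) (hh' : Continuous h') (hn : BNull φ r h)
    (hn' : BNull φ r h') : BNull φ r fun y => h y + h' y := by
  have := Tendsto.add hn hn'
  rw [add_zero] at this
  refine this.congr fun ε => ?_
  rw [← integral_add (integrable_bl hφ hφc hr hh ε) (integrable_bl hφ hφc hr hh' ε)]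
  congr 1 with y
  ring

/-- Multiplying by a continuous weight preserves vanishing traces. -/
lemma BNull.weight {φ r h c : Cn n → ℝ} (hφ : HasCompactSupport φ) (hφc : Continuous φ)
    (hr : Continuous r) (hh : Continuous h) (hc : Continuous c) (h0 : ∀ y, 0 ≤ h y)
    (hc0 : ∀ y, 0 ≤ c y) (hn : BNull φ r h) : BNull φ r fun y => c y * h y := by
  obtain ⟨C, hC0, hC⟩ := exists_bound_tsupport hφ hc
  refine BNull.mono hφ hφc hr (by fun_prop) (by fun_prop)
    (fun y => mul_nonneg (hc0 y) (h0 y)) (fun y hy => ?_) (hn.const_mul C)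
  have := hC y hy
  rw [norm_of_nonneg (hc0 y)] at this
  exact mul_le_mul_of_nonneg_right this (h0 y)

/-- Functions vanishing on a neighbourhood of `{r = 0}`, in the sense `r ≠ 0` on the support. -/
lemma bNull_of_forall_ne {φ r h : Cn n → ℝ} (hφ : HasCompactSupport φ)
    (hr : Continuous r) (hne : ∀ y ∈ tsupport φ, r y ≠ 0) : BNull φ r h := by
  obtain ⟨δ, hδ0, hδ⟩ : ∃ δ > 0, ∀ y ∈ tsupport φ, δ ≤ |r y| := by
    rcases (tsupport φ).eq_empty_or_nonempty with he | hne'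
    · exact ⟨1, one_pos, by simp [he]⟩
    · obtain ⟨y0, hy0, hmin⟩ := hφ.isCompact.exists_isMinOn hne' (hr.abs.continuousOn)
      exact ⟨|r y0|, abs_pos.2 (hne y0 hy0), fun y hy => hmin hy⟩
  refine tendsto_const_nhds.congr' ?_
  filter_upwards [Ioo_mem_nhdsGT (show (0 : ℝ) < δ / 2 by linarith)] with ε hε
  rw [eq_comm]
  refine integral_eq_zero_of_ae (ae_of_all _ fun y => ?_)
  by_cases hy : y ∈ tsupport φ
  · have : bl ε (r y) = 0 := by
      have hd := hδ y hy
      rcases le_or_gt 0 (r y) with h0 | h0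
      · exact bl_eq_zero_of_gt hε.1 (by linarith [hε.1])
      · rw [abs_of_neg h0] at hd
        exact bl_eq_zero_of_lt hε.1 (by linarith [hε.2])
    simp [this]
  · simp [image_eq_zero_of_notMem_tsupport hy]

/-- Functions which are `O(r)` have vanishing trace. -/
lemma bNull_of_le_abs {φ r h : Cn n → ℝ} (hφ : HasCompactSupport φ) (hφc : Continuous φ)
    (hr : Continuous r) (hh : Continuous h) {C : ℝ}
    (hle : ∀ y ∈ tsupport φ, r y < 0 → |h y| ≤ C * |r y|) : BNull φ r h := by
  obtain ⟨K, hK0, hK⟩ := exists_bl_mul_abs_le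
  suffices h : Tendsto (fun ε => ∫ y, bl ε (r y) * (φ y) ^ 2 * h y) (𝓝[>] 0)
      (𝓝 (∫ _ : Cn n, (0 : ℝ))) by simpa [BNull] using h
  refine tendsto_integral_filter_of_dominated_convergence
    (fun y => K * |C| * (φ y) ^ 2) ?_ ?_ ?_ ?_
  · exact Eventually.of_forall fun ε => (integrable_bl hφ hφc hr hh ε).aestronglyMeasurable
  · filter_upwards [self_mem_nhdsWithin] with ε hε
    refine ae_of_all _ fun y => ?_
    have hε' : (0 : ℝ) < ε := hε
    by_cases hy : y ∈ tsupport φ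
    · rcases le_or_gt 0 (r y) with h0 | h0
      · rw [bl_eq_zero_of_gt hε (by linarith)]
        simp only [zero_mul, norm_zero]
        positivity
      · rw [norm_mul, norm_mul, norm_of_nonneg (bl_nonneg hε _),
          norm_of_nonneg (sq_nonneg _), norm_eq_abs]
        have h1 := hle y hy h0
        have h2 := hK ε hε (r y)
        have h3 := bl_nonneg hε (r y)
        have h4 : C * |r y| ≤ |C| * |r y| := by gcongr; exact le_abs_self C
        calc bl ε (r y) * φ y ^ 2 * |h y| ≤ bl ε (r y) * φ y ^ 2 * (|C| * |r y|) := by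
              gcongr; exact h1.trans h4
          _ = (bl ε (r y) * |r y|) * |C| * φ y ^ 2 := by ring
          _ ≤ K * |C| * φ y ^ 2 := by gcongr
    · simp [image_eq_zero_of_notMem_tsupport hy]
  · refine Continuous.integrable_of_hasCompactSupport (by fun_prop) ?_
    refine HasCompactSupport.mono hφ fun y hy => ?_
    exact fun h => hy (by simp [h])
  · refine ae_of_all _ fun y => ?_
    by_cases hy : r y = 0
    · refine tendsto_const_nhds.congr' ?_
      filter_upwards [self_mem_nhdsWithin] with ε hε
      have hε' : (0 : ℝ) < ε := hε
      rw [bl_eq_zero_of_gt hε (by rw [hy]; linarith)]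
      simp
    · have := ((tendsto_bl_of_ne hy).mul_const ((φ y) ^ 2)).mul_const (h y)
      simpa using this

lemma integral_fderiv_apply_eq_zero {F : Cn n → ℂ} (hF : ContDiff ℝ 1 F)
    (hc : HasCompactSupport F) (v : Cn n) : ∫ y, ð F y v = 0 := by
  have h1 : Integrable fun y => ð F y v := by
    refine Continuous.integrable_of_hasCompactSupport ?_ (hc.fderiv_apply ℝ v)
    exact (hF.continuous_fderiv (by simp)).clm_apply continuous_const
  have h2 : Integrable F := hF.continuous.integrable_of_hasCompactSupport hc
  have := integral_mul_fderiv_eq_neg_fderiv_mul_of_integrable (μ := volume)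
    (f := fun _ : Cn n => (1 : ℂ)) (g := F) (v := v) (by simp) (by simpa using h1)
    (by simpa using h2) (fun _ _ => by fun_prop)
    (fun x _ => hF.differentiable (by simp) x)
  simpa using this

/-- The interchange of two constant coefficient derivatives. -/
lemma integral_swap_const {ψ f g : Cn n → ℂ} (hψ : Smooth ψ) (hψc : HasCompactSupport ψ)
    (hf : Smooth f) (hg : Smooth g) (v w : Cn n) :
    ∫ y, ψ y * (ð f y v * ð g y w - ð f y w * ð g y v) =
      -∫ y, f y * (ð ψ y v * ð g y w - ð ψ y w * ð g y v) := by
  have hdg : ∀ w, Smooth fun y => ð g y w := fun w =>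
    (hg.fderiv_right (by simp)).clm_apply contDiff_const
  have hF : ∀ w, Smooth fun y => ψ y * f y * ð g y w := fun w =>
    (hψ.mul hf).mul (hdg w)
  have hFc : ∀ w, HasCompactSupport fun y => ψ y * f y * ð g y w := fun w => by
    refine HasCompactSupport.mono hψc fun y hy => ?_
    exact fun h => hy (by simp [h])
  have hz := fun v w => integral_fderiv_apply_eq_zero ((hF w).of_le (by simp)) (hFc w) v
  have hI : ∀ v w, Integrable fun y => ð (fun y => ψ y * f y * ð g y w) y v := by
    intro v w
    refine Continuous.integrable_of_hasCompactSupport ?_ ((hFc w).fderiv_apply ℝ v)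
    exact ((hF w).continuous_fderiv (by simp)).clm_apply continuous_const
  have hd : ∀ y v w, ð (fun y => ψ y * f y * ð g y w) y v =
      ð ψ y v * f y * ð g y w + ψ y * ð f y v * ð g y w + ψ y * f y * ð (ð g) y v w := by
    intro y v w
    have h1 : HasFDerivAt ψ (ð ψ y) y := (hψ.differentiable (by simp) y).hasFDerivAt
    have h2 : HasFDerivAt f (ð f y) y := (hf.differentiable (by simp) y).hasFDerivAt
    have h3 : HasFDerivAt (ð g) (ð (ð g) y) y :=
      ((hg.fderiv_right (m := ∞) (by simp)).differentiable (by simp) y).hasFDerivAt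
    have h4 := (h1.mul h2).mul (h3.clm_apply (hasFDerivAt_const w y))
    have h5 := h4.fderiv
    simp only [Pi.mul_apply] at h5
    rw [show (fun y => ψ y * f y * ð g y w) = (ψ * f * fun y => (ð g y) w) from rfl, h5]
    simp
    ring
  have hsymm : ∀ y, ð (ð g) y v w = ð (ð g) y w v := by
    intro y
    have := (hg.contDiffAt (x := y)).isSymmSndFDerivAt (by
      simpa using WithTop.coe_le_coe.2 (le_top : (2 : ℕ∞) ≤ ⊤))
    exact this v w
  have key : ∀ y, ψ y * (ð f y v * ð g y w - ð f y w * ð g y v) =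
      (ð (fun y => ψ y * f y * ð g y w) y v - ð (fun y => ψ y * f y * ð g y v) y w) -
      f y * (ð ψ y v * ð g y w - ð ψ y w * ð g y v) := by
    intro y
    rw [hd, hd, hsymm y]
    ring
  simp_rw [key]
  have hdψ : ∀ v, Continuous fun y => ð ψ y v := fun v =>
    (hψ.continuous_fderiv (by simp)).clm_apply continuous_const
  rw [integral_sub ?_ ?_, integral_sub (hI v w) (hI w v), hz, hz]
  · simp
  · exact (hI v w).sub (hI w v)
  · refine Continuous.integrable_of_hasCompactSupport ?_ ?_
    · have := hdψ v
      have := hdψ w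
      have := (hdg v).continuous
      have := (hdg w).continuous
      have := hf.continuous
      fun_prop
    · refine HasCompactSupport.mono (hψc.fderiv ℝ) fun y hy => ?_
      exact fun h => hy (by simp [h])

lemma tendsto_setIntegral_chiE {F : Type*} [NormedAddCommGroup F] [NormedSpace ℝ F]
    {α : Type*} [MeasurableSpace α] {μ : Measure α} {r : α → ℝ} (hr : Measurable r)
    {h : α → F} (hh : IntegrableOn h {y | r y < 0} μ) :
    Tendsto (fun ε => ∫ y in {y | r y < 0}, chiE ε (r y) • h y ∂μ) (𝓝[>] 0) (𝓝 0) := by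
  have hm : MeasurableSet {y | r y < 0} := measurableSet_lt hr measurable_const
  suffices H : Tendsto (fun ε => ∫ y in {y | r y < 0}, chiE ε (r y) • h y ∂μ) (𝓝[>] 0)
      (𝓝 (∫ _ in {y | r y < 0}, (0 : F) ∂μ)) by simpa using H
  refine tendsto_integral_filter_of_dominated_convergence (fun y => ‖h y‖) ?_ ?_ hh.norm ?_
  · refine Eventually.of_forall fun ε => ?_
    exact ((contDiff_chiE ε).continuous.measurable.comp hr).aestronglyMeasurable.smul
      hh.aestronglyMeasurable
  · refine Eventually.of_forall fun ε => ae_of_all _ fun y => ?_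
    rw [norm_smul, norm_of_nonneg (chiE_nonneg _ _)]
    exact mul_le_of_le_one_left (norm_nonneg _) (chiE_le_one _ _)
  · refine (ae_restrict_iff' hm).2 (ae_of_all _ fun y hy => ?_)
    simpa using (tendsto_chiE_of_neg hy).smul_const (h y)

lemma integrable_chiE_smul {F : Type*} [NormedAddCommGroup F] [NormedSpace ℝ F]
    {α : Type*} [MeasurableSpace α] {μ : Measure α} {r : α → ℝ} (hr : Measurable r)
    {h : α → F} (hh : Integrable h μ) (ε : ℝ) : Integrable (fun y => chiE ε (r y) • h y) μ := by
  refine Integrable.mono' hh.norm ?_ (ae_of_all _ fun y => ?_)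
  · exact ((contDiff_chiE ε).continuous.measurable.comp hr).aestronglyMeasurable.smul
      hh.aestronglyMeasurable
  · rw [norm_smul, norm_of_nonneg (chiE_nonneg _ _)]
    exact mul_le_of_le_one_left (norm_nonneg _) (chiE_le_one _ _)

lemma tendsto_setIntegral_one_sub_chiE {F : Type*} [NormedAddCommGroup F] [NormedSpace ℝ F]
    {α : Type*} [MeasurableSpace α] {μ : Measure α} {r : α → ℝ} (hr : Measurable r)
    {h : α → F} (hh : IntegrableOn h {y | r y < 0} μ) :
    Tendsto (fun ε => ∫ y in {y | r y < 0}, (1 - chiE ε (r y)) • h y ∂μ) (𝓝[>] 0)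
      (𝓝 (∫ y in {y | r y < 0}, h y ∂μ)) := by
  have h1 := (tendsto_setIntegral_chiE hr hh).const_sub (∫ y in {y | r y < 0}, h y ∂μ)
  rw [sub_zero] at h1
  refine h1.congr fun ε => ?_
  rw [← integral_sub hh (integrable_chiE_smul hr hh ε)]
  congr 1 with y
  rw [sub_smul, one_smul]

lemma setIntegral_reg {F : Type*} [NormedAddCommGroup F] [NormedSpace ℝ F] {φ r : Cn n → ℝ}
    (hr : Continuous r) {h : Cn n → F} (h0 : ∀ y, y ∉ tsupport φ → h y = 0) :
    ∫ y in {y | r y < 0}, h y = ∫ y in reg φ r, h y := by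
  refine setIntegral_eq_of_subset_of_forall_sdiff_eq_zero
    (isOpen_lt hr continuous_const).measurableSet inter_subset_left fun y hy => ?_
  exact h0 y fun hy' => hy.2 ⟨hy.1, hy'⟩

/-- A vector in terms of its real coordinates. -/
lemma clm_eq_sum_rc {F : Type*} [NormedAddCommGroup F] [NormedSpace ℝ F] (L : Cn n →L[ℝ] F)
    (v : Cn n) : L v = ∑ a, rc n a v • L (rb n a) := by
  conv_lhs => rw [← sum_rc_rb n v]
  simp

lemma contDiff_rc (a : Fin n × Fin 2) : Smooth (rc n a) := by
  have h : ∀ i : Fin n, Smooth fun v : Cn n => v i := fun i => by fun_prop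
  unfold rc
  split_ifs
  · exact Complex.reCLM.contDiff.comp (h a.1)
  · exact Complex.imCLM.contDiff.comp (h a.1)

/-- **Interchange of derivatives on a domain.** The bilinear expression `Xf·Yg - Yf·Xg` integrates
to a lower order term when the boundary contribution vanishes. -/
lemma exists_swap_bound {φ r : Cn n → ℝ} (hφ : Smooth φ) (hφc : HasCompactSupport φ)
    (hr : Smooth r) {X Y : Cn n → Cn n} (hX : Smooth X) (hY : Smooth Y) :
    ∃ C, 0 ≤ C ∧ ∀ f g : Cn n → ℂ, Smooth f → Smooth g → BNull φ r (fun y => ‖f y‖ * ‖ð g y‖ *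
        (|ð r y (X y)| * ‖Y y‖ + |ð r y (Y y)| * ‖X y‖)) →
      ‖∫ y in reg φ r, ((φ y : ℂ) ^ 2) * (ð f y (X y) * ð g y (Y y) - ð f y (Y y) * ð g y (X y))‖ ≤
      C * ∫ y in reg φ r, ‖f y‖ * ‖ð g y‖ * |φ y| := by
  -- the weights
  let k : Fin n × Fin 2 → Fin n × Fin 2 → Cn n → ℝ := fun a b y => rc n a (X y) * rc n b (Y y)
  have hk : ∀ a b, Smooth (k a b) := fun a b =>
    ((contDiff_rc a).comp hX).mul ((contDiff_rc b).comp hY)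
  let P : Fin n × Fin 2 → Fin n × Fin 2 → Cn n → Cn n →L[ℝ] ℝ := fun a b y =>
    (2 * k a b y) • ð φ y + φ y • ð (k a b) y
  have hP : ∀ a b, Continuous (P a b) := fun a b => by
    have h1 := (hk a b).continuous
    have h2 := (hk a b).continuous_fderiv (by simp)
    have h3 := hφ.continuous_fderiv (by simp)
    have h4 := hφ.continuous
    fun_prop
  have hQ : Continuous fun y => ∑ a, ∑ b, 2 * (‖P a b y‖ * ‖rb n a‖ * ‖rb n b‖) := by fun_prop
  obtain ⟨C, hC0, hC⟩ := exists_bound_tsupport hφc hQ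
  refine ⟨C, hC0, fun f g hf hg hb => ?_⟩
  have hdf := hf.continuous_fderiv (by simp)
  have hdg := hg.continuous_fderiv (by simp)
  have hdr := hr.continuous_fderiv (by simp)
  have hfc := hf.continuous
  have hXc := hX.continuous
  have hYc := hY.continuous
  have hφc' := hφ.continuous
  have hrc := hr.continuous
  set S : Cn n → ℂ := fun y => ð f y (X y) * ð g y (Y y) - ð f y (Y y) * ð g y (X y) with hS
  have hSc : Continuous S := by fun_prop
  set h : Cn n → ℝ := fun y => ‖f y‖ * ‖ð g y‖ *
        (|ð r y (X y)| * ‖Y y‖ + |ð r y (Y y)| * ‖X y‖) with hh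
  have hhc : Continuous h := by fun_prop
  have hmeas := measurableSet_reg (φ := φ) hr.continuous
  -- the estimate for fixed `ε`
  have main : ∀ ε, 0 < ε → ‖∫ y in {y | r y < 0}, (1 - chiE ε (r y)) • ((φ y : ℂ) ^ 2 * S y)‖ ≤
      (C * ∫ y in reg φ r, ‖f y‖ * ‖ð g y‖ * |φ y|) + ∫ y, bl ε (r y) * (φ y) ^ 2 * h y := by
    intro ε hε
    let ψ : Fin n × Fin 2 → Fin n × Fin 2 → Cn n → ℝ := fun a b y =>
      (1 - chiE ε (r y)) * (φ y ^ 2 * k a b y)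
    have hψ : ∀ a b, Smooth (ψ a b) := fun a b =>
      (contDiff_const.sub ((contDiff_chiE ε).comp hr)).mul ((hφ.pow 2).mul (hk a b))
    have hψ' : ∀ a b, Smooth fun y => (ψ a b y : ℂ) := fun a b =>
      ofRealCLM.contDiff.comp (hψ a b)
    have hψc : ∀ a b, HasCompactSupport fun y => (ψ a b y : ℂ) := fun a b => by
      refine HasCompactSupport.mono hφc fun y hy => ?_
      exact fun h => hy (by simp [ψ, h])
    have hdψ : ∀ a b y v, ð (fun y => (ψ a b y : ℂ)) y v = (((1 - chiE ε (r y)) * φ y * P a b y v -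
          bl ε (r y) * φ y ^ 2 * k a b y * ð r y v : ℝ) : ℂ) := by
      intro a b y v
      have h1 : HasFDerivAt φ (ð φ y) y := (hφ.differentiable (by simp) y).hasFDerivAt
      have h2 : HasFDerivAt r (ð r y) y := (hr.differentiable (by simp) y).hasFDerivAt
      have h3 : HasFDerivAt (k a b) (ð (k a b) y) y :=
        ((hk a b).differentiable (by simp) y).hasFDerivAt
      have h4 := (hasDerivAt_chiE ε (r y)).comp_hasFDerivAt y h2
      have h5 := ((h4.const_sub 1).mul ((h1.pow 2).mul h3))
      have h6 : HasFDerivAt (fun y => (ψ a b y : ℂ)) _ y :=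
        ofRealCLM.hasFDerivAt.comp y h5
      rw [h6.fderiv]
      simp [P]
      ring
    have hsum : ∀ y, (1 - chiE ε (r y)) • ((φ y : ℂ) ^ 2 * S y) = ∑ a, ∑ b, (ψ a b y : ℂ) *
        (ð f y (rb n a) * ð g y (rb n b) - ð f y (rb n b) * ð g y (rb n a)) := by
      intro y
      simp only [hS]
      rw [clm_eq_sum_rc (ð f y) (X y), clm_eq_sum_rc (ð f y) (Y y),
        clm_eq_sum_rc (ð g y) (X y), clm_eq_sum_rc (ð g y) (Y y)]
      rw [mul_comm (∑ a, rc n a (Y y) • ð f y (rb n a))]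
      rw [sum_mul_sum, sum_mul_sum, ← sum_sub_distrib]
      simp_rw [← sum_sub_distrib, mul_sum, Finset.smul_sum]
      refine sum_congr rfl fun a _ => sum_congr rfl fun b _ => ?_
      simp only [ψ, k, real_smul]
      push_cast
      ring
    have hI : ∀ a b, Integrable fun y => (ψ a b y : ℂ) * (ð f y (rb n a) * ð g y (rb n b) -
          ð f y (rb n b) * ð g y (rb n a)) := by
      intro a b
      have h1 := (hψ' a b).continuous
      refine Continuous.integrable_of_hasCompactSupport (by fun_prop) (hψc a b).mul_right
    have hI' : ∀ a b, Integrable fun y => f y *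
        (ð (fun y => (ψ a b y : ℂ)) y (rb n a) * ð g y (rb n b) -
          ð (fun y => (ψ a b y : ℂ)) y (rb n b) * ð g y (rb n a)) := by
      intro a b
      have h1 := (hψ' a b).continuous_fderiv (by simp)
      refine Continuous.integrable_of_hasCompactSupport (by fun_prop) ?_
      refine HasCompactSupport.mono ((hψc a b).fderiv ℝ) fun y hy => ?_
      exact fun h => hy (by simp [h])
    have hext : ∫ y in {y | r y < 0}, (1 - chiE ε (r y)) • ((φ y : ℂ) ^ 2 * S y) =
        ∫ y, (1 - chiE ε (r y)) • ((φ y : ℂ) ^ 2 * S y) := by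
      apply setIntegral_eq_integral_of_forall_compl_eq_zero
      intro y hy
      rw [Set.mem_ofPred_eq, not_lt] at hy
      rw [chiE_eq_one hε (by linarith)]
      simp
    have hbound : ∀ y, ‖∑ a, ∑ b, f y * (ð (fun y => (ψ a b y : ℂ)) y (rb n a) * ð g y (rb n b) -
          ð (fun y => (ψ a b y : ℂ)) y (rb n b) * ð g y (rb n a))‖ ≤
        (reg φ r).indicator (fun y => C * (‖f y‖ * ‖ð g y‖ * |φ y|)) y +
          bl ε (r y) * (φ y) ^ 2 * h y := by
      intro y
      have hb0 := bl_nonneg hε (r y)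
      by_cases hy : y ∈ tsupport φ
      swap
      · have hφy := image_eq_zero_of_notMem_tsupport hy
        have hnr : y ∉ reg φ r := fun h => hy h.2
        simp_rw [hdψ]
        simp [hφy, hnr]
      have e1 : ∑ a, ∑ b, f y * (ð (fun y => (ψ a b y : ℂ)) y (rb n a) * ð g y (rb n b) -
          ð (fun y => (ψ a b y : ℂ)) y (rb n b) * ð g y (rb n a)) =
        (((1 - chiE ε (r y)) * φ y : ℝ) : ℂ) * f y * (∑ a, ∑ b,
          ((P a b y (rb n a) : ℂ) * ð g y (rb n b) - (P a b y (rb n b) : ℂ) * ð g y (rb n a))) -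
        ((bl ε (r y) * φ y ^ 2 : ℝ) : ℂ) * f y * ((ð r y (X y) : ℂ) * ð g y (Y y) -
            (ð r y (Y y) : ℂ) * ð g y (X y)) := by
        rw [clm_eq_sum_rc (ð r y) (X y), clm_eq_sum_rc (ð r y) (Y y),
          clm_eq_sum_rc (ð g y) (X y), clm_eq_sum_rc (ð g y) (Y y)]
        push_cast
        rw [mul_comm (∑ a, ((rc n a (Y y) • ð r y (rb n a) : ℝ) : ℂ))]
        rw [sum_mul_sum, sum_mul_sum, ← sum_sub_distrib]
        simp_rw [← sum_sub_distrib, mul_sum]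
        rw [← sum_sub_distrib]
        simp_rw [← sum_sub_distrib]
        refine sum_congr rfl fun a _ => sum_congr rfl fun b _ => ?_
        rw [hdψ, hdψ]
        simp only [k, real_smul, smul_eq_mul]
        push_cast
        ring
      rw [e1]
      refine (norm_sub_le _ _).trans (add_le_add ?_ ?_)
      · by_cases hr0 : r y < 0
        swap
        · have : chiE ε (r y) = 1 := chiE_eq_one hε (by linarith)
          rw [this]
          simp only [sub_self, zero_mul, ofReal_zero, norm_zero]
          exact Set.indicator_nonneg (fun y _ => by positivity) y
        rw [indicator_of_mem (show y ∈ reg φ r from ⟨hr0, hy⟩)]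
        rw [norm_mul, norm_mul, norm_real, norm_mul]
        have h1 : ‖1 - chiE ε (r y)‖ ≤ 1 := by
          rw [norm_eq_abs, abs_le]
          constructor <;> linarith [chiE_nonneg ε (r y), chiE_le_one ε (r y)]
        have h2 : ‖∑ a, ∑ b, ((P a b y (rb n a) : ℂ) * ð g y (rb n b) -
            (P a b y (rb n b) : ℂ) * ð g y (rb n a))‖ ≤ C * ‖ð g y‖ := by
          have h3 := hC y hy
          rw [norm_of_nonneg (by positivity)] at h3
          refine le_trans ?_ (mul_le_mul_of_nonneg_right h3 (norm_nonneg _))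
          rw [sum_mul]
          refine (norm_sum_le _ _).trans (sum_le_sum fun a _ => ?_)
          rw [sum_mul]
          refine (norm_sum_le _ _).trans (sum_le_sum fun b _ => ?_)
          refine (norm_sub_le _ _).trans ?_
          rw [norm_mul, norm_mul, norm_real, norm_real]
          have p1 := (P a b y).le_opNorm (rb n a)
          have p2 := (P a b y).le_opNorm (rb n b)
          have p3 := (ð g y).le_opNorm (rb n a)
          have p4 := (ð g y).le_opNorm (rb n b)
          calc ‖P a b y (rb n a)‖ * ‖ð g y (rb n b)‖ + ‖P a b y (rb n b)‖ * ‖ð g y (rb n a)‖ ≤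
              (‖P a b y‖ * ‖rb n a‖) * (‖ð g y‖ * ‖rb n b‖) +
                (‖P a b y‖ * ‖rb n b‖) * (‖ð g y‖ * ‖rb n a‖) := by gcongr
            _ = _ := by ring
        calc ‖1 - chiE ε (r y)‖ * ‖φ y‖ * ‖f y‖ * _ ≤ 1 * ‖φ y‖ * ‖f y‖ * (C * ‖ð g y‖) := by gcongr
          _ = C * (‖f y‖ * ‖ð g y‖ * |φ y|) := by rw [norm_eq_abs]; ring
      · rw [norm_mul, norm_mul, norm_real, norm_of_nonneg (by positivity)]
        have h2 : ‖(ð r y (X y) : ℂ) * ð g y (Y y) - (ð r y (Y y) : ℂ) * ð g y (X y)‖ ≤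
            ‖ð g y‖ * (|ð r y (X y)| * ‖Y y‖ + |ð r y (Y y)| * ‖X y‖) := by
          refine (norm_sub_le _ _).trans ?_
          rw [norm_mul, norm_mul, norm_real, norm_real, norm_eq_abs, norm_eq_abs]
          have p3 := (ð g y).le_opNorm (X y)
          have p4 := (ð g y).le_opNorm (Y y)
          calc |ð r y (X y)| * ‖ð g y (Y y)‖ +
                |ð r y (Y y)| * ‖ð g y (X y)‖ ≤
              |ð r y (X y)| * (‖ð g y‖ * ‖Y y‖) +
                |ð r y (Y y)| * (‖ð g y‖ * ‖X y‖) := by gcongr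
            _ = _ := by ring
        calc bl ε (r y) * φ y ^ 2 * ‖f y‖ * _ ≤ bl ε (r y) * φ y ^ 2 * ‖f y‖ * (‖ð g y‖ *
                (|ð r y (X y)| * ‖Y y‖ + |ð r y (Y y)| * ‖X y‖)) := by gcongr
          _ = _ := by simp only [hh]; ring
    rw [hext]
    have heq : ∫ y, (1 - chiE ε (r y)) • ((φ y : ℂ) ^ 2 * S y) = - ∫ y, ∑ a, ∑ b, f y *
        (ð (fun y => (ψ a b y : ℂ)) y (rb n a) * ð g y (rb n b) -
          ð (fun y => (ψ a b y : ℂ)) y (rb n b) * ð g y (rb n a)) := by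
      simp_rw [hsum]
      rw [integral_finsetSum _ fun a _ => integrable_finsetSum _ fun b _ => hI a b,
        integral_finsetSum _ fun a _ => integrable_finsetSum _ fun b _ => hI' a b,
        ← sum_neg_distrib]
      refine sum_congr rfl fun a _ => ?_
      rw [integral_finsetSum _ fun b _ => hI a b, integral_finsetSum _ fun b _ => hI' a b,
        ← sum_neg_distrib]
      refine sum_congr rfl fun b _ => ?_
      exact integral_swap_const (hψ' a b) (hψc a b) hf hg _ _
    rw [heq, norm_neg]
    have hi1 : Integrable ((reg φ r).indicator
        fun y => C * (‖f y‖ * ‖ð g y‖ * |φ y|)) := by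
      rw [integrable_indicator_iff hmeas]
      exact integrableOn_reg hφc (by fun_prop)
    have hi2 := integrable_bl hφc hφc' hrc hhc ε
    refine (norm_integral_le_of_norm_le (hi1.add hi2) (ae_of_all _ hbound)).trans ?_
    simp only [Pi.add_apply]
    rw [integral_add hi1 hi2, integral_indicator hmeas, integral_const_mul]
  have hlim1 : Tendsto (fun ε => ‖∫ y in {y | r y < 0},
      (1 - chiE ε (r y)) • ((φ y : ℂ) ^ 2 * S y)‖) (𝓝[>] 0)
      (𝓝 ‖∫ y in {y | r y < 0}, ((φ y : ℂ) ^ 2 * S y)‖) := by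
    refine (tendsto_setIntegral_one_sub_chiE hrc.measurable ?_).norm
    refine (Continuous.integrable_of_hasCompactSupport (by fun_prop) ?_).integrableOn
    refine HasCompactSupport.mono hφc fun y hy => ?_
    exact fun h => hy (by simp [h])
  have hlim2 := Tendsto.const_add (C * ∫ y in reg φ r, ‖f y‖ * ‖ð g y‖ * |φ y|) hb
  rw [add_zero] at hlim2
  rw [← setIntegral_reg hrc (fun y hy => by simp [image_eq_zero_of_notMem_tsupport hy])]
  refine le_of_tendsto_of_tendsto hlim1 hlim2 ?_
  filter_upwards [self_mem_nhdsWithin] with ε hε using main ε hε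

/-! ### Forms and their components -/

lemma form_expand (α : Form n q) (v : Fin q → Cn n) :
    α v = ∑ J : Fin q → Fin n × Fin 2, (∏ s, rc n (J s) (v s)) • α fun s => rb n (J s) := by
  classical
  conv_lhs => rw [show v = fun s => ∑ k, rc n k (v s) • rb n k from
    funext fun s => (sum_rc_rb n (v s)).symm]
  have h2 : α (fun s => ∑ k, rc n k (v s) • rb n k) =
      ∑ J : Fin q → Fin n × Fin 2, α (fun s => rc n (J s) (v s) • rb n (J s)) :=
    α.toMultilinearMap.map_sum (fun s k => rc n k (v s) • rb n k)
  rw [h2]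
  exact sum_congr rfl fun J _ =>
    α.toMultilinearMap.map_smul_univ (fun s => rc n (J s) (v s)) (fun s => rb n (J s))

lemma contDiffOn_form_apply_const {k : WithTop ℕ∞} {s : Set (Cn n)} {U : Cn n → Form n q}
    (hU : ContDiffOn ℝ k U s) (v : Fin q → Cn n) : ContDiffOn ℝ k (fun y => U y v) s :=
  (evL v).contDiff.comp_contDiffOn hU

lemma contDiffOn_form_apply {s : Set (Cn n)} {U : Cn n → Form n q}
    (hU : SmoothOn U s) {v : Fin q → Cn n → Cn n} (hv : ∀ i, SmoothOn (v i) s) :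
    SmoothOn (fun y => U y fun i => v i y) s := by
  simp_rw [fun y => form_expand (U y) fun i => v i y]
  refine ContDiffOn.sum fun J _ => ?_
  have h1 : SmoothOn (fun y => ∏ i, rc n (J i) (v i y)) s :=
    contDiffOn_prod fun i _ => (contDiff_rc (J i)).comp_contDiffOn (hv i)
  exact h1.smul (contDiffOn_form_apply_const hU _)

/-- The components of a form in the standard real basis, as a linear map. -/
def evRb (n q : ℕ) : Form n q →ₗ[ℝ] ((Fin q → Fin n × Fin 2) → ℂ) where
  toFun α J := α fun s => rb n (J s)
  map_add' α β := by ext; simp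
  map_smul' c α := by ext; simp

lemma evRb_injective (n q : ℕ) : Function.Injective (evRb n q) := by
  intro α β h
  ext v
  rw [form_expand α, form_expand β]
  exact sum_congr rfl fun J _ => by rw [show α (fun s => rb n (J s)) = _ from congrFun h J]; rfl

lemma exists_evRb_leftInverse (n q : ℕ) :
    ∃ L : ((Fin q → Fin n × Fin 2) → ℂ) →L[ℝ] Form n q, ∀ α, L (evRb n q α) = α := by
  obtain ⟨L, hL⟩ := (evRb n q).exists_leftInverse_of_injective
    (LinearMap.ker_eq_bot.2 (evRb_injective n q))
  exact ⟨LinearMap.toContinuousLinearMap L, fun α => LinearMap.congr_fun hL α⟩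

lemma contDiffOn_form_of_apply {k : WithTop ℕ∞} {s : Set (Cn n)} {U : Cn n → Form n q}
    (h : ∀ v : Fin q → Cn n, ContDiffOn ℝ k (fun y => U y v) s) : ContDiffOn ℝ k U s := by
  obtain ⟨L, hL⟩ := exists_evRb_leftInverse n q
  have : U = fun y => L (evRb n q (U y)) := funext fun y => (hL _).symm
  rw [this]
  exact L.contDiff.comp_contDiffOn (contDiffOn_pi.2 fun J => h _)

/-- The complex linear part `(f v - i f (i v)) / 2` of a real linear map. -/
def holPart (f : Cn n →L[ℝ] Form n q) (v : Cn n) : Form n q :=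
  (1 / 2 : ℂ) • (f v - î • f (î • v))

/-- `∂_v φ = (D_v φ - i D_{iv} φ) / 2`. -/
def dDir (φ : Cn n → ℂ) (y v : Cn n) : ℂ :=
  (1 / 2 : ℂ) * (ð φ y v - î * ð φ y (î • v))

lemma norm_conjPart_le (f : Cn n →L[ℝ] Form n q) (v : Cn n) : ‖conjPart f v‖ ≤ ‖f‖ * ‖v‖ := by
  rw [conjPart_apply, norm_smul]
  have h1 := f.le_opNorm v
  have h2 := f.le_opNorm (î • v)
  have h3 := norm_add_le (f v) (î • f (î • v))
  rw [norm_smul, norm_I, one_mul] at h2 h3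
  norm_num
  linarith

lemma norm_holPart_le (f : Cn n →L[ℝ] Form n q) (v : Cn n) : ‖holPart f v‖ ≤ ‖f‖ * ‖v‖ := by
  rw [holPart, norm_smul]
  have h1 := f.le_opNorm v
  have h2 := f.le_opNorm (î • v)
  have h3 := norm_sub_le (f v) (î • f (î • v))
  rw [norm_smul, norm_I, one_mul] at h2 h3
  norm_num
  linarith

lemma norm_form_apply_le (α : Form n q) (v : Fin q → Cn n) {C : ℝ} (hC : 0 ≤ C)
    (hv : ∀ s, ‖v s‖ ≤ C) : ‖α v‖ ≤ C ^ q * ‖α‖ := by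
  refine (α.le_opNorm v).trans ?_
  rw [mul_comm]
  refine mul_le_mul_of_nonneg_right ?_ (norm_nonneg _)
  calc ∏ i, ‖v i‖ ≤ ∏ _i : Fin q, C := Finset.prod_le_prod (fun _ _ => norm_nonneg _) fun i _ => hv i
    _ = C ^ q := by simp

section Comp

variable {φ : Cn n → ℝ} {E : Fin n → Cn n → Cn n}

/-- Uniform bounds for the components of forms in a smooth frame, and for their derivatives. -/
lemma exists_comp_bounds (hφc : HasCompactSupport φ) (hE : ∀ a, Smooth (E a)) (q : ℕ) :
    ∃ c, 0 ≤ c ∧ ∀ U : Cn n → Form n q, Smooth U → ∀ y ∈ tsupport φ,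
      (∀ α : Form n q, ∀ I : Fin q → Fin n, ‖α fun s => E (I s) y‖ ≤ c * ‖α‖) ∧
      (∀ a, ‖conjPart (ð U y) (E a y)‖ ≤ c * ‖ð U y‖) ∧
      (∀ a, ‖holPart (ð U y) (E a y)‖ ≤ c * ‖ð U y‖) ∧ ∀ I : Fin q → Fin n,
        ‖ð (fun y => U y fun s => E (I s) y) y‖ ≤ c * (‖ð U y‖ + ‖U y‖) ∧
        ∀ a, ‖dbarDir (fun y => U y fun s => E (I s) y) y (E a y) -
              conjPart (ð U y) (E a y) (fun s => E (I s) y)‖ ≤ c * ‖U y‖ ∧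
            ‖dDir (fun y => U y fun s => E (I s) y) y (E a y) -
              holPart (ð U y) (E a y) (fun s => E (I s) y)‖ ≤ c * ‖U y‖ := by
  have hEc : ∀ a, Continuous (E a) := fun a => (hE a).continuous
  have hEd : ∀ a, Continuous (ð (E a)) := fun a => (hE a).continuous_fderiv (by simp)
  have h1 : Continuous fun y => 1 + ∑ a, (‖E a y‖ + ‖ð (E a) y‖) := by fun_prop
  obtain ⟨C, hC0, hC⟩ := exists_bound_tsupport hφc h1
  have hC' : ∀ y ∈ tsupport φ, 1 ≤ C ∧ ∀ a, ‖E a y‖ ≤ C ∧ ‖ð (E a) y‖ ≤ C := by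
    intro y hy
    have h2 := hC y hy
    have h4 : ∀ a, ‖E a y‖ + ‖ð (E a) y‖ ≤ ∑ a, (‖E a y‖ + ‖ð (E a) y‖) := fun a =>
      single_le_sum (f := fun a => ‖E a y‖ + ‖ð (E a) y‖)
        (fun _ _ => by positivity) (mem_univ a)
    have h5 : 0 ≤ ∑ a, (‖E a y‖ + ‖ð (E a) y‖) := by positivity
    rw [norm_of_nonneg (by positivity)] at h2
    refine ⟨by linarith, fun a => ?_⟩
    have := norm_nonneg (E a y)
    have := norm_nonneg (ð (E a) y)
    constructor <;> linarith [h4 a]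
  -- a common constant
  set c := C ^ q + C + q * (C * C) ^ q * C ^ 2 + q * (C * C) ^ q with hc
  have hcq : 0 ≤ q * (C * C) ^ q * C ^ 2 := by positivity
  have hcq' : 0 ≤ q * (C * C) ^ q := by positivity
  have hcp : 0 ≤ C ^ q := by positivity
  refine ⟨c, by positivity, fun U hU y hy => ?_⟩
  obtain ⟨hC1, hCE⟩ := hC' y hy
  have hdf : ∀ (I : Fin q → Fin n) (v : Cn n),
      ð (fun y => U y fun s => E (I s) y) y v = ð U y v (fun s => E (I s) y) +
        ∑ i, U y (Function.update (fun s => E (I s) y) i (ð (E (I i)) y v)) := by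
    intro I v
    exact fderiv_continuousAlternatingMap_apply_apply (hU.differentiable (by simp) y)
      (fun i => (hE (I i)).differentiable (by simp) y) v
  have hrem : ∀ (I : Fin q → Fin n) (v : Cn n), ‖v‖ ≤ C →
      ‖∑ i, U y (Function.update (fun s => E (I s) y) i (ð (E (I i)) y v))‖ ≤
        q * (C * C) ^ q * ‖U y‖ := by
    intro I v hv
    calc _ ≤ ∑ i : Fin q, (C * C) ^ q * ‖U y‖ := by
          refine (norm_sum_le _ _).trans (sum_le_sum fun i _ => ?_)
          refine norm_form_apply_le _ _ (by positivity) fun s => ?_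
          rcases eq_or_ne s i with rfl | hsi
          · rw [Function.update_self]
            refine (ContinuousLinearMap.le_opNorm _ _).trans ?_
            exact mul_le_mul (hCE _).2 hv (norm_nonneg _) hC0
          · rw [Function.update_of_ne hsi]
            calc _ ≤ C := (hCE _).1
              _ ≤ C * C := by nlinarith
      _ = _ := by simp [mul_assoc]
  have hrem' : ∀ (I : Fin q → Fin n) (v : Cn n),
      ‖∑ i, U y (Function.update (fun s => E (I s) y) i (ð (E (I i)) y v))‖ ≤
        q * (C * C) ^ q * ‖U y‖ * ‖v‖ := by
    intro I v
    rcases eq_or_ne v 0 with rfl | hv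
    · simp [ContinuousAlternatingMap.map_update_zero]
    · have hv0 := norm_pos_iff.2 hv
      have h2 := hrem I ((‖v‖)⁻¹ • v) (by
        rw [norm_smul, norm_inv, norm_norm, inv_mul_cancel₀ hv0.ne']; exact hC1)
      simp only [map_smul, ContinuousAlternatingMap.map_update_smul, ← Finset.smul_sum] at h2
      rw [norm_smul, norm_inv, norm_norm, inv_mul_le_iff₀ hv0] at h2
      linarith
  have hev : ∀ α : Form n q, ∀ I : Fin q → Fin n, ‖α fun s => E (I s) y‖ ≤ C ^ q * ‖α‖ :=
    fun α I => norm_form_apply_le α _ hC0 fun s => (hCE _).1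
  have hCc : C ≤ c := by rw [hc]; linarith
  have hqc : C ^ q ≤ c := by rw [hc]; linarith
  have hrc : q * (C * C) ^ q ≤ c := by rw [hc]; linarith
  refine ⟨fun α I => ?_, fun a => ?_, fun a => ?_, fun I => ⟨?_, fun a => ⟨?_, ?_⟩⟩⟩
  · exact (hev α I).trans (by gcongr)
  · refine (norm_conjPart_le _ _).trans ?_
    rw [mul_comm]
    exact mul_le_mul_of_nonneg_right ((hCE a).1.trans hCc) (ContinuousLinearMap.opNorm_nonneg _)
  · refine (norm_holPart_le _ _).trans ?_
    rw [mul_comm]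
    exact mul_le_mul_of_nonneg_right ((hCE a).1.trans hCc) (ContinuousLinearMap.opNorm_nonneg _)
  · refine ContinuousLinearMap.opNorm_le_bound _ (by positivity) fun v => ?_
    rw [hdf]
    have h2 := hev (ð U y v) I
    have h3 := (ð U y).le_opNorm v
    have h4 := hrem' I v
    calc _ ≤ C ^ q * (‖ð U y‖ * ‖v‖) + q * (C * C) ^ q * ‖U y‖ * ‖v‖ := by
          refine (norm_add_le _ _).trans (add_le_add (h2.trans (by gcongr)) h4)
      _ ≤ c * (‖ð U y‖ * ‖v‖) + c * ‖U y‖ * ‖v‖ := by gcongr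
      _ = _ := by ring
  · have h2 := hrem I (E a y) (hCE a).1
    have h3 := hrem I (î • E a y) (by
      rw [norm_smul, norm_I, one_mul]; exact (hCE a).1)
    rw [dbarDir, hdf, hdf, conjPart_apply]
    set R1 := ∑ i, U y (Function.update (fun s => E (I s) y) i (ð (E (I i)) y (E a y)))
    set R2 := ∑ i, U y (Function.update (fun s => E (I s) y) i
      (ð (E (I i)) y (î • E a y)))
    have : (1 / 2 : ℂ) * (ð U y (E a y) (fun s => E (I s) y) + R1 + î *
          (ð U y (î • E a y) (fun s => E (I s) y) + R2)) -
        ((1 / 2 : ℂ) • (ð U y (E a y) + î • ð U y (î • E a y)))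
          (fun s => E (I s) y) = (1 / 2 : ℂ) * (R1 + î * R2) := by
      simp only [ContinuousAlternatingMap.smul_apply, ContinuousAlternatingMap.add_apply,
        smul_eq_mul]
      ring
    rw [this, norm_mul]
    have h4 := norm_add_le R1 (î * R2)
    rw [norm_mul, norm_I, one_mul] at h4
    have h5 : q * (C * C) ^ q * ‖U y‖ ≤ c * ‖U y‖ := by gcongr
    norm_num
    linarith
  · have h2 := hrem I (E a y) (hCE a).1
    have h3 := hrem I (î • E a y) (by
      rw [norm_smul, norm_I, one_mul]; exact (hCE a).1)
    rw [dDir, hdf, hdf, holPart]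
    set R1 := ∑ i, U y (Function.update (fun s => E (I s) y) i (ð (E (I i)) y (E a y)))
    set R2 := ∑ i, U y (Function.update (fun s => E (I s) y) i
      (ð (E (I i)) y (î • E a y)))
    have : (1 / 2 : ℂ) * (ð U y (E a y) (fun s => E (I s) y) + R1 - î *
          (ð U y (î • E a y) (fun s => E (I s) y) + R2)) -
        ((1 / 2 : ℂ) • (ð U y (E a y) - î • ð U y (î • E a y)))
          (fun s => E (I s) y) = (1 / 2 : ℂ) * (R1 - î * R2) := by
      simp only [ContinuousAlternatingMap.smul_apply, ContinuousAlternatingMap.sub_apply,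
        smul_eq_mul]
      ring
    rw [this, norm_mul]
    have h4 := norm_sub_le R1 (î * R2)
    rw [norm_mul, norm_I, one_mul] at h4
    have h5 : q * (C * C) ^ q * ‖U y‖ ≤ c * ‖U y‖ := by gcongr
    norm_num
    linarith

end Comp

/-! ### The interchange of complex derivatives -/

section Swap

variable {φ r : Cn n → ℝ}

lemma exists_swap_bound_symm (hφ : Smooth φ) (hφc : HasCompactSupport φ)
    (hr : Smooth r) {X Y : Cn n → Cn n} (hX : Smooth X) (hY : Smooth Y) :
    ∃ C, 0 ≤ C ∧ ∀ f g : Cn n → ℂ, Smooth f → Smooth g →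
      (BNull φ r (fun y => ‖f y‖) ∨ BNull φ r (fun y => ‖g y‖) ∨
        (BNull φ r (fun y => |ð r y (X y)|) ∧ BNull φ r (fun y => |ð r y (Y y)|))) →
      ‖∫ y in reg φ r, ((φ y : ℂ) ^ 2) * (ð f y (X y) * ð g y (Y y) - ð f y (Y y) * ð g y (X y))‖ ≤
      C * ∫ y in reg φ r, (‖f y‖ * ‖ð g y‖ + ‖g y‖ * ‖ð f y‖) * |φ y| := by
  obtain ⟨C, hC0, hC⟩ := exists_swap_bound hφ hφc hr hX hY
  refine ⟨C, hC0, fun f g hf hg hb => ?_⟩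
  have hdf := hf.continuous_fderiv (by simp)
  have hdg := hg.continuous_fderiv (by simp)
  have hdr := hr.continuous_fderiv (by simp)
  have hfc := hf.continuous
  have hgc := hg.continuous
  have hXc := hX.continuous
  have hYc := hY.continuous
  have hφc' := hφ.continuous
  have hrc := hr.continuous
  have i1 : IntegrableOn (fun y => ‖f y‖ * ‖ð g y‖ * |φ y|) (reg φ r) :=
    integrableOn_reg hφc (by fun_prop)
  have i2 : IntegrableOn (fun y => ‖g y‖ * ‖ð f y‖ * |φ y|) (reg φ r) :=
    integrableOn_reg hφc (by fun_prop)
  have hsum : ∫ y in reg φ r, (‖f y‖ * ‖ð g y‖ + ‖g y‖ * ‖ð f y‖) * |φ y| =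
      (∫ y in reg φ r, ‖f y‖ * ‖ð g y‖ * |φ y|) + ∫ y in reg φ r, ‖g y‖ * ‖ð f y‖ * |φ y| := by
    rw [← integral_add i1 i2]
    congr 1 with y
    ring
  have p1 : 0 ≤ ∫ y in reg φ r, ‖f y‖ * ‖ð g y‖ * |φ y| :=
    integral_nonneg fun y => by positivity
  have p2 : 0 ≤ ∫ y in reg φ r, ‖g y‖ * ‖ð f y‖ * |φ y| :=
    integral_nonneg fun y => by positivity
  rw [hsum, mul_add]
  have first : BNull φ r (fun y => ‖f y‖) ∨
      (BNull φ r (fun y => |ð r y (X y)|) ∧ BNull φ r (fun y => |ð r y (Y y)|)) →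
      ‖∫ y in reg φ r, ((φ y : ℂ) ^ 2) * (ð f y (X y) * ð g y (Y y) - ð f y (Y y) * ð g y (X y))‖ ≤
      C * ∫ y in reg φ r, ‖f y‖ * ‖ð g y‖ * |φ y| := by
    intro hb
    refine hC f g hf hg ?_
    rcases hb with hb | ⟨hb1, hb2⟩
    · have := hb.weight hφc hφc' hrc (by fun_prop) (c := fun y => ‖ð g y‖ *
        (|ð r y (X y)| * ‖Y y‖ + |ð r y (Y y)| * ‖X y‖)) (by fun_prop)
        (fun _ => norm_nonneg _) (fun _ => by positivity)
      convert this using 2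
      ring
    · have h1 := hb1.weight hφc hφc' hrc (by fun_prop) (c := fun y => ‖f y‖ * ‖ð g y‖ *
        ‖Y y‖) (by fun_prop) (fun _ => abs_nonneg _) (fun _ => by positivity)
      have h2 := hb2.weight hφc hφc' hrc (by fun_prop) (c := fun y => ‖f y‖ * ‖ð g y‖ *
        ‖X y‖) (by fun_prop) (fun _ => abs_nonneg _) (fun _ => by positivity)
      have := h1.add hφc hφc' hrc (by fun_prop) (by fun_prop) h2
      convert this using 2
      ring
  rcases hb with hb | hb | hb
  · linarith [first (Or.inl hb), mul_nonneg hC0 p2]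
  · have h3 := hC g f hg hf (by
      have := hb.weight hφc hφc' hrc (by fun_prop) (c := fun y => ‖ð f y‖ *
        (|ð r y (X y)| * ‖Y y‖ + |ð r y (Y y)| * ‖X y‖)) (by fun_prop)
        (fun _ => norm_nonneg _) (fun _ => by positivity)
      convert this using 2
      ring)
    have h4 : ∫ y in reg φ r, ((φ y : ℂ) ^ 2) * (ð f y (X y) * ð g y (Y y) -
        ð f y (Y y) * ð g y (X y)) =
        - ∫ y in reg φ r, ((φ y : ℂ) ^ 2) * (ð g y (X y) * ð f y (Y y) -
        ð g y (Y y) * ð f y (X y)) := by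
      rw [← integral_neg]
      congr 1 with y
      ring
    rw [h4, norm_neg]
    linarith [mul_nonneg hC0 p1]
  · linarith [first (Or.inr hb), mul_nonneg hC0 p2]

/-- The size of the derivative of `r` along `E a` and `i E a`. -/
def tanSize (r : Cn n → ℝ) (e : Cn n → Cn n) (y : Cn n) : ℝ :=
  |ð r y (e y)| + |ð r y (î • e y)|

lemma exists_swap_bound_complex (hφ : Smooth φ) (hφc : HasCompactSupport φ)
    (hr : Smooth r) {e e' : Cn n → Cn n} (he : Smooth e) (he' : Smooth e') :
    ∃ C, 0 ≤ C ∧ ∀ f g : Cn n → ℂ, Smooth f → Smooth g →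
      (BNull φ r (fun y => ‖f y‖) ∨ BNull φ r (fun y => ‖g y‖) ∨
        (BNull φ r (tanSize r e) ∧ BNull φ r (tanSize r e'))) →
      ‖∫ y in reg φ r, ((φ y : ℂ) ^ 2) * (dbarDir f y (e y) * dDir g y (e' y) -
        dDir f y (e' y) * dbarDir g y (e y))‖ ≤
      C * ∫ y in reg φ r, (‖f y‖ * ‖ð g y‖ + ‖g y‖ * ‖ð f y‖) * |φ y| := by
  have hIe : Smooth fun y => î • e y := he.const_smul _
  have hIe' : Smooth fun y => î • e' y := he'.const_smul _
  obtain ⟨C1, hC1, h1⟩ := exists_swap_bound_symm hφ hφc hr he he'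
  obtain ⟨C2, hC2, h2⟩ := exists_swap_bound_symm hφ hφc hr he hIe'
  obtain ⟨C3, hC3, h3⟩ := exists_swap_bound_symm hφ hφc hr hIe he'
  obtain ⟨C4, hC4, h4⟩ := exists_swap_bound_symm hφ hφc hr hIe hIe'
  refine ⟨C1 + C2 + C3 + C4, by positivity, fun f g hf hg hb => ?_⟩
  have hdf := hf.continuous_fderiv (by simp)
  have hdg := hg.continuous_fderiv (by simp)
  have hdr := hr.continuous_fderiv (by simp)
  have hec := he.continuous
  have hec' := he'.continuous
  have hφc' := hφ.continuous
  have hrc := hr.continuous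
  have hts : ∀ {e : Cn n → Cn n}, Continuous e → BNull φ r (tanSize r e) →
      BNull φ r (fun y => |ð r y (e y)|) ∧ BNull φ r (fun y => |ð r y (î • e y)|) := by
    intro e he hb
    unfold tanSize at hb
    constructor
    · exact BNull.mono hφc hφc' hrc (by fun_prop) (by fun_prop) (fun _ => abs_nonneg _)
        (fun y _ => le_add_of_nonneg_right (abs_nonneg _)) hb
    · exact BNull.mono hφc hφc' hrc (by fun_prop) (by fun_prop) (fun _ => abs_nonneg _)
        (fun y _ => le_add_of_nonneg_left (abs_nonneg _)) hb
  replace h1 := h1 f g hf hg (hb.imp_right <| Or.imp_right fun h =>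
    ⟨(hts hec h.1).1, (hts hec' h.2).1⟩)
  replace h2 := h2 f g hf hg (hb.imp_right <| Or.imp_right fun h =>
    ⟨(hts hec h.1).1, (hts hec' h.2).2⟩)
  replace h3 := h3 f g hf hg (hb.imp_right <| Or.imp_right fun h =>
    ⟨(hts hec h.1).2, (hts hec' h.2).1⟩)
  replace h4 := h4 f g hf hg (hb.imp_right <| Or.imp_right fun h =>
    ⟨(hts hec h.1).2, (hts hec' h.2).2⟩)
  set R := ∫ y in reg φ r, (‖f y‖ * ‖ð g y‖ + ‖g y‖ * ‖ð f y‖) * |φ y| with hR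
  have hR0 : 0 ≤ R := integral_nonneg fun y => by positivity
  let K : (Cn n → Cn n) → (Cn n → Cn n) → Cn n → ℂ := fun X Y y =>
    ((φ y : ℂ) ^ 2) * (ð f y (X y) * ð g y (Y y) - ð f y (Y y) * ð g y (X y))
  have hK : ∀ X Y, Continuous X → Continuous Y → IntegrableOn (K X Y) (reg φ r) := by
    intro X Y hX hY
    exact integrableOn_reg hφc (by fun_prop)
  have hIec : Continuous fun y => î • e y := by fun_prop
  have hIec' : Continuous fun y => î • e' y := by fun_prop
  have k1 := hK e e' hec hec'
  have k2 := (hK e _ hec hIec').const_mul (-î)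
  have k3 := (hK _ e' hIec hec').const_mul î
  have k4 := hK _ _ hIec hIec'
  have k12 : IntegrableOn (fun y => K e e' y + -î * K e (fun y => î • e' y) y)
    (reg φ r) := k1.add k2
  have k123 : IntegrableOn (fun y => K e e' y + -î * K e (fun y => î • e' y) y +
    î * K (fun y => î • e y) e' y) (reg φ r) := k12.add k3
  have key : ∫ y in reg φ r, ((φ y : ℂ) ^ 2) * (dbarDir f y (e y) * dDir g y (e' y) -
        dDir f y (e' y) * dbarDir g y (e y)) = (1 / 4 : ℂ) *
      ((∫ y in reg φ r, K e e' y) + -î * (∫ y in reg φ r, K e (fun y => î • e' y) y)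
        + î * (∫ y in reg φ r, K (fun y => î • e y) e' y) +
        ∫ y in reg φ r, K (fun y => î • e y) (fun y => î • e' y) y) := by
    rw [← integral_const_mul, ← integral_const_mul, ← integral_add k1 k2,
      ← integral_add k12 k3, ← integral_add k123 k4, ← integral_const_mul]
    congr 1 with y
    simp only [K, dbarDir, dDir]
    linear_combination ((φ y : ℂ) ^ 2) * (1 / 4 : ℂ) * (ð f y (î • e' y) * ð g y (î • e y) -
       ð f y (î • e y) * ð g y (î • e' y)) * I_sq
  rw [key, norm_mul]
  have n1 := norm_add_le ((∫ y in reg φ r, K e e' y) +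
    -î * (∫ y in reg φ r, K e (fun y => î • e' y) y)
        + î * (∫ y in reg φ r, K (fun y => î • e y) e' y))
        (∫ y in reg φ r, K (fun y => î • e y) (fun y => î • e' y) y)
  have n2 := norm_add_le ((∫ y in reg φ r, K e e' y) +
    -î * (∫ y in reg φ r, K e (fun y => î • e' y) y))
        (î * (∫ y in reg φ r, K (fun y => î • e y) e' y))
  have n3 := norm_add_le (∫ y in reg φ r, K e e' y)
    (-î * (∫ y in reg φ r, K e (fun y => î • e' y) y))
  rw [norm_mul, norm_I, one_mul] at n2
  rw [norm_mul, norm_neg, norm_I, one_mul] at n3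
  have h5 : ‖(1 / 4 : ℂ)‖ = 1 / 4 := by norm_num
  rw [h5]
  have p1 := mul_nonneg hC1 hR0
  have p2 := mul_nonneg hC2 hR0
  have p3 := mul_nonneg hC3 hR0
  have p4 := mul_nonneg hC4 hR0
  simp only [K] at n1 n2 n3 ⊢
  nlinarith

end Swap

/-! ### The local a priori estimate -/

lemma cons_frame {p : ℕ} {ι : Type*} (E : ι → Cn n) (b : ι) (K : Fin p → ι) :
    (Fin.cons (E b) fun s => E (K s) : Fin (p + 1) → Cn n) =
      fun s => E ((Fin.cons b K : Fin (p + 1) → ι) s) := by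
  ext s : 1
  refine Fin.cases ?_ (fun t => ?_) s <;> simp

lemma contDiff_form_apply {U : Cn n → Form n q} (hU : Smooth U)
    {v : Fin q → Cn n → Cn n} (hv : ∀ i, Smooth (v i)) : Smooth fun y => U y fun i => v i y := by
  rw [← contDiffOn_univ] at hU ⊢
  exact contDiffOn_form_apply hU fun i => (hv i).contDiffOn

lemma contDiff_conjPart {U : Cn n → Form n q} (hU : Smooth U) {e : Cn n → Cn n}
    (he : Smooth e) : Smooth fun y => conjPart (ð U y) (e y) := by
  have h1 := hU.fderiv_right (m := ∞) (by simp)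
  have h2 := h1.clm_apply (he.const_smul î)
  simp only [conjPart_apply]
  exact (((h1.clm_apply he).add (h2.const_smul î)).const_smul (1 / 2 : ℂ))

lemma contDiff_holPart {U : Cn n → Form n q} (hU : Smooth U) {e : Cn n → Cn n}
    (he : Smooth e) : Smooth fun y => holPart (ð U y) (e y) := by
  have h1 := hU.fderiv_right (m := ∞) (by simp)
  have h2 := h1.clm_apply (he.const_smul î)
  exact (((h1.clm_apply he).sub (h2.const_smul î)).const_smul (1 / 2 : ℂ))

section

variable {φ r : Cn n → ℝ} {E : Fin n → Cn n → Cn n}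

/-- The components `(∂̄_{E_a} U)(E_I)`. -/
def compA (E : Fin n → Cn n → Cn n) (U : Cn n → Form n q) (a : Fin n) (I : Fin q → Fin n)
    (y : Cn n) : ℂ :=
  conjPart (ð U y) (E a y) fun s => E (I s) y

/-- The components `(∂_{E_a} U)(E_I)`. -/
def compB (E : Fin n → Cn n → Cn n) (U : Cn n → Form n q) (a : Fin n) (I : Fin q → Fin n)
    (y : Cn n) : ℂ :=
  holPart (ð U y) (E a y) fun s => E (I s) y

lemma continuous_compA (hE : ∀ a, Smooth (E a)) {U : Cn n → Form n q}
    (hU : Smooth U) (a : Fin n) (I : Fin q → Fin n) : Continuous (compA E U a I) :=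
  (contDiff_form_apply (contDiff_conjPart hU (hE a)) fun i => hE (I i)).continuous

lemma continuous_compB (hE : ∀ a, Smooth (E a)) {U : Cn n → Form n q}
    (hU : Smooth U) (a : Fin n) (I : Fin q → Fin n) : Continuous (compB E U a I) :=
  (contDiff_form_apply (contDiff_holPart hU (hE a)) fun i => hE (I i)).continuous

lemma continuous_norm_fderiv {U : Cn n → Form n q} (hU : Smooth U) : Continuous fun y => ‖ð U y‖ :=
  continuous_norm.comp (hU.continuous_fderiv (by simp))

/-- The lower order error terms. -/
def errInt (φ r : Cn n → ℝ) (U : Cn n → Form n q) : ℝ :=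
  ∫ y in reg φ r, ‖U y‖ * (‖ð U y‖ + ‖U y‖) * |φ y|

lemma errInt_nonneg (U : Cn n → Form n q) : 0 ≤ errInt φ r U :=
  integral_nonneg fun _ => mul_nonneg (mul_nonneg (norm_nonneg _)
    (add_nonneg (ContinuousLinearMap.opNorm_nonneg _) (norm_nonneg _))) (abs_nonneg _)

lemma integrableOn_err (hφ : Smooth φ) (hφc : HasCompactSupport φ) {U : Cn n → Form n q}
    (hU : Smooth U) : IntegrableOn (fun y => ‖U y‖ * (‖ð U y‖ + ‖U y‖) * |φ y|) (reg φ r) := by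
  have h1 := hU.continuous
  have h2 : Continuous fun y => ‖ð U y‖ :=
    continuous_norm_fderiv hU
  have h3 := hφ.continuous
  exact integrableOn_reg hφc (by fun_prop)

lemma errInt_le (hφ : Smooth φ) (hφc : HasCompactSupport φ) (hφ1 : ∀ y, |φ y| ≤ 1)
    {U : Cn n → Form n q} (hU : Smooth U) {δ : ℝ} (hδ : 0 < δ) :
    errInt φ r U ≤ δ * (∫ y in reg φ r, φ y ^ 2 * ‖ð U y‖ ^ 2) +
      (1 / (4 * δ) + 1) * ∫ y in reg φ r, ‖U y‖ ^ 2 := by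
  have h1 := hU.continuous
  have h2 : Continuous fun y => ‖ð U y‖ :=
    continuous_norm_fderiv hU
  have h3 := hφ.continuous
  have i1 : IntegrableOn (fun y => δ * (φ y ^ 2 * ‖ð U y‖ ^ 2)) (reg φ r) :=
    integrableOn_reg hφc (by fun_prop)
  have i2 : IntegrableOn (fun y => (1 / (4 * δ) + 1) * ‖U y‖ ^ 2) (reg φ r) :=
    integrableOn_reg hφc (by fun_prop)
  rw [← integral_const_mul, ← integral_const_mul, ← integral_add i1 i2]
  refine integral_mono (integrableOn_err hφ hφc hU) (i1.add i2) fun y => ?_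
  have k1 : |φ y| * (‖U y‖ * ‖ð U y‖) ≤ δ * (φ y ^ 2 * ‖ð U y‖ ^ 2) + 1 / (4 * δ) * ‖U y‖ ^ 2 := by
    have k0 : 0 ≤ δ * (|φ y| * ‖ð U y‖ - 1 / (2 * δ) * ‖U y‖) ^ 2 := by positivity
    have k2 : δ * (|φ y| * ‖ð U y‖ - 1 / (2 * δ) * ‖U y‖) ^ 2 =
        δ * (φ y ^ 2 * ‖ð U y‖ ^ 2) + 1 / (4 * δ) * ‖U y‖ ^ 2 -
          |φ y| * (‖U y‖ * ‖ð U y‖) := by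
      rw [← sq_abs (φ y)]
      field_simp
      ring
    linarith
  have k3 : ‖U y‖ ^ 2 * |φ y| ≤ ‖U y‖ ^ 2 := mul_le_of_le_one_right (sq_nonneg _) (hφ1 y)
  have k4 : ‖U y‖ * (‖ð U y‖ + ‖U y‖) * |φ y| =
      |φ y| * (‖U y‖ * ‖ð U y‖) + ‖U y‖ ^ 2 * |φ y| := by ring
  simp only [Pi.add_apply]
  linarith

lemma fderiv_conj_apply (f : Cn n → ℂ) (hf : Smooth f) (y v : Cn n) :
    ð (fun y => conj (f y)) y v = conj (ð f y v) := by
  have h1 : HasFDerivAt f (ð f y) y := (hf.differentiable (by simp) y).hasFDerivAt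
  have h2 : HasFDerivAt (fun y => conj (f y)) _ y :=
    (conjCLE : ℂ →L[ℝ] ℂ).hasFDerivAt.comp y h1
  rw [h2.fderiv]
  simp

lemma norm_fderiv_conj (f : Cn n → ℂ) (hf : Smooth f) (y : Cn n) :
    ‖ð (fun y => conj (f y)) y‖ ≤ ‖ð f y‖ := by
  refine ContinuousLinearMap.opNorm_le_bound _ (norm_nonneg _) fun v => ?_
  rw [fderiv_conj_apply f hf, RCLike.norm_conj]
  exact (ð f y).le_opNorm v

lemma norm_mul_conj_sub_le (a b a' b' : ℂ) : ‖a * conj b - a' * conj b'‖ ≤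
      ‖a - a'‖ * ‖b‖ + ‖a'‖ * ‖b - b'‖ := by
  have : a * conj b - a' * conj b' = (a - a') * conj b + a' * conj (b - b') := by
    rw [map_sub]; ring
  rw [this]
  refine (norm_add_le _ _).trans ?_
  rw [norm_mul, norm_mul, RCLike.norm_conj, RCLike.norm_conj]

/-- The interchange of derivatives for components of forms. -/
lemma exists_swap_form (hφ : Smooth φ) (hφc : HasCompactSupport φ) (hφ1 : ∀ y, |φ y| ≤ 1)
    (hr : Smooth r) (hE : ∀ a, Smooth (E a)) (q : ℕ) (a b : Fin n) :
    ∃ C, 0 ≤ C ∧ ∀ (U : Cn n → Form n q), Smooth U → ∀ I I' : Fin q → Fin n,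
      (BNull φ r (fun y => ‖U y fun s => E (I s) y‖) ∨
        BNull φ r (fun y => ‖U y fun s => E (I' s) y‖) ∨
        (BNull φ r (tanSize r (E a)) ∧ BNull φ r (tanSize r (E b)))) →
      ‖∫ y in reg φ r, ((φ y : ℂ) ^ 2) * (compA E U a I y * conj (compA E U b I' y) -
        compB E U b I y * conj (compB E U a I' y))‖ ≤ C * errInt φ r U := by
  obtain ⟨c, hc0, hc⟩ := exists_comp_bounds hφc hE q
  obtain ⟨C, hC0, hC⟩ := exists_swap_bound_complex hφ hφc hr (hE a) (hE b)
  refine ⟨C * (2 * c ^ 2) + (4 * c ^ 3 + 2 * c ^ 2), by positivity, fun U hU I I' hb => ?_⟩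
  set f : Cn n → ℂ := fun y => U y fun s => E (I s) y with hf
  set h : Cn n → ℂ := fun y => U y fun s => E (I' s) y with hh
  have hfs : Smooth f := contDiff_form_apply hU fun i => hE (I i)
  have hhs : Smooth h := contDiff_form_apply hU fun i => hE (I' i)
  have hgs : Smooth fun y => conj (h y) := conjCLE.contDiff.comp hhs
  have hb' : (BNull φ r (fun y => ‖f y‖) ∨ BNull φ r (fun y => ‖conj (h y)‖) ∨
        (BNull φ r (tanSize r (E a)) ∧ BNull φ r (tanSize r (E b)))) := by
    simpa only [RCLike.norm_conj] using hb
  have h1 := hC f _ hfs hgs hb'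
  have hφcont := hφ.continuous
  have hUc := hU.continuous
  have hdU := hU.continuous_fderiv (by simp)
  have hdir1 : ∀ y v, dDir (fun y => conj (h y)) y v = conj (dbarDir h y v) := by
    intro y v
    rw [dDir, dbarDir, fderiv_conj_apply h hhs, fderiv_conj_apply h hhs]
    simp only [map_mul, map_add, conj_I, map_div₀, map_one, map_ofNat]
    ring
  have hdir2 : ∀ y v, dbarDir (fun y => conj (h y)) y v = conj (dDir h y v) := by
    intro y v
    rw [dDir, dbarDir, fderiv_conj_apply h hhs, fderiv_conj_apply h hhs]
    simp only [map_mul, map_sub, conj_I, map_div₀, map_one, map_ofNat]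
    ring
  simp only [hdir1, hdir2] at h1
  have hAI := continuous_compA hE hU a I
  have hAI' := continuous_compA hE hU b I'
  have hBI := continuous_compB hE hU b I
  have hBI' := continuous_compB hE hU a I'
  have hdd : ∀ {k : Cn n → ℂ} {e : Cn n → Cn n}, Smooth k → Smooth e →
      Continuous (fun y => dbarDir k y (e y)) ∧ Continuous (fun y => dDir k y (e y)) := by
    intro k e hk he
    have k1 := hk.continuous_fderiv (by simp)
    have k2 := he.continuous
    unfold dbarDir dDir
    constructor <;> fun_prop
  have c1 := (hdd hfs (hE a)).1
  have c2 := (hdd hhs (hE b)).1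
  have c3 := (hdd hfs (hE b)).2
  have c4 := (hdd hhs (hE a)).2
  have hconj : Continuous conj := continuous_conj
  set Y : Cn n → ℂ := fun y => dbarDir f y (E a y) * conj (dbarDir h y (E b y)) -
    dDir f y (E b y) * conj (dDir h y (E a y)) with hY
  set X : Cn n → ℂ := fun y => compA E U a I y * conj (compA E U b I' y) -
        compB E U b I y * conj (compB E U a I' y) with hX
  have hXc : Continuous X := by fun_prop
  have hYc : Continuous Y := by fun_prop
  have iX : IntegrableOn (fun y => ((φ y : ℂ) ^ 2) * (X y - Y y)) (reg φ r) :=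
    integrableOn_reg hφc (by fun_prop)
  have iY : IntegrableOn (fun y => ((φ y : ℂ) ^ 2) * Y y) (reg φ r) :=
    integrableOn_reg hφc (by fun_prop)
  have hmeas := measurableSet_reg (φ := φ) hr.continuous
  have hsplit : ∫ y in reg φ r, ((φ y : ℂ) ^ 2) * X y = (∫ y in reg φ r, ((φ y : ℂ) ^ 2) * Y y) +
        ∫ y in reg φ r, ((φ y : ℂ) ^ 2) * (X y - Y y) := by
    rw [← integral_add iY iX]
    congr 1 with y
    ring
  have herr := integrableOn_err (r := r) hφ hφc hU
  have hb1 : ∫ y in reg φ r, (‖f y‖ * ‖ð (fun y => conj (h y)) y‖ +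
      ‖conj (h y)‖ * ‖ð f y‖) * |φ y| ≤ 2 * c ^ 2 * errInt φ r U := by
    rw [errInt, ← integral_const_mul]
    refine setIntegral_mono_on ?_ (herr.const_mul _) hmeas fun y hy => ?_
    · have k1 := hgs.continuous_fderiv (by simp)
      have k2 := hfs.continuous_fderiv (by simp)
      have k3 := hfs.continuous
      have k4 := hhs.continuous
      exact integrableOn_reg hφc (by fun_prop)
    · obtain ⟨b1, _, _, b4⟩ := hc U hU y hy.2
      have e1 : ‖f y‖ ≤ c * ‖U y‖ := b1 (U y) I
      have e2 : ‖h y‖ ≤ c * ‖U y‖ := b1 (U y) I'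
      have e3 := (b4 I).1
      have e4 := (norm_fderiv_conj h hhs y).trans (b4 I').1
      rw [RCLike.norm_conj]
      calc _ ≤ ((c * ‖U y‖) * (c * (‖ð U y‖ + ‖U y‖)) +
            (c * ‖U y‖) * (c * (‖ð U y‖ + ‖U y‖))) * |φ y| := by gcongr
        _ = _ := by ring
  have hb2 : ‖∫ y in reg φ r, ((φ y : ℂ) ^ 2) * (X y - Y y)‖ ≤ (4 * c ^ 3 + 2 * c ^ 2) * errInt φ r U := by
    rw [errInt, ← integral_const_mul]
    refine norm_integral_le_of_norm_le (herr.const_mul _)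
      ((ae_restrict_iff' hmeas).2 (ae_of_all _ fun y hy => ?_))
    obtain ⟨b1, b2, b3, b4⟩ := hc U hU y hy.2
    set N := ‖U y‖ with hN
    set G := ‖ð U y‖ with hG
    have hN0 : 0 ≤ N := norm_nonneg _
    have hG0 : 0 ≤ G := ContinuousLinearMap.opNorm_nonneg _
    have d1 := ((b4 I).2 a).1
    have d2 := ((b4 I').2 b).1
    have d3 := ((b4 I).2 b).2
    have d4 := ((b4 I').2 a).2
    have a1 : ‖compA E U b I' y‖ ≤ c * (c * G) := (b1 _ I').trans (by gcongr; exact b2 b)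
    have a2 : ‖compB E U a I' y‖ ≤ c * (c * G) := (b1 _ I').trans (by gcongr; exact b3 a)
    have a3 : ‖compA E U a I y‖ ≤ c * (c * G) := (b1 _ I).trans (by gcongr; exact b2 a)
    have a4 : ‖compB E U b I y‖ ≤ c * (c * G) := (b1 _ I).trans (by gcongr; exact b3 b)
    have key : ∀ A1 A2 D1 D2 : ℂ, ‖A1‖ ≤ c * (c * G) → ‖A2‖ ≤ c * (c * G) →
        ‖D1 - A1‖ ≤ c * N → ‖D2 - A2‖ ≤ c * N → ‖A1 * conj A2 - D1 * conj D2‖ ≤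
          (2 * c ^ 3 + c ^ 2) * (N * (G + N)) := by
      intro A1 A2 D1 D2 h1 h2 h3 h4
      have k1 : ‖D1‖ ≤ c * (c * G) + c * N := by
        have := norm_add_le (D1 - A1) A1
        rw [sub_add_cancel] at this
        linarith
      rw [norm_sub_rev] at h3 h4
      calc _ ≤ ‖A1 - D1‖ * ‖A2‖ + ‖D1‖ * ‖A2 - D2‖ := norm_mul_conj_sub_le _ _ _ _
        _ ≤ c * N * (c * (c * G)) + (c * (c * G) + c * N) * (c * N) := by gcongr
        _ = (2 * c ^ 3) * (N * G) + c ^ 2 * (N * N) := by ring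
        _ ≤ (2 * c ^ 3) * (N * G) + c ^ 2 * (N * N) +
            ((2 * c ^ 3) * (N * N) + c ^ 2 * (N * G)) := le_add_of_nonneg_right (by positivity)
        _ = _ := by ring
    have q1 := key _ _ _ _ a3 a1 d1 d2
    have q2 := key _ _ _ _ a4 a2 d3 d4
    have q3 : ‖X y - Y y‖ ≤ (4 * c ^ 3 + 2 * c ^ 2) * (N * (G + N)) := by
      have : X y - Y y = (compA E U a I y * conj (compA E U b I' y) -
          dbarDir f y (E a y) * conj (dbarDir h y (E b y))) -
          (compB E U b I y * conj (compB E U a I' y) -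
          dDir f y (E b y) * conj (dDir h y (E a y))) := by
        simp only [hX, hY]; ring
      rw [this]
      refine (norm_sub_le _ _).trans ((add_le_add q1 q2).trans (le_of_eq ?_))
      ring
    rw [norm_mul, norm_pow, norm_real, norm_eq_abs]
    have q4 : |φ y| ^ 2 ≤ |φ y| := by
      rw [sq]; exact mul_le_of_le_one_left (abs_nonneg _) (hφ1 y)
    calc _ ≤ |φ y| * ((4 * c ^ 3 + 2 * c ^ 2) * (N * (G + N))) := by
          exact mul_le_mul q4 q3 (norm_nonneg _) (abs_nonneg _)
      _ = _ := by ring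
  rw [hsplit]
  refine (norm_add_le _ _).trans ?_
  calc _ ≤ C * (2 * c ^ 2 * errInt φ r U) + (4 * c ^ 3 + 2 * c ^ 2) * errInt φ r U :=
        add_le_add (h1.trans (by gcongr)) hb2
    _ = _ := by ring

end

/-- `|∂̄U|²`, up to a factor, in the frame `E`. -/
def dbarSq (E : Fin n → Cn n → Cn n) (U : Cn n → Form n q) (y : Cn n) : ℝ :=
  ∑ I : Fin (q + 1) → Fin n, ‖dbarL (ð U y) fun s => E (I s) y‖ ^ 2

/-- The principal part of `|ϑU|²`, up to a factor, in the frame `E`. -/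
def thetaSq (E : Fin n → Cn n → Cn n) : {q : ℕ} → (U : Cn n → Form n q) → Cn n → ℝ
  | 0, _, _ => 0
  | p + 1, U, y => ∑ K : Fin p → Fin n, ‖∑ a, compB E U a (Fin.cons a K : Fin (p + 1) → Fin n) y‖ ^ 2

/-- `∑ |∂̄_{E_a} U_I|²`. -/
def aSq (E : Fin n → Cn n → Cn n) (U : Cn n → Form n q) (y : Cn n) : ℝ :=
  ∑ a, ∑ I : Fin q → Fin n, ‖compA E U a I y‖ ^ 2

section

variable {φ r : Cn n → ℝ} {E : Fin n → Cn n → Cn n}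

lemma continuous_thetaSq (hE : ∀ a, Smooth (E a)) {U : Cn n → Form n q}
    (hU : Smooth U) : Continuous (thetaSq E U) := by
  have := fun a I => continuous_compB hE hU a I
  cases q with
  | zero => exact continuous_const
  | succ p =>
    unfold thetaSq
    fun_prop

lemma contDiff_dbarL {U : Cn n → Form n q} (hU : Smooth U) : Smooth fun y => dbarL (ð U y) := by
  have h1 : Smooth (ð U) := hU.fderiv_right (m := ∞) (by simp)
  have h2 : Smooth (dbarL (n := n) (q := q)) := ContinuousLinearMap.contDiff _
  exact h2.comp h1

lemma continuous_dbarSq (hE : ∀ a, Smooth (E a)) {U : Cn n → Form n q}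
    (hU : Smooth U) : Continuous (dbarSq E U) := by
  have h2 := contDiff_dbarL hU
  have := fun I : Fin (q + 1) → Fin n =>
    (contDiff_form_apply h2 fun s => hE (I s)).continuous
  unfold dbarSq
  fun_prop

lemma dbarSq_nonneg (U : Cn n → Form n q) (y : Cn n) : 0 ≤ dbarSq E U y :=
  sum_nonneg fun _ _ => sq_nonneg _

lemma thetaSq_nonneg (U : Cn n → Form n q) (y : Cn n) : 0 ≤ thetaSq E U y := by
  cases q with
  | zero => exact le_rfl
  | succ p => exact sum_nonneg fun _ _ => sq_nonneg _

lemma ofReal_norm_sq (z : ℂ) : ((‖z‖ ^ 2 : ℝ) : ℂ) = z * conj z := by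
  rw [Complex.mul_conj, Complex.normSq_eq_norm_sq]

/-- In degree zero `∂̄` controls all antiholomorphic derivatives. -/
lemma dbarSq_zero (U : Cn n → Form n 0) (y : Cn n) : dbarSq E U y = aSq E U y := by
  have h1 := sum_dbarL_mul_conj (ð U y) (dbarL (ð U y)) fun a => E a y
  have h2 : ((dbarSq E U y : ℝ) : ℂ) = aSq E U y := by
    simp only [dbarSq, aSq, ofReal_sum, ofReal_norm_sq]
    rw [h1]
    simp only [compA, Nat.cast_zero, zero_add, one_mul]
    refine sum_congr rfl fun a _ => sum_congr rfl fun K _ => ?_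
    congr 2
    rw [dbarL_apply]
    simp only [Fin.sum_univ_succ, Finset.univ_eq_empty, Finset.sum_empty]
    simp [conjPart_apply, mul_add]
  exact_mod_cast h2

/-- The Bochner type identity behind the basic estimate. -/
lemma aSq_succ {p : ℕ} (U : Cn n → Form n (p + 1)) (y : Cn n) :
    ((aSq E U y : ℝ) : ℂ) = (1 / (p + 2) : ℂ) * dbarSq E U y + (p + 1 : ℂ) * (thetaSq E U y +
      ∑ a, ∑ b, ∑ K : Fin p → Fin n, (compA E U a (Fin.cons b K : Fin (p + 1) → Fin n) y *
            conj (compA E U b (Fin.cons a K : Fin (p + 1) → Fin n) y) -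
          compB E U b (Fin.cons b K : Fin (p + 1) → Fin n) y *
            conj (compB E U a (Fin.cons a K : Fin (p + 1) → Fin n) y))) := by
  have h1 := sum_dbarL_sq (ð U y) fun a => E a y
  have hp : (p + 2 : ℂ) ≠ 0 := by exact_mod_cast (by omega : p + 2 ≠ 0)
  have h2 : (thetaSq E U y : ℂ) = ∑ a, ∑ b, ∑ K : Fin p → Fin n,
      compB E U b (Fin.cons b K : Fin (p + 1) → Fin n) y *
            conj (compB E U a (Fin.cons a K : Fin (p + 1) → Fin n) y) := by
    simp only [thetaSq, ofReal_sum, ofReal_norm_sq]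
    simp only [map_sum, sum_mul_sum]
    rw [sum_comm]
    conv_rhs => rw [sum_comm]
    exact sum_congr rfl fun a _ => sum_comm
  have h3 : (dbarSq E U y : ℂ) = (p + 2) * (aSq E U y - (p + 1) * ∑ a, ∑ b, ∑ K : Fin p → Fin n,
        compA E U a (Fin.cons b K : Fin (p + 1) → Fin n) y *
            conj (compA E U b (Fin.cons a K : Fin (p + 1) → Fin n) y)) := by
    simp only [dbarSq, aSq, ofReal_sum, ofReal_norm_sq, compA]
    rw [h1]
    simp only [cons_frame (fun a => E a y)]
  simp only [sum_sub_distrib]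
  rw [← h2, h3]
  field_simp
  ring

lemma integral_sq_norm_le_errInt (hφ : Smooth φ) (hφc : HasCompactSupport φ)
    (hφ1 : ∀ y, |φ y| ≤ 1) {U : Cn n → Form n q} (hU : Smooth U) :
    ∫ y in reg φ r, φ y ^ 2 * ‖U y‖ ^ 2 ≤ errInt φ r U := by
  have h1 := hU.continuous
  have h3 := hφ.continuous
  refine integral_mono (integrableOn_reg hφc (by fun_prop)) (integrableOn_err hφ hφc hU)
    fun y => ?_
  have h4 : φ y ^ 2 ≤ |φ y| := by
    rw [← sq_abs, sq]; exact mul_le_of_le_one_left (abs_nonneg _) (hφ1 y)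
  have h5 : 0 ≤ ‖U y‖ * ‖ð U y‖ * |φ y| :=
    mul_nonneg (mul_nonneg (norm_nonneg _) (ContinuousLinearMap.opNorm_nonneg _)) (abs_nonneg _)
  have h6 := mul_le_mul_of_nonneg_right h4 (sq_nonneg ‖U y‖)
  simp only
  nlinarith

lemma absorb {K X D N R : ℝ} (hK0 : 0 ≤ K) (hX0 : 0 ≤ X) (h4 : X ≤ K * (D + R))
    (h5 : R ≤ 1 / (2 * (K + 1)) * X + (1 / (4 * (1 / (2 * (K + 1)))) + 1) * N) (hD : 0 ≤ D)
    (hN : 0 ≤ N) : X ≤ (2 * K + 2 * K * (1 / (4 * (1 / (2 * (K + 1)))) + 1)) * (D + N) := by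
  have hKp : 0 < 2 * (K + 1) := by positivity
  have h6 : K * (1 / (2 * (K + 1)) * X) ≤ 1 / 2 * X := by
    rw [← mul_assoc]
    refine mul_le_mul_of_nonneg_right ?_ hX0
    rw [mul_one_div, div_le_iff₀ hKp]
    linarith
  set M := 1 / (4 * (1 / (2 * (K + 1)))) + 1 with hM
  have hM0 : 0 ≤ M := by positivity
  have h7 := mul_le_mul_of_nonneg_left h5 hK0
  have h8 : 0 ≤ K * M * D := by positivity
  have h9 : 0 ≤ K * N := by positivity
  nlinarith

/-- The boundary conditions in direction `a`: either `E_a` is tangential, or the components of `U`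
containing `a` have vanishing trace and the holomorphic derivative along `E_a` is controlled by the
antiholomorphic one. -/
def FrameCond (φ r : Cn n → ℝ) (E : Fin n → Cn n → Cn n) (C : ℝ) (U : Cn n → Form n q) : Prop :=
  ∀ a, BNull φ r (tanSize r (E a)) ∨
    ((∀ (I : Fin q → Fin n) (s : Fin q), I s = a → BNull φ r fun y => ‖U y fun s => E (I s) y‖) ∧
      ∀ y ∈ reg φ r, ∀ I, ‖compB E U a I y‖ ≤ ‖compA E U a I y‖ + C * ‖U y‖)

lemma exists_aSq_bound (hφ : Smooth φ) (hφc : HasCompactSupport φ) (hφ1 : ∀ y, |φ y| ≤ 1)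
    (hr : Smooth r) (hE : ∀ a, Smooth (E a)) (q : ℕ) (C₁ : ℝ) :
    ∃ C, 0 ≤ C ∧ ∀ (U : Cn n → Form n q), Smooth U → FrameCond φ r E C₁ U →
      ∫ y in reg φ r, φ y ^ 2 * aSq E U y ≤ C * ((∫ y in reg φ r, φ y ^ 2 * dbarSq E U y) +
          (∫ y in reg φ r, φ y ^ 2 * thetaSq E U y) + errInt φ r U) := by
  cases q with
  | zero =>
    refine ⟨1, zero_le_one, fun U hU _ => ?_⟩
    have h1 : 0 ≤ ∫ y in reg φ r, φ y ^ 2 * thetaSq E U y :=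
      integral_nonneg fun y => mul_nonneg (sq_nonneg _) (thetaSq_nonneg U y)
    have h2 := errInt_nonneg (φ := φ) (r := r) U
    simp only [dbarSq_zero]
    linarith
  | succ p =>
    choose c hc0 hc using fun a b => exists_swap_form hφ hφc hφ1 hr hE (p + 1) a b
    set S : ℝ := ∑ a, ∑ b, ∑ _K : Fin p → Fin n, c a b with hS
    have hS0 : 0 ≤ S := sum_nonneg fun a _ => sum_nonneg fun b _ =>
      sum_nonneg fun _ _ => hc0 a b
    refine ⟨1 + (p + 1) + (p + 1) * S, by positivity, fun U hU hF => ?_⟩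
    have hφcont := hφ.continuous
    have e2 := errInt_nonneg (φ := φ) (r := r) U
    set k : Fin n → Fin n → (Fin p → Fin n) → Cn n → ℂ := fun a b K y =>
        (compA E U a (Fin.cons b K : Fin (p + 1) → Fin n) y *
            conj (compA E U b (Fin.cons a K : Fin (p + 1) → Fin n) y) -
          compB E U b (Fin.cons b K : Fin (p + 1) → Fin n) y *
            conj (compB E U a (Fin.cons a K : Fin (p + 1) → Fin n) y)) with hk
    have hkc : ∀ a b K, Continuous (k a b K) := by
      intro a b K
      have k1 := fun a I => continuous_compA hE hU a I
      have k2 := fun a I => continuous_compB hE hU a I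
      have hconj : Continuous conj := continuous_conj
      fun_prop
    have hkb : ∀ a b K, ‖∫ y in reg φ r, ((φ y : ℂ) ^ 2) * k a b K y‖ ≤ c a b * errInt φ r U := by
      intro a b K
      refine hc a b U hU _ _ ?_
      rcases hF b with h | h
      · rcases hF a with h' | h'
        · exact Or.inr (Or.inr ⟨h', h⟩)
        · exact Or.inr (Or.inl (h'.1 _ 0 (by simp)))
      · exact Or.inl (h.1 _ 0 (by simp))
    have hik : ∀ a b K, IntegrableOn (fun y => ((φ y : ℂ) ^ 2) * k a b K y) (reg φ r) := by
      intro a b K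
      have := hkc a b K
      exact integrableOn_reg hφc (by fun_prop)
    have hsumk : ‖∫ y in reg φ r, ((φ y : ℂ) ^ 2) * ∑ a, ∑ b, ∑ K, k a b K y‖ ≤
        S * errInt φ r U := by
      simp only [mul_sum]
      rw [integral_finsetSum _ fun a _ => integrable_finsetSum _ fun b _ =>
        integrable_finsetSum _ fun K _ => hik a b K]
      rw [hS, sum_mul]
      refine (norm_sum_le _ _).trans (sum_le_sum fun a _ => ?_)
      rw [integral_finsetSum _ fun b _ => integrable_finsetSum _ fun K _ => hik a b K, sum_mul]
      refine (norm_sum_le _ _).trans (sum_le_sum fun b _ => ?_)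
      rw [integral_finsetSum _ fun K _ => hik a b K, sum_mul]
      exact (norm_sum_le _ _).trans (sum_le_sum fun K _ => hkb a b K)
    have cd := continuous_dbarSq hE hU
    have ct := continuous_thetaSq hE hU
    have i1 : IntegrableOn (fun y => φ y ^ 2 * dbarSq E U y) (reg φ r) :=
      integrableOn_reg hφc (by fun_prop)
    have i2 : IntegrableOn (fun y => φ y ^ 2 * thetaSq E U y) (reg φ r) :=
      integrableOn_reg hφc (by fun_prop)
    have i3 : IntegrableOn (fun y => (((φ y : ℂ) ^ 2) * ∑ a, ∑ b, ∑ K, k a b K y).re)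
        (reg φ r) := by
      refine integrableOn_reg hφc (continuous_re.comp ?_)
      fun_prop
    have hre : ∀ y, φ y ^ 2 * aSq E U y = 1 / (p + 2) * (φ y ^ 2 * dbarSq E U y) +
        (p + 1) * (φ y ^ 2 * thetaSq E U y) +
          (p + 1) * (((φ y : ℂ) ^ 2) * ∑ a, ∑ b, ∑ K, k a b K y).re := by
      intro y
      have h1 := congrArg Complex.re
        (congrArg (fun z => ((φ y ^ 2 : ℝ) : ℂ) * z) (aSq_succ (E := E) U y))
      have h2 : ((φ y ^ 2 : ℝ) : ℂ) * ((aSq E U y : ℝ) : ℂ) =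
        ((φ y ^ 2 * aSq E U y : ℝ) : ℂ) := by push_cast; rfl
      rw [h2, ofReal_re] at h1
      rw [h1]
      set kk := ∑ a, ∑ b, ∑ K, k a b K y
      have h3 : ((φ y ^ 2 : ℝ) : ℂ) * ((1 / (p + 2) : ℂ) * dbarSq E U y +
          (p + 1 : ℂ) * (thetaSq E U y + kk)) =
          ((1 / (p + 2) * (φ y ^ 2 * dbarSq E U y) + (p + 1) * (φ y ^ 2 * thetaSq E U y) : ℝ) : ℂ) +
          ((p + 1 : ℝ) : ℂ) * (((φ y : ℂ) ^ 2) * kk) := by push_cast; ring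
      rw [h3, add_re, ofReal_re, re_ofReal_mul]
    have hint : ∫ y in reg φ r, φ y ^ 2 * aSq E U y =
        1 / (p + 2) * (∫ y in reg φ r, φ y ^ 2 * dbarSq E U y) +
        (p + 1) * (∫ y in reg φ r, φ y ^ 2 * thetaSq E U y) +
          (p + 1) * ∫ y in reg φ r, (((φ y : ℂ) ^ 2) * ∑ a, ∑ b, ∑ K, k a b K y).re := by
      have j1 := i1.const_mul (1 / (p + 2 : ℝ))
      have j2 := i2.const_mul (p + 1 : ℝ)
      have j3 := i3.const_mul (p + 1 : ℝ)
      have j12 : IntegrableOn (fun y => 1 / (p + 2 : ℝ) * (φ y ^ 2 * dbarSq E U y) +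
        (p + 1) * (φ y ^ 2 * thetaSq E U y)) (reg φ r) := j1.add j2
      rw [← integral_const_mul, ← integral_const_mul, ← integral_const_mul,
        ← integral_add j1 j2, ← integral_add j12 j3]
      exact integral_congr_ae (ae_of_all _ hre)
    have hreal : ∫ y in reg φ r, (((φ y : ℂ) ^ 2) * ∑ a, ∑ b, ∑ K, k a b K y).re ≤
        S * errInt φ r U := by
      have i4 : IntegrableOn (fun y => ((φ y : ℂ) ^ 2) * ∑ a, ∑ b, ∑ K, k a b K y)
        (reg φ r) := integrableOn_reg hφc (by fun_prop)
      have : ∫ y in reg φ r, (((φ y : ℂ) ^ 2) * ∑ a, ∑ b, ∑ K, k a b K y).re =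
        (∫ y in reg φ r, ((φ y : ℂ) ^ 2) * ∑ a, ∑ b, ∑ K, k a b K y).re := integral_re i4
      rw [this]
      exact (Complex.re_le_norm _).trans hsumk
    have p1 : 0 ≤ ∫ y in reg φ r, φ y ^ 2 * dbarSq E U y :=
      integral_nonneg fun y => mul_nonneg (sq_nonneg _) (dbarSq_nonneg U y)
    have p2 : 0 ≤ ∫ y in reg φ r, φ y ^ 2 * thetaSq E U y :=
      integral_nonneg fun y => mul_nonneg (sq_nonneg _) (thetaSq_nonneg U y)
    rw [hint]
    have hp : (1 : ℝ) / (p + 2) ≤ 1 := by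
      rw [div_le_one (by positivity)]; linarith [(Nat.cast_nonneg p : (0 : ℝ) ≤ p)]
    have q1 := mul_le_mul_of_nonneg_right hp p1
    have hp0 : (0 : ℝ) ≤ p := Nat.cast_nonneg p
    have q2 := mul_le_mul_of_nonneg_left hreal (show (0 : ℝ) ≤ p + 1 by positivity)
    have q3 := mul_nonneg hS0 p1
    have q4 := mul_nonneg hS0 p2
    have q5 := mul_nonneg hp0 p1
    have q6 := mul_nonneg hp0 p2
    have q7 := mul_nonneg hp0 e2
    have q8 := mul_nonneg hp0 q3
    have q9 := mul_nonneg hp0 q4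
    nlinarith

lemma exists_bSq_bound (hφ : Smooth φ) (hφc : HasCompactSupport φ) (hφ1 : ∀ y, |φ y| ≤ 1)
    (hr : Smooth r) (hE : ∀ a, Smooth (E a)) (q : ℕ) (C₁ : ℝ) :
    ∃ C, 0 ≤ C ∧ ∀ (U : Cn n → Form n q), Smooth U → FrameCond φ r E C₁ U →
      ∀ a I, ∫ y in reg φ r, φ y ^ 2 * ‖compB E U a I y‖ ^ 2 ≤
        C * ((∫ y in reg φ r, φ y ^ 2 * ‖compA E U a I y‖ ^ 2) + errInt φ r U) := by
  choose c hc0 hc using fun a => exists_swap_form hφ hφc hφ1 hr hE q a a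
  have hs0 : 0 ≤ ∑ a, c a := sum_nonneg fun a _ => hc0 a
  refine ⟨2 + ∑ a, c a + 2 * C₁ ^ 2, by positivity, fun U hU hF a I => ?_⟩
  have hφcont := hφ.continuous
  have hUc := hU.continuous
  have e2 := errInt_nonneg (φ := φ) (r := r) U
  have ca := continuous_compA hE hU a I
  have cb := continuous_compB hE hU a I
  have i1 : IntegrableOn (fun y => φ y ^ 2 * ‖compA E U a I y‖ ^ 2) (reg φ r) :=
    integrableOn_reg hφc (by fun_prop)
  have i2 : IntegrableOn (fun y => φ y ^ 2 * ‖compB E U a I y‖ ^ 2) (reg φ r) :=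
    integrableOn_reg hφc (by fun_prop)
  have p1 : 0 ≤ ∫ y in reg φ r, φ y ^ 2 * ‖compA E U a I y‖ ^ 2 :=
      integral_nonneg fun y => by positivity
  have q1 := mul_nonneg hs0 p1
  have q2 := mul_nonneg hs0 e2
  have q3 := mul_nonneg (sq_nonneg C₁) p1
  have q4 := mul_nonneg (sq_nonneg C₁) e2
  rcases hF a with h | ⟨-, h⟩
  · have h1 := hc a U hU I I (Or.inr (Or.inr ⟨h, h⟩))
    have h2 : ∫ y in reg φ r, ((φ y : ℂ) ^ 2) * (compA E U a I y * conj
        (compA E U a I y) - compB E U a I y * conj (compB E U a I y)) =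
        (((∫ y in reg φ r, φ y ^ 2 * ‖compA E U a I y‖ ^ 2) -
          ∫ y in reg φ r, φ y ^ 2 * ‖compB E U a I y‖ ^ 2 : ℝ) : ℂ) := by
      rw [← integral_sub i1 i2, ← integral_complex_ofReal]
      congr 1 with y
      rw [← ofReal_norm_sq, ← ofReal_norm_sq]
      push_cast
      ring
    rw [h2, norm_real, norm_eq_abs] at h1
    have h3 := (abs_le.1 h1).1
    have h4 := mul_le_mul_of_nonneg_right
      (single_le_sum (fun a _ => hc0 a) (mem_univ a)) e2
    nlinarith
  · have hmeas := measurableSet_reg (φ := φ) hr.continuous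
    have i3 : IntegrableOn (fun y => φ y ^ 2 * ‖U y‖ ^ 2) (reg φ r) :=
      integrableOn_reg hφc (by fun_prop)
    have h1 : ∫ y in reg φ r, φ y ^ 2 * ‖compB E U a I y‖ ^ 2 ≤
        2 * (∫ y in reg φ r, φ y ^ 2 * ‖compA E U a I y‖ ^ 2) +
          2 * C₁ ^ 2 * ∫ y in reg φ r, φ y ^ 2 * ‖U y‖ ^ 2 := by
      rw [← integral_const_mul, ← integral_const_mul,
        ← integral_add (i1.const_mul _) (i3.const_mul _)]
      refine setIntegral_mono_on i2 ((i1.const_mul _).add (i3.const_mul _)) hmeas fun y hy => ?_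
      have h2 := h y hy I
      have h3 : ‖compB E U a I y‖ ^ 2 ≤ 2 * ‖compA E U a I y‖ ^ 2 + 2 * C₁ ^ 2 * ‖U y‖ ^ 2 := by
        nlinarith [sq_nonneg (‖compA E U a I y‖ - C₁ * ‖U y‖), norm_nonneg (compB E U a I y)]
      have := mul_le_mul_of_nonneg_left h3 (sq_nonneg (φ y))
      linarith
    have h2 := integral_sq_norm_le_errInt (r := r) hφ hφc hφ1 hU
    have h3 := mul_le_mul_of_nonneg_left h2 (show 0 ≤ 2 * C₁ ^ 2 by positivity)
    nlinarith

set_option maxHeartbeats 800000 in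
/-- **The local a priori estimate.** -/
theorem exists_local_estimate (hφ : Smooth φ) (hφc : HasCompactSupport φ)
    (hφ1 : ∀ y, |φ y| ≤ 1) (hr : Smooth r) (hE : ∀ a, Smooth (E a)) (q : ℕ) (C₁ : ℝ)
    {C₂ : ℝ} (hfr : ∀ y ∈ tsupport φ, ∀ f : Cn n →L[ℝ] Form n q, (∀ v, IsT0 (f v)) →
      ‖f‖ ^ 2 ≤ C₂ * ∑ a, ∑ I : Fin q → Fin n, (‖conjPart f (E a y) fun s => E (I s) y‖ ^ 2 +
        ‖holPart f (E a y) fun s => E (I s) y‖ ^ 2)) :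
    ∃ C, 0 ≤ C ∧ ∀ (U : Cn n → Form n q), Smooth U → (∀ y v, IsT0 (ð U y v)) →
      FrameCond φ r E C₁ U → ∫ y in reg φ r, φ y ^ 2 * ‖ð U y‖ ^ 2 ≤
        C * ((∫ y in reg φ r, φ y ^ 2 * dbarSq E U y) +
          (∫ y in reg φ r, φ y ^ 2 * thetaSq E U y) + ∫ y in reg φ r, ‖U y‖ ^ 2) := by
  obtain ⟨Ca, hCa0, hCa⟩ := exists_aSq_bound hφ hφc hφ1 hr hE q C₁
  obtain ⟨Cb, hCb0, hCb⟩ := exists_bSq_bound hφ hφc hφ1 hr hE q C₁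
  set m : ℝ := ∑ _a : Fin n, ∑ _I : Fin q → Fin n, (1 : ℝ) with hm
  have hm0 : 0 ≤ m := sum_nonneg fun _ _ => sum_nonneg fun _ _ => zero_le_one
  set K := |C₂| * ((1 + Cb) * Ca + Cb * m) with hK
  have hK0 : 0 ≤ K := by positivity
  have hKp : 0 < 2 * (K + 1) := by positivity
  refine ⟨2 * K + 2 * K * (1 / (4 * (1 / (2 * (K + 1)))) + 1), by positivity, fun U hU hT hF => ?_⟩
  have hφcont := hφ.continuous
  have hUc := hU.continuous
  have hDU := continuous_norm_fderiv hU
  have e2 := errInt_nonneg (φ := φ) (r := r) U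
  have ca := fun a I => continuous_compA hE hU a I
  have cb := fun a I => continuous_compB hE hU a I
  have hmeas := measurableSet_reg (φ := φ) hr.continuous
  have i1 : ∀ a I, IntegrableOn (fun y => φ y ^ 2 * ‖compA E U a I y‖ ^ 2) (reg φ r) :=
    fun a I => integrableOn_reg hφc (by fun_prop)
  have i2 : ∀ a I, IntegrableOn (fun y => φ y ^ 2 * ‖compB E U a I y‖ ^ 2) (reg φ r) :=
    fun a I => integrableOn_reg hφc (by fun_prop)
  have p1 : 0 ≤ ∫ y in reg φ r, φ y ^ 2 * dbarSq E U y :=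
      integral_nonneg fun y => mul_nonneg (sq_nonneg _) (dbarSq_nonneg U y)
  have p2 : 0 ≤ ∫ y in reg φ r, φ y ^ 2 * thetaSq E U y :=
      integral_nonneg fun y => mul_nonneg (sq_nonneg _) (thetaSq_nonneg U y)
  set X := ∫ y in reg φ r, φ y ^ 2 * ‖ð U y‖ ^ 2 with hX
  set D1 := ∫ y in reg φ r, φ y ^ 2 * dbarSq E U y with hD1
  set D2 := ∫ y in reg φ r, φ y ^ 2 * thetaSq E U y with hD2
  set N := ∫ y in reg φ r, ‖U y‖ ^ 2 with hN
  have hN0 : 0 ≤ N := integral_nonneg fun y => sq_nonneg _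
  set A : ℝ := ∫ y in reg φ r, φ y ^ 2 * aSq E U y with hA
  have hAs : A = ∑ a, ∑ I, ∫ y in reg φ r, φ y ^ 2 * ‖compA E U a I y‖ ^ 2 := by
    simp only [hA, aSq, mul_sum]
    rw [integral_finsetSum _ fun a _ => integrable_finsetSum _ fun I _ => i1 a I]
    refine sum_congr rfl fun a _ => ?_
    rw [integral_finsetSum _ fun I _ => i1 a I]
  have h1 : A ≤ Ca * (D1 + D2 + errInt φ r U) := hCa U hU hF
  have h2 : ∑ a, ∑ I, ∫ y in reg φ r, φ y ^ 2 * ‖compB E U a I y‖ ^ 2 ≤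
      Cb * (A + m * errInt φ r U) := by
    rw [hAs, hm, sum_mul, ← sum_add_distrib, mul_sum]
    refine sum_le_sum fun a _ => ?_
    rw [sum_mul, ← sum_add_distrib, mul_sum]
    refine sum_le_sum fun I _ => ?_
    rw [one_mul]
    exact hCb U hU hF a I
  have h3 : X ≤ |C₂| * (A + ∑ a, ∑ I, ∫ y in reg φ r, φ y ^ 2 * ‖compB E U a I y‖ ^ 2) := by
    have i12 : ∀ a I, IntegrableOn (fun y => φ y ^ 2 * ‖compA E U a I y‖ ^ 2 +
        φ y ^ 2 * ‖compB E U a I y‖ ^ 2) (reg φ r) := fun a I => (i1 a I).add (i2 a I)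
    have i3 : IntegrableOn (fun y => ∑ a, ∑ I, (φ y ^ 2 * ‖compA E U a I y‖ ^ 2 +
        φ y ^ 2 * ‖compB E U a I y‖ ^ 2)) (reg φ r) :=
      integrable_finsetSum _ fun a _ => integrable_finsetSum _ fun I _ => i12 a I
    have h4 : A + ∑ a, ∑ I, ∫ y in reg φ r, φ y ^ 2 * ‖compB E U a I y‖ ^ 2 =
        ∫ y in reg φ r, ∑ a, ∑ I, (φ y ^ 2 * ‖compA E U a I y‖ ^ 2 +
          φ y ^ 2 * ‖compB E U a I y‖ ^ 2) := by
      rw [hAs, ← sum_add_distrib, integral_finsetSum _ fun a _ =>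
        integrable_finsetSum _ fun I _ => i12 a I]
      refine sum_congr rfl fun a _ => ?_
      rw [← sum_add_distrib, integral_finsetSum _ fun I _ => i12 a I]
      refine sum_congr rfl fun I _ => ?_
      exact (integral_add (i1 a I) (i2 a I)).symm
    rw [h4, ← integral_const_mul]
    refine setIntegral_mono_on (integrableOn_reg hφc (by fun_prop)) (i3.const_mul _) hmeas
      fun y hy => ?_
    have h5 := hfr y hy.2 (ð U y) (hT y)
    have h6 : ∑ a, ∑ I, (φ y ^ 2 * ‖compA E U a I y‖ ^ 2 + φ y ^ 2 * ‖compB E U a I y‖ ^ 2) =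
        φ y ^ 2 * ∑ a, ∑ I, (‖compA E U a I y‖ ^ 2 + ‖compB E U a I y‖ ^ 2) := by
      simp only [mul_sum, mul_add]
    have h7 : 0 ≤ ∑ a, ∑ I, (‖compA E U a I y‖ ^ 2 + ‖compB E U a I y‖ ^ 2) :=
      sum_nonneg fun _ _ => sum_nonneg fun _ _ => by positivity
    rw [h6]
    calc _ ≤ φ y ^ 2 * (|C₂| * ∑ a, ∑ I, (‖compA E U a I y‖ ^ 2 + ‖compB E U a I y‖ ^ 2)) :=
          mul_le_mul_of_nonneg_left
            (h5.trans (mul_le_mul_of_nonneg_right (le_abs_self _) h7)) (sq_nonneg _)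
      _ = _ := by ring
  have h4 : X ≤ K * (D1 + D2 + errInt φ r U) := by
    have a1 := mul_le_mul_of_nonneg_left h2 (abs_nonneg C₂)
    have a2 := mul_le_mul_of_nonneg_left h1 (show 0 ≤ |C₂| * (1 + Cb) by positivity)
    have a3 : 0 ≤ |C₂| * Cb * m * (D1 + D2) := by positivity
    calc X ≤ |C₂| * (1 + Cb) * A + |C₂| * (Cb * (m * errInt φ r U)) := by linarith
      _ ≤ |C₂| * (1 + Cb) * (Ca * (D1 + D2 + errInt φ r U)) + |C₂| * (Cb * (m * errInt φ r U)) +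
          |C₂| * Cb * m * (D1 + D2) := by linarith
      _ = _ := by rw [hK]; ring
  have h5 := errInt_le (r := r) hφ hφc hφ1 hU (δ := 1 / (2 * (K + 1))) (by positivity)
  rw [← hX, ← hN] at h5
  have hX0 : 0 ≤ X := integral_nonneg fun y => mul_nonneg (sq_nonneg _) (sq_nonneg _)
  exact absorb hK0 hX0 h4 h5 (add_nonneg p1 p2) hN0

end

/-! ### Smooth Hermitian metrics on open sets -/

section Mat

variable {X : Type*} [NormedAddCommGroup X] [NormedSpace ℝ X] {ι : Type*} [Fintype ι]
  [DecidableEq ι] {𝕜 : Type*} [RCLike 𝕜] {s : Set X}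

lemma contDiffOn_det {M : X → Matrix ι ι 𝕜} (h : ∀ i j, SmoothOn (fun x => M x i j) s) :
    SmoothOn (fun x => (M x).det) s := by
  simp only [Matrix.det_apply]
  refine ContDiffOn.sum fun σ _ => ?_
  exact (contDiffOn_prod fun i _ => h _ _).const_smul _

lemma contDiffOn_matrix_inv {M : X → Matrix ι ι 𝕜}
    (h : ∀ i j, SmoothOn (fun x => M x i j) s) (hd : ∀ x ∈ s, (M x).det ≠ 0) (i j : ι) :
    SmoothOn (fun x => (M x)⁻¹ i j) s := by
  have h1 : ∀ x, (M x)⁻¹ i j = (M x).det⁻¹ * (Matrix.updateRow (M x) j (Pi.single i 1)).det := by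
    intro x
    rw [Matrix.inv_def, Matrix.smul_apply, Ring.inverse_eq_inv', Matrix.adjugate_apply, smul_eq_mul]
  simp only [h1]
  refine ((contDiffOn_det h).inv hd).mul (contDiffOn_det fun a b => ?_)
  by_cases ha : a = j
  · subst ha
    simp only [Matrix.updateRow_self]
    exact contDiffOn_const
  · simp only [Matrix.updateRow_ne ha]
    exact h a b

end Mat

/-- A smooth Hermitian metric on the open set `Ω`. -/
structure IsMet (B : Cn n → Bil n) (Ω : Set (Cn n)) : Prop where
  isOpen : IsOpen Ω
  smooth : SmoothOn B Ω
  herm : ∀ y ∈ Ω, IsHerm (B y)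

lemma contDiffOn_gramB {B : Cn n → Bil n} {Ω : Set (Cn n)}
    (hB : SmoothOn B Ω) (a b : Fin n × Fin 2) : SmoothOn (fun y => gramB (B y) a b) Ω :=
  (hB.clm_apply contDiffOn_const).clm_apply contDiffOn_const

lemma IsHerm.exists_unitary {B : Bil n} (hB : IsHerm B) : ∃ E : Fin n → Cn n, IsUnitary B E := by
  rcases Nat.eq_zero_or_pos n with rfl | hn
  · exact ⟨fun a => a.elim0, fun a => a.elim0⟩
  · obtain ⟨W, E, hW, hpW, hWV, hE, hEu, hE0⟩ := exists_unitary_frame (B := fun _ => B) hn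
      (V := Set.univ) isOpen_univ contDiffOn_const (fun y _ => hB) (p := 0) (Set.mem_univ _)
      (fun _ => EuclideanSpace.single ⟨0, hn⟩ (1 : ℂ)) contDiffOn_const (by simp)
    exact ⟨fun a => E a 0, hEu 0 hpW⟩

lemma IsHerm.det_pos {B : Bil n} (hB : IsHerm B) : 0 < (gramB B).det := by
  refine Matrix.PosDef.det_pos (Matrix.PosDef.of_dotProduct_mulVec_pos ?_ fun x hx => ?_)
  · ext a b
    exact hB.symm _ _
  · have h1 : star x ⬝ᵥ (gramB B).mulVec x = B (∑ a, x a • rb n a) (∑ a, x a • rb n a) := by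
      simp only [map_sum, map_smul, sum_apply, smul_apply, dotProduct, Matrix.mulVec, gramB,
        Matrix.of_apply, smul_eq_mul, mul_sum, Pi.star_apply, star_trivial]
      refine sum_congr rfl fun a _ => sum_congr rfl fun b _ => ?_
      rw [hB.symm]
      ring
    rw [h1]
    refine hB.pos _ fun h0 => hx ?_
    exact funext fun a => Fintype.linearIndependent_iff.1 (linearIndependent_rb n) x h0 a

lemma IsHerm.dens_pos {B : Bil n} (hB : IsHerm B) : 0 < dens B :=
  sqrt_pos.2 hB.det_pos

lemma IsMet.contDiffOn_dens {B : Cn n → Bil n} {Ω : Set (Cn n)}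
    (hB : IsMet B Ω) : SmoothOn (fun y => dens (B y)) Ω :=
  (contDiffOn_det (contDiffOn_gramB hB.smooth)).sqrt fun y hy => (hB.herm y hy).det_pos.ne'

lemma IsMet.contDiffOn_inv {B : Cn n → Bil n} {Ω : Set (Cn n)}
    (hB : IsMet B Ω) (a b : Fin n × Fin 2) : SmoothOn (fun y => (gramB (B y))⁻¹ a b) Ω :=
  contDiffOn_matrix_inv (contDiffOn_gramB hB.smooth) (fun y hy => (hB.herm y hy).det_pos.ne') a b

/-! ### The inner product of forms -/

section FInner

variable {G : Matrix (Fin n × Fin 2) (Fin n × Fin 2) ℝ}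

/-- The inner product with a fixed form, as a complex linear functional. -/
def fInnerL (G : Matrix (Fin n × Fin 2) (Fin n × Fin 2) ℝ) (β : Form n q) : Form n q →ₗ[ℂ] ℂ where
  toFun α := fInner G α β
  map_add' α α' := by
    simp only [fInner, ContinuousAlternatingMap.add_apply, add_mul, mul_add, sum_add_distrib]
  map_smul' c α := by
    simp only [fInner, ContinuousAlternatingMap.smul_apply, smul_eq_mul, mul_sum, RingHom.id_apply]
    refine sum_congr rfl fun I _ => sum_congr rfl fun K _ => ?_
    ring

lemma fInner_add_right (α β β' : Form n q) :
    fInner G α (β + β') = fInner G α β + fInner G α β' := by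
  simp only [fInner, ContinuousAlternatingMap.add_apply, map_add, mul_add, sum_add_distrib]

lemma fInner_smul_right (c : ℂ) (α β : Form n q) : fInner G α (c • β) = conj c * fInner G α β := by
  simp only [fInner, ContinuousAlternatingMap.smul_apply, smul_eq_mul, mul_sum, map_mul]
  refine sum_congr rfl fun I _ => sum_congr rfl fun K _ => ?_
  ring

lemma fInner_smul_left (c : ℂ) (α β : Form n q) : fInner G (c • α) β = c * fInner G α β :=
  (fInnerL G β).map_smul c α

lemma fInner_add_left (α α' β : Form n q) : fInner G (α + α') β = fInner G α β + fInner G α' β :=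
  (fInnerL G β).map_add α α'

lemma fInner_sub_left (α α' β : Form n q) : fInner G (α - α') β = fInner G α β - fInner G α' β :=
  (fInnerL G β).map_sub α α'

lemma fInner_sub_right (α β β' : Form n q) :
    fInner G α (β - β') = fInner G α β - fInner G α β' := by
  have := fInner_add_right (G := G) α (β - β') β'
  rw [sub_add_cancel] at this
  rw [this]; ring

lemma fInner_sum_left {ι : Type*} (s : Finset ι) (α : ι → Form n q) (β : Form n q) :
    fInner G (∑ i ∈ s, α i) β = ∑ i ∈ s, fInner G (α i) β :=
  map_sum (fInnerL G β) α s

lemma fInner_sum_right {ι : Type*} (s : Finset ι) (α : Form n q) (β : ι → Form n q) :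
    fInner G α (∑ i ∈ s, β i) = ∑ i ∈ s, fInner G α (β i) := by
  classical
  induction s using Finset.induction_on with
  | empty => simp [fInner]
  | insert a s ha ih => rw [Finset.sum_insert ha, Finset.sum_insert ha, fInner_add_right, ih]

variable {B : Bil n}

lemma fInner_conj_symm (hB : IsHerm B) (α β : Form n q) :
    conj (fInner (gramB B) α β) = fInner (gramB B) β α := by
  obtain ⟨E, hE⟩ := hB.exists_unitary
  rw [fInner_unitary_real hB hE, fInner_unitary_real hB hE]
  simp only [map_mul, map_sum, map_inv₀, map_natCast, conj_conj]
  congr 1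
  exact sum_congr rfl fun I _ => mul_comm _ _

/-- The squared length of a form in a real orthonormal frame. -/
lemma fInner_self_eq (hB : IsHerm B) {E : Fin n → Cn n} (hE : IsUnitary B E) (α : Form n q) :
    fInner (gramB B) α α = (((q.factorial : ℝ))⁻¹ *
      ∑ I : Fin q → Fin n × Fin 2, ‖α (fun s => rf E (I s))‖ ^ 2 : ℝ) := by
  rw [fInner_unitary_real hB hE]
  push_cast
  congr 1
  refine sum_congr rfl fun I _ => ?_
  rw [← ofReal_norm_sq]
  push_cast
  rfl

/-- The squared length `|α|²` of a form. -/
def fSq (G : Matrix (Fin n × Fin 2) (Fin n × Fin 2) ℝ) (α : Form n q) : ℝ := (fInner G α α).re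

lemma fInner_self (hB : IsHerm B) (α : Form n q) : fInner (gramB B) α α = fSq (gramB B) α := by
  obtain ⟨E, hE⟩ := hB.exists_unitary
  rw [fSq, fInner_self_eq hB hE, ofReal_re]

lemma fSq_nonneg (hB : IsHerm B) (α : Form n q) : 0 ≤ fSq (gramB B) α := by
  obtain ⟨E, hE⟩ := hB.exists_unitary
  rw [fSq, fInner_self_eq hB hE, ofReal_re]
  positivity

lemma form_eq_zero_of_rf (hB : IsHerm B) {E : Fin n → Cn n} (hE : IsUnitary B E) {α : Form n q}
    (h : ∀ I : Fin q → Fin n × Fin 2, α (fun s => rf E (I s)) = 0) : α = 0 := by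
  ext v
  classical
  conv_lhs => rw [show v = fun s => ∑ k, B (rf E k) (v s) • rf E k from
    funext fun s => (hE.sum_rf hB (v s)).symm]
  have h2 : α (fun s => ∑ k, B (rf E k) (v s) • rf E k) =
      ∑ J : Fin q → Fin n × Fin 2, α (fun s => B (rf E (J s)) (v s) • rf E (J s)) :=
    α.toMultilinearMap.map_sum (fun s k => B (rf E k) (v s) • rf E k)
  rw [h2]
  refine sum_eq_zero fun J _ => ?_
  have h3 := α.toMultilinearMap.map_smul_univ (fun s => B (rf E (J s)) (v s)) fun s => rf E (J s)
  have h4 : α.toMultilinearMap (fun s => rf E (J s)) = 0 := h J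
  rw [h4, smul_zero] at h3
  exact h3

lemma fSq_pos (hB : IsHerm B) {α : Form n q} (hα : α ≠ 0) : 0 < fSq (gramB B) α := by
  obtain ⟨E, hE⟩ := hB.exists_unitary
  refine lt_of_le_of_ne (fSq_nonneg hB α) fun h => hα (form_eq_zero_of_rf hB hE fun I => ?_)
  rw [fSq, fInner_self_eq hB hE, ofReal_re, eq_comm, mul_eq_zero] at h
  have h1 := h.resolve_left (by positivity)
  rw [Finset.sum_eq_zero_iff_of_nonneg fun _ _ => sq_nonneg _] at h1
  simpa using h1 I (mem_univ I)

/-- Young's inequality for the inner product of forms. -/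
lemma two_mul_re_fInner_le (hB : IsHerm B) (α β : Form n q) :
    2 * (fInner (gramB B) α β).re ≤ fSq (gramB B) α + fSq (gramB B) β := by
  have h1 := fSq_nonneg hB (α - β)
  have h2 := congrArg Complex.re (fInner_conj_symm hB α β)
  rw [conj_re] at h2
  rw [fSq, fInner_sub_left, fInner_sub_right, fInner_sub_right] at h1
  simp only [Complex.sub_re] at h1
  simp only [fSq]
  linarith

lemma fSq_add_le (hB : IsHerm B) (α β : Form n q) :
    fSq (gramB B) (α + β) ≤ 2 * fSq (gramB B) α + 2 * fSq (gramB B) β := by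
  have h1 := fSq_nonneg hB (α - β)
  rw [fSq, fInner_sub_left, fInner_sub_right, fInner_sub_right] at h1
  simp only [Complex.sub_re] at h1
  simp only [fSq]
  rw [fInner_add_left, fInner_add_right, fInner_add_right]
  simp only [add_re]
  linarith

lemma fSq_smul (c : ℂ) (α : Form n q) : fSq G (c • α) = ‖c‖ ^ 2 * fSq G α := by
  rw [fSq, fInner_smul_left, fInner_smul_right, ← mul_assoc, ← ofReal_norm_sq, re_ofReal_mul]
  rfl

end FInner

instance finiteDimensional_form (n q : ℕ) : FiniteDimensional ℝ (Form n q) :=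
  FiniteDimensional.of_injective (evRb n q) (evRb_injective n q)

section Bounds

variable {B : Cn n → Bil n} {Ω K : Set (Cn n)}

lemma IsMet.continuousOn_fSq (hB : IsMet B Ω) :
    ContinuousOn (fun p : Cn n × Form n q => fSq (gramB (B p.1)) p.2) (Ω ×ˢ Set.univ) := by
  have h1 : ∀ a b, ContinuousOn (fun p : Cn n × Form n q => (gramB (B p.1))⁻¹ a b)
      (Ω ×ˢ Set.univ) := fun a b =>
    (hB.contDiffOn_inv a b).continuousOn.comp continuousOn_fst fun p hp => hp.1
  have h2 : ∀ v : Fin q → Cn n, ContinuousOn (fun p : Cn n × Form n q => p.2 v)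
      (Ω ×ˢ Set.univ) := fun v =>
    ((evL v).continuous.comp continuous_snd).continuousOn
  unfold fSq fInner
  refine continuous_re.comp_continuousOn (continuousOn_const.mul ?_)
  refine continuousOn_finset_sum _ fun I _ => continuousOn_finset_sum _ fun J _ => ?_
  refine ContinuousOn.mul ?_ ((h2 _).mul (continuous_conj.comp_continuousOn (h2 _)))
  exact continuous_ofReal.comp_continuousOn (continuousOn_finset_prod _ fun s _ => h1 _ _)

/-- On compact sets the length given by a metric is comparable with the norm. -/
lemma IsMet.exists_fSq_bounds (hB : IsMet B Ω) (hK : IsCompact K) (hKΩ : K ⊆ Ω) (q : ℕ) :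
    ∃ C, 0 < C ∧ ∀ y ∈ K, ∀ α : Form n q,
      ‖α‖ ^ 2 ≤ C * fSq (gramB (B y)) α ∧ fSq (gramB (B y)) α ≤ C * ‖α‖ ^ 2 := by
  have hS : IsCompact (K ×ˢ Metric.sphere (0 : Form n q) 1) := hK.prod (isCompact_sphere _ _)
  have hc : ContinuousOn (fun p : Cn n × Form n q => fSq (gramB (B p.1)) p.2)
      (K ×ˢ Metric.sphere (0 : Form n q) 1) :=
    hB.continuousOn_fSq.mono (Set.prod_mono hKΩ (Set.subset_univ _))
  have hne : ∀ p ∈ K ×ˢ Metric.sphere (0 : Form n q) 1, 0 < fSq (gramB (B p.1)) p.2 := by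
    intro p hp
    refine fSq_pos (hB.herm _ (hKΩ hp.1)) fun h0 => ?_
    have := hp.2
    rw [h0] at this
    simp at this
  obtain ⟨C1, hC1⟩ := hS.exists_bound_of_continuousOn hc
  obtain ⟨C2, hC2⟩ := hS.exists_bound_of_continuousOn (hc.inv₀ fun p hp => (hne p hp).ne')
  refine ⟨max 1 (max C1 C2), by positivity, fun y hy α => ?_⟩
  rcases eq_or_ne α 0 with rfl | hα
  · have : fSq (gramB (B y)) (0 : Form n q) = 0 := by simp [fSq, fInner]
    rw [this]
    simp
  have hα0 := norm_pos_iff.2 hα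
  set β : Form n q := ((‖α‖ : ℂ)⁻¹) • α with hβ
  have hβ1 : ‖β‖ = 1 := by
    rw [hβ, norm_smul, norm_inv, norm_real, norm_norm, inv_mul_cancel₀ hα0.ne']
  have hαβ : α = (‖α‖ : ℂ) • β := by
    rw [hβ, smul_smul, mul_inv_cancel₀ (by exact_mod_cast hα0.ne'), one_smul]
  have hmem : (y, β) ∈ K ×ˢ Metric.sphere (0 : Form n q) 1 := ⟨hy, by simpa using hβ1⟩
  have h0 := hne _ hmem
  have h1 := hC1 _ hmem
  have h2 := hC2 _ hmem
  simp only at h0 h1 h2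
  rw [Pi.inv_apply, norm_of_nonneg (inv_nonneg.2 h0.le)] at h2
  rw [norm_of_nonneg h0.le] at h1
  have h3 : fSq (gramB (B y)) α = ‖α‖ ^ 2 * fSq (gramB (B y)) β := by
    conv_lhs => rw [hαβ, fSq_smul, norm_real, norm_norm]
  rw [h3]
  have h4 : 1 ≤ max 1 (max C1 C2) * fSq (gramB (B y)) β := by
    rw [← div_le_iff₀ h0, one_div]
    exact h2.trans ((le_max_right _ _).trans (le_max_right _ _))
  have h5 : fSq (gramB (B y)) β ≤ max 1 (max C1 C2) :=
    h1.trans ((le_max_left _ _).trans (le_max_right _ _))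
  have h6 := sq_nonneg ‖α‖
  constructor
  · nlinarith [mul_le_mul_of_nonneg_left h4 h6]
  · nlinarith [mul_le_mul_of_nonneg_left h5 h6]

/-- The constant relating `|α|²` with the sum over the components in a unitary frame. -/
def cq (q : ℕ) : ℝ := ((q.factorial : ℝ))⁻¹ * 2 ^ q

lemma cq_pos (q : ℕ) : 0 < cq q := by unfold cq; positivity

lemma cq_succ (q : ℕ) : cq (q + 1) * (q + 1) = 2 * cq q := by
  unfold cq
  rw [Nat.factorial_succ]
  push_cast
  have : (q.factorial : ℝ) ≠ 0 := by positivity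
  have : (q + 1 : ℝ) ≠ 0 := by positivity
  field_simp
  ring

lemma fInner_frame {B : Bil n} (hB : IsHerm B) {E : Fin n → Cn n}
    (hE : IsUnitary B E) {α β : Form n q} (hα : IsT0 α) (hβ : IsT0 β) :
    fInner (gramB B) α β = cq q * ∑ I : Fin q → Fin n, α (fun s => E (I s)) *
        conj (β (fun s => E (I s))) := by
  rw [fInner_unitary hB hE hα hβ, cq]
  push_cast
  rfl

lemma fSq_frame {B : Bil n} (hB : IsHerm B) {E : Fin n → Cn n}
    (hE : IsUnitary B E) {α : Form n q} (hα : IsT0 α) :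
    fSq (gramB B) α = cq q * ∑ I : Fin q → Fin n, ‖α (fun s => E (I s))‖ ^ 2 := by
  have h := fInner_self hB α
  rw [fInner_frame hB hE hα hα] at h
  have h2 : ((cq q * ∑ I : Fin q → Fin n, ‖α (fun s => E (I s))‖ ^ 2 : ℝ) : ℂ) =
    fSq (gramB B) α := by
    rw [← h, Complex.ofReal_mul, ofReal_sum]
    simp only [ofReal_norm_sq]
  exact_mod_cast h2.symm

/-- The derivative of a `(0,q)` form is controlled by its components in a unitary frame. -/
lemma IsMet.exists_frame_bound (hB : IsMet B Ω) (hK : IsCompact K) (hKΩ : K ⊆ Ω)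
    {E : Fin n → Cn n → Cn n} (hE : ∀ a, ContinuousOn (E a) K)
    (hEu : ∀ y ∈ K, IsUnitary (B y) fun a => E a y) (q : ℕ) :
    ∃ C, 0 ≤ C ∧ ∀ y ∈ K, ∀ f : Cn n →L[ℝ] Form n q, (∀ v, IsT0 (f v)) →
      ‖f‖ ^ 2 ≤ C * ∑ a, ∑ I : Fin q → Fin n, (‖conjPart f (E a y) fun s => E (I s) y‖ ^ 2 +
        ‖holPart f (E a y) fun s => E (I s) y‖ ^ 2) := by
  obtain ⟨C, hC0, hC⟩ := hB.exists_fSq_bounds hK hKΩ q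
  have hrf : ∀ a : Fin n × Fin 2, ContinuousOn (fun y => rf (fun a => E a y) a) K := by
    intro a
    unfold rf
    split_ifs
    · exact hE _
    · exact (hE _).const_smul î
  choose D hD using fun a : Fin n × Fin 2 => hK.exists_bound_of_continuousOn
    ((hB.smooth.continuousOn.mono hKΩ).clm_apply (hrf a))
  have hDnn : ∀ a, 0 ≤ |D a| := fun a => abs_nonneg _
  set m : ℝ := ∑ a, |D a| with hm
  have hm0 : 0 ≤ m := sum_nonneg fun a _ => hDnn a
  refine ⟨m ^ 2 * (C * (cq q * 4)), by have := cq_pos q; positivity, fun y hy f hf => ?_⟩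
  set S : ℝ := ∑ a, ∑ I : Fin q → Fin n, (‖conjPart f (E a y) fun s => E (I s) y‖ ^ 2 +
        ‖holPart f (E a y) fun s => E (I s) y‖ ^ 2) with hS
  have hS0 : 0 ≤ S := sum_nonneg fun _ _ => sum_nonneg fun _ _ => by positivity
  set T := Real.sqrt (C * (cq q * 4) * S) with hT
  have hcq := cq_pos q
  have hT2 : T ^ 2 = C * (cq q * 4) * S := sq_sqrt (by positivity)
  have hsplit : ∀ a : Fin n × Fin 2, ‖f (rf (fun a => E a y) a)‖ ≤ T := by
    intro a
    rw [hT]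
    refine Real.le_sqrt_of_sq_le ?_
    refine (hC y hy _).1.trans ?_
    rw [fSq_frame (hB.herm y (hKΩ hy)) (hEu y hy) (hf _), mul_assoc, mul_assoc]
    refine mul_le_mul_of_nonneg_left (mul_le_mul_of_nonneg_left ?_ hcq.le) hC0.le
    have h1 : ∀ I : Fin q → Fin n, ‖f (rf (fun a => E a y) a) fun s => E (I s) y‖ ^ 2 ≤
        4 * (‖conjPart f (E a.1 y) fun s => E (I s) y‖ ^ 2 +
        ‖holPart f (E a.1 y) fun s => E (I s) y‖ ^ 2) := by
      intro I
      set P := conjPart f (E a.1 y) fun s => E (I s) y with hP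
      set Q := holPart f (E a.1 y) fun s => E (I s) y with hQ
      have h2 : ‖f (rf (fun a => E a y) a) fun s => E (I s) y‖ ≤ ‖P‖ + ‖Q‖ := by
        rw [rf]
        split_ifs
        · have : f (E a.1 y) (fun s => E (I s) y) = P + Q := by
            simp only [hP, hQ, conjPart_apply, holPart, ContinuousAlternatingMap.smul_apply,
              ContinuousAlternatingMap.add_apply, ContinuousAlternatingMap.sub_apply, smul_eq_mul]
            ring
          rw [this]
          exact norm_add_le _ _
        · have : f (î • E a.1 y) (fun s => E (I s) y) = -î * (P - Q) := by
            simp only [hP, hQ, conjPart_apply, holPart, ContinuousAlternatingMap.smul_apply,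
              ContinuousAlternatingMap.add_apply, ContinuousAlternatingMap.sub_apply, smul_eq_mul]
            linear_combination f (î • E a.1 y) (fun s => E (I s) y) * I_sq
          rw [this, norm_mul, norm_neg, norm_I, one_mul]
          exact norm_sub_le _ _
      have := norm_nonneg (f (rf (fun a => E a y) a) fun s => E (I s) y)
      nlinarith [sq_nonneg (‖P‖ - ‖Q‖), norm_nonneg P, norm_nonneg Q]
    calc _ ≤ ∑ I : Fin q → Fin n, 4 * (‖conjPart f (E a.1 y) fun s => E (I s) y‖ ^ 2 +
        ‖holPart f (E a.1 y) fun s => E (I s) y‖ ^ 2) := sum_le_sum fun I _ => h1 I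
      _ = 4 * ∑ I : Fin q → Fin n, (‖conjPart f (E a.1 y) fun s => E (I s) y‖ ^ 2 +
        ‖holPart f (E a.1 y) fun s => E (I s) y‖ ^ 2) := by rw [mul_sum]
      _ ≤ 4 * S := by
        refine mul_le_mul_of_nonneg_left ?_ (by norm_num)
        exact single_le_sum (f := fun a => ∑ I : Fin q → Fin n,
          (‖conjPart f (E a y) fun s => E (I s) y‖ ^ 2 + ‖holPart f (E a y) fun s => E (I s) y‖ ^ 2))
          (fun _ _ => sum_nonneg fun _ _ => by positivity) (mem_univ a.1)
  have hT0 : 0 ≤ T := sqrt_nonneg _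
  have hop : ‖f‖ ≤ m * T := by
    refine ContinuousLinearMap.opNorm_le_bound _ (by positivity) fun v => ?_
    have hv := (hEu y hy).sum_rf (hB.herm y (hKΩ hy)) v
    conv_lhs => rw [← hv, map_sum]
    refine (norm_sum_le _ _).trans ?_
    rw [hm, sum_mul, sum_mul]
    refine sum_le_sum fun a _ => ?_
    rw [map_smul, norm_smul]
    have h1 : ‖B y (rf (fun a => E a y) a) v‖ ≤ |D a| * ‖v‖ :=
      ((B y (rf (fun a => E a y) a)).le_opNorm v).trans
        (mul_le_mul_of_nonneg_right ((hD a y hy).trans (le_abs_self _)) (norm_nonneg _))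
    calc _ ≤ (|D a| * ‖v‖) * T := mul_le_mul h1 (hsplit a) (norm_nonneg _) (by positivity)
      _ = _ := by ring
  calc ‖f‖ ^ 2 ≤ (m * T) ^ 2 :=
        pow_le_pow_left₀ (ContinuousLinearMap.opNorm_nonneg _) hop 2
    _ = _ := by rw [mul_pow, hT2]; ring

end Bounds

/-! ### Riesz representation for `(0,q)` forms -/

/-- The space of `(0,q)` forms on `ℂⁿ` with constant coefficients. -/
def t0Sub (n q : ℕ) : Submodule ℂ (Form n q) where
  carrier := {α | IsT0 α}
  add_mem' {α β} hα hβ v i := by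
    have h1 := hα v i
    have h2 := hβ v i
    simp only [ContinuousAlternatingMap.add_apply, h1, h2]
    ring
  zero_mem' v i := by simp
  smul_mem' c α hα v i := by
    have h1 := hα v i
    simp only [ContinuousAlternatingMap.smul_apply, h1, smul_eq_mul]
    ring

lemma mem_t0Sub {α : Form n q} : α ∈ t0Sub n q ↔ IsT0 α := Iff.rfl

instance finite_t0Sub (n q : ℕ) : Module.Finite ℂ (t0Sub n q) := by
  have : Module.Finite ℂ (Form n q) := Module.Finite.of_restrictScalars_finite ℝ ℂ _
  infer_instance

instance free_t0Sub (n q : ℕ) : Module.Free ℂ (t0Sub n q) :=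
  Module.Free.of_divisionRing ℂ (t0Sub n q)

/-- A basis of the space of `(0,q)` forms with constant coefficients. -/
def bT (n q : ℕ) : Module.Basis (Fin (Module.finrank ℂ (t0Sub n q))) ℂ (t0Sub n q) :=
  Module.finBasis ℂ (t0Sub n q)

lemma IsT0.sum_repr {α : Form n q} (hα : IsT0 α) :
    ∃ c : Fin (Module.finrank ℂ (t0Sub n q)) → ℂ, α = ∑ r, c r • (bT n q r : Form n q) := by
  refine ⟨fun r => (bT n q).repr ⟨α, hα⟩ r, ?_⟩
  have := congrArg (t0Sub n q).subtype ((bT n q).sum_repr ⟨α, hα⟩)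
  rw [map_sum] at this
  exact this.symm

section Riesz

/-- The matrix of the inner product on constant `(0,q)` forms. -/
def hermM (q : ℕ) (B : Bil n) :
    Matrix (Fin (Module.finrank ℂ (t0Sub n q))) (Fin (Module.finrank ℂ (t0Sub n q))) ℂ :=
  Matrix.of fun r s => fInner (gramB B) (bT n q r : Form n q) (bT n q s : Form n q)

lemma det_hermM_ne_zero {B : Bil n} (hB : IsHerm B) : (hermM q B).det ≠ 0 := by
  intro h
  obtain ⟨v, hv0, hv⟩ := Matrix.exists_vecMul_eq_zero_iff.2 h
  set β : Form n q := ∑ r, v r • (bT n q r : Form n q) with hβ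
  have h1 : ∀ s, fInner (gramB B) β (bT n q s : Form n q) = 0 := by
    intro s
    have := congrFun hv s
    simp only [Matrix.vecMul, dotProduct, hermM, Matrix.of_apply, Pi.zero_apply] at this
    rw [hβ, fInner_sum_left]
    simpa only [fInner_smul_left] using this
  have h2 : fInner (gramB B) β β = 0 := by
    conv_lhs => rw [hβ, fInner_sum_right, ← hβ]
    simp [fInner_smul_right, h1]
  have h3 : β = 0 := by
    by_contra h0
    have := fSq_pos hB h0
    rw [fSq, h2] at this
    simp at this
  have h4 : ∑ r, v r • bT n q r = 0 := by
    have h5 : (t0Sub n q).subtype (∑ r, v r • bT n q r) = 0 := by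
      rw [map_sum]
      exact h3
    exact (Submodule.subtype_injective _) (h5.trans (map_zero _).symm)
  have h6 := (bT n q).repr_sum_self v
  rw [h4, map_zero] at h6
  exact hv0 h6.symm

/-- The `(0,q)` form representing a complex linear functional. -/
def riesz (B : Bil n) (L : Form n q → ℂ) : Form n q :=
  ∑ s, conj ((hermM q B)⁻¹.mulVec (fun r => L (bT n q r : Form n q)) s) • (bT n q s : Form n q)

lemma isT0_riesz (B : Bil n) (L : Form n q → ℂ) : IsT0 (riesz B L) :=
  mem_t0Sub.1 (Submodule.sum_mem _ fun s _ => Submodule.smul_mem _ _ (bT n q s).2)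

lemma fInner_riesz {B : Bil n} (hB : IsHerm B) (L : Form n q →ₗ[ℂ] ℂ) {β : Form n q} (hβ : IsT0 β) :
    fInner (gramB B) β (riesz B L) = L β := by
  have h1 : ∀ r, fInner (gramB B) (bT n q r : Form n q) (riesz B L) = L (bT n q r : Form n q) := by
    intro r
    have h2 : (hermM q B).mulVec ((hermM q B)⁻¹.mulVec fun r => L (bT n q r : Form n q)) =
        fun r => L (bT n q r : Form n q) := by
      rw [Matrix.mulVec_mulVec, Matrix.mul_nonsing_inv _ (Ne.isUnit (det_hermM_ne_zero hB)),
        Matrix.one_mulVec]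
    have h3 := congrFun h2 r
    rw [Matrix.mulVec, dotProduct] at h3
    rw [riesz, fInner_sum_right, ← h3]
    refine sum_congr rfl fun s _ => ?_
    rw [fInner_smul_right, conj_conj, mul_comm]
    rfl
  obtain ⟨c, rfl⟩ := hβ.sum_repr
  rw [fInner_sum_left, map_sum]
  refine sum_congr rfl fun r _ => ?_
  rw [fInner_smul_left, map_smul, h1, smul_eq_mul]

lemma ext_fInner {B : Bil n} (hB : IsHerm B) {γ γ' : Form n q} (hγ : IsT0 γ)
    (hγ' : IsT0 γ') (h : ∀ β, IsT0 β → fInner (gramB B) β γ = fInner (gramB B) β γ') : γ = γ' := by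
  by_contra h0
  have h1 := fSq_pos hB (sub_ne_zero.2 h0)
  have h2 := h (γ - γ') ((t0Sub n q).sub_mem hγ hγ')
  rw [fSq, fInner_sub_right, h2] at h1
  simp at h1

lemma contDiffOn_fInner {B : Cn n → Bil n} {Ω : Set (Cn n)} (hB : IsMet B Ω)
    {U V : Cn n → Form n q} (hU : SmoothOn U Ω) (hV : SmoothOn V Ω) :
    SmoothOn (fun y => fInner (gramB (B y)) (U y) (V y)) Ω := by
  unfold fInner
  refine contDiffOn_const.mul (ContDiffOn.sum fun I _ => ContDiffOn.sum fun K _ => ?_)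
  refine ContDiffOn.mul ?_ ((contDiffOn_form_apply_const hU _).mul
    (conjCLE.contDiff.comp_contDiffOn (contDiffOn_form_apply_const hV _)))
  have h1 : SmoothOn (fun y => ∏ s, (gramB (B y))⁻¹ (I s) (K s)) Ω :=
    contDiffOn_prod fun s _ => hB.contDiffOn_inv _ _
  exact ofRealCLM.contDiff.comp_contDiffOn h1

lemma contDiffOn_riesz {B : Cn n → Bil n} {Ω : Set (Cn n)} (hB : IsMet B Ω)
    {L : Cn n → Form n q → ℂ} (hL : ∀ β, SmoothOn (fun y => L y β) Ω) :
    SmoothOn (fun y => riesz (B y) (L y)) Ω := by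
  unfold riesz
  refine ContDiffOn.sum fun s _ => ContDiffOn.smul (?_ : SmoothOn (fun y => conj
    ((hermM q (B y))⁻¹.mulVec (fun r => L y (bT n q r : Form n q)) s)) Ω) contDiffOn_const
  refine conjCLE.contDiff.comp_contDiffOn ?_
  unfold Matrix.mulVec dotProduct
  refine ContDiffOn.sum fun r _ => ContDiffOn.mul ?_ (hL _)
  exact contDiffOn_matrix_inv (fun i j => contDiffOn_fInner hB contDiffOn_const contDiffOn_const)
    (fun y hy => det_hermM_ne_zero (hB.herm y hy)) s r

end Riesz

/-! ### The formal adjoint of `∂̄` -/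

section Theta

/-- The coefficients of the weighted inner product with `γ`. -/
def pairC (B : Bil n) (γ : Form n q) (I : Fin q → Fin n × Fin 2) : ℂ :=
  (dens B : ℂ) * ((q.factorial : ℂ))⁻¹ *
    ∑ K : Fin q → Fin n × Fin 2, ((∏ s, (gramB B)⁻¹ (I s) (K s) : ℝ) : ℂ) *
      conj (γ (fun s => rb n (K s)))

lemma sum_pairC (B : Bil n) (γ β : Form n q) :
    ∑ I, pairC B γ I * β (fun s => rb n (I s)) = dens B * fInner (gramB B) β γ := by
  simp only [pairC, fInner, mul_sum, sum_mul]
  refine sum_congr rfl fun I _ => sum_congr rfl fun K _ => ?_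
  ring

variable {B : Cn n → Bil n} {Ω : Set (Cn n)}

lemma IsMet.contDiffOn_pairC (hB : IsMet B Ω) {U : Cn n → Form n q} (hU : SmoothOn U Ω)
    (I : Fin q → Fin n × Fin 2) : SmoothOn (fun y => pairC (B y) (U y) I) Ω := by
  unfold pairC
  refine ContDiffOn.mul (ContDiffOn.mul ?_ contDiffOn_const) (ContDiffOn.sum fun K _ => ?_)
  · exact ofRealCLM.contDiff.comp_contDiffOn hB.contDiffOn_dens
  · refine ContDiffOn.mul ?_ (conjCLE.contDiff.comp_contDiffOn
      (contDiffOn_form_apply_const hU _))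
    have h1 : SmoothOn (fun y => ∏ s, (gramB (B y))⁻¹ (I s) (K s)) Ω :=
      contDiffOn_prod fun s _ => hB.contDiffOn_inv _ _
    exact ofRealCLM.contDiff.comp_contDiffOn h1

lemma IsMet.differentiableAt_pairC (hB : IsMet B Ω) {U : Cn n → Form n q}
    (hU : SmoothOn U Ω) (I : Fin q → Fin n × Fin 2) {y : Cn n} (hy : y ∈ Ω) :
    DifferentiableAt ℝ (fun y => pairC (B y) (U y) I) y :=
  ((hB.contDiffOn_pairC hU I).contDiffAt (hB.isOpen.mem_nhds hy)).differentiableAt (by simp)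

/-- The real coordinate functionals. -/
def rcL (n : ℕ) (a : Fin n × Fin 2) : Cn n →L[ℝ] ℝ := LinearMap.toContinuousLinearMap ((rbB n).coord a)

lemma rcL_apply (a : Fin n × Fin 2) (v : Cn n) : rcL n a v = rc n a v := by
  have h : (rbB n).coord a v = rc n a v := by
    conv_lhs => rw [← sum_rc_rb n v]
    simp only [map_sum, map_smul, ← rbB_apply, Module.Basis.coord_apply, Module.Basis.repr_self]
    simp [Finsupp.single_apply]
  exact h

/-- The symbol `β ↦ (ξ ∧ β)^{0,q+1}` of `∂̄`. -/
def symb (ξ : Cn n →L[ℝ] ℝ) : Form n q →L[ℝ] Form n (q + 1) :=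
  dbarL ∘L (ContinuousLinearMap.smulRightL ℝ (Cn n) (Form n q) ξ)

lemma symb_apply (ξ : Cn n →L[ℝ] ℝ) (β : Form n q) : symb ξ β = dbarL (ξ.smulRight β) := rfl

lemma symb_smul (ξ : Cn n →L[ℝ] ℝ) (c : ℂ) (β : Form n q) : symb ξ (c • β) = c • symb ξ β := by
  rw [symb_apply, symb_apply, ← dbarL_smul]
  congr 1
  ext v : 1
  simp [smul_comm c]

lemma isT0_symb (ξ : Cn n →L[ℝ] ℝ) {β : Form n q} (hβ : IsT0 β) : IsT0 (symb ξ β) := by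
  refine isT0_dbarL _ fun v => ?_
  have := (t0Sub n q).smul_mem ((ξ v : ℝ) : ℂ) hβ
  rw [mem_t0Sub] at this
  exact this

lemma sum_symb (f : Cn n →L[ℝ] Form n q) : ∑ a, symb (rcL n a) (f (rb n a)) = dbarL f := by
  simp only [symb_apply, ← map_sum]
  congr 1
  ext v : 1
  simp only [sum_apply, ContinuousLinearMap.smulRight_apply, rcL_apply]
  conv_rhs => rw [← sum_rc_rb n v]
  simp

lemma sum_smul_symb (ξ : Cn n →L[ℝ] ℝ) (β : Form n q) :
    ∑ a, ξ (rb n a) • symb (rcL n a) β = symb ξ β := by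
  have := sum_symb (ξ.smulRight β)
  simp only [ContinuousLinearMap.smulRight_apply, map_smul] at this
  rw [this, symb_apply]

/-- The divergence of the functionals `β ↦ ⟨(dx_a ∧ β)^{0,q+1} | U⟩ μ`. -/
def divL (B : Cn n → Bil n) (U : Cn n → Form n (q + 1)) (y : Cn n) : Form n q →ₗ[ℂ] ℂ where
  toFun β := ∑ a, ∑ I, ð (fun y => pairC (B y) (U y) I) y (rb n a) *
    symb (rcL n a) β (fun s => rb n (I s))
  map_add' β β' := by
    simp only [map_add, ContinuousAlternatingMap.add_apply, mul_add, sum_add_distrib]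
  map_smul' c β := by
    simp only [symb_smul, ContinuousAlternatingMap.smul_apply, smul_eq_mul, RingHom.id_apply,
      mul_sum]
    refine sum_congr rfl fun a _ => sum_congr rfl fun I _ => ?_
    ring

lemma divL_apply (U : Cn n → Form n (q + 1)) (y : Cn n) (β : Form n q) :
    divL B U y β = ∑ a, ∑ I, ð (fun y => pairC (B y) (U y) I) y (rb n a) *
      symb (rcL n a) β (fun s => rb n (I s)) := rfl

/-- The formal adjoint of `∂̄` for the metric `B`. -/
def theta (B : Cn n → Bil n) (U : Cn n → Form n (q + 1)) (y : Cn n) : Form n q :=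
  riesz (B y) ((-(dens (B y) : ℂ)⁻¹) • divL B U y : Form n q →ₗ[ℂ] ℂ)

lemma isT0_theta (U : Cn n → Form n (q + 1)) (y : Cn n) : IsT0 (theta B U y) := isT0_riesz _ _

lemma IsMet.contDiffOn_divL (hB : IsMet B Ω) {U : Cn n → Form n (q + 1)}
    (hU : SmoothOn U Ω) (β : Form n q) : SmoothOn (fun y => divL B U y β) Ω := by
  have h1 : ∀ a I, SmoothOn
      (fun y => ð (fun y => pairC (B y) (U y) I) y (rb n a)) Ω := fun a I =>
    ((hB.contDiffOn_pairC hU I).fderiv_of_isOpen hB.isOpen (m := ∞) (by simp)).clm_apply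
      contDiffOn_const
  simp only [divL_apply]
  exact ContDiffOn.sum fun a _ => ContDiffOn.sum fun I _ => (h1 a I).mul contDiffOn_const

lemma IsMet.contDiffOn_theta (hB : IsMet B Ω) {U : Cn n → Form n (q + 1)}
    (hU : SmoothOn U Ω) : SmoothOn (theta B U) Ω := by
  refine contDiffOn_riesz hB fun β => ?_
  simp only [LinearMap.smul_apply, smul_eq_mul]
  have h1 : SmoothOn (fun y => (dens (B y) : ℂ)) Ω :=
    ofRealCLM.contDiff.comp_contDiffOn hB.contDiffOn_dens
  exact ((h1.inv fun y hy => by exact_mod_cast (hB.herm y hy).dens_pos.ne').neg).mul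
    (hB.contDiffOn_divL hU β)

/-- The defining property of the formal adjoint. -/
lemma IsMet.fInner_theta (hB : IsMet B Ω) (U : Cn n → Form n (q + 1))
    {y : Cn n} (hy : y ∈ Ω) {β : Form n q} (hβ : IsT0 β) :
    dens (B y) * fInner (gramB (B y)) β (theta B U y) = -divL B U y β := by
  have h0 : (dens (B y) : ℂ) ≠ 0 := by exact_mod_cast (hB.herm y hy).dens_pos.ne'
  rw [theta, fInner_riesz (hB.herm y hy) _ hβ, LinearMap.smul_apply, smul_eq_mul]
  field_simp

lemma contDiff_of_tsupport {F : Type*} [NormedAddCommGroup F] [NormedSpace ℝ F] {f : Cn n → F}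
    (hΩ : IsOpen Ω) (hf : SmoothOn f Ω) (hs : tsupport f ⊆ Ω) : Smooth f := by
  rw [contDiff_iff_contDiffAt]
  intro y
  by_cases hy : y ∈ tsupport f
  · exact hf.contDiffAt (hΩ.mem_nhds (hs hy))
  · have h1 : f =ᶠ[𝓝 y] fun _ => 0 := notMem_tsupport_iff_eventuallyEq.1 hy
    exact contDiffAt_const.congr_of_eventuallyEq h1

/-- `ϑ` is the formal adjoint of `∂̄`. -/
lemma IsMet.integral_theta (hB : IsMet B Ω) {U : Cn n → Form n (q + 1)} (hU : SmoothOn U Ω)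
    {W : Cn n → Form n q} (hW : Smooth W) (hWc : HasCompactSupport W)
    (hWs : tsupport W ⊆ Ω) (hW0 : ∀ y, IsT0 (W y)) :
    ∫ y, (dens (B y) : ℂ) * fInner (gramB (B y)) (dbarL (ð W y)) (U y) =
      ∫ y, (dens (B y) : ℂ) * fInner (gramB (B y)) (W y) (theta B U y) := by
  set F : Fin n × Fin 2 → Cn n → ℂ := fun a y => ∑ I, pairC (B y) (U y) I *
    symb (rcL n a) (W y) (fun s => rb n (I s)) with hF
  have hsW : ∀ a, Smooth fun y => symb (rcL n a) (W y) := fun a => by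
    have h2 : Smooth (symb (q := q) (rcL n a)) := ContinuousLinearMap.contDiff _
    exact h2.comp hW
  have hsWI : ∀ a (I : Fin (q + 1) → Fin n × Fin 2),
      Smooth fun y => symb (rcL n a) (W y) (fun s => rb n (I s)) := fun a I => by
    rw [← contDiffOn_univ]
    exact contDiffOn_form_apply_const (hsW a).contDiffOn _
  have hsupp : ∀ a, Function.support (F a) ⊆ Function.support W := by
    intro a y hy
    exact fun h => hy (by simp [hF, h])
  have hFc : ∀ a, HasCompactSupport (F a) := fun a => hWc.mono (hsupp a)
  have hFs : ∀ a, Smooth (F a) := fun a =>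
    contDiff_of_tsupport hB.isOpen
      (ContDiffOn.sum fun I _ => (hB.contDiffOn_pairC hU I).mul (hsWI a I).contDiffOn)
      ((closure_mono (hsupp a)).trans hWs)
  have hint : ∀ a, Integrable fun y => ð (F a) y (rb n a) := fun a =>
    (((hFs a).continuous_fderiv (by simp)).clm_apply continuous_const).integrable_of_hasCompactSupport
      (((hFc a).fderiv (𝕜 := ℝ)).comp_left (g := fun L : Cn n →L[ℝ] ℂ => L (rb n a)) rfl)
  have hzero : ∫ y, ∑ a, ð (F a) y (rb n a) = 0 := by
    rw [integral_finsetSum _ fun a _ => hint a]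
    exact sum_eq_zero fun a _ => integral_fderiv_apply_eq_zero
      ((hFs a).of_le (by exact_mod_cast le_top)) (hFc a) _
  have hpt : ∀ y, ∑ a, ð (F a) y (rb n a) =
      (dens (B y) : ℂ) * fInner (gramB (B y)) (dbarL (ð W y)) (U y) -
        (dens (B y) : ℂ) * fInner (gramB (B y)) (W y) (theta B U y) := by
    intro y
    by_cases hy : y ∈ tsupport W
    · have hyΩ := hWs hy
      have h1 : ∀ a, ð (F a) y (rb n a) =
          (∑ I, pairC (B y) (U y) I * symb (rcL n a) (ð W y (rb n a)) fun s => rb n (I s)) +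
          ∑ I, ð (fun y => pairC (B y) (U y) I) y (rb n a) *
            symb (rcL n a) (W y) fun s => rb n (I s) := by
        intro a
        have hev : ∀ I : Fin (q + 1) → Fin n × Fin 2,
            HasFDerivAt (fun y => symb (rcL n a) (W y) fun s => rb n (I s))
              (((evL fun s => rb n (I s)).comp
                (symb (rcL n a))).comp (ð W y)) y := fun I =>
          ((evL fun s => rb n (I s)).comp
                (symb (rcL n a))).hasFDerivAt.comp y (hW.differentiable (by simp) y).hasFDerivAt
        have h2 : HasFDerivAt (F a) _ y := HasFDerivAt.fun_sum (u := Finset.univ) fun I _ =>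
          (hB.differentiableAt_pairC hU I hyΩ).hasFDerivAt.fun_mul (hev I)
        rw [h2.fderiv, ← sum_add_distrib]
        simp only [sum_apply, add_apply, smul_apply, smul_eq_mul]
        refine sum_congr rfl fun I _ => ?_
        rw [mul_comm (ð (fun y => pairC (B y) (U y) I) y (rb n a))]
        rfl
      rw [hB.fInner_theta U hyΩ (hW0 y)]
      simp only [h1, sum_add_distrib, divL_apply, sub_neg_eq_add]
      congr 1
      simp only [sum_pairC]
      rw [← mul_sum, ← fInner_sum_left, sum_symb]
    · have h1 : W =ᶠ[𝓝 y] fun _ => 0 := notMem_tsupport_iff_eventuallyEq.1 hy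
      have h2 : ∀ a, F a =ᶠ[𝓝 y] fun _ => 0 := by
        intro a
        filter_upwards [h1] with z hz
        simp [hF, hz]
      have h3 : ð W y = 0 := by rw [h1.fderiv_eq]; simp
      have h4 : W y = 0 := h1.self_of_nhds
      have h5 : ∀ a, ð (F a) y = 0 := fun a => by rw [(h2 a).fderiv_eq]; simp
      simp [h3, h4, h5, fInner]
  have hc1 : Smooth fun y =>
      (dens (B y) : ℂ) * fInner (gramB (B y)) (W y) (theta B U y) := by
    refine contDiff_of_tsupport hB.isOpen ((ofRealCLM.contDiff.comp_contDiffOn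
      hB.contDiffOn_dens).mul (contDiffOn_fInner hB hW.contDiffOn (hB.contDiffOn_theta hU)))
      ((closure_mono fun y hy => ?_).trans hWs)
    exact fun h => hy (by simp [h, fInner])
  have hi1 : Integrable fun y =>
      (dens (B y) : ℂ) * fInner (gramB (B y)) (W y) (theta B U y) := by
    refine hc1.continuous.integrable_of_hasCompactSupport (hWc.mono fun y hy => ?_)
    exact fun h => hy (by simp [h, fInner])
  have hi2 : Integrable fun y =>
      (dens (B y) : ℂ) * fInner (gramB (B y)) (dbarL (ð W y)) (U y) := by
    have := (integrable_finsetSum (s := Finset.univ) fun a _ => hint a).add hi1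
    refine this.congr (ae_of_all _ fun y => ?_)
    simp only [Pi.add_apply]
    rw [hpt]
    ring
  simp only [hpt] at hzero
  rw [integral_sub hi2 hi1, sub_eq_zero] at hzero
  exact hzero

/-- The commutator of `ϑ` with the multiplication by a function. -/
lemma IsMet.fInner_theta_smul (hB : IsMet B Ω) {U : Cn n → Form n (q + 1)}
    (hU : SmoothOn U Ω) {r : Cn n → ℝ} (hr : SmoothOn r Ω) {y : Cn n} (hy : y ∈ Ω)
    {β : Form n q} (hβ : IsT0 β) :
    fInner (gramB (B y)) β (r y • theta B U y - theta B (fun y => r y • U y) y) =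
      fInner (gramB (B y)) (symb (ð r y) β) (U y) := by
  have h0 : (dens (B y) : ℂ) ≠ 0 := by exact_mod_cast (hB.herm y hy).dens_pos.ne'
  have hrU : SmoothOn (fun y => r y • U y) Ω := hr.smul hU
  have hsm : ∀ (c : ℝ) {p : ℕ} (α β : Form n p),
      fInner (gramB (B y)) α (c • β) = c * fInner (gramB (B y)) α β := by
    intro c p α β
    have := fInner_smul_right (G := gramB (B y)) (c : ℂ) α β
    rw [conj_ofReal] at this
    exact this
  have hsml : ∀ (c : ℝ) {p : ℕ} (α β : Form n p),
      fInner (gramB (B y)) (c • α) β = c * fInner (gramB (B y)) α β := fun c p α β =>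
    fInner_smul_left (G := gramB (B y)) (c : ℂ) α β
  have h1 := hB.fInner_theta U hy hβ
  have h2 := hB.fInner_theta (fun y => r y • U y) hy hβ
  have hpre : ∀ I, (fun y => pairC (B y) (r y • U y) I) = fun y => r y • pairC (B y) (U y) I := by
    intro I
    ext z
    simp only [pairC, ContinuousAlternatingMap.smul_apply, real_smul, map_mul, conj_ofReal, mul_sum]
    refine sum_congr rfl fun K _ => ?_
    ring
  have h3 : divL B (fun y => r y • U y) y β = r y * divL B U y β +
      dens (B y) * fInner (gramB (B y)) (symb (ð r y) β) (U y) := by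
    rw [← sum_smul_symb (ð r y) β, fInner_sum_left]
    simp only [divL_apply, hpre, mul_sum, ← sum_add_distrib]
    refine sum_congr rfl fun a _ => ?_
    have h4 := sum_pairC (B y) (U y) (symb (rcL n a) β)
    rw [hsml, mul_left_comm, ← h4, mul_sum, ← sum_add_distrib]
    refine sum_congr rfl fun I _ => ?_
    have hd := ((hr.contDiffAt (hB.isOpen.mem_nhds hy)).differentiableAt (by simp)).hasFDerivAt.smul
      (hB.differentiableAt_pairC hU I hy).hasFDerivAt
    have hd' : ð (fun y => r y • pairC (B y) (U y) I) y = _ := hd.fderiv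
    rw [hd']
    simp only [add_apply, smul_apply, ContinuousLinearMap.smulRight_apply, real_smul]
    ring
  refine mul_left_cancel₀ h0 ?_
  rw [fInner_sub_right, hsm, mul_sub, h2, h3]
  linear_combination (r y : ℂ) * h1

end Theta

/-! ### The formal adjoint in unitary frames -/

section Frame

lemma IsT0.curryLeft {U : Form n (q + 1)} (hU : IsT0 U) (v : Cn n) : IsT0 (U.curryLeft v) := by
  intro w i
  have := hU (Fin.cons v w) i.succ
  simp only [ContinuousAlternatingMap.curryLeft_apply_apply, Matrix.vecCons]
  rw [← Fin.cons_update] at this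
  simpa using this

/-- The antilinear part of a real covector. -/
def covBar (ξ : Cn n →L[ℝ] ℝ) (v : Cn n) : ℂ := (1 / 2 : ℂ) * (ξ v + î * ξ (î • v))

lemma fInner_symb {B : Bil n} (hB : IsHerm B) {E : Fin n → Cn n}
    (hE : IsUnitary B E) (ξ : Cn n →L[ℝ] ℝ) {β : Form n q} (hβ : IsT0 β) {V : Form n (q + 1)}
    (hV : IsT0 V) : fInner (gramB B) (symb ξ β) V =
      2 * fInner (gramB B) β (∑ a, conj (covBar ξ (E a)) • V.curryLeft (E a)) := by
  have hsum : ∀ (c : Fin n → ℂ), IsT0 (∑ a, c a • V.curryLeft (E a)) := fun c =>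
    (t0Sub n q).sum_mem fun a _ => (t0Sub n q).smul_mem _ (hV.curryLeft _)
  rw [fInner_frame hB hE (isT0_symb ξ hβ) hV, fInner_frame hB hE hβ (hsum _), symb_apply,
    sum_dbarL_mul_conj]
  have h1 : ∀ (a : Fin n) (K : Fin q → Fin n), conjPart (ξ.smulRight β) (E a) (fun s => E (K s)) *
      conj (V (Fin.cons (E a) fun s => E (K s))) = β (fun s => E (K s)) *
        conj ((conj (covBar ξ (E a)) • V.curryLeft (E a))
          fun s => E (K s)) := by
    intro a K
    simp only [conjPart_apply, ContinuousAlternatingMap.smul_apply,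
      ContinuousAlternatingMap.add_apply, ContinuousLinearMap.smulRight_apply, covBar, smul_eq_mul,
      real_smul, ContinuousAlternatingMap.curryLeft_apply_apply, Matrix.vecCons, map_mul, conj_conj]
    ring
  simp only [h1]
  have h2 : ∀ (f : Fin n → Form n q) (v : Fin q → Cn n), (∑ a, f a) v = ∑ a, f a v :=
    fun f v => map_sum (evL v) f Finset.univ
  simp only [h2, map_sum, mul_sum]
  rw [sum_comm]
  refine sum_congr rfl fun K _ => sum_congr rfl fun a _ => ?_
  have h3 := cq_succ q
  have h4 : (cq (q + 1) : ℂ) * (q + 1) = 2 * cq q := by exact_mod_cast h3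
  linear_combination (β (fun s => E (K s)) * conj
    ((conj (covBar ξ (E a)) • V.curryLeft (E a)) fun s => E (K s))) * h4

variable {B : Cn n → Bil n} {Ω : Set (Cn n)}

/-- The commutator of `ϑ` with a function in a unitary frame. -/
lemma IsMet.theta_smul_eq (hB : IsMet B Ω) {U : Cn n → Form n (q + 1)}
    (hU : SmoothOn U Ω) (hU0 : ∀ y ∈ Ω, IsT0 (U y)) {r : Cn n → ℝ} (hr : SmoothOn r Ω)
    {y : Cn n} (hy : y ∈ Ω) {E : Fin n → Cn n} (hE : IsUnitary (B y) E) :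
    r y • theta B U y - theta B (fun y => r y • U y) y =
      (2 : ℂ) • ∑ a, conj (covBar (ð r y) (E a)) • (U y).curryLeft (E a) := by
  have hH := hB.herm y hy
  refine ext_fInner hH ?_ ?_ fun β hβ => ?_
  · exact (t0Sub n q).sub_mem ((t0Sub n q).smul_mem (r y : ℂ) (isT0_theta U y)) (isT0_theta _ y)
  · exact (t0Sub n q).smul_mem _ ((t0Sub n q).sum_mem fun a _ =>
      (t0Sub n q).smul_mem _ ((hU0 y hy).curryLeft _))
  · rw [hB.fInner_theta_smul hU hr hy hβ, fInner_symb hH hE _ hβ (hU0 y hy), fInner_smul_right,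
      map_ofNat]

lemma isT0_fderiv {U : Cn n → Form n q} {Ω : Set (Cn n)} (hΩ : IsOpen Ω)
    (hU0 : ∀ y ∈ Ω, IsT0 (U y)) {y : Cn n} (hy : y ∈ Ω) (hd : DifferentiableAt ℝ U y) (v : Cn n) :
    IsT0 (ð U y v) := by
  intro w i
  have h1 : ∀ w : Fin q → Cn n, HasFDerivAt (fun y => U y w)
      ((evL w).comp (ð U y)) y := fun w =>
    (evL w).hasFDerivAt.comp y hd.hasFDerivAt
  have h2 : (fun y => U y (Function.update w i (î • w i))) =ᶠ[𝓝 y]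
      fun y => -î * U y w := by
    filter_upwards [hΩ.mem_nhds hy] with z hz
    exact hU0 z hz w i
  have h3 := (h1 (Function.update w i (î • w i))).congr_of_eventuallyEq h2.symm
  exact DFunLike.congr_fun (h3.unique ((h1 w).const_mul (-î))) v

/-- The real coefficients of the weighted inner product. -/
def wgt (q : ℕ) (B : Cn n → Bil n) (I K : Fin q → Fin n × Fin 2) (y : Cn n) : ℂ :=
  (dens (B y) : ℂ) * ((q.factorial : ℂ))⁻¹ * ((∏ s, (gramB (B y))⁻¹ (I s) (K s) : ℝ) : ℂ)

lemma pairC_eq_sum_wgt (B : Cn n → Bil n) (γ : Form n q) (I : Fin q → Fin n × Fin 2) (y : Cn n) :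
    pairC (B y) γ I = ∑ K, wgt q B I K y * conj (γ fun s => rb n (K s)) := by
  simp only [pairC, wgt, mul_sum]
  refine sum_congr rfl fun K _ => ?_
  ring

lemma IsMet.contDiffOn_wgt (hB : IsMet B Ω) (I K : Fin q → Fin n × Fin 2) :
    SmoothOn (wgt q B I K) Ω := by
  unfold wgt
  refine ContDiffOn.mul (ContDiffOn.mul ?_ contDiffOn_const) ?_
  · exact ofRealCLM.contDiff.comp_contDiffOn hB.contDiffOn_dens
  · have h1 : SmoothOn (fun y => ∏ s, (gramB (B y))⁻¹ (I s) (K s)) Ω :=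
      contDiffOn_prod fun s _ => hB.contDiffOn_inv _ _
    exact ofRealCLM.contDiff.comp_contDiffOn h1

/-- The zero order part of `ϑ`. -/
def lowL (B : Cn n → Bil n) (γ : Form n (q + 1)) (y : Cn n) (β : Form n q) : ℂ :=
  ∑ a, ∑ I, ∑ K, ð (wgt (q + 1) B I K) y (rb n a) * conj (γ fun s => rb n (K s)) *
    symb (rcL n a) β (fun s => rb n (I s))

lemma IsMet.divL_eq (hB : IsMet B Ω) {U : Cn n → Form n (q + 1)} (hU : SmoothOn U Ω)
    {y : Cn n} (hy : y ∈ Ω) (β : Form n q) : divL B U y β = lowL B (U y) y β + dens (B y) *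
      ∑ a, fInner (gramB (B y)) (symb (rcL n a) β) (ð U y (rb n a)) := by
  have hUd : DifferentiableAt ℝ U y :=
    (hU.contDiffAt (hB.isOpen.mem_nhds hy)).differentiableAt (by simp)
  have h1 : ∀ (I : Fin (q + 1) → Fin n × Fin 2) (v : Cn n), ð (fun y => pairC (B y) (U y) I) y v =
        (∑ K, ð (wgt (q + 1) B I K) y v * conj (U y fun s => rb n (K s))) +
          pairC (B y) (ð U y v) I := by
    intro I v
    have hev : ∀ K : Fin (q + 1) → Fin n × Fin 2,
        HasFDerivAt (fun y => conj (U y fun s => rb n (K s)))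
          (((conjCLE : ℂ →L[ℝ] ℂ).comp
            (evL fun s => rb n (K s))).comp (ð U y)) y :=
      fun K => ((conjCLE : ℂ →L[ℝ] ℂ).comp
        (evL fun s => rb n (K s))).hasFDerivAt.comp y
          hUd.hasFDerivAt
    have hw : ∀ K, DifferentiableAt ℝ (wgt (q + 1) B I K) y := fun K =>
      ((hB.contDiffOn_wgt I K).contDiffAt (hB.isOpen.mem_nhds hy)).differentiableAt (by simp)
    have h2 : HasFDerivAt (fun y => ∑ K, wgt (q + 1) B I K y *
        conj (U y fun s => rb n (K s))) _ y :=
      HasFDerivAt.fun_sum (u := Finset.univ) fun K _ => (hw K).hasFDerivAt.fun_mul (hev K)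
    simp only [pairC_eq_sum_wgt]
    rw [h2.fderiv, ← sum_add_distrib]
    simp only [sum_apply, add_apply, smul_apply, smul_eq_mul]
    refine sum_congr rfl fun K _ => ?_
    rw [mul_comm (ð (wgt (q + 1) B I K) y v), add_comm]
    rfl
  simp only [divL_apply, lowL, h1, add_mul, sum_add_distrib, sum_mul, mul_sum]
  congr 1
  refine sum_congr rfl fun a _ => ?_
  rw [← sum_pairC]

/-- The principal part of `-ϑ/2` in a frame. -/
def prinForm (E : Fin n → Cn n) (f : Cn n →L[ℝ] Form n (q + 1)) : Form n q :=
  ∑ a, (holPart f (E a)).curryLeft (E a)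

lemma isT0_prinForm (E : Fin n → Cn n) {f : Cn n →L[ℝ] Form n (q + 1)} (hf : ∀ v, IsT0 (f v)) :
    IsT0 (prinForm E f) := by
  refine (t0Sub n q).sum_mem fun a _ => ?_
  refine IsT0.curryLeft ?_ _
  exact (t0Sub n (q + 1)).smul_mem _ ((t0Sub n (q + 1)).sub_mem (hf _)
    ((t0Sub n (q + 1)).smul_mem _ (hf _)))

lemma sum_fInner_symb {B : Bil n} (hB : IsHerm B) {E : Fin n → Cn n}
    (hE : IsUnitary B E) {β : Form n q} (hβ : IsT0 β) {f : Cn n →L[ℝ] Form n (q + 1)}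
    (hf : ∀ v, IsT0 (f v)) :
    ∑ a, fInner (gramB B) (symb (rcL n a) β) (f (rb n a)) = 2 * fInner (gramB B) β (prinForm E f) := by
  have h1 : ∀ a, fInner (gramB B) (symb (rcL n a) β) (f (rb n a)) = 2 * fInner (gramB B) β
      (∑ b, conj (covBar (rcL n a) (E b)) • (f (rb n a)).curryLeft (E b)) :=
    fun a => fInner_symb hB hE _ hβ (hf _)
  simp only [h1, ← mul_sum, ← fInner_sum_right]
  rw [sum_comm, prinForm]
  congr 2
  refine sum_congr rfl fun b _ => ?_
  ext w
  have h2 : ∀ (F : Fin n × Fin 2 → Form n q) (v : Fin q → Cn n), (∑ a, F a) v = ∑ a, F a v :=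
    fun F v => map_sum (evL v) F Finset.univ
  rw [h2]
  simp only [ContinuousAlternatingMap.smul_apply, ContinuousAlternatingMap.curryLeft_apply_apply,
    holPart, ContinuousAlternatingMap.sub_apply, smul_eq_mul, covBar, map_mul, map_add,
    conj_I, conj_ofReal, map_div₀, map_one, map_ofNat]
  have h3 : ∀ v : Cn n, f v (Matrix.vecCons (E b) w) =
      ∑ a, (rcL n a v : ℂ) * f (rb n a) (Matrix.vecCons (E b) w) := by
    intro v
    have h4 := congrArg (evL (Matrix.vecCons (E b) w))
      (clm_eq_sum_rc f v)
    rw [map_sum] at h4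
    simpa [rcL_apply] using h4
  rw [h3 (E b), h3 (î • E b), mul_sum, ← sum_sub_distrib, mul_sum]
  refine sum_congr rfl fun a _ => ?_
  ring

lemma IsMet.exists_lowL_bound (hB : IsMet B Ω) {K : Set (Cn n)} (hK : IsCompact K) (hKΩ : K ⊆ Ω)
    (q : ℕ) : ∃ C, 0 ≤ C ∧ ∀ y ∈ K, ∀ (γ : Form n (q + 1)) (β : Form n q),
      ‖lowL B γ y β‖ ≤ C * (‖γ‖ * ‖β‖) := by
  have h1 : ∀ (a : Fin n × Fin 2) (I J : Fin (q + 1) → Fin n × Fin 2),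
      ContinuousOn (fun y => ð (wgt (q + 1) B I J) y (rb n a)) K := fun a I J =>
    (((hB.contDiffOn_wgt I J).continuousOn_fderiv_of_isOpen hB.isOpen (by simp)).clm_apply
      continuousOn_const).mono hKΩ
  choose D hD using fun a I J => hK.exists_bound_of_continuousOn (h1 a I J)
  have h2 : ∀ (p : ℕ) (v : Fin p → Cn n), ∃ c, 0 ≤ c ∧ ∀ γ : Form n p, ‖γ v‖ ≤ c * ‖γ‖ :=
    fun p v => ⟨‖evL v‖,
      ContinuousLinearMap.opNorm_nonneg _, fun γ =>
      (evL v).le_opNorm γ⟩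
  choose c hc0 hc using h2
  have h3 : ∀ a : Fin n × Fin 2, ∃ s, 0 ≤ s ∧ ∀ β : Form n q, ‖symb (rcL n a) β‖ ≤ s * ‖β‖ :=
    fun a => ⟨‖symb (q := q) (rcL n a)‖, ContinuousLinearMap.opNorm_nonneg _, fun β =>
      (symb (rcL n a)).le_opNorm β⟩
  choose s hs0 hs using h3
  refine ⟨∑ a, ∑ I : Fin (q + 1) → Fin n × Fin 2, ∑ J : Fin (q + 1) → Fin n × Fin 2,
    |D a I J| * c _ (fun s => rb n (J s)) * (c _ (fun s => rb n (I s)) * s a), ?_,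
    fun y hy γ β => ?_⟩
  · refine sum_nonneg fun a _ => sum_nonneg fun I _ => sum_nonneg fun J _ => ?_
    have := hc0 _ (fun s => rb n (J s))
    have := hc0 _ (fun s => rb n (I s))
    have := hs0 a
    positivity
  · unfold lowL
    simp only [sum_mul]
    refine (norm_sum_le _ _).trans (sum_le_sum fun a _ => ?_)
    refine (norm_sum_le _ _).trans (sum_le_sum fun I _ => ?_)
    refine (norm_sum_le _ _).trans (sum_le_sum fun J _ => ?_)
    rw [norm_mul, norm_mul, RCLike.norm_conj]
    have k1 := (hD a I J y hy).trans (le_abs_self _)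
    have k2 := hc _ (fun s => rb n (J s)) γ
    have k3 := hc _ (fun s => rb n (I s)) (symb (rcL n a) β)
    have k4 := mul_le_mul_of_nonneg_left (hs a β) (hc0 _ (fun s => rb n (I s)))
    have := hc0 _ (fun s => rb n (J s))
    calc _ ≤ |D a I J| * (c _ (fun s => rb n (J s)) * ‖γ‖) *
          (c _ (fun s => rb n (I s)) * (s a * ‖β‖)) := by
          refine mul_le_mul (mul_le_mul k1 k2 (norm_nonneg _) (abs_nonneg _)) (k3.trans k4)
            (norm_nonneg _) (by positivity)
      _ = _ := by ring

/-- The principal part of `ϑ` is controlled by `ϑ` up to lower order terms. -/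
lemma IsMet.exists_thetaSq_le (hB : IsMet B Ω) {K : Set (Cn n)} (hK : IsCompact K) (hKΩ : K ⊆ Ω)
    (q : ℕ) : ∃ C, 0 ≤ C ∧ ∀ U : Cn n → Form n (q + 1), SmoothOn U Ω →
      (∀ y ∈ Ω, IsT0 (U y)) → ∀ E : Fin n → Cn n → Cn n, ∀ y ∈ K, IsUnitary (B y) (fun a => E a y) →
      thetaSq E U y ≤ C * (fSq (gramB (B y)) (theta B U y) + ‖U y‖ ^ 2) := by
  obtain ⟨C1, hC1, h1⟩ := hB.exists_lowL_bound hK hKΩ q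
  obtain ⟨C2, hC2, h2⟩ := hB.exists_fSq_bounds hK hKΩ q
  obtain ⟨C3, hC3⟩ := hK.exists_bound_of_continuousOn
    ((hB.contDiffOn_dens.inv fun y hy => (hB.herm y hy).dens_pos.ne').continuousOn.mono hKΩ)
  set D := (|C3| * C1) ^ 2 * C2 with hD
  have hD0 : 0 ≤ D := by positivity
  have hcq := cq_pos q
  refine ⟨(cq q)⁻¹ * (1 + D), by positivity, fun U hU hU0 E y hy hE => ?_⟩
  have hyΩ := hKΩ hy
  have hH := hB.herm y hyΩ
  have hUd : DifferentiableAt ℝ U y :=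
    (hU.contDiffAt (hB.isOpen.mem_nhds hyΩ)).differentiableAt (by simp)
  have hT := isT0_fderiv hB.isOpen hU0 hyΩ hUd
  set P : Form n q := prinForm (fun a => E a y) (ð U y) with hP
  have hP0 : IsT0 P := isT0_prinForm _ hT
  have hPs : thetaSq E U y = (cq q)⁻¹ * fSq (gramB (B y)) P := by
    rw [fSq_frame hH hE hP0, ← mul_assoc, inv_mul_cancel₀ hcq.ne', one_mul, thetaSq]
    refine sum_congr rfl fun J _ => ?_
    congr 2
    have h3 : ∀ (F : Fin n → Form n q) (v : Fin q → Cn n), (∑ a, F a) v = ∑ a, F a v :=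
      fun F v => map_sum (evL v) F Finset.univ
    rw [hP, prinForm, h3]
    refine sum_congr rfl fun a _ => ?_
    rw [compB, ContinuousAlternatingMap.curryLeft_apply_apply, Matrix.vecCons,
      cons_frame (fun a => E a y)]
  set γ : Form n q := theta B U y + (2 : ℂ) • P with hγ
  have hγ0 : IsT0 γ := (t0Sub n q).add_mem (isT0_theta U y) ((t0Sub n q).smul_mem _ hP0)
  have hkey : (dens (B y) : ℂ) * fInner (gramB (B y)) γ γ = -lowL B (U y) y γ := by
    have k1 := hB.fInner_theta U hyΩ hγ0
    rw [hB.divL_eq hU hyΩ, sum_fInner_symb hH hE hγ0 hT] at k1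
    conv_lhs => rw [hγ, fInner_add_right, ← hγ, fInner_smul_right, map_ofNat]
    linear_combination k1
  have hdp := hH.dens_pos
  have hγs : fSq (gramB (B y)) γ ≤ D * ‖U y‖ ^ 2 := by
    rw [fInner_self hH] at hkey
    have k2 := congrArg norm hkey
    rw [norm_neg, norm_mul, norm_real, norm_real, norm_of_nonneg hdp.le,
      norm_of_nonneg (fSq_nonneg hH _)] at k2
    have k3 := h1 y hy (U y) γ
    rw [← k2] at k3
    have k4 : fSq (gramB (B y)) γ ≤ |C3| * C1 * (‖U y‖ * ‖γ‖) := by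
      have k5 := (hC3 y hy).trans (le_abs_self _)
      rw [Pi.inv_apply, norm_of_nonneg (inv_nonneg.2 hdp.le)] at k5
      calc fSq (gramB (B y)) γ = (dens (B y))⁻¹ * (dens (B y) * fSq (gramB (B y)) γ) := by
            rw [← mul_assoc, inv_mul_cancel₀ hdp.ne', one_mul]
        _ ≤ |C3| * (C1 * (‖U y‖ * ‖γ‖)) := by
            refine mul_le_mul k5 k3 (mul_nonneg hdp.le (fSq_nonneg hH _)) (abs_nonneg _)
        _ = _ := by ring
    have k6 := (h2 y hy γ).1
    have k7 : fSq (gramB (B y)) γ ^ 2 ≤ D * ‖U y‖ ^ 2 * fSq (gramB (B y)) γ := by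
      calc fSq (gramB (B y)) γ ^ 2 ≤ (|C3| * C1 * (‖U y‖ * ‖γ‖)) ^ 2 :=
            pow_le_pow_left₀ (fSq_nonneg hH _) k4 2
        _ = (|C3| * C1) ^ 2 * ‖U y‖ ^ 2 * ‖γ‖ ^ 2 := by ring
        _ ≤ (|C3| * C1) ^ 2 * ‖U y‖ ^ 2 * (C2 * fSq (gramB (B y)) γ) :=
            mul_le_mul_of_nonneg_left k6 (by positivity)
        _ = _ := by rw [hD]; ring
    rcases (fSq_nonneg hH γ).eq_or_lt with k8 | k8
    · rw [← k8]; positivity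
    · rw [sq] at k7
      exact le_of_mul_le_mul_right k7 k8
  have hfin : 4 * fSq (gramB (B y)) P ≤ 2 * fSq (gramB (B y)) γ +
      2 * fSq (gramB (B y)) (theta B U y) := by
    have k1 : (2 : ℂ) • P = γ + (-1 : ℂ) • theta B U y := by
      ext v
      simp only [hγ, ContinuousAlternatingMap.add_apply, ContinuousAlternatingMap.smul_apply,
        smul_eq_mul]
      ring
    have k2 := fSq_add_le hH γ ((-1 : ℂ) • theta B U y)
    rw [← k1, fSq_smul, fSq_smul] at k2
    norm_num at k2
    linarith
  rw [hPs, mul_assoc]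
  refine mul_le_mul_of_nonneg_left ?_ (inv_nonneg.2 hcq.le)
  have k1 := fSq_nonneg hH (theta B U y)
  have k2 := mul_nonneg hD0 k1
  nlinarith [fSq_nonneg hH P, sq_nonneg ‖U y‖]

lemma dbarSq_eq {B : Bil n} (hB : IsHerm B) {E : Fin n → Cn n → Cn n}
    {y : Cn n} (hE : IsUnitary B fun a => E a y) {U : Cn n → Form n q} (hU : ∀ v, IsT0 (ð U y v)) :
    dbarSq E U y = (cq (q + 1))⁻¹ * fSq (gramB B) (dbarL (ð U y)) := by
  rw [fSq_frame hB hE (isT0_dbarL _ hU), ← mul_assoc, inv_mul_cancel₀ (cq_pos _).ne', one_mul]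
  rfl

end Frame

/-! ### Biholomorphic invariance -/

/-- `ψ` is a biholomorphic map from `Ω` onto `Ω'`, with inverse `ψ'`. -/
structure IsBihol (ψ ψ' : Cn n → Cn n) (Ω Ω' : Set (Cn n)) : Prop where
  isOpen : IsOpen Ω
  isOpen' : IsOpen Ω'
  maps : ∀ y ∈ Ω, ψ y ∈ Ω'
  maps' : ∀ y ∈ Ω', ψ' y ∈ Ω
  left_inv : ∀ y ∈ Ω, ψ' (ψ y) = y
  right_inv : ∀ y ∈ Ω', ψ (ψ' y) = y
  smooth : SmoothOn ψ Ω
  smooth' : SmoothOn ψ' Ω'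
  hol : ∀ y ∈ Ω, ∀ v, ð ψ y (î • v) = î • ð ψ y v

/-- The pullback of a form on `ℂⁿ`. -/
def pullF (ψ : Cn n → Cn n) (W : Cn n → Form n q) (y : Cn n) : Form n q :=
  (W (ψ y)).compContinuousLinearMap (ð ψ y)

namespace IsBihol

variable {ψ ψ' : Cn n → Cn n} {Ω Ω' : Set (Cn n)}

lemma differentiableAt (h : IsBihol ψ ψ' Ω Ω') {y : Cn n} (hy : y ∈ Ω) : DifferentiableAt ℝ ψ y :=
  (h.smooth.contDiffAt (h.isOpen.mem_nhds hy)).differentiableAt (by simp)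

lemma differentiableAt' (h : IsBihol ψ ψ' Ω Ω') {y : Cn n} (hy : y ∈ Ω') :
    DifferentiableAt ℝ ψ' y :=
  (h.smooth'.contDiffAt (h.isOpen'.mem_nhds hy)).differentiableAt (by simp)

lemma fderiv_comp (h : IsBihol ψ ψ' Ω Ω') {y : Cn n} (hy : y ∈ Ω) :
    (ð ψ' (ψ y)).comp (ð ψ y) = ContinuousLinearMap.id ℝ _ := by
  rw [← _root_.fderiv_comp y (h.differentiableAt' (h.maps y hy)) (h.differentiableAt hy)]
  have : ψ' ∘ ψ =ᶠ[𝓝 y] id := by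
    filter_upwards [h.isOpen.mem_nhds hy] with z hz
    exact h.left_inv z hz
  rw [this.fderiv_eq, fderiv_id]

lemma fderiv_comp' (h : IsBihol ψ ψ' Ω Ω') {y : Cn n} (hy : y ∈ Ω) :
    (ð ψ y).comp (ð ψ' (ψ y)) = ContinuousLinearMap.id ℝ _ := by
  have h1 := h.differentiableAt hy
  rw [← h.left_inv y hy] at h1
  have h2 := _root_.fderiv_comp (ψ y) h1 (h.differentiableAt' (h.maps y hy))
  rw [h.left_inv y hy] at h2
  rw [← h2]
  have : ψ ∘ ψ' =ᶠ[𝓝 (ψ y)] id := by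
    filter_upwards [h.isOpen'.mem_nhds (h.maps y hy)] with z hz
    exact h.right_inv z hz
  rw [this.fderiv_eq, fderiv_id]

lemma symm (h : IsBihol ψ ψ' Ω Ω') : IsBihol ψ' ψ Ω' Ω where
  isOpen := h.isOpen'
  isOpen' := h.isOpen
  maps := h.maps'
  maps' := h.maps
  left_inv := h.right_inv
  right_inv := h.left_inv
  smooth := h.smooth'
  smooth' := h.smooth
  hol y hy v := by
    have h1 := h.fderiv_comp (h.maps' y hy)
    have h2 := h.fderiv_comp' (h.maps' y hy)
    rw [h.right_inv y hy] at h1 h2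
    have h3 : v = ð ψ (ψ' y) (ð ψ' y v) := (DFunLike.congr_fun h2 v).symm
    have h4 := h.hol _ (h.maps' y hy) (ð ψ' y v)
    rw [← h3] at h4
    rw [← h4]
    exact DFunLike.congr_fun h1 _

lemma det_ne_zero (h : IsBihol ψ ψ' Ω Ω') {y : Cn n} (hy : y ∈ Ω) : (ð ψ y).det ≠ 0 := by
  have h1 := congrArg (fun L : Cn n →L[ℝ] Cn n => LinearMap.det (L : Cn n →ₗ[ℝ] Cn n))
    (h.fderiv_comp hy)
  simp only [ContinuousLinearMap.toLinearMap_comp, LinearMap.det_comp,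
    ContinuousLinearMap.coe_id, LinearMap.det_id] at h1
  exact right_ne_zero_of_mul_eq_one h1

lemma contDiffOn_fderiv (h : IsBihol ψ ψ' Ω Ω') : SmoothOn (ð ψ) Ω :=
  h.smooth.fderiv_of_isOpen h.isOpen (by simp)

lemma contDiffOn_pullF (h : IsBihol ψ ψ' Ω Ω') {W : Cn n → Form n q}
    (hW : SmoothOn W Ω') : SmoothOn (pullF ψ W) Ω := by
  refine contDiffOn_form_of_apply fun v => ?_
  exact contDiffOn_form_apply (hW.comp h.smooth h.maps) (v := fun i y => ð ψ y (v i))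
    fun i => h.contDiffOn_fderiv.clm_apply contDiffOn_const

lemma isT0_pullF (h : IsBihol ψ ψ' Ω Ω') {W : Cn n → Form n q} {y : Cn n} (hy : y ∈ Ω)
    (hW : IsT0 (W (ψ y))) : IsT0 (pullF ψ W y) := by
  intro v i
  have := hW (fun s => ð ψ y (v s)) i
  rw [← h.hol y hy] at this
  simp only [pullF, ContinuousAlternatingMap.compContinuousLinearMap_apply]
  refine Eq.trans (congrArg (W (ψ y)) ?_) this
  ext s : 1
  rcases eq_or_ne s i with rfl | hs
  · simp
  · simp [hs]

lemma pullF_pullF (h : IsBihol ψ ψ' Ω Ω') (W : Cn n → Form n q) {y : Cn n} (hy : y ∈ Ω) :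
    pullF ψ (pullF ψ' W) y = W y := by
  ext v
  simp only [pullF, ContinuousAlternatingMap.compContinuousLinearMap_apply, h.left_inv y hy]
  congr 1
  ext s : 1
  exact DFunLike.congr_fun (h.fderiv_comp hy) (v s)

/-- `∂̄` commutes with pullback under biholomorphic maps. -/
lemma dbarL_pullF (h : IsBihol ψ ψ' Ω Ω') {W : Cn n → Form n q}
    {y : Cn n} (hy : y ∈ Ω) (hW : ∀ z ∈ Ω', IsT0 (W z)) (hWd : SmoothOn W Ω') :
    dbarL (ð (pullF ψ W) y) = pullF ψ (fun z => dbarL (ð W z)) y := by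
  have hWy : DifferentiableAt ℝ W (ψ y) :=
    (hWd.contDiffAt (h.isOpen'.mem_nhds (h.maps y hy))).differentiableAt (by simp)
  have hψ := h.differentiableAt hy
  have hd2 : DifferentiableAt ℝ (ð ψ) y :=
    (h.contDiffOn_fderiv.contDiffAt (h.isOpen.mem_nhds hy)).differentiableAt (by simp)
  have hsymm : ∀ v w, ð (ð ψ) y v w = ð (ð ψ) y w v := by
    have h1 := (h.smooth.contDiffAt (h.isOpen.mem_nhds hy)).isSymmSndFDerivAt
      (by simpa using WithTop.coe_le_coe.2 (le_top : (2 : ℕ∞) ≤ ⊤))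
    exact fun v w => h1 v w
  have hI : ∀ v w, ð (ð ψ) y (î • v) w = î • ð (ð ψ) y v w := by
    intro v w
    rw [hsymm, hsymm v w]
    have e1 : HasFDerivAt (fun z => ð ψ z (î • v))
        ((ContinuousLinearMap.apply ℝ (Cn n) (î • v)).comp (ð (ð ψ) y)) y :=
      (ContinuousLinearMap.apply ℝ (Cn n) (î • v)).hasFDerivAt.comp y hd2.hasFDerivAt
    have e2 : HasFDerivAt (fun z => ð ψ z v)
        ((ContinuousLinearMap.apply ℝ (Cn n) v).comp (ð (ð ψ) y)) y :=
      (ContinuousLinearMap.apply ℝ (Cn n) v).hasFDerivAt.comp y hd2.hasFDerivAt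
    have e3 : (fun z => ð ψ z (î • v)) =ᶠ[𝓝 y]
        fun z => î • ð ψ z v := by
      filter_upwards [h.isOpen.mem_nhds hy] with z hz
      exact h.hol z hz v
    exact DFunLike.congr_fun ((e1.congr_of_eventuallyEq e3.symm).unique
      (e2.const_smul î)) w
  have hder : ð (pullF ψ W) y = (ContinuousAlternatingMap.compContinuousLinearMapCLM (ð ψ y)).comp
        ((ð W (ψ y)).comp (ð ψ y)) +
      ((W (ψ y)).fderivCompContinuousLinearMap (ð ψ y)).comp (ð (ð ψ) y) := by
    have h1 : HasFDerivAt (fun z => W (ψ z)) ((ð W (ψ y)).comp (ð ψ y)) y :=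
      hWy.hasFDerivAt.comp y hψ.hasFDerivAt
    exact (h1.continuousAlternatingMapCompContinuousLinearMap hd2.hasFDerivAt).fderiv
  have hS : conjPart (((W (ψ y)).fderivCompContinuousLinearMap (ð ψ y)).comp
      (ð (ð ψ) y)) = ((W (ψ y)).fderivCompContinuousLinearMap
        (ð ψ y)).comp (ð (ð ψ) y) := by
    ext v w
    rw [conjPart_apply]
    simp only [ContinuousAlternatingMap.smul_apply, ContinuousAlternatingMap.add_apply,
      ContinuousLinearMap.comp_apply, ContinuousAlternatingMap.fderivCompContinuousLinearMap_apply,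
      smul_eq_mul]
    have h1 : ∀ i, (W (ψ y)) (fun j => (Function.update (fun _ => ð ψ y) i
          (ð (ð ψ) y (î • v)) j) (w j)) =
        -î * (W (ψ y)) (fun j => (Function.update (fun _ => ð ψ y) i
          (ð (ð ψ) y v) j) (w j)) := by
      intro i
      rw [← hW _ (h.maps y hy) _ i]
      congr 1
      ext j : 1
      rcases eq_or_ne j i with rfl | hj
      · simp [hI]
      · simp [hj]
    simp only [h1, ← mul_sum]
    linear_combination (-(1 / 2 : ℂ) * ∑ i, (W (ψ y)) (fun j => (Function.update
      (fun _ => ð ψ y) i (ð (ð ψ) y v) j) (w j))) * I_sq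
  have hzero : dbarL (((W (ψ y)).fderivCompContinuousLinearMap (ð ψ y)).comp
      (ð (ð ψ) y)) = 0 := by
    rw [dbarL, ContinuousLinearMap.comp_apply, hS]
    exact ContinuousAlternatingMap.alternatizeUncurryFin_fderivCompContinuousLinearMap_eq_zero _ _
      hsymm
  rw [hder, map_add, hzero, add_zero]
  ext v
  simp only [pullF, dbarL_apply, ContinuousAlternatingMap.compContinuousLinearMap_apply,
    ContinuousLinearMap.comp_apply, ContinuousAlternatingMap.compContinuousLinearMapCLM_apply,
    h.hol y hy]
  rfl

section Theta

variable {B B' : Cn n → Bil n}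

lemma image_eq (h : IsBihol ψ ψ' Ω Ω') : ψ '' Ω = Ω' := by
  ext z
  constructor
  · rintro ⟨y, hy, rfl⟩
    exact h.maps y hy
  · exact fun hz => ⟨ψ' z, h.maps' z hz, h.right_inv z hz⟩

/-- Change of variables for integrals against the Riemannian densities. -/
lemma integral_eq (h : IsBihol ψ ψ' Ω Ω') (hBB : ∀ y ∈ Ω, B y = pullB (B' (ψ y)) (ð ψ y))
    (F : Cn n → ℂ) : ∫ z in Ω', (dens (B' z) : ℂ) * F z = ∫ y in Ω, (dens (B y) : ℂ) * F (ψ y) := by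
  rw [← h.image_eq, integral_image_eq_integral_abs_det_fderiv_smul volume h.isOpen.measurableSet
    (fun y hy => (h.differentiableAt hy).hasFDerivAt.hasFDerivWithinAt)
    (fun y hy z hz hyz => by rw [← h.left_inv y hy, hyz, h.left_inv z hz])]
  refine setIntegral_congr_fun h.isOpen.measurableSet fun y hy => ?_
  simp only [hBB y hy, dens_pullB, real_smul]
  push_cast
  ring

/-- The formal adjoint commutes with isometric biholomorphic pullbacks. -/
lemma theta_pullF (h : IsBihol ψ ψ' Ω Ω') (hB : IsMet B Ω) (hB' : IsMet B' Ω')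
    (hBB : ∀ y ∈ Ω, B y = pullB (B' (ψ y)) (ð ψ y)) {U : Cn n → Form n (q + 1)}
    (hU : SmoothOn U Ω') {y : Cn n} (hy : y ∈ Ω) :
    theta B (pullF ψ U) y = pullF ψ (theta B' U) y := by
  have hpU := h.contDiffOn_pullF hU
  have hθ := hB'.contDiffOn_theta hU
  have hpθ := h.contDiffOn_pullF hθ
  have hθp := hB.contDiffOn_theta hpU
  refine ext_fInner (hB.herm y hy) (isT0_theta _ _) (h.isT0_pullF hy (isT0_theta _ _))
    fun β hβ => ?_
  set δ : Cn n → Form n q := fun z => theta B (pullF ψ U) z - pullF ψ (theta B' U) z with hδ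
  set H : Cn n → ℂ := fun z => (dens (B z) : ℂ) * fInner (gramB (B z)) β (δ z) with hH
  have hHc : ContinuousOn H Ω := by
    have h1 : SmoothOn (fun z => (dens (B z) : ℂ)) Ω :=
      ofRealCLM.contDiff.comp_contDiffOn hB.contDiffOn_dens
    exact (h1.mul (contDiffOn_fInner hB contDiffOn_const (hθp.sub hpθ))).continuousOn
  have hpair : ∀ {p : ℕ} (α γ : Cn n → Form n p) (z : Cn n), z ∈ Ω →
      fInner (gramB (B z)) (pullF ψ α z) (pullF ψ γ z) = fInner (gramB (B' (ψ z))) (α (ψ z)) (γ (ψ z)) := by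
    intro p α γ z hz
    rw [hBB z hz]
    exact fInner_pullback _ _ (h.det_ne_zero hz) _ _
  have hzero : ∀ k : Cn n → ℝ, Smooth k → HasCompactSupport k → tsupport k ⊆ Ω →
      ∫ z, k z • H z = 0 := by
    intro k hk hkc hks
    set W : Cn n → Form n q := fun z => k z • β with hWdef
    have hW : Smooth W := hk.smul contDiff_const
    have hsW : Function.support W ⊆ Function.support k := fun z hz => by
      rw [Function.mem_support] at hz ⊢
      contrapose! hz
      simp only [hWdef, hz]
      exact zero_smul ℝ β
    have hWc : HasCompactSupport W := hkc.mono hsW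
    have hWs : tsupport W ⊆ Ω := (closure_mono hsW).trans hks
    have hW0 : ∀ z, IsT0 (W z) := fun z => (t0Sub n q).smul_mem (k z : ℂ) hβ
    set W' : Cn n → Form n q := Ω'.indicator (pullF ψ' W) with hW'def
    have hK' : IsCompact (ψ '' tsupport W) := hWc.isCompact.image_of_continuousOn
      (h.smooth.continuousOn.mono hWs)
    have hsW' : Function.support W' ⊆ ψ '' tsupport W := by
      intro z hz
      rw [Function.mem_support] at hz
      have hzΩ : z ∈ Ω' := by
        by_contra h0
        exact hz (indicator_of_notMem h0 _)
      refine ⟨ψ' z, subset_tsupport _ ?_, h.right_inv z hzΩ⟩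
      rw [Function.mem_support]
      intro h0
      refine hz ?_
      rw [hW'def, indicator_of_mem hzΩ, pullF, h0]
      ext
      simp
    have htW' : tsupport W' ⊆ ψ '' tsupport W := closure_minimal hsW' hK'.isClosed
    have htΩ' : tsupport W' ⊆ Ω' := by
      refine htW'.trans ?_
      rintro _ ⟨z, hz, rfl⟩
      exact h.maps z (hWs hz)
    have hW'c : HasCompactSupport W' := hK'.of_isClosed_subset (isClosed_tsupport _) htW'
    have hW's : Smooth W' := by
      refine contDiff_of_tsupport h.isOpen' ?_ htΩ'
      refine (h.symm.contDiffOn_pullF hW.contDiffOn).congr fun z hz => ?_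
      exact indicator_of_mem hz _
    have hW'0 : ∀ z, IsT0 (W' z) := by
      intro z
      by_cases hz : z ∈ Ω'
      · rw [hW'def, indicator_of_mem hz]
        exact h.symm.isT0_pullF hz (hW0 _)
      · rw [hW'def, indicator_of_notMem hz]
        exact (t0Sub n q).zero_mem
    have hWW' : ∀ z ∈ Ω, pullF ψ W' z = W z := by
      intro z hz
      rw [← h.pullF_pullF W hz]
      simp only [pullF, hW'def, indicator_of_mem (h.maps z hz)]
    have i1 := hB.integral_theta hpU hW hWc hWs hW0
    have i2 := hB'.integral_theta hU hW's hW'c htΩ' hW'0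
    have restr : ∀ {Ω₀ : Set (Cn n)} {W₀ : Cn n → Form n q} {G : Cn n → ℂ}, tsupport W₀ ⊆ Ω₀ →
        (∀ z, z ∉ tsupport W₀ → G z = 0) → ∫ z, G z = ∫ z in Ω₀, G z := by
      intro Ω₀ W₀ G hs h0
      rw [eq_comm]
      exact setIntegral_eq_integral_of_forall_compl_eq_zero fun z hz => h0 z fun hz' => hz (hs hz')
    have hDW : ∀ {W₀ : Cn n → Form n q} (z : Cn n), z ∉ tsupport W₀ → W₀ z = 0 ∧ ð W₀ z = 0 := by
      intro W₀ z hz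
      have h1 : W₀ =ᶠ[𝓝 z] fun _ => 0 := notMem_tsupport_iff_eventuallyEq.1 hz
      exact ⟨h1.self_of_nhds, by rw [h1.fderiv_eq]; simp⟩
    rw [restr hWs fun z hz => by simp [(hDW z hz).2, fInner],
      restr hWs fun z hz => by simp [(hDW z hz).1, fInner]] at i1
    rw [restr htΩ' fun z hz => by simp [(hDW z hz).2, fInner],
      restr htΩ' fun z hz => by simp [(hDW z hz).1, fInner], h.integral_eq hBB,
      h.integral_eq hBB] at i2
    have e1 : ∫ z in Ω, (dens (B z) : ℂ) *
        fInner (gramB (B' (ψ z))) (dbarL (ð W' (ψ z))) (U (ψ z)) =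
        ∫ z in Ω, (dens (B z) : ℂ) * fInner (gramB (B z)) (dbarL (ð W z)) (pullF ψ U z) := by
      refine setIntegral_congr_fun h.isOpen.measurableSet fun z hz => ?_
      beta_reduce
      rw [← hpair (fun z => dbarL (ð W' z)) U z hz, ← h.dbarL_pullF hz (fun z _ => hW'0 z)
        hW's.contDiffOn]
      have : pullF ψ W' =ᶠ[𝓝 z] W := by
        filter_upwards [h.isOpen.mem_nhds hz] with w hw
        exact hWW' w hw
      rw [this.fderiv_eq]
    have e2 : ∫ z in Ω, (dens (B z) : ℂ) * fInner (gramB (B' (ψ z))) (W' (ψ z)) (theta B' U (ψ z)) =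
        ∫ z in Ω, (dens (B z) : ℂ) * fInner (gramB (B z)) (W z) (pullF ψ (theta B' U) z) := by
      refine setIntegral_congr_fun h.isOpen.measurableSet fun z hz => ?_
      beta_reduce
      rw [← hpair W' (theta B' U) z hz, hWW' z hz]
    rw [e1, e2, i1] at i2
    have c1 : ∀ {γ : Cn n → Form n q}, SmoothOn γ Ω →
        IntegrableOn (fun z => (dens (B z) : ℂ) * fInner (gramB (B z)) (W z) (γ z)) Ω := by
      intro γ hγ
      have h1 : SmoothOn (fun z => (dens (B z) : ℂ)) Ω :=
        ofRealCLM.contDiff.comp_contDiffOn hB.contDiffOn_dens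
      have h2 := h1.mul (contDiffOn_fInner hB hW.contDiffOn hγ)
      have hs : Function.support (fun z => (dens (B z) : ℂ) * fInner (gramB (B z)) (W z) (γ z)) ⊆
          Function.support W := fun z hz => by
        exact fun h => hz (by simp [h, fInner])
      exact ((contDiff_of_tsupport h.isOpen h2
        ((closure_mono hs).trans hWs)).continuous.integrable_of_hasCompactSupport
          (hWc.mono hs)).integrableOn
    have e3 : ∫ z, k z • H z = ∫ z in Ω, k z • H z :=
      restr (W₀ := W) hWs fun z hz => by
        have h1 := (hDW z hz).1
        have h2 : k z • H z = (dens (B z) : ℂ) * fInner (gramB (B z)) (W z) (δ z) := by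
          have h3 : fInner (gramB (B z)) (W z) (δ z) = k z * fInner (gramB (B z)) β (δ z) :=
            fInner_smul_left (k z : ℂ) β (δ z)
          rw [h3, hH, real_smul]
          ring
        rw [h2, h1]
        simp [fInner]
    rw [e3]
    have e4 : ∫ z in Ω, k z • H z = (∫ z in Ω, (dens (B z) : ℂ) *
        fInner (gramB (B z)) (W z) (theta B (pullF ψ U) z)) -
        ∫ z in Ω, (dens (B z) : ℂ) * fInner (gramB (B z)) (W z) (pullF ψ (theta B' U) z) := by
      rw [← integral_sub (c1 hθp) (c1 hpθ)]
      refine integral_congr_ae (ae_of_all _ fun z => ?_)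
      have h3 : fInner (gramB (B z)) (W z) (δ z) = k z * fInner (gramB (B z)) β (δ z) :=
        fInner_smul_left (k z : ℂ) β (δ z)
      have h4 : fInner (gramB (B z)) (W z) (δ z) = _ := fInner_sub_right _ _ _
      simp only [hH, real_smul]
      linear_combination (-(dens (B z) : ℂ)) * h3 + (dens (B z) : ℂ) * h4
    rw [e4, i2, sub_self]
  have hloc : LocallyIntegrableOn H Ω := hHc.locallyIntegrableOn h.isOpen.measurableSet
  have hae := h.isOpen.ae_eq_zero_of_integral_contDiff_smul_eq_zero hloc hzero
  have hall : Set.EqOn H (fun _ => 0) Ω := by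
    refine Measure.eqOn_open_of_ae_eq (μ := volume) ?_ h.isOpen hHc continuousOn_const
    rw [Filter.EventuallyEq, ae_restrict_iff' h.isOpen.measurableSet]
    exact hae
  have h1 := hall hy
  simp only [hH, hδ] at h1
  have h0 : (dens (B y) : ℂ) ≠ 0 := by exact_mod_cast (hB.herm y hy).dens_pos.ne'
  have h2 := (mul_eq_zero.1 h1).resolve_left h0
  rw [fInner_sub_right, sub_eq_zero] at h2
  exact h2

end Theta

end IsBihol

variable {M' : Type*} [TopologicalSpace M'] [ChartedSpace (Cn n) M']
  [IsManifold 𝓘(ℂ, Cn n) ω M'] [MeasurableSpace M'] [BorelSpace M'] [SecondCountableTopology M']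
  [T2Space M'] [MulAction Circle M'] {e e' : OpenPartialHomeomorph M' (Cn n)} {g : RMetric n M'}
  {ρ : M' → ℝ} {m : ℤ} {ι : Type} [Fintype ι] {ec : ι → OpenPartialHomeomorph M' (Cn n)}
  {χ : SmoothPartitionOfUnity ι 𝓘(ℝ, Cn n) M' (closure (dom ρ))}

set_option hygiene false in
/-- The `(0,q)` forms on `M'`. -/
notation "𝓕" q:max => (x : M') → AltForm n q x

set_option hygiene false in
/-- The atlas of `M'`. -/
notation "𝒰" => atlas (Cn n) M'

/-! ### Holomorphic charts -/

/-- The differential of the inverse of the chart `e`. -/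
def chD (e : OpenPartialHomeomorph M' (Cn n)) (y : Cn n) : Cn n →L[ℝ] Cn n :=
  (mfderiv 𝓘(ℝ, Cn n) 𝓘(ℝ, Cn n) e.symm y : Cn n →L[ℝ] TS n (e.symm y))

/-- The differential of the action of `c`. -/
def actD (c : Circle) (x : M') : Cn n →L[ℝ] Cn n :=
  (actDeriv n c x : TS n x →L[ℝ] TS n (c • x))

/-- The value of `u` at `x`, as a form on the model space. -/
def frm (u : 𝓕 q) (x : M') : Form n q := u x

/-- The action of `c` on `M'` in the charts `e` and `e'`. -/
def actChart (e e' : OpenPartialHomeomorph M' (Cn n)) (c : Circle)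
    (y : Cn n) : Cn n := e' (c • e.symm y)

/-- The points of the chart `e` that the action of `c` maps into the chart `e'`. -/
def actDom (e e' : OpenPartialHomeomorph M' (Cn n)) (c : Circle) :
    Set (Cn n) := e.target ∩ e.symm ⁻¹' ((fun x => c • x) ⁻¹' e'.source)

lemma inChart_eq (e : OpenPartialHomeomorph M' (Cn n)) (u : 𝓕 q)
    (y : Cn n) : inChart e u y = (frm u (e.symm y)).compContinuousLinearMap (chD e y) := rfl

lemma HasMFDerivAt.restrictScalars_real {N' : Type*} [TopologicalSpace N'] [ChartedSpace (Cn n) N']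
    {f : M' → N'} {x : M'} {A : Cn n →L[ℂ] Cn n} (h : HasMFDerivAt 𝓘(ℂ, Cn n) 𝓘(ℂ, Cn n) f x A) :
    HasMFDerivAt 𝓘(ℝ, Cn n) 𝓘(ℝ, Cn n) f x (A.restrictScalars ℝ) := by
  refine ⟨h.1, ?_⟩
  have h2 : HasFDerivWithinAt (𝕜 := ℂ) (writtenInExtChartAt 𝓘(ℂ, Cn n) 𝓘(ℂ, Cn n) x f) A
    (Set.range 𝓘(ℂ, Cn n)) _ := h.2
  exact h2.restrictScalars ℝ

lemma mfderiv_I_smul {N' : Type*} [TopologicalSpace N'] [ChartedSpace (Cn n) N']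
    {f : M' → N'} {x : M'} (h : MDifferentiableAt 𝓘(ℂ, Cn n) 𝓘(ℂ, Cn n) f x) (v : Cn n) :
    (id (mfderiv 𝓘(ℝ, Cn n) 𝓘(ℝ, Cn n) f x) : Cn n →L[ℝ] Cn n) (î • v) =
      î • (id (mfderiv 𝓘(ℝ, Cn n) 𝓘(ℝ, Cn n) f x) : Cn n →L[ℝ] Cn n) v := by
  have h1 := HasMFDerivAt.restrictScalars_real h.hasMFDerivAt
  have h2 : (id (mfderiv 𝓘(ℝ, Cn n) 𝓘(ℝ, Cn n) f x) : Cn n →L[ℝ] Cn n) =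
    (id (mfderiv 𝓘(ℂ, Cn n) 𝓘(ℂ, Cn n) f x) : Cn n →L[ℂ] Cn n).restrictScalars ℝ := h1.mfderiv
  rw [h2]
  exact map_smul (id (mfderiv 𝓘(ℂ, Cn n) 𝓘(ℂ, Cn n) f x) : Cn n →L[ℂ] Cn n) _ _

lemma contMDiffOn_chart (he : e ∈ 𝒰) : ContMDiffOn 𝓘(ℝ, Cn n) 𝓘(ℝ, Cn n) ∞ e e.source :=
  contMDiffOn_of_mem_maximalAtlas (IsManifold.subset_maximalAtlas he)

lemma contMDiffOn_chart_symm (he : e ∈ 𝒰) : ContMDiffOn 𝓘(ℝ, Cn n) 𝓘(ℝ, Cn n) ∞ e.symm e.target :=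
  contMDiffOn_symm_of_mem_maximalAtlas (IsManifold.subset_maximalAtlas he)

lemma mdifferentiableAt_chart_symm (he : e ∈ 𝒰) {y : Cn n} (hy : y ∈ e.target) :
    MDifferentiableAt 𝓘(ℝ, Cn n) 𝓘(ℝ, Cn n) e.symm y :=
  ((contMDiffOn_chart_symm he).contMDiffAt (e.open_target.mem_nhds hy)).mdifferentiableAt (by simp)

lemma mdifferentiableAt_chart (he : e ∈ 𝒰) {x : M'} (hx : x ∈ e.source) :
    MDifferentiableAt 𝓘(ℝ, Cn n) 𝓘(ℝ, Cn n) e x :=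
  ((contMDiffOn_chart he).contMDiffAt (e.open_source.mem_nhds hx)).mdifferentiableAt (by simp)

lemma chD_I_smul (he : e ∈ 𝒰) {y : Cn n} (hy : y ∈ e.target) (v : Cn n) :
    chD e y (î • v) = î • chD e y v :=
  haveI : IsManifold 𝓘(ℂ, Cn n) 1 M' := IsManifold.of_le (n := ω) le_top
  mfderiv_I_smul (mdifferentiableAt_atlas_symm he hy) v

/-- The differential of the chart `e`, in the coordinates given by `e`. -/
def chDinv (e : OpenPartialHomeomorph M' (Cn n)) (y : Cn n) : Cn n →L[ℝ] Cn n :=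
  (mfderiv 𝓘(ℝ, Cn n) 𝓘(ℝ, Cn n) e (e.symm y) : TS n (e.symm y) →L[ℝ] Cn n)

lemma chDinv_comp_chD (he : e ∈ 𝒰) {y : Cn n} (hy : y ∈ e.target) :
    (chDinv e y).comp (chD e y) = ContinuousLinearMap.id ℝ _ := by
  have h1 := (mdifferentiableAt_chart he (e.map_target hy)).hasMFDerivAt.comp y
    (mdifferentiableAt_chart_symm he hy).hasMFDerivAt
  have h2 : HasMFDerivAt 𝓘(ℝ, Cn n) 𝓘(ℝ, Cn n) (e ∘ e.symm) y (ContinuousLinearMap.id ℝ _) := by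
    refine (hasMFDerivAt_id y).congr_of_eventuallyEq ?_
    filter_upwards [e.open_target.mem_nhds hy] with z hz
    exact e.right_inv hz
  exact hasMFDerivAt_unique h1 h2

lemma chD_comp_chDinv (he : e ∈ 𝒰) {y : Cn n} (hy : y ∈ e.target) :
    (chD e y).comp (chDinv e y) = ContinuousLinearMap.id ℝ _ := by
  have h := chDinv_comp_chD he hy
  have h3 : (chDinv e y : Cn n →ₗ[ℝ] Cn n) ∘ₗ (chD e y : Cn n →ₗ[ℝ] Cn n) = LinearMap.id := by
    ext1 v
    exact congrArg (fun A : Cn n →L[ℝ] Cn n => A v) h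
  ext1 v
  exact congrArg (fun A : Cn n →ₗ[ℝ] Cn n => A v) ((LinearMap.comp_eq_id_comm ℝ _).1 h3)

lemma chD_det_ne_zero (he : e ∈ 𝒰) {y : Cn n} (hy : y ∈ e.target) : (chD e y).det ≠ 0 := by
  intro h0
  have h := congrArg ContinuousLinearMap.det (chDinv_comp_chD he hy)
  rw [show ((chDinv e y).comp (chD e y)).det = (chDinv e y).det * (chD e y).det from
    LinearMap.det_comp _ _, h0, mul_zero] at h
  exact zero_ne_one (h.trans LinearMap.det_id)

lemma isT0_inChart (he : e ∈ 𝒰) {y : Cn n} (hy : y ∈ e.target)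
    {u : 𝓕 q} (hu : IsType0 (u (e.symm y))) : IsT0 (inChart e u y) := by
  intro v i
  have h := hu (fun k => chD e y (v k)) i
  have h2 : (fun k => chD e y (Function.update v i (î • v i) k)) =
      Function.update (fun k => chD e y (v k)) i (î • chD e y (v i)) := by
    ext1 k
    rcases eq_or_ne k i with rfl | hk
    · simp [chD_I_smul he hy]
    · simp [hk]
  exact (congrArg (fun w => frm u (e.symm y) w) h2).trans h

lemma eq_of_inChart (he : e ∈ 𝒰) {y : Cn n} (hy : y ∈ e.target)
    {u v : 𝓕 q} (h : inChart e u y = inChart e v y) : u (e.symm y) = v (e.symm y) := by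
  have h2 := congrArg (fun α : Form n q => α.compContinuousLinearMap (chDinv e y)) h
  have h3 : ∀ w : 𝓕 q, (inChart e w y).compContinuousLinearMap (chDinv e y) = frm w (e.symm y) := by
    intro w
    ext z
    simp only [inChart_eq, ContinuousAlternatingMap.compContinuousLinearMap_apply]
    refine congrArg _ (funext fun k => ?_)
    exact congrArg (fun A : Cn n →L[ℝ] Cn n => A (z k)) (chD_comp_chDinv he hy)
  exact (h3 u).symm.trans (h2.trans (h3 v))

lemma isType0_of_inChart (he : e ∈ 𝒰) {y : Cn n} (hy : y ∈ e.target)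
    {u : 𝓕 q} (hu : IsT0 (inChart e u y)) : IsType0 (u (e.symm y)) := by
  have h3 : (inChart e u y).compContinuousLinearMap (chDinv e y) = frm u (e.symm y) := by
    ext z
    simp only [inChart_eq, ContinuousAlternatingMap.compContinuousLinearMap_apply]
    refine congrArg _ (funext fun k => ?_)
    exact congrArg (fun A : Cn n →L[ℝ] Cn n => A (z k)) (chD_comp_chDinv he hy)
  have hI : ∀ v, chDinv e y (î • v) = î • chDinv e y v := by
    intro v
    have h1 : ∀ w, chD e y (chDinv e y w) = w := fun w =>
      congrArg (fun A : Cn n →L[ℝ] Cn n => A w) (chD_comp_chDinv he hy)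
    have h2 : ∀ w, chDinv e y (chD e y w) = w := fun w =>
      congrArg (fun A : Cn n →L[ℝ] Cn n => A w) (chDinv_comp_chD he hy)
    rw [← h2 (î • chDinv e y v), chD_I_smul he hy, h1]
  have h4 : IsT0 (frm u (e.symm y)) := by
    rw [← h3]
    intro v i
    have h := hu (fun k => chDinv e y (v k)) i
    rw [← hI] at h
    have h2 : (fun k => chDinv e y (Function.update v i (î • v i) k)) =
        Function.update (fun k => chDinv e y (v k)) i (chDinv e y (î • v i)) := by
      ext1 k
      rcases eq_or_ne k i with rfl | hk
      · simp
      · simp [hk]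
    exact (congrArg (fun w => inChart e u y w) h2).trans h
  exact h4

section Act

variable (hact : IsHolomorphicCircleAction n M')
include hact

lemma contMDiff_act (c : Circle) : ContMDiff 𝓘(ℝ, Cn n) 𝓘(ℝ, Cn n) ∞ (fun x : M' => c • x) := by
  obtain ⟨θ, rfl⟩ : ∃ θ, Circle.exp θ = c := ⟨_, Circle.exp_arg c⟩
  have h : ContMDiff 𝓘(ℝ, Cn n) (𝓘(ℝ, ℝ).prod 𝓘(ℝ, Cn n)) ∞ (fun x : M' => ((θ, x) : ℝ × M')) :=
    contMDiff_const.prodMk contMDiff_id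
  exact hact.smooth.comp h

lemma actDeriv_I_smul (c : Circle) (x : M') (v : Cn n) : actD c x (î • v) = î • actD c x v :=
  mfderiv_I_smul (hact.holomorphic c x) v

lemma isOpen_actDom (c : Circle) : IsOpen (actDom e e' c) :=
  e.symm.isOpen_inter_preimage (e'.open_source.preimage (contMDiff_act hact c).continuous)

lemma contDiffOn_actChart (he : e ∈ 𝒰) (he' : e' ∈ 𝒰) (c : Circle) :
    SmoothOn (actChart e e' c) (actDom e e' c) := by
  rw [← contMDiffOn_iff_contDiffOn]
  exact ((contMDiffOn_chart he').comp ((contMDiff_act hact c).comp_contMDiffOn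
    ((contMDiffOn_chart_symm he).mono inter_subset_left)) fun y hy => hy.2)

lemma chD_comp_fderiv (he : e ∈ 𝒰) (he' : e' ∈ 𝒰) (c : Circle) {y : Cn n} (hy : y ∈ actDom e e' c) :
    (chD e' (actChart e e' c y)).comp (ð (actChart e e' c) y) =
      (actD c (e.symm y)).comp (chD e y) := by
  have hd : HasMFDerivAt 𝓘(ℝ, Cn n) 𝓘(ℝ, Cn n) (actChart e e' c) y
      (ð (actChart e e' c) y) :=
    ((((contDiffOn_actChart hact he he' c).contDiffAt
      ((isOpen_actDom hact c).mem_nhds hy)).differentiableAt (by simp)).hasFDerivAt).hasMFDerivAt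
  have h1 := (mdifferentiableAt_chart_symm he' (e'.map_source hy.2)).hasMFDerivAt.comp y hd
  have h2 := ((contMDiff_act hact c (e.symm y)).mdifferentiableAt (by simp)).hasMFDerivAt.comp y
    (mdifferentiableAt_chart_symm he hy.1).hasMFDerivAt
  have h3 := h2.congr_of_eventuallyEq (f₁ := e'.symm ∘ actChart e e' c) (by
    filter_upwards [(isOpen_actDom hact c).mem_nhds hy] with z hz
    exact e'.left_inv hz.2)
  exact (hasMFDerivAt_unique h1 h3 :)

lemma isBihol_actChart (he : e ∈ 𝒰) (he' : e' ∈ 𝒰) (c : Circle) :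
    IsBihol (actChart e e' c) (actChart e' e c⁻¹) (actDom e e' c) (actDom e' e c⁻¹) := by
  have hm : ∀ (e e' : OpenPartialHomeomorph M' (Cn n)) (c : Circle) (y : Cn n),
      y ∈ actDom e e' c → actChart e e' c y ∈ actDom e' e c⁻¹ := by
    intro e e' c y hy
    refine ⟨e'.map_source hy.2, ?_⟩
    show c⁻¹ • e'.symm (e' (c • e.symm y)) ∈ e.source
    rw [e'.left_inv hy.2, inv_smul_smul]
    exact e.map_target hy.1
  have hi : ∀ (e e' : OpenPartialHomeomorph M' (Cn n)) (c : Circle) (y : Cn n),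
      y ∈ actDom e e' c → actChart e' e c⁻¹ (actChart e e' c y) = y := by
    intro e e' c y hy
    show e (c⁻¹ • e'.symm (e' (c • e.symm y))) = y
    rw [e'.left_inv hy.2, inv_smul_smul, e.right_inv hy.1]
  refine ⟨isOpen_actDom hact c, isOpen_actDom hact c⁻¹, hm e e' c, fun y hy => ?_, hi e e' c,
    fun y hy => ?_, contDiffOn_actChart hact he he' c, contDiffOn_actChart hact he' he c⁻¹, ?_⟩
  · simpa using hm e' e c⁻¹ y hy
  · simpa using hi e' e c⁻¹ y hy
  · intro y hy v
    have h1 : ∀ w, chD e' (actChart e e' c y) (ð (actChart e e' c) y w) =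
        (actD c (e.symm y)) (chD e y w) := fun w =>
      congrArg (fun A : Cn n →L[ℝ] Cn n => A w) (chD_comp_fderiv hact he he' c hy)
    have hy' : actChart e e' c y ∈ e'.target := e'.map_source hy.2
    have h2 : ∀ w, chDinv e' (actChart e e' c y) (chD e' (actChart e e' c y) w) = w := fun w =>
      congrArg (fun A : Cn n →L[ℝ] Cn n => A w) (chDinv_comp_chD he' hy')
    rw [← h2 (ð (actChart e e' c) y (î • v)), h1, chD_I_smul he hy.1,
      actDeriv_I_smul hact, ← h1, ← chD_I_smul he' hy', h2]

lemma inChart_actPullback (he : e ∈ 𝒰) (he' : e' ∈ 𝒰)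
    (c : Circle) (u : 𝓕 q) {y : Cn n} (hy : y ∈ actDom e e' c) :
    inChart e (actPullback c u) y = pullF (actChart e e' c) (inChart e' u) y := by
  have h1 : frm u (e'.symm (actChart e e' c y)) = frm u (c • e.symm y) :=
    congrArg (frm u) (e'.left_inv hy.2)
  have h2 : inChart e (actPullback c u) y = ((frm u (c • e.symm y)).compContinuousLinearMap
        ((actD c (e.symm y)).comp (chD e y)) : Form n q) := rfl
  rw [h2, ← chD_comp_fderiv hact he he' c hy, ← h1]
  rfl

end Act

section Met

variable (g : RMetric n M')

/-- The metric at `x`, as a bilinear form on the model space. -/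
def inn (x : M') : Bil n := g.inner x

/-- The metric in the coordinates given by `e`. -/
def metB (e : OpenPartialHomeomorph M' (Cn n)) (y : Cn n) : Bil n :=
  pullB (inn g (e.symm y)) (chD e y)

lemma formInner_symm (he : e ∈ 𝒰) {y : Cn n} (hy : y ∈ e.target) (u v : 𝓕 q) :
    formInner g (u (e.symm y)) (v (e.symm y)) =
      fInner (gramB (metB g e y)) (inChart e u y) (inChart e v y) := by
  exact (fInner_pullback (inn g (e.symm y)) (chD e y) (chD_det_ne_zero he hy) _ _).symm

lemma contDiffOn_metB (he : e ∈ 𝒰) : SmoothOn (metB g e) e.target := by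
  have hs : ∀ v : Cn n, ContMDiffOn 𝓘(ℝ, Cn n) (𝓘(ℝ, Cn n).prod 𝓘(ℝ, Cn n)) ∞
      (fun y => Bundle.TotalSpace.mk' (Cn n) (E := fun x : M' => TangentSpace 𝓘(ℝ, Cn n) x)
        (e.symm y) (chD e y v)) e.target := by
    intro v
    have h1 := (contMDiffOn_chart_symm he).contMDiffOn_tangentMapWithin (m := ∞) (by simp)
      e.open_target.uniqueMDiffOn
    have h2 : ContMDiffOn 𝓘(ℝ, Cn n) 𝓘(ℝ, Cn n).tangent ∞
        (fun y : Cn n => (Bundle.TotalSpace.mk' (Cn n) y v : TangentBundle 𝓘(ℝ, Cn n) (Cn n)))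
        e.target := contMDiffOn_vectorSpace_iff_contDiffOn.2 contDiffOn_const
    refine (h1.comp h2 fun y hy => hy).congr fun y hy => ?_
    simp only [Function.comp_apply, tangentMapWithin]
    rw [mfderivWithin_of_isOpen e.open_target hy]
    rfl
  have hg : ContMDiffOn 𝓘(ℝ, Cn n) (𝓘(ℝ, Cn n).prod 𝓘(ℝ, Bil n)) ∞
      (fun y => Bundle.TotalSpace.mk' (Bil n)
        (E := fun x : M' => TangentSpace 𝓘(ℝ, Cn n) x →L[ℝ] TangentSpace 𝓘(ℝ, Cn n) x →L[ℝ] ℝ)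
        (e.symm y) (g.inner (e.symm y))) e.target :=
    g.contMDiff.comp_contMDiffOn (contMDiffOn_chart_symm he)
  have h : ∀ v w, SmoothOn (fun y => metB g e y v w) e.target := by
    intro v w
    have h2 := ContMDiffOn.clm_bundle_apply₂ (F₁ := Cn n) (F₂ := Cn n)
      (F₃ := ℝ) (E₃ := Bundle.Trivial M' ℝ) hg (hs v) (hs w)
    rw [← contMDiffOn_iff_contDiffOn]
    intro y hy
    have h3 := h2 y hy
    simp only [Bundle.contMDiffWithinAt_totalSpace] at h3
    exact h3.2
  rw [contDiffOn_clm_apply]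
  intro v
  rw [contDiffOn_clm_apply]
  exact h v

lemma isMet_metB (hg : IsHermitianMetric g) (he : e ∈ 𝒰) : IsMet (metB g e) e.target := by
  refine ⟨e.open_target, contDiffOn_metB g he, fun y hy => ⟨fun v w => ?_, ?_, ?_⟩⟩
  · exact (g.symm (e.symm y) (chD e y v) (chD e y w) :)
  · intro v hv
    have h0 : chD e y v ≠ 0 := by
      intro h0
      have h1 : chDinv e y (chD e y v) = v :=
        congrArg (fun A : Cn n →L[ℝ] Cn n => A v) (chDinv_comp_chD he hy)
      exact hv (by rw [← h1, h0, map_zero])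
    exact g.pos (e.symm y) (chD e y v) h0
  · intro v w
    have h : inn g (e.symm y) (î • chD e y v) (î • chD e y w) =
      inn g (e.symm y) (chD e y v) (chD e y w) := hg (e.symm y) (chD e y v) (chD e y w)
    rw [← chD_I_smul he hy, ← chD_I_smul he hy] at h
    exact h

lemma metB_actChart (hact : IsHolomorphicCircleAction n M')
    (hginv : IsInvariantMetric g) (he : e ∈ 𝒰) (he' : e' ∈ 𝒰)
    (c : Circle) {y : Cn n} (hy : y ∈ actDom e e' c) :
    metB g e y = pullB (metB g e' (actChart e e' c y)) (ð (actChart e e' c) y) := by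
  have h1 : inn g (e'.symm (actChart e e' c y)) = inn g (c • e.symm y) :=
    congrArg (inn g) (e'.left_inv hy.2)
  have hA : ∀ w, chD e' (actChart e e' c y) (ð (actChart e e' c) y w) =
        (actD c (e.symm y)) (chD e y w) := fun w =>
      congrArg (fun A : Cn n →L[ℝ] Cn n => A w) (chD_comp_fderiv hact he he' c hy)
  ext v w
  show _ = inn g (e'.symm (actChart e e' c y))
    (chD e' (actChart e e' c y) (ð (actChart e e' c) y v))
    (chD e' (actChart e e' c y) (ð (actChart e e' c) y w))
  rw [h1, hA, hA]
  exact (hginv c (e.symm y) (chD e y v) (chD e y w)).symm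

end Met

/-! ### The Cauchy-Riemann operator and its formal adjoint on smooth forms -/

/-- The form with the expression `F e` in the chart `e`. -/
def glueForm (F : OpenPartialHomeomorph M' (Cn n) → Cn n → Form n q) (x : M') : AltForm n q x :=
  (F (chartAt (Cn n) x) (chartAt (Cn n) x x)).compContinuousLinearMap
    (chDinv (chartAt (Cn n) x) (chartAt (Cn n) x x))

section ActGroup

lemma actD_one (x : M') : actD (n := n) (1 : Circle) x = ContinuousLinearMap.id ℝ _ := by
  have h1 : HasMFDerivAt 𝓘(ℝ, Cn n) 𝓘(ℝ, Cn n) (fun y : M' => (1 : Circle) • y) x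
      (ContinuousLinearMap.id ℝ (Cn n)) :=
    (hasMFDerivAt_id x).congr_of_eventuallyEq (Eventually.of_forall fun y => one_smul _ y)
  exact h1.mfderiv

lemma frm_actPullback (c : Circle) (u : 𝓕 q) (x : M') :
    frm (actPullback c u) x = (frm u (c • x)).compContinuousLinearMap (actD c x) := rfl

lemma actPullback_one (u : 𝓕 q) : actPullback 1 u = u := by
  funext x
  have h : frm (actPullback 1 u) x = frm u x := by
    rw [frm_actPullback, actD_one, one_smul]
    rfl
  exact h

variable (hact : IsHolomorphicCircleAction n M')
include hact

lemma actD_mul (c d : Circle) (x : M') :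
    actD (n := n) (c * d) x = (actD c (d • x)).comp (actD d x) := by
  have h1 := ((contMDiff_act hact c (d • x)).mdifferentiableAt (by simp)).hasMFDerivAt.comp x
    ((contMDiff_act hact d x).mdifferentiableAt (by simp)).hasMFDerivAt
  have h2 := h1.congr_of_eventuallyEq (f₁ := fun y => (c * d) • y)
    (Eventually.of_forall fun y => mul_smul c d y)
  exact h2.mfderiv

lemma frm_actPullback_mul (c d : Circle) (u : 𝓕 q) (x : M') : frm (actPullback (c * d) u) x =
      (frm (actPullback c u) (d • x)).compContinuousLinearMap (actD d x) := by
  rw [frm_actPullback, frm_actPullback, actD_mul hact, mul_smul]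
  rfl

lemma inChart_eq_pullF (he : e ∈ 𝒰) (he' : e' ∈ 𝒰) (u : 𝓕 q) {y : Cn n} (hy : y ∈ actDom e e' 1) :
    inChart e u y = pullF (actChart e e' 1) (inChart e' u) y := by
  have h := inChart_actPullback hact he he' 1 u hy
  rwa [actPullback_one] at h

lemma inChart_glueForm {F : OpenPartialHomeomorph M' (Cn n) → Cn n → Form n q}
    (hF : ∀ e ∈ 𝒰, ∀ e' ∈ 𝒰, ∀ y ∈ actDom e e' 1, F e y = pullF (actChart e e' 1) (F e') y)
    (he : e ∈ 𝒰) {y : Cn n} (hy : y ∈ e.target) : inChart e (glueForm F) y = F e y := by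
  set e' := chartAt (Cn n) (e.symm y) with he'
  have hm : e' ∈ 𝒰 := chart_mem_atlas _ _
  have hs : e.symm y ∈ e'.source := mem_chart_source _ _
  have hy' : y ∈ actDom e e' 1 := by
    refine ⟨hy, ?_⟩
    show (1 : Circle) • e.symm y ∈ e'.source
    rwa [one_smul]
  have hψ : actChart e e' 1 y = e' (e.symm y) := by rw [actChart, one_smul]
  rw [inChart_eq_pullF hact he hm _ hy', hF e he e' hm y hy', pullF, pullF]
  congr 1
  rw [hψ, inChart_eq, e'.left_inv hs]
  have h1 : frm (glueForm F) (e.symm y) = (F e' (e' (e.symm y))).compContinuousLinearMap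
    (chDinv e' (e' (e.symm y))) := rfl
  rw [h1]
  ext v
  simp only [ContinuousAlternatingMap.compContinuousLinearMap_apply]
  refine congrArg _ (funext fun k => ?_)
  exact congrArg (fun A : Cn n →L[ℝ] Cn n => A (v k)) (chDinv_comp_chD hm (e'.map_source hs))

end ActGroup

/-- `∂̄u` for a smooth form `u`. -/
def dbarG (u : 𝓕 q) : 𝓕 (q + 1) :=
  glueForm fun e y => dbarL (ð (inChart e u) y)

/-- `ϑu` for a smooth form `u`, where `ϑ` is the formal adjoint of `∂̄`. -/
def thetaG (g : RMetric n M') (u : 𝓕 (q + 1)) : 𝓕 q :=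
  glueForm fun e y => theta (metB g e) (inChart e u) y

lemma IsSmoothForm.isT0 {u : 𝓕 q} (hu : IsSmoothForm u)
    (he : e ∈ 𝒰) {y : Cn n} (hy : y ∈ e.target) : IsT0 (inChart e u y) :=
  isT0_inChart he hy (hu.type0 _)

lemma theta_congr {B : Cn n → Bil n} {U V : Cn n → Form n (q + 1)}
    {y : Cn n} (h : U =ᶠ[𝓝 y] V) : theta B U y = theta B V y := by
  have h1 : divL B U y = divL B V y := by
    refine LinearMap.ext fun β => ?_
    rw [divL_apply, divL_apply]
    refine sum_congr rfl fun a _ => sum_congr rfl fun I _ => ?_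
    have h2 : (fun y => pairC (B y) (U y) I) =ᶠ[𝓝 y] fun y => pairC (B y) (V y) I := by
      filter_upwards [h] with z hz
      rw [hz]
    rw [h2.fderiv_eq]
  rw [theta, theta, h1]

lemma theta_const_smul {B : Cn n → Bil n} {U : Cn n → Form n (q + 1)}
    {y : Cn n} (hB : IsHerm (B y)) (c : ℂ) : theta B (fun y => c • U y) y = c • theta B U y := by
  refine ext_fInner hB (isT0_theta _ _) ((t0Sub n q).smul_mem c (isT0_theta _ _)) fun β hβ => ?_
  have h1 : ∀ I, ð (fun y => pairC (B y) (c • U y) I) y =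
      conj c • ð (fun y => pairC (B y) (U y) I) y := by
    intro I
    have h2 : (fun y => pairC (B y) (c • U y) I) = conj c • fun y => pairC (B y) (U y) I := by
      funext z
      simp only [pairC, Pi.smul_apply, smul_eq_mul, ContinuousAlternatingMap.smul_apply, map_mul,
        mul_sum]
      refine sum_congr rfl fun K _ => by ring
    rw [h2, fderiv_const_smul_field]
    rfl
  have h3 : divL B (fun y => c • U y) y β = conj c * divL B U y β := by
    simp only [divL_apply, h1, smul_apply, smul_eq_mul, mul_sum]
    refine sum_congr rfl fun a _ => sum_congr rfl fun I _ => by ring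
  rw [fInner_smul_right, theta, theta, fInner_riesz hB _ hβ, fInner_riesz hB _ hβ]
  simp only [LinearMap.smul_apply, smul_eq_mul, h3]
  ring

section

variable (hact : IsHolomorphicCircleAction n M')
include hact

lemma dbarL_actChart {u : 𝓕 q} (hu : IsSmoothForm u)
    (he : e ∈ 𝒰) (he' : e' ∈ 𝒰) (c : Circle) {y : Cn n} (hy : y ∈ actDom e e' c) :
    dbarL (ð (inChart e (actPullback c u)) y) =
      pullF (actChart e e' c) (fun z => dbarL (ð (inChart e' u) z)) y := by
  have hb := isBihol_actChart hact he he' c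
  have h1 : inChart e (actPullback c u) =ᶠ[𝓝 y] pullF (actChart e e' c) (inChart e' u) := by
    filter_upwards [hb.isOpen.mem_nhds hy] with z hz
    exact inChart_actPullback hact he he' c u hz
  rw [h1.fderiv_eq]
  exact hb.dbarL_pullF hy (fun z hz => hu.isT0 he' hz.1)
    ((hu.smooth e' he').mono inter_subset_left)

lemma theta_actChart {g : RMetric n M'} (hgJ : IsHermitianMetric g)
    (hginv : IsInvariantMetric g) {u : 𝓕 (q + 1)} (hu : IsSmoothForm u)
    (he : e ∈ 𝒰) (he' : e' ∈ 𝒰) (c : Circle) {y : Cn n} (hy : y ∈ actDom e e' c) :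
    theta (metB g e) (inChart e (actPullback c u)) y =
      pullF (actChart e e' c) (fun z => theta (metB g e') (inChart e' u) z) y := by
  have hb := isBihol_actChart hact he he' c
  have h1 : inChart e (actPullback c u) =ᶠ[𝓝 y] pullF (actChart e e' c) (inChart e' u) := by
    filter_upwards [hb.isOpen.mem_nhds hy] with z hz
    exact inChart_actPullback hact he he' c u hz
  rw [theta_congr h1]
  have hB := isMet_metB g hgJ he
  have hB' := isMet_metB g hgJ he'
  exact hb.theta_pullF
    ⟨hb.isOpen, hB.smooth.mono inter_subset_left, fun z hz => hB.herm z hz.1⟩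
    ⟨hb.isOpen', hB'.smooth.mono inter_subset_left, fun z hz => hB'.herm z hz.1⟩
    (fun z hz => metB_actChart g hact hginv he he' c hz)
    ((hu.smooth e' he').mono inter_subset_left) hy

lemma inChart_dbarG {u : 𝓕 q} (hu : IsSmoothForm u) (he : e ∈ 𝒰) {y : Cn n} (hy : y ∈ e.target) :
    inChart e (dbarG u) y = dbarL (ð (inChart e u) y) := by
  refine inChart_glueForm hact (fun e he e' he' y hy => ?_) he hy
  have h := dbarL_actChart hact hu he he' 1 hy
  rwa [actPullback_one] at h

lemma inChart_thetaG {g : RMetric n M'} (hgJ : IsHermitianMetric g)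
    (hginv : IsInvariantMetric g) {u : 𝓕 (q + 1)} (hu : IsSmoothForm u)
    (he : e ∈ 𝒰) {y : Cn n} (hy : y ∈ e.target) :
    inChart e (thetaG g u) y = theta (metB g e) (inChart e u) y := by
  refine inChart_glueForm hact (fun e he e' he' y hy => ?_) he hy
  have h := theta_actChart hact hgJ hginv hu he he' 1 hy
  rwa [actPullback_one] at h

omit hact in
lemma isSmoothForm_of_inChart {u : 𝓕 q} {F : OpenPartialHomeomorph M' (Cn n) → Cn n → Form n q}
    (h : ∀ e ∈ 𝒰, ∀ y ∈ e.target, inChart e u y = F e y)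
    (h0 : ∀ e ∈ 𝒰, ∀ y ∈ e.target, IsT0 (F e y))
    (hF : ∀ e ∈ 𝒰, SmoothOn (F e) e.target) : IsSmoothForm u := by
  refine ⟨fun x => ?_, fun e he => (hF e he).congr (h e he)⟩
  have hx := mem_chart_source (Cn n) x
  have ha := chart_mem_atlas (Cn n) x
  have h1 := isType0_of_inChart ha (mem_chart_target (Cn n) x) (u := u)
    (by rw [h _ ha _ (mem_chart_target (Cn n) x)]; exact h0 _ ha _ (mem_chart_target (Cn n) x))
  rwa [(chartAt (Cn n) x).left_inv hx] at h1

lemma isSmoothForm_dbarG {u : 𝓕 q} (hu : IsSmoothForm u) : IsSmoothForm (dbarG u) := by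
  refine isSmoothForm_of_inChart (fun e he y hy => inChart_dbarG hact hu he hy) ?_ ?_
  · intro e he y hy
    exact isT0_dbarL _ fun v => isT0_fderiv e.open_target (fun z hz => hu.isT0 he hz) hy
      (((hu.smooth e he).contDiffAt (e.open_target.mem_nhds hy)).differentiableAt (by simp)) v
  · intro e he
    have h2 : Smooth (dbarL (n := n) (q := q)) := ContinuousLinearMap.contDiff _
    exact h2.comp_contDiffOn ((hu.smooth e he).fderiv_of_isOpen e.open_target (m := ∞) (by simp))

lemma isSmoothForm_thetaG {g : RMetric n M'} (hgJ : IsHermitianMetric g)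
    (hginv : IsInvariantMetric g) {u : 𝓕 (q + 1)} (hu : IsSmoothForm u) :
    IsSmoothForm (thetaG g u) := by
  refine isSmoothForm_of_inChart (fun e he y hy => inChart_thetaG hact hgJ hginv hu he hy)
    (fun e he y hy => isT0_theta _ _) fun e he => ?_
  exact (isMet_metB g hgJ he).contDiffOn_theta (hu.smooth e he)

/-! ### Fourier components -/

lemma IsFourierForm.actPullback_exp {m : ℤ} {u : 𝓕 q} (hu : IsFourierForm m u) (θ : ℝ) (x : M') :
    actPullback (Circle.exp θ) u x = Complex.exp (î * m * θ) • u x := by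
  have hm : frm (actPullback (Circle.exp θ) u) x = Complex.exp (î * m * θ) • frm u x := by
    ext v
    rw [ContinuousAlternatingMap.smul_apply, smul_eq_mul]
    set k : ℝ → ℂ := fun t => frm (actPullback (Circle.exp t) u) x v with hk
    have hd : ∀ t, HasDerivAt k (î * m * k t) t := by
      intro t
      have h1 : HasDerivAt (fun s : ℝ => frm (actPullback (Circle.exp s) u) (Circle.exp t • x))
          ((î * (m : ℂ)) • frm u (Circle.exp t • x)) 0 := hu.lie (Circle.exp t • x)
      have h2 : HasDerivAt (fun s : ℝ => k (s + t)) (î * m * k t) 0 := by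
        have h3 := (evL
          (fun j => actD (Circle.exp t) x (v j))).hasFDerivAt.comp_hasDerivAt (0 : ℝ) h1
        refine HasDerivAt.congr_deriv (h3.congr_of_eventuallyEq
          (Eventually.of_forall fun s => ?_)) ?_
        · show frm (actPullback (Circle.exp (s + t)) u) x v = _
          rw [Circle.exp_add, frm_actPullback_mul hact]
          rfl
        · rfl
      have h4 := HasDerivAt.comp_sub_const t t (f := fun s => k (s + t)) (by simpa using h2)
      simpa using h4
    have hd2 : ∀ t, HasDerivAt (fun t : ℝ => Complex.exp (-(î * m * t)) * k t) 0 t := by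
      intro t
      have h1 : HasDerivAt (fun t : ℝ => -(î * m * (t : ℂ))) (-(î * m)) t := by
        simpa using ((ofRealCLM.hasDerivAt (x := t)).const_mul (î * m)).fun_neg
      refine (h1.cexp.mul (hd t)).congr_deriv ?_
      ring
    have h5 := is_const_of_deriv_eq_zero (fun t => (hd2 t).differentiableAt)
      (fun t => (hd2 t).deriv) θ 0
    have h6 : k 0 = frm u x v := by
      simp only [hk, Circle.exp_zero, actPullback_one]
    simp only [ofReal_zero, mul_zero, neg_zero, Complex.exp_zero, one_mul, h6] at h5
    rw [← h5, ← mul_assoc, ← Complex.exp_add]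
    simp [hk]
  exact hm

omit hact in
lemma isFourierForm_of_actPullback {m : ℤ} {u : 𝓕 q} (hu : IsSmoothForm u) (h : ∀ (θ : ℝ) (x : M'),
      actPullback (Circle.exp θ) u x = Complex.exp (î * m * θ) • u x) : IsFourierForm m u := by
  refine ⟨hu, fun x => ?_⟩
  have h1 : HasDerivAt (fun t : ℝ => Complex.exp (î * m * t)) (î * m) 0 := by
    have h2 : HasDerivAt (fun t : ℝ => î * m * (t : ℂ)) (î * m) 0 := by
      simpa using (ofRealCLM.hasDerivAt (x := (0 : ℝ))).const_mul (î * m)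
    simpa using h2.cexp
  have h3 : HasDerivAt (fun t : ℝ => Complex.exp (î * m * t) • frm u x)
    ((î * (m : ℂ)) • frm u x) 0 := HasDerivAt.smul_const (F := Form n q) h1 (frm u x)
  exact h3.congr_of_eventuallyEq (Eventually.of_forall fun t => h t x)

lemma isFourierForm_of_inChart {q p : ℕ} {m : ℤ} {u : 𝓕 q}
    (hu : IsFourierForm m u) {w : (x : M') → AltForm n p x} (hw : IsSmoothForm w)
    (P : OpenPartialHomeomorph M' (Cn n) → (Cn n → Form n q) → Cn n → Form n p)
    (h1 : ∀ e ∈ 𝒰, ∀ y ∈ e.target, inChart e w y = P e (inChart e u) y)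
    (h2 : ∀ e ∈ 𝒰, ∀ e' ∈ 𝒰, ∀ c, ∀ y ∈ actDom e e' c,
      P e (inChart e (actPullback c u)) y = pullF (actChart e e' c) (P e' (inChart e' u)) y)
    (h3 : ∀ e ∈ 𝒰, ∀ (c : ℂ), ∀ y ∈ e.target,
      P e (fun y => c • inChart e u y) y = c • P e (inChart e u) y) : IsFourierForm m w := by
  refine isFourierForm_of_actPullback hw fun θ x => ?_
  set c := Circle.exp θ
  set e := chartAt (Cn n) x
  set e' := chartAt (Cn n) (c • x)
  have he : e ∈ 𝒰 := chart_mem_atlas _ _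
  have he' : e' ∈ 𝒰 := chart_mem_atlas _ _
  have hy : e x ∈ actDom e e' c := by
    refine ⟨mem_chart_target _ x, ?_⟩
    show c • e.symm (e x) ∈ e'.source
    rw [e.left_inv (mem_chart_source _ x)]
    exact mem_chart_source _ (c • x)
  have h4 : inChart e (actPullback c w) (e x) =
      inChart e (fun x => (Complex.exp (î * m * θ) • w x : AltForm n p x)) (e x) := by
    have h5 : inChart e (actPullback c u) = fun y => Complex.exp (î * m * θ) • inChart e u y := by
      funext y
      have h6 : frm (actPullback c u) (e.symm y) =
        Complex.exp (î * m * θ) • frm u (e.symm y) := hu.actPullback_exp hact θ _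
      rw [inChart_eq, h6]
      rfl
    rw [inChart_actPullback hact he he' c _ hy, pullF, h1 e' he' (actChart e e' c (e x)) (e'.map_source hy.2)]
    refine (h2 e he e' he' c _ hy).symm.trans ?_
    rw [h5, h3 e he _ _ hy.1, ← h1 e he _ hy.1]
    rfl
  have h6 : frm (actPullback c w) (e.symm (e x)) =
    Complex.exp (î * m * θ) • frm w (e.symm (e x)) := eq_of_inChart he hy.1 h4
  rw [e.left_inv (mem_chart_source _ x)] at h6
  exact h6

lemma isFourierForm_dbarG {m : ℤ} {u : 𝓕 q}
    (hu : IsFourierForm m u) : IsFourierForm m (dbarG u) := by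
  refine isFourierForm_of_inChart hact hu (isSmoothForm_dbarG hact hu.toIsSmoothForm)
    (fun _ U y => dbarL (ð U y))
    (fun e he y hy => inChart_dbarG hact hu.toIsSmoothForm he hy)
    (fun e he e' he' c y hy => dbarL_actChart hact hu.toIsSmoothForm he he' c hy) ?_
  intro e he c y hy
  have h5 : DifferentiableAt ℝ (inChart e u) y := ((hu.smooth e he).contDiffAt
    (e.open_target.mem_nhds hy)).differentiableAt (by simp)
  rw [show ð (fun y => c • inChart e u y) y = c • ð (inChart e u) y from
      (HasFDerivAt.fun_const_smul (F := Form n q) h5.hasFDerivAt c).fderiv, dbarL_smul]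

lemma isFourierForm_thetaG {m : ℤ} {g : RMetric n M'} (hgJ : IsHermitianMetric g)
    (hginv : IsInvariantMetric g) {u : 𝓕 (q + 1)}
    (hu : IsFourierForm m u) : IsFourierForm m (thetaG g u) :=
  isFourierForm_of_inChart hact hu (isSmoothForm_thetaG hact hgJ hginv hu.toIsSmoothForm)
    (fun e U y => theta (metB g e) U y)
    (fun e he y hy => inChart_thetaG hact hgJ hginv hu.toIsSmoothForm he hy)
    (fun e he e' he' c y hy => theta_actChart hact hgJ hginv hu.toIsSmoothForm he he' c hy)
    fun e he c y hy => theta_const_smul ((isMet_metB g hgJ he).herm y hy) c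

omit hact in
lemma contDiffOn_comp_symm (he : e ∈ 𝒰) {f : M' → ℝ}
    (hf : ContMDiff 𝓘(ℝ, Cn n) 𝓘(ℝ, ℝ) ∞ f) : SmoothOn (fun y => f (e.symm y)) e.target := by
  rw [← contMDiffOn_iff_contDiffOn]
  exact hf.comp_contMDiffOn (contMDiffOn_chart_symm he)

omit hact in
lemma IsSmoothForm.smul {f : M' → ℝ} (hf : ContMDiff 𝓘(ℝ, Cn n) 𝓘(ℝ, ℝ) ∞ f)
    {u : 𝓕 q} (hu : IsSmoothForm u) : IsSmoothForm fun x => (f x • u x : AltForm n q x) := by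
  refine ⟨fun x v i => ?_, fun e he => ?_⟩
  · have h : ∀ w, w = Function.update v i (J n x (v i)) → frm u x w = -î * frm u x v := by
      rintro w rfl
      exact hu.type0 x v i
    have h2 : ∀ w, (f x • frm u x) w = (f x : ℂ) * frm u x w := fun w => by
      rw [ContinuousAlternatingMap.smul_apply, real_smul]
    refine (h2 _).trans ?_
    refine Eq.trans ?_ (congrArg (-î * ·) (h2 v)).symm
    rw [h _ rfl]
    ring
  · exact (contDiffOn_comp_symm he hf).smul (hu.smooth e he)

omit hact in
lemma IsSmoothForm.sub {u v : 𝓕 q} (hu : IsSmoothForm u)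
    (hv : IsSmoothForm v) : IsSmoothForm fun x => (u x - v x : AltForm n q x) := by
  refine ⟨fun x w i => ?_, fun e he => ?_⟩
  · have h : ∀ z, z = Function.update w i (J n x (w i)) → frm u x z = -î * frm u x w ∧
        frm v x z = -î * frm v x w := by
      rintro z rfl
      exact ⟨hu.type0 x w i, hv.type0 x w i⟩
    have h2 : ∀ w, (frm u x - frm v x) w = frm u x w - frm v x w := fun w => rfl
    refine (h2 _).trans ?_
    refine Eq.trans ?_ (congrArg (-î * ·) (h2 w)).symm
    rw [(h _ rfl).1, (h _ rfl).2]
    ring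
  · exact (hu.smooth e he).sub (hv.smooth e he)

lemma IsFourierForm.smul {m : ℤ} {f : M' → ℝ} (hf : ContMDiff 𝓘(ℝ, Cn n) 𝓘(ℝ, ℝ) ∞ f)
    (hfi : ∀ (c : Circle) x, f (c • x) = f x) {u : 𝓕 q}
    (hu : IsFourierForm m u) : IsFourierForm m fun x => (f x • u x : AltForm n q x) := by
  refine isFourierForm_of_actPullback (hu.toIsSmoothForm.smul hf) fun θ x => ?_
  have h : frm (actPullback (Circle.exp θ) u) x = Complex.exp (î * m * θ) • frm u x :=
    hu.actPullback_exp hact θ x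
  have h2 : frm (actPullback (Circle.exp θ) fun x => (f x • u x : AltForm n q x)) x =
      f (Circle.exp θ • x) • frm (actPullback (Circle.exp θ) u) x := rfl
  refine h2.trans ?_
  rw [hfi, h, smul_comm]
  rfl

lemma IsFourierForm.sub {m : ℤ} {u v : 𝓕 q} (hu : IsFourierForm m u) (hv : IsFourierForm m v) :
    IsFourierForm m fun x => (u x - v x : AltForm n q x) := by
  refine isFourierForm_of_actPullback (hu.toIsSmoothForm.sub hv.toIsSmoothForm) fun θ x => ?_
  have h : frm (actPullback (Circle.exp θ) u) x = Complex.exp (î * m * θ) • frm u x :=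
    hu.actPullback_exp hact θ x
  have h' : frm (actPullback (Circle.exp θ) v) x = Complex.exp (î * m * θ) • frm v x :=
    hv.actPullback_exp hact θ x
  have h2 : frm (actPullback (Circle.exp θ) fun x => (u x - v x : AltForm n q x)) x =
      frm (actPullback (Circle.exp θ) u) x - frm (actPullback (Circle.exp θ) v) x := rfl
  refine h2.trans ?_
  rw [h, h']
  refine ContinuousAlternatingMap.ext fun z => ?_
  exact (mul_sub _ (frm u x z) (frm v x z)).symm

end

/-! ### The Riemannian volume -/

section Volume

/-- The Riemannian volume in the coordinates given by `e`. -/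
def chM (g : RMetric n M') (e : OpenPartialHomeomorph M' (Cn n)) : Measure (Cn n) :=
  ((volume : Measure (Cn n)).restrict e.target).withDensity
    (fun y => ENNReal.ofReal (dens (metB g e y)))

lemma chartVolume_eq_map : chartVolume g e = (chM g e).map e.symm := rfl

omit [ChartedSpace (Cn n) M'] in
lemma measurableSet_target_inter {S : Set M'} (hS : MeasurableSet S) :
    MeasurableSet (e.target ∩ e.symm ⁻¹' S) := by
  have h1 : Measurable (e.target.restrict e.symm) :=
    (continuousOn_iff_continuous_restrict.1 e.continuousOn_symm).measurable
  have h2 := (e.open_target.measurableSet).subtype_image (h1 hS)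
  convert h2 using 1
  ext y
  simp [Set.restrict, and_comm]

lemma aemeasurable_symm : AEMeasurable e.symm (chM g e) :=
  (e.continuousOn_symm.aemeasurable e.open_target.measurableSet).mono_ac
    (withDensity_absolutelyContinuous _ _)

lemma chartVolume_apply {S : Set M'} (hS : MeasurableSet S) :
    chartVolume g e S = ∫⁻ y in e.target ∩ e.symm ⁻¹' S, ENNReal.ofReal (dens (metB g e y)) := by
  rw [chartVolume_eq_map, Measure.map_apply_of_aemeasurable aemeasurable_symm hS, chM,
    withDensity_apply', Measure.restrict_restrict' e.open_target.measurableSet, Set.inter_comm]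

lemma chartVolume_inter_source {S : Set M'} (hS : MeasurableSet S) :
    chartVolume g e (S ∩ e.source) = chartVolume g e S := by
  rw [chartVolume_apply hS, chartVolume_apply (hS.inter e.open_source.measurableSet)]
  congr 2
  ext y
  constructor
  · exact fun h => ⟨h.1, h.2.1⟩
  · exact fun h => ⟨h.1, h.2, e.map_target h.1⟩

lemma chartVolume_restrict_source : (chartVolume g e).restrict e.source = chartVolume g e := by
  ext S hS
  rw [Measure.restrict_apply hS, chartVolume_inter_source hS]

variable (hact : IsHolomorphicCircleAction n M') (hginv : IsInvariantMetric g)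
include hact hginv

lemma chartVolume_eq_of_subset (he : e ∈ 𝒰) (he' : e' ∈ 𝒰) {S : Set M'}
    (hS : MeasurableSet S) (h : S ⊆ e.source) (h' : S ⊆ e'.source) :
    chartVolume g e S = chartVolume g e' S := by
  have hb := isBihol_actChart hact he he' 1
  have hψ : ∀ y, actChart e e' 1 y = e' (e.symm y) := fun y => by rw [actChart, one_smul]
  have hsub : e.target ∩ e.symm ⁻¹' S ⊆ actDom e e' 1 := by
    refine fun y hy => ⟨hy.1, ?_⟩
    show (1 : Circle) • e.symm y ∈ e'.source
    rw [one_smul]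
    exact h' hy.2
  have himg : actChart e e' 1 '' (e.target ∩ e.symm ⁻¹' S) = e'.target ∩ e'.symm ⁻¹' S := by
    ext z
    constructor
    · rintro ⟨y, hy, rfl⟩
      rw [hψ]
      refine ⟨e'.map_source (h' hy.2), ?_⟩
      rw [mem_preimage, e'.left_inv (h' hy.2)]
      exact hy.2
    · intro hz
      refine ⟨e (e'.symm z), ⟨e.map_source (h hz.2), ?_⟩, ?_⟩
      · rw [mem_preimage, e.left_inv (h hz.2)]
        exact hz.2
      · rw [hψ, e.left_inv (h hz.2), e'.right_inv hz.1]
  rw [chartVolume_apply hS, chartVolume_apply hS, ← himg,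
    lintegral_image_eq_lintegral_abs_det_fderiv_mul _ (measurableSet_target_inter hS)
      (fun y hy => (hb.differentiableAt (hsub hy)).hasFDerivAt.hasFDerivWithinAt)
      (fun y hy z hz hyz => by
        rw [← hb.left_inv y (hsub hy), hyz, hb.left_inv z (hsub hz)])]
  refine setLIntegral_congr_fun (measurableSet_target_inter hS) fun y hy => ?_
  show ENNReal.ofReal (dens (metB g e y)) = _
  rw [metB_actChart g hact hginv he he' 1 (hsub hy), dens_pullB, ENNReal.ofReal_mul (abs_nonneg _)]

lemma vol_restrict_source (he : e ∈ 𝒰) : (vol g).restrict e.source = chartVolume g e := by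
  apply le_antisymm
  · cases isEmpty_or_nonempty M' with
    | inl h => exact (Subsingleton.elim _ _).le
    | inr h =>
      obtain ⟨s, hs, hcov⟩ := TopologicalSpace.countable_cover_nhds
        (fun x : M' => (chartAt (Cn n) x).open_source.mem_nhds (mem_chart_source (Cn n) x))
      have hsne : s.Nonempty := by
        rw [Set.nonempty_iff_ne_empty]
        rintro rfl
        simp only [Set.biUnion_empty] at hcov
        exact (Set.empty_ne_univ hcov).elim
      obtain ⟨p, rfl⟩ := hs.exists_eq_range hsne
      set f : ℕ → OpenPartialHomeomorph M' (Cn n) := fun k => chartAt (Cn n) (p k) with hf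
      have hfa : ∀ k, f k ∈ 𝒰 := fun k => chart_mem_atlas _ _
      have hU : ⋃ k, (f k).source = Set.univ := by
        rw [← hcov, Set.biUnion_range]
      set D := disjointed fun k => (f k).source with hD
      have hDm : ∀ k, MeasurableSet (D k) :=
        fun k => MeasurableSet.disjointed (fun j => (f j).open_source.measurableSet) k
      set ν : Measure M' := Measure.sum fun k => (chartVolume g (f k)).restrict (D k) with hν
      have hν1 : ∀ e₁ ∈ 𝒰, ∀ S, MeasurableSet S → S ⊆ e₁.source → ν S = chartVolume g e₁ S := by
        intro e₁ he₁ S hS hSe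
        have h1 : ∀ k, (chartVolume g (f k)).restrict (D k) S = (chartVolume g e₁) (S ∩ D k) := by
          intro k
          rw [Measure.restrict_apply hS]
          exact chartVolume_eq_of_subset hact hginv (hfa k) he₁ (hS.inter (hDm k))
            (inter_subset_right.trans (disjointed_subset _ k)) (inter_subset_left.trans hSe)
        rw [hν, Measure.sum_apply _ hS, tsum_congr h1, ← measure_iUnion, ← Set.inter_iUnion,
          hD, iUnion_disjointed, hU, Set.inter_univ]
        · intro i j hij
          exact ((disjoint_disjointed _ hij).mono inter_subset_right inter_subset_right)
        · exact fun k => hS.inter (hDm k)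
      have hν2 : ∀ e₁ ∈ 𝒰, ν.restrict e₁.source = chartVolume g e₁ := by
        intro e₁ he₁
        ext S hS
        rw [Measure.restrict_apply hS,
          hν1 e₁ he₁ _ (hS.inter e₁.open_source.measurableSet) inter_subset_right,
          chartVolume_inter_source hS]
      rw [← hν2 e he]
      refine Measure.restrict_mono le_rfl (sSup_le ?_)
      rintro _ ⟨e₁, he₁, rfl⟩
      rw [← hν2 e₁ he₁]
      exact Measure.restrict_le_self
  · rw [← chartVolume_restrict_source]
    exact Measure.restrict_mono le_rfl (le_sSup ⟨e, he, rfl⟩)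

lemma vol_restrict_inter_source (he : e ∈ 𝒰) {S : Set M'} (hS : MeasurableSet S) :
    (vol g).restrict (S ∩ e.source) = ((chM g e).restrict (e.symm ⁻¹' S)).map e.symm := by
  rw [← Measure.restrict_restrict hS, vol_restrict_source hact hginv he, chartVolume_eq_map]
  ext S' hS'
  have h1 : AEMeasurable e.symm ((chM g e).restrict (e.symm ⁻¹' S)) :=
    aemeasurable_symm.mono_measure Measure.restrict_le_self
  rw [Measure.restrict_apply hS', Measure.map_apply_of_aemeasurable h1 hS',
    Measure.map_apply_of_aemeasurable aemeasurable_symm (hS'.inter hS),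
    Measure.restrict_apply₀, Set.preimage_inter]
  exact h1.nullMeasurable hS'

omit hact hginv in
lemma chM_restrict {S : Set M'} (hS : MeasurableSet S) : (chM g e).restrict (e.symm ⁻¹' S) =
    (volume.restrict (e.target ∩ e.symm ⁻¹' S)).withDensity
      (fun y => ENNReal.ofReal (dens (metB g e y))) := by
  have h1 : (chM g e).restrict (e.symm ⁻¹' S) = (chM g e).restrict (e.target ∩ e.symm ⁻¹' S) := by
    refine Measure.restrict_congr_set ?_
    have h2 : ∀ᵐ y ∂(chM g e), y ∈ e.target :=
      (withDensity_absolutelyContinuous _ _) (ae_restrict_mem e.open_target.measurableSet)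
    filter_upwards [h2] with y hy
    exact propext ⟨fun h => ⟨hy, h⟩, fun h => h.2⟩
  rw [h1, chM, restrict_withDensity (measurableSet_target_inter hS),
    Measure.restrict_restrict (measurableSet_target_inter hS)]
  congr 2
  rw [Set.inter_right_comm, Set.inter_self]

omit hact hginv
  [ChartedSpace (Cn n) M'] in
lemma aemeasurable_chart {μ : Measure M'} {S : Set M'} :
    AEMeasurable e (μ.restrict (S ∩ e.source)) :=
  (e.continuousOn.aemeasurable e.open_source.measurableSet).mono_measure
    (Measure.restrict_mono inter_subset_right le_rfl)

lemma map_vol_restrict (he : e ∈ 𝒰) {S : Set M'} (hS : MeasurableSet S) :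
    ((vol g).restrict (S ∩ e.source)).map e =
      (volume.restrict (e.target ∩ e.symm ⁻¹' S)).withDensity
        (fun y => ENNReal.ofReal (dens (metB g e y))) := by
  have h0 := vol_restrict_inter_source hact hginv he hS
  have h1 : AEMeasurable e.symm ((chM g e).restrict (e.symm ⁻¹' S)) :=
    aemeasurable_symm.mono_measure Measure.restrict_le_self
  have h2 : AEMeasurable e (((chM g e).restrict (e.symm ⁻¹' S)).map e.symm) := by
    rw [← h0]
    exact aemeasurable_chart
  rw [h0, h2.map_map_of_aemeasurable h1, ← chM_restrict hS]
  have h3 : e ∘ e.symm =ᵐ[(chM g e).restrict (e.symm ⁻¹' S)] id := by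
    have h4 : ∀ᵐ y ∂(chM g e), y ∈ e.target :=
      (withDensity_absolutelyContinuous _ _) (ae_restrict_mem e.open_target.measurableSet)
    filter_upwards [ae_restrict_of_ae h4] with y hy
    exact e.right_inv hy
  rw [Measure.map_congr h3, Measure.map_id]

omit hact hginv
  [ChartedSpace (Cn n) M'] in
lemma comp_symm_comp_ae {μ : Measure M'} {E : Type*} {S : Set M'} (hS : MeasurableSet S)
    (h : M' → E) : (fun x => h (e.symm (e x))) =ᵐ[μ.restrict (S ∩ e.source)] h := by
  filter_upwards [ae_restrict_mem (hS.inter e.open_source.measurableSet)] with x hx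
  rw [e.left_inv hx.2]

section Transfer

variable {E : Type*} [NormedAddCommGroup E] [NormedSpace ℝ E] {h : M' → E} {S : Set M'}

lemma aesm_of_chart (he : e ∈ 𝒰) (hS : MeasurableSet S)
    (hm : AEStronglyMeasurable (fun y => h (e.symm y)) (volume.restrict (e.target ∩ e.symm ⁻¹' S))) :
    AEStronglyMeasurable h ((vol g).restrict (S ∩ e.source)) := by
  have h1 : AEStronglyMeasurable (fun y => h (e.symm y))
      (((vol g).restrict (S ∩ e.source)).map e) := by
    rw [map_vol_restrict hact hginv he hS]
    exact hm.mono_ac (withDensity_absolutelyContinuous _ _)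
  exact (h1.comp_aemeasurable aemeasurable_chart).congr (comp_symm_comp_ae hS h)

lemma ae_of_chart {P : M' → Prop} (he : e ∈ 𝒰) (hS : MeasurableSet S)
    (hP : ∀ᵐ y ∂(volume.restrict (e.target ∩ e.symm ⁻¹' S)), P (e.symm y)) :
    ∀ᵐ x ∂((vol g).restrict (S ∩ e.source)), P x := by
  have h1 : ∀ᵐ y ∂(((vol g).restrict (S ∩ e.source)).map e), P (e.symm y) := by
    rw [map_vol_restrict hact hginv he hS]
    exact (withDensity_absolutelyContinuous _ _) hP
  filter_upwards [ae_of_ae_map aemeasurable_chart h1,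
    ae_restrict_mem (hS.inter e.open_source.measurableSet)] with x hx hx2
  rwa [e.left_inv hx2.2] at hx

variable (hgJ : IsHermitianMetric g)
include hgJ

omit hact hginv in
lemma aemeasurable_dens (he : e ∈ 𝒰) (hS : MeasurableSet S) :
    AEMeasurable (fun y => ENNReal.ofReal (dens (metB g e y)))
      (volume.restrict (e.target ∩ e.symm ⁻¹' S)) :=
  (((isMet_metB g hgJ he).contDiffOn_dens.continuousOn.aemeasurable
    e.open_target.measurableSet).mono_measure
      (Measure.restrict_mono inter_subset_left le_rfl)).ennreal_ofReal

lemma integrable_chart_iff (he : e ∈ 𝒰) (hS : MeasurableSet S)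
    (hm : AEStronglyMeasurable (fun y => h (e.symm y)) (volume.restrict (e.target ∩ e.symm ⁻¹' S))) :
    IntegrableOn h (S ∩ e.source) (vol g) ↔
      IntegrableOn (fun y => dens (metB g e y) • h (e.symm y)) (e.target ∩ e.symm ⁻¹' S) := by
  have h1 : AEStronglyMeasurable (fun y => h (e.symm y))
      (((vol g).restrict (S ∩ e.source)).map e) := by
    rw [map_vol_restrict hact hginv he hS]
    exact hm.mono_ac (withDensity_absolutelyContinuous _ _)
  have h2 := integrable_map_measure h1 aemeasurable_chart
  rw [map_vol_restrict hact hginv he hS, integrable_withDensity_iff_integrable_smul₀'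
    (aemeasurable_dens hgJ he hS) (Eventually.of_forall fun y => ENNReal.ofReal_lt_top)] at h2
  rw [IntegrableOn, IntegrableOn, ← integrable_congr (comp_symm_comp_ae hS h)]
  refine h2.symm.trans (integrable_congr ?_)
  refine Eventually.of_forall fun y => ?_
  exact congrArg (· • h (e.symm y)) (ENNReal.toReal_ofReal (sqrt_nonneg _))

lemma setIntegral_chart (he : e ∈ 𝒰) (hS : MeasurableSet S)
    (hm : AEStronglyMeasurable (fun y => h (e.symm y)) (volume.restrict (e.target ∩ e.symm ⁻¹' S))) :
    ∫ x in S ∩ e.source, h x ∂(vol g) =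
      ∫ y in e.target ∩ e.symm ⁻¹' S, dens (metB g e y) • h (e.symm y) := by
  have h1 : AEStronglyMeasurable (fun y => h (e.symm y))
      (((vol g).restrict (S ∩ e.source)).map e) := by
    rw [map_vol_restrict hact hginv he hS]
    exact hm.mono_ac (withDensity_absolutelyContinuous _ _)
  have h2 := integral_map aemeasurable_chart h1
  rw [map_vol_restrict hact hginv he hS, integral_withDensity_eq_integral_toReal_smul₀
    (aemeasurable_dens hgJ he hS) (Eventually.of_forall fun y => ENNReal.ofReal_lt_top)] at h2
  rw [← integral_congr_ae (comp_symm_comp_ae hS h), ← h2]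
  refine integral_congr_ae (Eventually.of_forall fun y => ?_)
  exact congrArg (· • h (e.symm y)) (ENNReal.toReal_ofReal (sqrt_nonneg _))

lemma isLocallyFiniteMeasure_vol : IsLocallyFiniteMeasure (vol g) := by
  refine ⟨fun x => ?_⟩
  set e := chartAt (Cn n) x
  have he : e ∈ 𝒰 := chart_mem_atlas _ _
  have hx : x ∈ e.source := mem_chart_source _ x
  obtain ⟨K, hK, hxK, hKt⟩ := exists_compact_subset e.open_target (e.map_source hx)
  refine ⟨e.source ∩ e ⁻¹' (interior K), ?_, ?_⟩
  · exact (e.isOpen_inter_preimage isOpen_interior).mem_nhds ⟨hx, hxK⟩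
  · have hm : MeasurableSet (e.source ∩ e ⁻¹' (interior K)) :=
      (e.isOpen_inter_preimage isOpen_interior).measurableSet
    have h1 : vol g (e.source ∩ e ⁻¹' (interior K)) =
        chartVolume g e (e.source ∩ e ⁻¹' (interior K)) := by
      rw [← vol_restrict_source hact hginv he, Measure.restrict_apply hm, Set.inter_right_comm,
        Set.inter_self]
    rw [h1, chartVolume_apply hm]
    refine lt_of_le_of_lt (lintegral_mono_set (t := K) ?_) ?_
    · intro y hy
      have h2 := hy.2.2
      rw [mem_preimage, e.right_inv hy.1] at h2
      exact interior_subset h2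
    · have h3 : IntegrableOn (fun y => dens (metB g e y)) K :=
        ((isMet_metB g hgJ he).contDiffOn_dens.continuousOn.mono hKt).integrableOn_compact hK
      exact h3.lintegral_lt_top

end Transfer

end Volume

/-! ### Square integrable forms on an invariant domain -/

/-- A relatively compact domain with smooth invariant boundary, in a manifold with a holomorphic
circle action and an invariant Hermitian metric. -/
structure IsInvariantDomain (g : RMetric n M') (ρ : M' → ℝ) : Prop where
  act : IsHolomorphicCircleAction n M'
  defining : IsInvariantDefiningFunction n ρ
  cpt : IsCompact (closure (dom ρ))
  herm : IsHermitianMetric g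
  inv : IsInvariantMetric g

/-- The squared norm of the `L²` norm. -/
def nSq (g : RMetric n M') (ρ : M' → ℝ) (u : 𝓕 q) : ℝ :=
  ∫ x in dom ρ, formNormSq g (u x) ∂(vol g)

lemma isHerm_inn (hgJ : IsHermitianMetric g) (x : M') : IsHerm (inn g x) := by
  refine ⟨fun v w => ?_, fun v hv => ?_, fun v w => ?_⟩
  · exact (g.symm x v w :)
  · exact g.pos x v hv
  · exact hgJ x v w

lemma formInner_eq (u v : 𝓕 q) (x : M') :
    formInner g (u x) (v x) = fInner (gramB (inn g x)) (frm u x) (frm v x) := rfl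

lemma formNormSq_nonneg (hgJ : IsHermitianMetric g) (u : 𝓕 q) (x : M') :
    0 ≤ formNormSq g (u x) := fSq_nonneg (isHerm_inn hgJ x) _

lemma formNormSq_symm (he : e ∈ 𝒰) {y : Cn n} (hy : y ∈ e.target) (u : 𝓕 q) :
    formNormSq g (u (e.symm y)) = fSq (gramB (metB g e y)) (inChart e u y) :=
  congrArg Complex.re (formInner_symm g he hy u u)

lemma norm_fInner_le {B : Bil n} (hB : IsHerm B) (α β : Form n q) :
    ‖fInner (gramB B) α β‖ ≤ fSq (gramB B) α + fSq (gramB B) β := by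
  obtain ⟨c, hc, hcz⟩ : ∃ c : ℂ, ‖c‖ = 1 ∧ c * fInner (gramB B) α β = ‖fInner (gramB B) α β‖ := by
    rcases eq_or_ne (fInner (gramB B) α β) 0 with h0 | h0
    · exact ⟨1, by simp, by simp [h0]⟩
    · have h1 : (‖fInner (gramB B) α β‖ : ℂ) ≠ 0 := by exact_mod_cast norm_ne_zero_iff.2 h0
      refine ⟨‖fInner (gramB B) α β‖ / fInner (gramB B) α β, ?_, div_mul_cancel₀ _ h0⟩
      rw [norm_div, norm_real, norm_norm, div_self (norm_ne_zero_iff.2 h0)]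
  have h1 := two_mul_re_fInner_le hB (c • α) β
  rw [fInner_smul_left, hcz, fSq_smul, hc, ofReal_re] at h1
  have h2 := norm_nonneg (fInner (gramB B) α β)
  linarith

lemma continuous_formInner (hgJ : IsHermitianMetric g) {u v : 𝓕 q}
    (hu : IsSmoothForm u) (hv : IsSmoothForm v) : Continuous fun x => formInner g (u x) (v x) := by
  rw [continuous_iff_continuousAt]
  intro x
  set e := chartAt (Cn n) x
  have he : e ∈ 𝒰 := chart_mem_atlas _ _
  have hx : x ∈ e.source := mem_chart_source _ x
  have h1 : ContinuousAt (fun y => fInner (gramB (metB g e y)) (inChart e u y) (inChart e v y))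
      (e x) := (contDiffOn_fInner (isMet_metB g hgJ he) (hu.smooth e he)
        (hv.smooth e he)).continuousOn.continuousAt (e.open_target.mem_nhds (e.map_source hx))
  refine (h1.comp (e.continuousAt hx)).congr ?_
  filter_upwards [e.open_source.mem_nhds hx] with z hz
  rw [Function.comp_apply, ← formInner_symm g he (e.map_source hz), formInner_eq, e.left_inv hz]
  rfl

variable (n M') in
lemma exists_countable_charts : ∃ s : Set M', s.Countable ∧
    ∀ S : Set M', S = ⋃ p : s, S ∩ (chartAt (Cn n) (p : M')).source := by
  obtain ⟨s, hs, hcov⟩ := TopologicalSpace.countable_cover_nhds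
    (fun x : M' => (chartAt (Cn n) x).open_source.mem_nhds (mem_chart_source (Cn n) x))
  refine ⟨s, hs, fun S => ?_⟩
  rw [← Set.inter_iUnion, ← Set.biUnion_eq_iUnion s fun p _ => (chartAt (Cn n) p).source, hcov,
    Set.inter_univ]

lemma aesm_of_sources {μ : Measure M'} {h : M' → ℂ} {S : Set M'} (H : ∀ e ∈ 𝒰,
    AEStronglyMeasurable h (μ.restrict (S ∩ e.source))) :
    AEStronglyMeasurable h (μ.restrict S) := by
  obtain ⟨s, hs, hS⟩ := exists_countable_charts n M'
  have := hs.to_subtype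
  rw [hS S, aestronglyMeasurable_iUnion_iff]
  exact fun p => H _ (chart_mem_atlas _ _)

lemma ae_of_sources {μ : Measure M'} {P : M' → Prop} {S : Set M'} (H : ∀ e ∈ 𝒰,
    ∀ᵐ x ∂(μ.restrict (S ∩ e.source)), P x) : ∀ᵐ x ∂(μ.restrict S), P x := by
  obtain ⟨s, hs, hS⟩ := exists_countable_charts n M'
  have := hs.to_subtype
  rw [hS S, ae_restrict_iUnion_iff]
  exact fun p => H _ (chart_mem_atlas _ _)

namespace IsInvariantDomain

variable (H : IsInvariantDomain g ρ)
include H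

lemma continuous_rho : Continuous ρ := H.defining.smooth.continuous

lemma isOpen_dom : IsOpen (dom ρ) := isOpen_lt H.continuous_rho continuous_const

lemma isOpen_chart_dom : IsOpen (e.target ∩ e.symm ⁻¹' dom ρ) :=
  e.symm.isOpen_inter_preimage H.isOpen_dom

lemma measurableSet_dom : MeasurableSet (dom ρ) := H.isOpen_dom.measurableSet

lemma integrableOn_of_continuous {h : M' → ℂ} (hh : Continuous h) :
    IntegrableOn h (dom ρ) (vol g) := by
  have := isLocallyFiniteMeasure_vol H.act H.inv H.herm
  have h1 : IntegrableOn h (closure (dom ρ)) (vol g) := by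
    have h2 : vol g (closure (dom ρ)) < ⊤ := H.cpt.measure_lt_top
    obtain ⟨C, hC⟩ := H.cpt.exists_bound_of_continuousOn hh.continuousOn
    refine Measure.integrableOn_of_bounded (M := C) h2.ne hh.aestronglyMeasurable ?_
    filter_upwards [ae_restrict_mem isClosed_closure.measurableSet] with x hx using hC x hx
  exact h1.mono_set subset_closure

lemma aesm_chart_formInner {a b : 𝓕 q} (ha : IsL2Form g (dom ρ) a)
    (hb : IsL2Form g (dom ρ) b) (he : e ∈ 𝒰) :
    AEStronglyMeasurable (fun y => formInner g (a (e.symm y)) (b (e.symm y)))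
      (volume.restrict (e.target ∩ e.symm ⁻¹' dom ρ)) := by
  have h1 : AEStronglyMeasurable
      (fun y => fInner (gramB (metB g e y)) (inChart e a y) (inChart e b y))
      (volume.restrict (e.target ∩ e.symm ⁻¹' dom ρ)) := by
    have hev : ∀ {w : 𝓕 q} (_ : IsL2Form g (dom ρ) w) (v : Fin q → Cn n),
        AEStronglyMeasurable (fun y => inChart e w y v)
          (volume.restrict (e.target ∩ e.symm ⁻¹' dom ρ)) := fun hw v =>
      (evL v).continuous.comp_aestronglyMeasurable
        (hw.measurable e he)
    unfold fInner
    refine AEStronglyMeasurable.const_mul (Finset.aestronglyMeasurable_fun_sum _ fun I _ =>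
      Finset.aestronglyMeasurable_fun_sum _ fun K _ => AEStronglyMeasurable.mul ?_
        ((hev ha _).mul (continuous_conj.comp_aestronglyMeasurable (hev hb _)))) _
    have h2 : ContinuousOn (fun y => ((∏ s, (gramB (metB g e y))⁻¹ (I s) (K s) : ℝ) : ℂ))
        e.target := continuous_ofReal.comp_continuousOn
      (continuousOn_finsetProd _ fun s _ =>
        ((isMet_metB g H.herm he).contDiffOn_inv (I s) (K s)).continuousOn)
    exact (h2.mono inter_subset_left).aestronglyMeasurable
      (measurableSet_target_inter H.measurableSet_dom)
  refine h1.congr ?_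
  filter_upwards [ae_restrict_mem (measurableSet_target_inter H.measurableSet_dom)] with y hy
  exact (formInner_symm g he hy.1 a b).symm

lemma aesm_formInner {a b : 𝓕 q} (ha : IsL2Form g (dom ρ) a) (hb : IsL2Form g (dom ρ) b) :
    AEStronglyMeasurable (fun x => formInner g (a x) (b x)) ((vol g).restrict (dom ρ)) :=
  aesm_of_sources (n := n) fun _ he =>
    aesm_of_chart H.act H.inv he H.measurableSet_dom (H.aesm_chart_formInner ha hb he)

lemma integrableOn_formInner {a b : 𝓕 q} (ha : IsL2Form g (dom ρ) a) (hb : IsL2Form g (dom ρ) b) :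
    IntegrableOn (fun x => formInner g (a x) (b x)) (dom ρ) (vol g) :=
  Integrable.mono' (ha.integrable.add hb.integrable) (H.aesm_formInner ha hb)
    (ae_of_all _ fun x => norm_fInner_le (isHerm_inn H.herm x) (frm a x) (frm b x))

lemma isL2Form {u : 𝓕 q} (hu : IsSmoothForm u) : IsL2Form g (dom ρ) u :=
  ⟨fun x _ => hu.type0 x, fun e he => ((hu.smooth e he).continuousOn.mono
    inter_subset_left).aestronglyMeasurable (measurableSet_target_inter H.measurableSet_dom),
    (H.integrableOn_of_continuous (continuous_formInner H.herm hu hu)).re⟩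

lemma isL2Fourier {m : ℤ} {u : 𝓕 q} (hu : IsFourierForm m u) : IsL2Fourier g (dom ρ) m u := by
  refine ⟨H.isL2Form hu.toIsSmoothForm, fun ε hε => ⟨u, hu, ?_⟩⟩
  have h : ∀ x, formNormSq g (u x - u x) = 0 := by
    intro x
    have h1 : frm u x - frm u x = 0 := sub_self _
    have h2 : formNormSq g (u x - u x) = fSq (gramB (inn g x)) (frm u x - frm u x) := rfl
    rw [h2, h1, fSq]
    simp [fInner]
  simp only [l2Norm, h, integral_zero, Real.sqrt_zero]
  exact hε

lemma isWeakDbar {u : 𝓕 q} (hu : IsSmoothForm u) : IsWeakDbar (dom ρ) u (dbarG u) := by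
  intro e he φ hφ hφc hφs v
  have hφt : tsupport φ ⊆ e.target := hφs.trans inter_subset_left
  have hd : ∀ y ∈ e.target, DifferentiableAt ℝ (inChart e u) y := fun y hy =>
    ((hu.smooth e he).contDiffAt (e.open_target.mem_nhds hy)).differentiableAt (by simp)
  have hk : ∀ w : Fin q → Cn n, SmoothOn (fun y => inChart e u y w) e.target := fun w =>
    contDiffOn_form_apply_const (hu.smooth e he) w
  have hk' : ∀ (w : Fin q → Cn n) (z : Cn n) (y : Cn n), y ∈ e.target →
      ð (fun y => inChart e u y w) y z = ð (inChart e u) y z w := by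
    intro w z y hy
    have h1 := (evL w).hasFDerivAt.comp y
      (hd y hy).hasFDerivAt
    exact congrArg (fun L : Cn n →L[ℝ] ℂ => L z) h1.fderiv
  have hφ0 : ∀ y, y ∉ e.target → φ y = 0 ∧ ð φ y = 0 := fun y hy =>
    ⟨image_eq_zero_of_notMem_tsupport fun h => hy (hφt h),
      image_eq_zero_of_notMem_tsupport fun h => hy (hφt (tsupport_fderiv_subset ℝ h))⟩
  have hsm : ∀ w : Fin q → Cn n, Smooth fun y => inChart e u y w * φ y := fun w =>
    contDiff_of_tsupport e.open_target ((hk w).mul hφ.contDiffOn)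
      ((tsupport_mul_subset_right).trans hφt)
  have hc : ∀ w : Fin q → Cn n, HasCompactSupport fun y => inChart e u y w * φ y := fun w =>
    hφc.mul_left
  have i1 : ∀ (w : Fin q → Cn n) (z : Cn n), Integrable fun y => ð (inChart e u) y z w * φ y := by
    intro w z
    have h1 : SmoothOn (fun y => ð (inChart e u) y z) e.target :=
      ((hu.smooth e he).fderiv_of_isOpen e.open_target (m := ∞) (by simp)).clm_apply
        contDiffOn_const
    exact (contDiff_of_tsupport e.open_target ((contDiffOn_form_apply_const h1 w).mul
      hφ.contDiffOn) (tsupport_mul_subset_right.trans hφt)).continuous.integrable_of_hasCompactSupport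
        hφc.mul_left
  have i2 : ∀ (w : Fin q → Cn n) (z : Cn n), Integrable fun y => inChart e u y w * ð φ y z := by
    intro w z
    have h1 : Smooth fun y => ð φ y z :=
      (hφ.fderiv_right (m := ∞) (by simp)).clm_apply contDiff_const
    have h2 : tsupport (fun y => ð φ y z) ⊆ e.target :=
      (tsupport_fderiv_apply_subset ℝ z).trans hφt
    exact (contDiff_of_tsupport e.open_target ((hk w).mul h1.contDiffOn)
      (tsupport_mul_subset_right.trans h2)).continuous.integrable_of_hasCompactSupport
        (hφc.fderiv_apply ℝ z).mul_left
  have hparts : ∀ (w : Fin q → Cn n) (z : Cn n), ∫ y, ð (inChart e u) y z w * φ y =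
      -∫ y, inChart e u y w * ð φ y z := by
    intro w z
    have h0 := integral_fderiv_apply_eq_zero ((hsm w).of_le (by simp)) (hc w) z
    have h1 : ∀ y, ð (fun y => inChart e u y w * φ y) y z =
        ð (inChart e u) y z w * φ y + inChart e u y w * ð φ y z := by
      intro y
      by_cases hy : y ∈ e.target
      · have h2 := (((hk w).contDiffAt (e.open_target.mem_nhds hy)).differentiableAt
          (by simp)).hasFDerivAt.fun_mul (hφ.differentiable (by simp) y).hasFDerivAt
        rw [h2.fderiv]
        simp only [add_apply, smul_apply, smul_eq_mul, hk' w z y hy]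
        ring
      · have h2 : ð (fun y => inChart e u y w * φ y) y = 0 :=
          image_eq_zero_of_notMem_tsupport fun h => hy
            (((tsupport_fderiv_subset ℝ).trans (tsupport_mul_subset_right.trans hφt)) h)
        simp [h2, (hφ0 y hy).1, (hφ0 y hy).2]
    simp only [h1] at h0
    rw [integral_add (i1 w z) (i2 w z)] at h0
    exact eq_neg_of_add_eq_zero_left h0
  have e1 : ∀ y, inChart e (dbarG u) y v * φ y = ∑ j : Fin (q + 1), (-1 : ℂ) ^ (j : ℕ) * (1 / 2) *
      (ð (inChart e u) y (v j) (j.removeNth v) * φ y + î *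
        (ð (inChart e u) y (î • v j) (j.removeNth v) * φ y)) := by
    intro y
    by_cases hy : y ∈ e.target
    · rw [inChart_dbarG H.act hu he hy, dbarL_apply, sum_mul]
      refine sum_congr rfl fun j _ => ?_
      ring
    · simp [(hφ0 y hy).1]
  simp only [e1]
  rw [integral_finsetSum]
  · rw [← sum_neg_distrib]
    refine sum_congr rfl fun j _ => ?_
    rw [integral_const_mul, integral_add (i1 _ _) ((i1 _ _).const_mul _), integral_const_mul,
      hparts, hparts, ← mul_neg, mul_assoc]
    congr 1
    have e2 : ∀ y, inChart e u y (j.removeNth v) * dbarDir φ y (v j) =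
        (1 / 2) * (inChart e u y (j.removeNth v) * ð φ y (v j) + î *
          (inChart e u y (j.removeNth v) * ð φ y (î • v j))) := by
      intro y
      rw [dbarDir]
      ring
    simp only [e2]
    rw [integral_const_mul, integral_add (i2 _ _) ((i2 _ _).const_mul _), integral_const_mul]
    ring
  · exact fun j _ => ((i1 _ _).add ((i1 _ _).const_mul _)).const_mul _

lemma dbarGraph {m : ℤ} {u : 𝓕 q} (hu : IsFourierForm m u) : DbarGraph g (dom ρ) m u (dbarG u) :=
  ⟨H.isL2Fourier hu, H.isL2Fourier (isFourierForm_dbarG H.act hu), H.isWeakDbar hu.toIsSmoothForm⟩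

end IsInvariantDomain

/-! ### Duality on an invariant domain -/

lemma fInner_real_smul_left (G : Matrix (Fin n × Fin 2) (Fin n × Fin 2) ℝ) (c : ℝ)
    (α β : Form n q) : fInner G (c • α) β = c * fInner G α β := by
  rw [show c • α = (c : ℂ) • α from ContinuousAlternatingMap.ext fun v => real_smul,
    fInner_smul_left]

lemma symb_smul_left (c : ℝ) (ξ : Cn n →L[ℝ] ℝ) (β : Form n q) : symb (c • ξ) β = c • symb ξ β := by
  rw [symb_apply, symb_apply, ← map_smul]
  congr 1
  ext v : 1
  exact mul_smul c (ξ v) β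

lemma exists_dens_bounds (hgJ : IsHermitianMetric g) (he : e ∈ 𝒰) {K : Set (Cn n)}
    (hK : IsCompact K) (hKt : K ⊆ e.target) :
    ∃ D > 0, ∀ y ∈ K, 1 ≤ D * dens (metB g e y) ∧ dens (metB g e y) ≤ D := by
  have hB := isMet_metB g hgJ he
  have hc := hB.contDiffOn_dens.continuousOn.mono hKt
  have hp : ∀ y ∈ K, 0 < dens (metB g e y) := fun y hy => (hB.herm y (hKt hy)).dens_pos
  obtain ⟨C₁, h1⟩ := hK.exists_bound_of_continuousOn hc
  obtain ⟨C₂, h2⟩ := hK.exists_bound_of_continuousOn (hc.inv₀ fun y hy => (hp y hy).ne')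
  refine ⟨max 1 (max C₁ C₂), by positivity, fun y hy => ⟨?_, ?_⟩⟩
  · have h3 := (le_abs_self _).trans (h2 y hy)
    calc (1 : ℝ) = (dens (metB g e y))⁻¹ * dens (metB g e y) := (inv_mul_cancel₀ (hp y hy).ne').symm
      _ ≤ _ := mul_le_mul_of_nonneg_right (h3.trans ((le_max_right _ _).trans (le_max_right _ _)))
        (hp y hy).le
  · exact ((le_abs_self _).trans (h1 y hy)).trans ((le_max_left _ _).trans (le_max_right _ _))

lemma dbarG_eq_zero (hact : IsHolomorphicCircleAction n M') {w : 𝓕 q}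
    (hw : IsSmoothForm w) {x : M'} (h : ∀ᶠ z in 𝓝 x, frm w z = 0) : frm (dbarG w) x = 0 := by
  set e := chartAt (Cn n) x
  have he : e ∈ 𝒰 := chart_mem_atlas _ _
  have hx : x ∈ e.source := mem_chart_source _ x
  have h1 : inChart e w =ᶠ[𝓝 (e x)] fun _ => 0 := by
    have h2 : Tendsto e.symm (𝓝 (e x)) (𝓝 x) := by
      have := e.symm.continuousAt (x := e x) (e.map_source hx)
      rwa [ContinuousAt, e.left_inv hx] at this
    filter_upwards [h2.eventually h] with y hy
    rw [inChart_eq, hy]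
    rfl
  have h3 : inChart e (dbarG w) (e x) = inChart e (fun x => (0 : AltForm n (q + 1) x)) (e x) := by
    rw [inChart_dbarG hact hw he (e.map_source hx), h1.fderiv_eq, fderiv_const_apply, map_zero]
    rfl
  have h4 : frm (dbarG w) (e.symm (e x)) = 0 := eq_of_inChart he (e.map_source hx) h3
  rwa [e.left_inv hx] at h4

lemma fInner_zero_left (G : Matrix (Fin n × Fin 2) (Fin n × Fin 2) ℝ) (β : Form n q) :
    fInner G 0 β = 0 := by
  simp [fInner]

variable (g ρ) in
/-- The form `ρϑu - ϑ(ρu)`, that is, the contraction of `u` with `∂ρ`. -/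
def bdryForm (u : 𝓕 (q + 1)) (x : M') : AltForm n q x :=
  ρ x • thetaG g u x - thetaG g (fun x => (ρ x • u x : AltForm n (q + 1) x)) x

namespace IsInvariantDomain

variable (H : IsInvariantDomain g ρ)
include H

lemma exists_setIntegral_chart_le (he : e ∈ 𝒰) {K : Set (Cn n)} (hK : IsCompact K)
    (hKt : K ⊆ e.target) : ∃ D > 0, ∀ h : M' → ℝ, (∀ x, 0 ≤ h x) → IntegrableOn h (dom ρ) (vol g) →
      AEStronglyMeasurable (fun y => h (e.symm y)) (volume.restrict (e.target ∩ e.symm ⁻¹' dom ρ)) →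
      IntegrableOn (fun y => h (e.symm y)) (K ∩ e.symm ⁻¹' dom ρ) ∧
      ∫ y in K ∩ e.symm ⁻¹' dom ρ, h (e.symm y) ≤ D * ∫ x in dom ρ, h x ∂(vol g) := by
  obtain ⟨D, hD, hDb⟩ := exists_dens_bounds H.herm he hK hKt
  refine ⟨D, hD, fun h h0 hh hm => ?_⟩
  have hsub : K ∩ e.symm ⁻¹' dom ρ ⊆ e.target ∩ e.symm ⁻¹' dom ρ := fun y hy => ⟨hKt hy.1, hy.2⟩
  have hKm : MeasurableSet (K ∩ e.symm ⁻¹' dom ρ) := by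
    have : K ∩ e.symm ⁻¹' dom ρ = K ∩ (e.target ∩ e.symm ⁻¹' dom ρ) := by
      rw [← Set.inter_assoc, Set.inter_eq_left.2 hKt]
    rw [this]
    exact hK.measurableSet.inter (measurableSet_target_inter H.measurableSet_dom)
  have h1 := (integrable_chart_iff H.act H.inv H.herm he H.measurableSet_dom hm).1
    (hh.mono_set inter_subset_left)
  have h2 : ∀ y ∈ K ∩ e.symm ⁻¹' dom ρ,
      h (e.symm y) ≤ D * (dens (metB g e y) • h (e.symm y)) := fun y hy => by
    rw [smul_eq_mul, ← mul_assoc]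
    exact le_mul_of_one_le_left (h0 _) (hDb y hy.1).1
  have h3 : IntegrableOn (fun y => h (e.symm y)) (K ∩ e.symm ⁻¹' dom ρ) := by
    refine Integrable.mono' ((h1.mono_set hsub).const_mul D)
      (hm.mono_measure (Measure.restrict_mono hsub le_rfl)) ?_
    filter_upwards [ae_restrict_mem hKm] with y hy
    rw [norm_of_nonneg (h0 _)]
    exact h2 y hy
  refine ⟨h3, ?_⟩
  calc ∫ y in K ∩ e.symm ⁻¹' dom ρ, h (e.symm y)
      ≤ ∫ y in K ∩ e.symm ⁻¹' dom ρ, D * (dens (metB g e y) • h (e.symm y)) :=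
        setIntegral_mono_on h3 ((h1.mono_set hsub).const_mul D) hKm h2
    _ = D * ∫ y in K ∩ e.symm ⁻¹' dom ρ, dens (metB g e y) • h (e.symm y) := integral_const_mul _ _
    _ ≤ D * ∫ y in e.target ∩ e.symm ⁻¹' dom ρ, dens (metB g e y) • h (e.symm y) := by
        refine mul_le_mul_of_nonneg_left (setIntegral_mono_set h1 (ae_of_all _ fun y =>
          mul_nonneg (sqrt_nonneg _) (h0 _)) (Eventually.of_forall hsub)) hD.le
    _ = D * ∫ x in dom ρ ∩ e.source, h x ∂(vol g) := by
        rw [setIntegral_chart H.act H.inv H.herm he H.measurableSet_dom hm]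
    _ ≤ _ := mul_le_mul_of_nonneg_left (setIntegral_mono_set hh (ae_of_all _ h0)
        (Eventually.of_forall inter_subset_left)) hD.le

lemma ae_eq_dbarG {u : 𝓕 q} (hu : IsSmoothForm u)
    {a : 𝓕 (q + 1)} (ha : IsL2Form g (dom ρ) a) (hw : IsWeakDbar (dom ρ) u a) :
    ∀ᵐ x ∂((vol g).restrict (dom ρ)), frm a x = frm (dbarG u) x := by
  refine ae_of_sources (n := n) fun e he => ae_of_chart H.act H.inv he H.measurableSet_dom ?_
  have hs := isSmoothForm_dbarG H.act hu
  set Ω := e.target ∩ e.symm ⁻¹' dom ρ with hΩ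
  have hΩo : IsOpen Ω := H.isOpen_chart_dom
  have hm := (ha.measurable e he)
  have hev : ∀ v, AEStronglyMeasurable (fun y => inChart e a y v) (volume.restrict Ω) := fun v =>
    (evL v).continuous.comp_aestronglyMeasurable hm
  have hloc : ∀ v, LocallyIntegrableOn (fun y => inChart e a y v) Ω := by
    intro v
    rw [locallyIntegrableOn_iff hΩo.isLocallyClosed]
    intro K hKΩ hK
    obtain ⟨D, hD, hD1⟩ := H.exists_setIntegral_chart_le he hK (hKΩ.trans inter_subset_left)
    have h1 := (hD1 (fun x => formNormSq g (a x)) (formNormSq_nonneg H.herm a) ha.integrable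
      (continuous_re.comp_aestronglyMeasurable (H.aesm_chart_formInner ha ha he))).1
    rw [Set.inter_eq_left.2 (hKΩ.trans inter_subset_right)] at h1
    obtain ⟨C, hC0, hC⟩ := (isMet_metB g H.herm he).exists_fSq_bounds hK
      (hKΩ.trans inter_subset_left) (q + 1)
    have h2 : IntegrableOn (fun y => (1 + C * formNormSq g (a (e.symm y))) * ∏ i, ‖v i‖) K :=
      ((integrableOn_const hK.measure_lt_top.ne).add (h1.const_mul C)).mul_const _
    refine Integrable.mono' h2 ((hev v).mono_measure (Measure.restrict_mono hKΩ le_rfl)) ?_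
    filter_upwards [ae_restrict_mem hK.measurableSet] with y hy
    refine (ContinuousAlternatingMap.le_opNorm _ _).trans ?_
    refine mul_le_mul_of_nonneg_right ?_ (Finset.prod_nonneg fun i _ => norm_nonneg _)
    rw [formNormSq_symm he (hKΩ hy).1]
    have h3 := (hC y hy (inChart e a y)).1
    nlinarith [sq_nonneg (‖inChart e a y‖ - 1)]
  have hae : ∀ J : Fin (q + 1) → Fin n × Fin 2, ∀ᵐ y ∂(volume : Measure (Cn n)), y ∈ Ω →
      inChart e a y (fun s => rb n (J s)) - inChart e (dbarG u) y (fun s => rb n (J s)) = 0 := by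
    intro J
    set v : Fin (q + 1) → Cn n := fun s => rb n (J s)
    have hloc2 : LocallyIntegrableOn (fun y => inChart e (dbarG u) y v) Ω :=
      (contDiffOn_form_apply_const (hs.smooth e he) v).continuousOn.mono
        inter_subset_left |>.locallyIntegrableOn hΩo.measurableSet
    refine hΩo.ae_eq_zero_of_integral_contDiff_smul_eq_zero ((hloc v).sub hloc2) ?_
    intro k hk hkc hks
    have hkC : Smooth fun y => (k y : ℂ) := ofRealCLM.contDiff.comp hk
    have hkc' : HasCompactSupport fun y => (k y : ℂ) := hkc.comp_left (g := Complex.ofReal) rfl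
    have hks' : tsupport (fun y => (k y : ℂ)) ⊆ Ω :=
      (tsupport_comp_subset (g := Complex.ofReal) rfl k).trans hks
    have h1 := (hw e he _ hkC hkc' hks' v).trans (H.isWeakDbar hu e he _ hkC hkc' hks' v).symm
    have i : ∀ f : Cn n → ℂ, LocallyIntegrableOn f Ω → Integrable fun y => f y * (k y : ℂ) := by
      intro f hf
      have h2 := (hf.integrableOn_compact_subset hks hkc).mul_continuousOn
        hkC.continuous.continuousOn hkc
      refine (integrableOn_iff_integrable_of_support_subset fun y hy => ?_).1 h2
      by_contra h3
      exact hy (by simp [image_eq_zero_of_notMem_tsupport h3])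
    rw [← sub_eq_zero, ← integral_sub (i _ (hloc v)) (i _ hloc2)] at h1
    rw [← h1]
    refine integral_congr_ae (ae_of_all _ fun y => ?_)
    show k y • (_ - _) = _
    rw [real_smul]
    ring
  rw [ae_restrict_iff' hΩo.measurableSet]
  filter_upwards [ae_all_iff.2 hae] with y hy hyΩ
  refine eq_of_inChart he hyΩ.1 (u := a) (v := dbarG u) ?_
  exact evRb_injective n (q + 1) (funext fun J => sub_eq_zero.1 (hy J hyΩ))

lemma integral_dbarG_of_compact {w : 𝓕 q} (hw : IsSmoothForm w)
    {u : 𝓕 (q + 1)} (hu : IsSmoothForm u) (he : e ∈ 𝒰)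
    {K : Set M'} (hK : IsCompact K) (hKe : K ⊆ e.source) (hKd : K ⊆ dom ρ)
    (h0 : ∀ x, x ∉ K → frm w x = 0) : ∫ x in dom ρ, formInner g (dbarG w x) (u x) ∂(vol g) =
      ∫ x in dom ρ, formInner g (w x) (thetaG g u x) ∂(vol g) := by
  have hB := isMet_metB g H.herm he
  have hdw := isSmoothForm_dbarG H.act hw
  have hθ := isSmoothForm_thetaG H.act H.herm H.inv hu
  have hd0 : ∀ x, x ∉ K → frm (dbarG w) x = 0 := fun x hx =>
    dbarG_eq_zero H.act hw (by
      filter_upwards [hK.isClosed.isOpen_compl.mem_nhds hx] with z hz using h0 z hz)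
  have hred : ∀ {p : ℕ} (α β : (x : M') → AltForm n p x), IsSmoothForm α → IsSmoothForm β →
      (∀ x, x ∉ K → frm α x = 0) → ∫ x in dom ρ, formInner g (α x) (β x) ∂(vol g) =
        ∫ y in e.target ∩ e.symm ⁻¹' dom ρ,
          (dens (metB g e y) : ℂ) * fInner (gramB (metB g e y)) (inChart e α y) (inChart e β y) := by
    intro p α β hα hβ hα0
    have h1 : ∫ x in dom ρ, formInner g (α x) (β x) ∂(vol g) =
        ∫ x in dom ρ ∩ e.source, formInner g (α x) (β x) ∂(vol g) := by
      refine setIntegral_eq_of_subset_of_forall_sdiff_eq_zero H.measurableSet_dom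
        inter_subset_left fun x hx => ?_
      rw [formInner_eq, hα0 x fun h => hx.2 ⟨hx.1, hKe h⟩, fInner_zero_left]
    rw [h1, setIntegral_chart H.act H.inv H.herm he H.measurableSet_dom
      (H.aesm_chart_formInner (H.isL2Form hα) (H.isL2Form hβ) he)]
    refine setIntegral_congr_fun (measurableSet_target_inter H.measurableSet_dom) fun y hy => ?_
    show dens (metB g e y) • formInner g (α (e.symm y)) (β (e.symm y)) = _
    rw [formInner_symm g he hy.1, real_smul]
  set K' := e '' K with hK'
  have hK'c : IsCompact K' := hK.image_of_continuousOn (e.continuousOn.mono hKe)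
  have hK't : K' ⊆ e.target := by
    rintro _ ⟨x, hx, rfl⟩
    exact e.map_source (hKe hx)
  have hK'd : K' ⊆ e.target ∩ e.symm ⁻¹' dom ρ := by
    rintro _ ⟨x, hx, rfl⟩
    refine ⟨e.map_source (hKe hx), ?_⟩
    rw [mem_preimage, e.left_inv (hKe hx)]
    exact hKd hx
  set W : Cn n → Form n q := e.target.indicator (inChart e w) with hW
  have hWin : ∀ y ∈ e.target, W y = inChart e w y := fun y hy => indicator_of_mem hy _
  have hW0 : ∀ y, y ∉ K' → W y = 0 := by
    intro y hy
    by_cases hyt : y ∈ e.target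
    · rw [hWin y hyt, inChart_eq, h0 _ fun h => hy ⟨_, h, e.right_inv hyt⟩]
      rfl
    · exact indicator_of_notMem hyt _
  have hWK : tsupport W ⊆ K' :=
    closure_minimal (fun y hy => by_contra fun h => hy (hW0 y h)) hK'c.isClosed
  have hWs : Smooth W :=
    contDiff_of_tsupport e.open_target ((hw.smooth e he).congr hWin) (hWK.trans hK't)
  have hWc : HasCompactSupport W := hK'c.of_isClosed_subset (isClosed_tsupport _) hWK
  have hWT : ∀ y, IsT0 (W y) := by
    intro y
    by_cases hyt : y ∈ e.target
    · rw [hWin y hyt]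
      exact hw.isT0 he hyt
    · rw [show W y = 0 from indicator_of_notMem hyt _]
      exact (t0Sub n q).zero_mem
  have hmain := hB.integral_theta (hu.smooth e he) hWs hWc (hWK.trans hK't) hWT
  rw [hred _ _ hdw hu hd0, hred _ _ hw hθ h0]
  have hm := measurableSet_target_inter (e := e) H.measurableSet_dom
  have e1 : ∫ y in e.target ∩ e.symm ⁻¹' dom ρ, (dens (metB g e y) : ℂ) *
      fInner (gramB (metB g e y)) (inChart e (dbarG w) y) (inChart e u y) =
      ∫ y, (dens (metB g e y) : ℂ) *
        fInner (gramB (metB g e y)) (dbarL (ð W y)) (inChart e u y) := by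
    refine Eq.trans ?_ (setIntegral_eq_integral_of_forall_compl_eq_zero
      (s := e.target ∩ e.symm ⁻¹' dom ρ) ?_)
    · refine setIntegral_congr_fun hm fun y hy => ?_
      have h1 : W =ᶠ[𝓝 y] inChart e w := by
        filter_upwards [e.open_target.mem_nhds hy.1] with z hz using hWin z hz
      show _ * fInner _ (inChart e (dbarG w) y) _ = _
      rw [inChart_dbarG H.act hw he hy.1, h1.fderiv_eq]
    · intro y hy
      have h1 : ð W y = 0 := image_eq_zero_of_notMem_tsupport fun h =>
        hy (hK'd (hWK (tsupport_fderiv_subset ℝ h)))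
      rw [h1, map_zero, fInner_zero_left, mul_zero]
  have e2 : ∫ y in e.target ∩ e.symm ⁻¹' dom ρ, (dens (metB g e y) : ℂ) *
      fInner (gramB (metB g e y)) (inChart e w y) (inChart e (thetaG g u) y) =
      ∫ y, (dens (metB g e y) : ℂ) *
        fInner (gramB (metB g e y)) (W y) (theta (metB g e) (inChart e u) y) := by
    refine Eq.trans ?_ (setIntegral_eq_integral_of_forall_compl_eq_zero
      (s := e.target ∩ e.symm ⁻¹' dom ρ) ?_)
    · refine setIntegral_congr_fun hm fun y hy => ?_
      show _ * fInner _ (inChart e w y) (inChart e (thetaG g u) y) = _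
      rw [inChart_thetaG H.act H.herm H.inv hu he hy.1, hWin y hy.1]
    · intro y hy
      rw [hW0 y fun h => hy (hK'd h), fInner_zero_left, mul_zero]
  rw [e1, e2, hmain]

lemma integral_dbarG (hec : ∀ i, ec i ∈ 𝒰) (hχ : χ.IsSubordinate fun i => (ec i).source) {v : 𝓕 q}
    (hv : IsSmoothForm v) {u : 𝓕 (q + 1)} (hu : IsSmoothForm u) {δ : ℝ}
    (hδ : 0 < δ) (h0 : ∀ x, -δ < ρ x → frm v x = 0) :
    l2Inner g (dom ρ) (dbarG v) u = l2Inner g (dom ρ) v (thetaG g u) := by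
  have hθ := isSmoothForm_thetaG H.act H.herm H.inv hu
  set w : ι → 𝓕 q := fun i x => χ i x • v x with hw
  have hws : ∀ i, IsSmoothForm (w i) := fun i => hv.smul (χ i).contMDiff
  have hsum : ∀ x, frm v x = ∑ i, frm (w i) x := by
    intro x
    by_cases hx : -δ < ρ x
    · have h1 : ∀ i, frm (w i) x = χ i x • frm v x := fun i => rfl
      simp only [h1, h0 x hx]
      exact (sum_eq_zero fun i _ => smul_zero _).symm
    · have hx2 : x ∈ closure (dom ρ) := subset_closure (show ρ x < 0 by linarith [not_lt.1 hx])
      have h1 : ∑ i, χ i x = 1 := by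
        rw [← finsum_eq_sum_of_fintype]
        exact χ.sum_eq_one hx2
      refine ContinuousAlternatingMap.ext fun z => ?_
      have h2 : ∀ i, frm (w i) x z = (χ i x : ℂ) * frm v x z := fun i => real_smul
      rw [ContinuousAlternatingMap.sum_apply]
      simp only [h2]
      rw [← sum_mul, ← ofReal_sum, h1, Complex.ofReal_one, one_mul]
  have hdsum : ∀ x, frm (dbarG v) x = ∑ i, frm (dbarG (w i)) x := by
    intro x
    set e := chartAt (Cn n) x
    have he : e ∈ 𝒰 := chart_mem_atlas _ _
    have hx : x ∈ e.source := mem_chart_source _ x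
    have h1 : inChart e v = fun y => ∑ i, inChart e (w i) y := by
      funext y
      refine ContinuousAlternatingMap.ext fun z => ?_
      rw [ContinuousAlternatingMap.sum_apply, inChart_eq, hsum,
        ContinuousAlternatingMap.compContinuousLinearMap_apply, ContinuousAlternatingMap.sum_apply]
      rfl
    have hy := e.map_source hx
    have h2 : inChart e (dbarG v) (e x) =
        inChart e (fun x => (∑ i, frm (dbarG (w i)) x : Form n (q + 1))) (e x) := by
      rw [inChart_dbarG H.act hv he hy, h1, fderiv_fun_sum fun i _ =>
        (((hws i).smooth e he).contDiffAt (e.open_target.mem_nhds hy)).differentiableAt (by simp),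
        map_sum]
      refine ContinuousAlternatingMap.ext fun z => ?_
      have h4 : inChart e (fun x => (∑ i, frm (dbarG (w i)) x : Form n (q + 1))) (e x) z =
          ∑ i, inChart e (dbarG (w i)) (e x) z := ContinuousAlternatingMap.sum_apply _ _
      rw [ContinuousAlternatingMap.sum_apply, h4]
      exact sum_congr rfl fun i _ => by rw [inChart_dbarG H.act (hws i) he hy]
    have h3 : frm (dbarG v) (e.symm (e x)) = ∑ i, frm (dbarG (w i)) (e.symm (e x)) :=
      eq_of_inChart he hy h2
    rwa [e.left_inv hx] at h3
  have hKc : IsCompact {x | ρ x ≤ -δ} :=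
    H.cpt.of_isClosed_subset (isClosed_le H.continuous_rho continuous_const) fun x hx =>
      subset_closure (show ρ x < 0 by linarith [show ρ x ≤ -δ from hx])
  have hi : ∀ i, ∫ x in dom ρ, formInner g (dbarG (w i) x) (u x) ∂(vol g) =
      ∫ x in dom ρ, formInner g (w i x) (thetaG g u x) ∂(vol g) := by
    intro i
    refine H.integral_dbarG_of_compact (hws i) hu (hec i)
      (hKc.inter_left (isClosed_tsupport (χ i))) (fun x hx => hχ i hx.1)
      (fun x hx => show ρ x < 0 by linarith [show ρ x ≤ -δ from hx.2]) fun x hx => ?_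
    have h1 : frm (w i) x = χ i x • frm v x := rfl
    rw [h1]
    by_cases hx2 : -δ < ρ x
    · rw [h0 x hx2]
      exact smul_zero (A := Form n q) (χ i x)
    · rw [image_eq_zero_of_notMem_tsupport fun h => hx ⟨h, not_lt.1 hx2⟩]
      exact zero_smul ℝ (frm v x)
  have e1 : ∀ x, formInner g (dbarG v x) (u x) = ∑ i, formInner g (dbarG (w i) x) (u x) := by
    intro x
    simp only [formInner_eq]
    rw [hdsum, fInner_sum_left]
  have e2 : ∀ x, formInner g (v x) (thetaG g u x) = ∑ i, formInner g (w i x) (thetaG g u x) := by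
    intro x
    simp only [formInner_eq]
    rw [hsum, fInner_sum_left]
  rw [l2Inner, l2Inner]
  simp only [e1, e2]
  rw [integral_finsetSum _ fun i _ => H.integrableOn_of_continuous
      (continuous_formInner H.herm (isSmoothForm_dbarG H.act (hws i)) hu),
    integral_finsetSum _ fun i _ => H.integrableOn_of_continuous
      (continuous_formInner H.herm (hws i) hθ)]
  exact sum_congr rfl fun i _ => hi i

end IsInvariantDomain

/-! ### Consequences of membership in the domain of the adjoint -/

lemma formInner_smul_left (f : M' → ℝ) (u v : 𝓕 q) (x : M') :
    formInner g (f x • u x : AltForm n q x) (v x) = f x * formInner g (u x) (v x) :=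
  fInner_real_smul_left _ (f x) (frm u x) (frm v x)

namespace IsInvariantDomain

variable (H : IsInvariantDomain g ρ)
include H

lemma contMDiff_comp_rho {k : ℝ → ℝ} (hk : Smooth k) :
    ContMDiff 𝓘(ℝ, Cn n) 𝓘(ℝ, ℝ) ∞ fun x => k (ρ x) :=
  hk.contMDiff.comp H.defining.smooth

lemma isFourierForm_comp_rho_smul {k : ℝ → ℝ} (hk : Smooth k) {u : 𝓕 q}
    (hu : IsFourierForm m u) : IsFourierForm m fun x => (k (ρ x) • u x : AltForm n q x) :=
  hu.smul H.act (H.contMDiff_comp_rho hk) fun c x => by rw [H.defining.invariant]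

lemma isFourierForm_bdryForm {u : 𝓕 (q + 1)} (hu : IsFourierForm m u) :
    IsFourierForm m (bdryForm g ρ u) :=
  (H.isFourierForm_comp_rho_smul contDiff_id (isFourierForm_thetaG H.act H.herm H.inv hu)).sub H.act
    (isFourierForm_thetaG H.act H.herm H.inv (H.isFourierForm_comp_rho_smul contDiff_id hu))

lemma inChart_bdryForm {u : 𝓕 (q + 1)} (hu : IsSmoothForm u)
    (he : e ∈ 𝒰) {y : Cn n} (hy : y ∈ e.target) :
    inChart e (bdryForm g ρ u) y = ρ (e.symm y) • theta (metB g e) (inChart e u) y -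
      theta (metB g e) (fun y => ρ (e.symm y) • inChart e u y) y := by
  have h1 := inChart_thetaG H.act H.herm H.inv hu he hy
  have h2 := inChart_thetaG H.act H.herm H.inv (hu.smul H.defining.smooth) he hy
  have h3 : inChart e (bdryForm g ρ u) y = ρ (e.symm y) • inChart e (thetaG g u) y -
    inChart e (thetaG g (fun x => (ρ x • u x : AltForm n (q + 1) x))) y := rfl
  rw [h3, h1, h2]
  rfl

lemma formInner_dbarG_smul {k : ℝ → ℝ} (hk : Smooth k) {w : 𝓕 q}
    (hw : IsSmoothForm w) {u : 𝓕 (q + 1)} (hu : IsSmoothForm u) (x : M') :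
    formInner g (dbarG (fun x => (k (ρ x) • w x : AltForm n q x)) x) (u x) =
      k (ρ x) * formInner g (dbarG w x) (u x) +
        deriv k (ρ x) * formInner g (w x) (bdryForm g ρ u x) := by
  set e := chartAt (Cn n) x
  have he : e ∈ 𝒰 := chart_mem_atlas _ _
  have hx : x ∈ e.source := mem_chart_source _ x
  have hkw : IsSmoothForm fun x => (k (ρ x) • w x : AltForm n q x) :=
    hw.smul (H.contMDiff_comp_rho hk)
  suffices h : ∀ y ∈ e.target,
      formInner g (dbarG (fun x => (k (ρ x) • w x : AltForm n q x)) (e.symm y)) (u (e.symm y)) =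
      k (ρ (e.symm y)) * formInner g (dbarG w (e.symm y)) (u (e.symm y)) +
        deriv k (ρ (e.symm y)) * formInner g (w (e.symm y)) (bdryForm g ρ u (e.symm y)) by
    have h1 := h (e x) (e.map_source hx)
    simp only [formInner_eq] at h1 ⊢
    rwa [e.left_inv hx] at h1
  intro y hy
  have hr : SmoothOn (fun y => ρ (e.symm y)) e.target :=
    contDiffOn_comp_symm he H.defining.smooth
  have hrd : DifferentiableAt ℝ (fun y => ρ (e.symm y)) y :=
    (hr.contDiffAt (e.open_target.mem_nhds hy)).differentiableAt (by simp)
  have hkd := (hk.differentiable (by simp) (ρ (e.symm y))).hasDerivAt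
  have h1 := hkd.comp_hasFDerivAt y hrd.hasFDerivAt
  have hwd : DifferentiableAt ℝ (inChart e w) y :=
    ((hw.smooth e he).contDiffAt (e.open_target.mem_nhds hy)).differentiableAt (by simp)
  have h2 : HasFDerivAt (inChart e fun x => (k (ρ x) • w x : AltForm n q x)) _ y :=
    h1.smul hwd.hasFDerivAt
  rw [formInner_symm g he hy, formInner_symm g he hy, formInner_symm g he hy,
    inChart_dbarG H.act hkw he hy, inChart_dbarG H.act hw he hy, H.inChart_bdryForm hu he hy,
    (isMet_metB g H.herm he).fInner_theta_smul (hu.smooth e he) hr hy (hw.isT0 he hy), h2.fderiv,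
    map_add, fInner_add_left, map_smul, fInner_real_smul_left]
  congr 1
  rw [← symb_apply, symb_smul_left, fInner_real_smul_left]

lemma nSq_thetaG_le (hec : ∀ i, ec i ∈ 𝒰)
    (hχ : χ.IsSubordinate fun i => (ec i).source) {u : 𝓕 (q + 1)} (hu : IsFourierForm m u) {c : 𝓕 q}
    (hc : DbarStarGraph g (dom ρ) m u c) : nSq g ρ (thetaG g u) ≤ nSq g ρ c := by
  have hθ := isFourierForm_thetaG H.act H.herm H.inv hu
  set θ := thetaG g u
  have hθ2 := H.isL2Form hθ.toIsSmoothForm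
  have hc2 := hc.2.1.toIsL2Form
  have hρm : Measurable ρ := H.continuous_rho.measurable
  have hlim : ∀ {h : M' → ℝ}, IntegrableOn h (dom ρ) (vol g) →
      Tendsto (fun ε => ∫ x in dom ρ, (1 - chiE ε (ρ x)) * h x ∂(vol g)) (𝓝[>] 0)
        (𝓝 (∫ x in dom ρ, h x ∂(vol g))) := fun hh =>
    tendsto_setIntegral_one_sub_chiE (r := ρ) hρm hh
  have hint : ∀ {h : M' → ℝ} (ε : ℝ), IntegrableOn h (dom ρ) (vol g) →
      IntegrableOn (fun x => (1 - chiE ε (ρ x)) * h x) (dom ρ) (vol g) := fun ε hh => by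
    have h1 := hh.sub (integrable_chiE_smul hρm hh ε)
    refine h1.congr (ae_of_all _ fun x => ?_)
    simp only [Pi.sub_apply, smul_eq_mul]
    ring
  refine le_of_tendsto_of_tendsto (hlim hθ2.integrable) (hlim hc2.integrable) ?_
  filter_upwards [self_mem_nhdsWithin] with ε hε
  have hk : Smooth fun t => 1 - chiE ε t := contDiff_const.sub (contDiff_chiE ε)
  set v : 𝓕 q := fun x => (1 - chiE ε (ρ x)) • θ x with hv
  have hvF : IsFourierForm m v := H.isFourierForm_comp_rho_smul hk hθ
  have h1 := hc.2.2 v (dbarG v) (H.dbarGraph hvF)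
  rw [H.integral_dbarG hec hχ hvF.toIsSmoothForm hu.toIsSmoothForm hε fun x hx => ?_] at h1
  · have h2 : ∀ {w : 𝓕 q}, IsL2Form g (dom ρ) w → (l2Inner g (dom ρ) v w).re =
          ∫ x in dom ρ, (1 - chiE ε (ρ x)) * (formInner g (θ x) (w x)).re ∂(vol g) := by
      intro w hw
      have h3 := integral_re (H.integrableOn_formInner (H.isL2Form hvF.toIsSmoothForm) hw)
      refine h3.symm.trans (integral_congr_ae (ae_of_all _ fun x => ?_))
      show (formInner g (v x) (w x)).re = _
      rw [hv, formInner_smul_left (fun x => 1 - chiE ε (ρ x)) θ w, re_ofReal_mul]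
    have h3 : ∫ x in dom ρ, (1 - chiE ε (ρ x)) * formNormSq g (θ x) ∂(vol g) =
        ∫ x in dom ρ, (1 - chiE ε (ρ x)) * (formInner g (θ x) (c x)).re ∂(vol g) := by
      rw [← h2 hc2, ← h1, h2 hθ2]
      rfl
    have h4 : ∫ x in dom ρ, (1 - chiE ε (ρ x)) * (formInner g (θ x) (c x)).re ∂(vol g) ≤
        ∫ x in dom ρ, ((1 / 2) * ((1 - chiE ε (ρ x)) * formNormSq g (θ x)) +
          (1 / 2) * ((1 - chiE ε (ρ x)) * formNormSq g (c x))) ∂(vol g) := by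
      refine integral_mono (hint ε (H.integrableOn_formInner hθ2 hc2).re)
        (((hint ε hθ2.integrable).const_mul _).add ((hint ε hc2.integrable).const_mul _))
        fun x => ?_
      have h5 := two_mul_re_fInner_le (isHerm_inn H.herm x) (frm θ x) (frm c x)
      have h6 : 0 ≤ 1 - chiE ε (ρ x) := sub_nonneg.2 (chiE_le_one _ _)
      have h7 : 2 * (formInner g (θ x) (c x)).re ≤ formNormSq g (θ x) + formNormSq g (c x) := h5
      show (1 - chiE ε (ρ x)) * (formInner g (θ x) (c x)).re ≤ _
      nlinarith
    rw [integral_add ((hint ε hθ2.integrable).const_mul _) ((hint ε hc2.integrable).const_mul _),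
      integral_const_mul, integral_const_mul] at h4
    linarith
  · have h5 : frm v x = (1 - chiE ε (ρ x)) • frm θ x := rfl
    rw [h5, chiE_eq_one hε (le_of_lt hx), sub_self]
    exact zero_smul ℝ (frm θ x)

lemma tendsto_bdryForm {u : 𝓕 (q + 1)} (hu : IsFourierForm m u) {c : 𝓕 q}
    (hc : DbarStarGraph g (dom ρ) m u c) :
    Tendsto (fun ε => ∫ x in dom ρ, bl ε (ρ x) * formNormSq g (bdryForm g ρ u x) ∂(vol g))
      (𝓝[>] 0) (𝓝 0) := by
  have hw := H.isFourierForm_bdryForm hu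
  set w := bdryForm g ρ u with hwd
  have hw2 := H.isL2Form hw.toIsSmoothForm
  have hdw := isSmoothForm_dbarG H.act hw.toIsSmoothForm
  have hρm : Measurable ρ := H.continuous_rho.measurable
  set h : M' → ℂ := fun x => formInner g (w x) (c x) - formInner g (dbarG w x) (u x) with hh
  have i1 := H.integrableOn_formInner hw2 hc.2.1.toIsL2Form
  have i2 := H.integrableOn_formInner (H.isL2Form hdw) hc.1.toIsL2Form
  have i3 : IntegrableOn h (dom ρ) (vol g) := i1.sub i2
  have hlim := (continuous_re.tendsto 0).comp
    (tendsto_setIntegral_chiE (r := ρ) hρm i3)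
  rw [Complex.zero_re] at hlim
  refine hlim.congr' ?_
  filter_upwards [self_mem_nhdsWithin] with ε hε
  have hvF := H.isFourierForm_comp_rho_smul (contDiff_chiE ε) hw
  have h1 := hc.2.2 _ _ (H.dbarGraph hvF)
  have hbl : ∀ t, deriv (chiE ε) t = bl ε t := fun t => (hasDerivAt_chiE ε t).deriv
  have j1 := integrable_chiE_smul hρm i1 ε
  have j2 := integrable_chiE_smul hρm i2 ε
  have j3 : IntegrableOn (fun x => (bl ε (ρ x) : ℂ) * formInner g (w x) (w x)) (dom ρ) (vol g) :=
    H.integrableOn_of_continuous ((continuous_ofReal.comp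
      ((contDiff_bl ε).continuous.comp H.continuous_rho)).mul
        (continuous_formInner H.herm hw.toIsSmoothForm hw.toIsSmoothForm))
  have e1 : l2Inner g (dom ρ) (dbarG fun x => (chiE ε (ρ x) • w x : AltForm n q x)) u =
      (∫ x in dom ρ, chiE ε (ρ x) • formInner g (dbarG w x) (u x) ∂(vol g)) +
        ∫ x in dom ρ, (bl ε (ρ x) : ℂ) * formInner g (w x) (w x) ∂(vol g) := by
    rw [← integral_add j2 j3]
    refine integral_congr_ae (ae_of_all _ fun x => ?_)
    beta_reduce
    rw [H.formInner_dbarG_smul (contDiff_chiE ε) hw.toIsSmoothForm hu.toIsSmoothForm, hbl,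
      real_smul]
  have e2 : l2Inner g (dom ρ) (fun x => (chiE ε (ρ x) • w x : AltForm n q x)) c =
      ∫ x in dom ρ, chiE ε (ρ x) • formInner g (w x) (c x) ∂(vol g) := by
    refine integral_congr_ae (ae_of_all _ fun x => ?_)
    beta_reduce
    rw [formInner_smul_left (fun x => chiE ε (ρ x)), real_smul]
  rw [e1, e2] at h1
  have e3 : ∫ x in dom ρ, chiE ε (ρ x) • h x ∂(vol g) =
      ∫ x in dom ρ, (bl ε (ρ x) : ℂ) * formInner g (w x) (w x) ∂(vol g) := by
    rw [← sub_eq_of_eq_add' h1.symm, ← integral_sub j1 j2]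
    refine integral_congr_ae (ae_of_all _ fun x => ?_)
    exact smul_sub _ _ _
  show (∫ x in dom ρ, chiE ε (ρ x) • h x ∂(vol g)).re = _
  rw [e3]
  refine (integral_re j3).symm.trans (integral_congr_ae (ae_of_all _ fun x => ?_))
  show ((bl ε (ρ x) : ℂ) * formInner g (w x) (w x)).re = _
  rw [re_ofReal_mul]
  rfl

end IsInvariantDomain

/-! ### The generator of the action in a chart -/

section Flow

variable (hact : IsHolomorphicCircleAction n M')

variable (e) in
/-- The action in the chart `e`, as a function of the angle and the point. -/
def flow (p : ℝ × Cn n) : Cn n := e (Circle.exp p.1 • e.symm p.2)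

variable (e) in
/-- The domain of `flow`. -/
def flowDom : Set (ℝ × Cn n) :=
  (Set.univ ×ˢ e.target) ∩ (fun p => Circle.exp p.1 • e.symm p.2) ⁻¹' e.source

variable (e) in
/-- The vector field generating the action, in the chart `e`. -/
def genT (y : Cn n) : Cn n := ð (flow e) (0, y) (1, 0)

variable (e) in
/-- The derivative at `θ = 0` of the differential of the action, in the chart `e`. -/
def genD (y : Cn n) : Cn n →L[ℝ] Cn n :=
  ð (fun p => (ð (flow e) p).comp (ContinuousLinearMap.inr ℝ ℝ (Cn n))) (0, y) (1, 0)

lemma zero_mem_flowDom {y : Cn n} (hy : y ∈ e.target) : ((0 : ℝ), y) ∈ flowDom e := by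
  refine ⟨⟨trivial, hy⟩, ?_⟩
  simpa using e.map_target hy

include hact

lemma contMDiffOn_flow (he : e ∈ 𝒰) :
    ContMDiffOn 𝓘(ℝ, ℝ × Cn n) 𝓘(ℝ, Cn n) ∞ (fun p : ℝ × Cn n => Circle.exp p.1 • e.symm p.2)
      (Set.univ ×ˢ e.target) := by
  have h1 : ContMDiffOn 𝓘(ℝ, ℝ × Cn n) (𝓘(ℝ, ℝ).prod 𝓘(ℝ, Cn n)) ∞
      (fun p : ℝ × Cn n => ((p.1, e.symm p.2) : ℝ × M')) (Set.univ ×ˢ e.target) :=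
    (contDiff_fst.contMDiff.contMDiffOn).prodMk
      ((contMDiffOn_chart_symm he).comp contDiff_snd.contMDiff.contMDiffOn fun p hp => hp.2)
  exact hact.smooth.comp_contMDiffOn h1

lemma isOpen_flowDom (he : e ∈ 𝒰) : IsOpen (flowDom e) :=
  (contMDiffOn_flow hact he).continuousOn.isOpen_inter_preimage
    (isOpen_univ.prod e.open_target) e.open_source

lemma contDiffOn_flow (he : e ∈ 𝒰) : SmoothOn (flow e) (flowDom e) := by
  rw [← contMDiffOn_iff_contDiffOn]
  exact (contMDiffOn_chart he).comp ((contMDiffOn_flow hact he).mono inter_subset_left)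
    fun p hp => hp.2

lemma contDiffOn_zero_prod {F : Type*} [NormedAddCommGroup F] [NormedSpace ℝ F]
    {f : ℝ × Cn n → F} (hf : SmoothOn f (flowDom e)) : SmoothOn (fun y => f (0, y)) e.target :=
  hf.comp (contDiff_const.prodMk contDiff_id).contDiffOn fun _ hy => zero_mem_flowDom hy

lemma contDiffOn_genT (he : e ∈ 𝒰) : SmoothOn (genT e) e.target :=
  contDiffOn_zero_prod hact (f := fun p => ð (flow e) p (1, 0))
    (((contDiffOn_flow hact he).fderiv_of_isOpen (isOpen_flowDom hact he) (m := ∞)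
      (by simp)).clm_apply contDiffOn_const)

lemma contDiffOn_fderiv_flow (he : e ∈ 𝒰) : SmoothOn
    (fun p => (ð (flow e) p).comp (ContinuousLinearMap.inr ℝ ℝ (Cn n))) (flowDom e) :=
  ((contDiffOn_flow hact he).fderiv_of_isOpen (isOpen_flowDom hact he) (m := ∞)
    (by simp)).clm_comp contDiffOn_const

lemma contDiffOn_genD (he : e ∈ 𝒰) : SmoothOn (genD e) e.target :=
  contDiffOn_zero_prod hact (f := fun p => ð (fun p => (ð (flow e) p).comp
      (ContinuousLinearMap.inr ℝ ℝ (Cn n))) p (1, 0))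
    (((contDiffOn_fderiv_flow hact he).fderiv_of_isOpen (isOpen_flowDom hact he) (m := ∞)
      (by simp)).clm_apply contDiffOn_const)

lemma hasDerivAt_flow (he : e ∈ 𝒰) {y : Cn n} (hy : y ∈ e.target) :
    HasDerivAt (fun θ : ℝ => flow e (θ, y)) (genT e y) 0 := by
  have h1 : HasFDerivAt (flow e) (ð (flow e) (0, y)) ((0 : ℝ), y) :=
    (((contDiffOn_flow hact he).contDiffAt ((isOpen_flowDom hact he).mem_nhds
      (zero_mem_flowDom hy))).differentiableAt (by simp)).hasFDerivAt
  exact h1.comp_hasDerivAt (0 : ℝ) ((hasDerivAt_id (0 : ℝ)).prodMk (hasDerivAt_const _ y))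

lemma chD_genT (he : e ∈ 𝒰) {y : Cn n} (hy : y ∈ e.target) :
    chD e y (genT e y) = T n (e.symm y) := by
  have h0 : flow e (0, y) = y := by simp [flow, e.right_inv hy]
  have h1 : HasMFDerivAt 𝓘(ℝ, ℝ) 𝓘(ℝ, Cn n) (fun θ : ℝ => flow e (θ, y)) 0
    (ContinuousLinearMap.toSpanSingleton ℝ (genT e y)) :=
      (hasDerivAt_flow hact he hy).hasFDerivAt.hasMFDerivAt
  have h2 : HasMFDerivAt 𝓘(ℝ, Cn n) 𝓘(ℝ, Cn n) e.symm (flow e (0, y)) (chD e (flow e (0, y))) :=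
    (mdifferentiableAt_chart_symm he (by rw [h0]; exact hy)).hasMFDerivAt
  have h3 := h2.comp (0 : ℝ) h1
  have h4 := h3.congr_of_eventuallyEq (f₁ := fun θ : ℝ => Circle.exp θ • e.symm y) (by
    have h5 : ∀ᶠ θ in 𝓝 (0 : ℝ), (θ, y) ∈ flowDom e :=
      (Continuous.prodMk_left y).continuousAt.preimage_mem_nhds
        ((isOpen_flowDom hact he).mem_nhds (zero_mem_flowDom hy))
    filter_upwards [h5] with θ hθ
    exact (e.left_inv hθ.2).symm)
  have h6 : T n (e.symm y) =
      ((chD e (flow e (0, y))).comp (ContinuousLinearMap.toSpanSingleton ℝ (genT e y))) (1 : ℝ) :=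
    congrArg (fun L : ℝ →L[ℝ] Cn n => L 1) h4.mfderiv
  rw [h6, h0]
  simp

/-- The derivative of a Fourier form along the generator of the action. -/
lemma fderiv_genT {m : ℤ} (he : e ∈ 𝒰) {u : 𝓕 q}
    (hu : IsFourierForm m u) {y : Cn n} (hy : y ∈ e.target) :
    ð (inChart e u) y (genT e y) = (î * m) • inChart e u y -
      (inChart e u y).fderivCompContinuousLinearMap (ContinuousLinearMap.id ℝ _) (genD e y) := by
  have h0 : flow e (0, y) = y := by simp [flow, e.right_inv hy]
  have hUd : HasFDerivAt (inChart e u) (ð (inChart e u) y) (flow e (0, y)) := by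
    rw [h0]
    exact (((hu.smooth e he).contDiffAt (e.open_target.mem_nhds hy)).differentiableAt
      (by simp)).hasFDerivAt
  have hA : ∀ θ, (θ, y) ∈ flowDom e → ð (actChart e e (Circle.exp θ)) y =
      (ð (flow e) (θ, y)).comp (ContinuousLinearMap.inr ℝ ℝ (Cn n)) := by
    intro θ hθ
    have h1 : HasFDerivAt (flow e) (ð (flow e) (θ, y)) (θ, y) :=
      (((contDiffOn_flow hact he).contDiffAt ((isOpen_flowDom hact he).mem_nhds
        hθ)).differentiableAt (by simp)).hasFDerivAt
    exact (h1.comp y (hasFDerivAt_prodMk_right θ y)).fderiv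
  set D : ℝ × Cn n → Cn n →L[ℝ] Cn n :=
    fun p => (ð (flow e) p).comp (ContinuousLinearMap.inr ℝ ℝ (Cn n)) with hD
  have h1 : HasDerivAt (fun θ : ℝ => D (θ, y)) (genD e y) 0 := by
    have h2 : HasFDerivAt D (ð D (0, y)) ((0 : ℝ), y) :=
      (((contDiffOn_fderiv_flow hact he).contDiffAt ((isOpen_flowDom hact he).mem_nhds
        (zero_mem_flowDom hy))).differentiableAt (by simp)).hasFDerivAt
    exact h2.comp_hasDerivAt (0 : ℝ) ((hasDerivAt_id (0 : ℝ)).prodMk (hasDerivAt_const _ y))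
  have hD0 : D (0, y) = ContinuousLinearMap.id ℝ _ := by
    rw [hD]
    beta_reduce
    rw [← hA 0 (zero_mem_flowDom hy)]
    have h2 : actChart e e (Circle.exp 0) =ᶠ[𝓝 y] id := by
      filter_upwards [e.open_target.mem_nhds hy] with z hz
      simp [actChart, e.right_inv hz]
    rw [h2.fderiv_eq, fderiv_id]
  have h3 : HasFDerivAt (fun θ : ℝ => inChart e u (flow e (θ, y)))
      ((ð (inChart e u) y).comp (ContinuousLinearMap.toSpanSingleton ℝ (genT e y))) 0 :=
    HasFDerivAt.comp (g := inChart e u) (f := fun θ : ℝ => flow e (θ, y)) (0 : ℝ) hUd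
      (hasDerivAt_flow hact he hy).hasFDerivAt
  have h4 := h3.continuousAlternatingMapCompContinuousLinearMap h1.hasFDerivAt
  have h5 : HasDerivAt (fun θ : ℝ => Complex.exp (î * m * θ) • inChart e u y)
      ((î * m) • inChart e u y) 0 := by
    have h2 : HasDerivAt (fun t : ℝ => î * m * (t : ℂ)) (î * m) 0 := by
      simpa using (ofRealCLM.hasDerivAt (x := (0 : ℝ))).const_mul (î * m)
    exact HasDerivAt.smul_const (F := Form n q) (by simpa using h2.cexp) (inChart e u y)
  have h6 : (fun θ : ℝ => Complex.exp (î * m * θ) • inChart e u y) =ᶠ[𝓝 0]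
      fun θ => (inChart e u (flow e (θ, y))).compContinuousLinearMap (D (θ, y)) := by
    have h7 : ∀ᶠ θ in 𝓝 (0 : ℝ), (θ, y) ∈ flowDom e :=
      (Continuous.prodMk_left y).continuousAt.preimage_mem_nhds
        ((isOpen_flowDom hact he).mem_nhds (zero_mem_flowDom hy))
    filter_upwards [h7] with θ hθ
    have h8 := inChart_actPullback hact he he (Circle.exp θ) u ⟨hθ.1.2, hθ.2⟩
    rw [pullF, hA θ hθ] at h8
    refine Eq.trans ?_ h8
    have h9 : frm (actPullback (Circle.exp θ) u) (e.symm y) =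
      Complex.exp (î * m * θ) • frm u (e.symm y) := hu.actPullback_exp hact θ _
    rw [inChart_eq _ (actPullback _ _), h9]
    rfl
  have h7 := congrArg (fun L : ℝ →L[ℝ] Form n q => L 1)
    ((h4.congr_of_eventuallyEq h6).unique h5.hasFDerivAt)
  rw [eq_sub_iff_add_eq]
  simp only [h0, hD0] at h7
  refine ContinuousAlternatingMap.ext fun w => ?_
  have h8 := congrArg (fun L : Form n q => L w) h7
  simpa using h8

lemma exists_fderiv_genT_le (he : e ∈ 𝒰) {K : Set (Cn n)} (hK : IsCompact K)
    (hKt : K ⊆ e.target) (q : ℕ) (m : ℤ) : ∃ C, 0 ≤ C ∧ ∀ u : 𝓕 q, IsFourierForm m u → ∀ y ∈ K,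
        ‖ð (inChart e u) y (genT e y)‖ ≤ C * ‖inChart e u y‖ := by
  obtain ⟨C₀, hC₀⟩ := hK.exists_bound_of_continuousOn
    ((contDiffOn_genD hact he).continuousOn.mono hKt)
  refine ⟨‖î * m‖ + q * (max 1 C₀) ^ q, by positivity, fun u hu y hy => ?_⟩
  rw [fderiv_genT hact he hu (hKt hy), add_mul]
  refine (norm_sub_le _ _).trans (add_le_add (norm_smul (β := Form n q) _ _).le ?_)
  refine ContinuousAlternatingMap.opNorm_le_bound _ (by positivity) fun w => ?_
  rw [ContinuousAlternatingMap.fderivCompContinuousLinearMap_apply]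
  have h1 : ∀ i, ‖inChart e u y fun j => (Function.update (fun _ => ContinuousLinearMap.id ℝ (Cn n))
      i (genD e y) j) (w j)‖ ≤ ‖inChart e u y‖ * ((max 1 C₀) ^ q * ∏ j, ‖w j‖) := by
    intro i
    refine (ContinuousAlternatingMap.le_opNorm _ _).trans ?_
    refine mul_le_mul_of_nonneg_left ?_ (norm_nonneg (E := Form n q) _)
    have h2 : ∏ j : Fin q, (max 1 C₀ * ‖w j‖) = (max 1 C₀) ^ q * ∏ j, ‖w j‖ := by
      rw [Finset.prod_mul_distrib, Finset.prod_const, card_univ, Fintype.card_fin]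
    rw [← h2]
    refine Finset.prod_le_prod (fun j _ => norm_nonneg _) fun j _ => ?_
    rcases eq_or_ne j i with rfl | hj
    · rw [Function.update_self]
      exact ((genD e y).le_opNorm _).trans (mul_le_mul_of_nonneg_right
        ((hC₀ y hy).trans (le_max_right _ _)) (norm_nonneg _))
    · rw [Function.update_of_ne hj]
      exact le_mul_of_one_le_left (norm_nonneg _) (le_max_left _ _)
  refine (norm_sum_le _ _).trans ((sum_le_sum fun i _ => h1 i).trans (le_of_eq ?_))
  rw [sum_const, card_univ, Fintype.card_fin, nsmul_eq_mul]
  ring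

end Flow

/-! ### Criteria for vanishing traces -/

section BNull

variable {φ r h : Cn n → ℝ}

/-- Near a point where `dr ≠ 0`, the boundary layers have uniformly bounded mass. -/
lemma exists_integral_bl_le (hφ : Smooth φ) (hφc : HasCompactSupport φ)
    (hr : Smooth r) {N : Cn n} {c : ℝ} (hc : 0 < c) (hN : ∀ y ∈ tsupport φ, c ≤ ð r y N) :
    ∃ C, 0 ≤ C ∧ ∀ ε > 0, ∫ y, bl ε (r y) * φ y ^ 2 ≤ C := by
  have hφn : Continuous φ := hφ.continuous
  have hrn : Continuous r := hr.continuous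
  have hdφ : Continuous fun y => ð φ y N :=
    (hφ.continuous_fderiv (by simp)).clm_apply continuous_const
  have hdr : Continuous fun y => ð r y N :=
    (hr.continuous_fderiv (by simp)).clm_apply continuous_const
  set A := ∫ y, |2 * φ y * ð φ y N| with hA
  have hA0 : 0 ≤ A := integral_nonneg fun y => abs_nonneg _
  refine ⟨A / c, by positivity, fun ε hε => ?_⟩
  have hsupp : ∀ {f : Cn n → ℝ}, Continuous f → (∀ y, φ y = 0 → f y = 0) → Integrable f := by
    intro f hf h0
    refine hf.integrable_of_hasCompactSupport (hφc.mono fun y hy => ?_)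
    rw [Function.mem_support] at hy ⊢
    exact fun h => hy (h0 y h)
  have hbl : Continuous fun y => bl ε (r y) := (contDiff_bl ε).continuous.comp hrn
  have hch : Continuous fun y => chiE ε (r y) := (contDiff_chiE ε).continuous.comp hrn
  have i1 : Integrable fun y => bl ε (r y) * φ y ^ 2 := hsupp (by fun_prop) fun y h => by simp [h]
  have i2 : Integrable fun y => bl ε (r y) * φ y ^ 2 * ð r y N :=
    hsupp (by fun_prop) fun y h => by simp [h]
  have i3 : Integrable fun y => chiE ε (r y) * (2 * φ y * ð φ y N) :=
    hsupp (by fun_prop) fun y h => by simp [h]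
  have i4 : Integrable fun y => |2 * φ y * ð φ y N| :=
    hsupp (by fun_prop) fun y h => by simp [h]
  set F : Cn n → ℝ := fun y => chiE ε (r y) * φ y ^ 2 with hF
  have hFs : Smooth F := ((contDiff_chiE ε).comp hr).mul (hφ.pow 2)
  have hFd : ∀ y, ð F y N = bl ε (r y) * φ y ^ 2 * ð r y N +
      chiE ε (r y) * (2 * φ y * ð φ y N) := by
    intro y
    have h1 := (hasDerivAt_chiE ε (r y)).comp_hasFDerivAt y
      (hr.differentiable (by simp) y).hasFDerivAt
    have h2 := (hφ.differentiable (by simp) y).hasFDerivAt.pow 2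
    have h3 : HasFDerivAt F _ y := h1.mul h2
    rw [h3.fderiv]
    simp
    ring
  have h0 : ∫ y, ð F y N = 0 := by
    have h1 : ContDiff ℝ 1 fun y => (F y : ℂ) :=
      ofRealCLM.contDiff.comp (hFs.of_le (by simp))
    have h2 : HasCompactSupport fun y => (F y : ℂ) := hφc.mono fun y hy => by
      rw [Function.mem_support] at hy ⊢
      exact fun h => hy (by simp [hF, h])
    have h3 := integral_fderiv_apply_eq_zero h1 h2 N
    have h4 : ∀ y, ð (fun y => (F y : ℂ)) y N = ((ð F y N : ℝ) : ℂ) := by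
      intro y
      have h5 : HasFDerivAt (fun y => (F y : ℂ)) (ofRealCLM.comp (ð F y)) y :=
        ofRealCLM.hasFDerivAt.comp y (hFs.differentiable (by simp) y).hasFDerivAt
      rw [h5.fderiv]
      rfl
    simp only [h4] at h3
    rw [integral_complex_ofReal] at h3
    exact_mod_cast h3
  simp only [hFd] at h0
  rw [integral_add i2 i3] at h0
  have h1 : -∫ y, chiE ε (r y) * (2 * φ y * ð φ y N) ≤ A := by
    rw [← integral_neg]
    refine integral_mono i3.neg i4 fun y => ?_
    refine (neg_le_abs _).trans ?_
    rw [abs_mul, abs_of_nonneg (chiE_nonneg ε _)]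
    exact mul_le_of_le_one_left (abs_nonneg _) (chiE_le_one ε _)
  have h2 : c * ∫ y, bl ε (r y) * φ y ^ 2 ≤ ∫ y, bl ε (r y) * φ y ^ 2 * ð r y N := by
    rw [← integral_const_mul]
    refine integral_mono (i1.const_mul c) i2 fun y => ?_
    by_cases hy : y ∈ tsupport φ
    · have := mul_le_mul_of_nonneg_left (hN y hy) (mul_nonneg (bl_nonneg hε (r y)) (sq_nonneg (φ y)))
      linarith
    · simp [image_eq_zero_of_notMem_tsupport hy]
  rw [le_div_iff₀ hc]
  linarith

/-- A function which is, up to an arbitrarily small constant, bounded by functions with vanishing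
trace has vanishing trace. -/
lemma bNull_of_le_add (hφ : HasCompactSupport φ) (hφc : Continuous φ) (hr : Continuous r)
    (hh : Continuous h) (h0 : ∀ y, 0 ≤ h y) {C : ℝ} (hC : 0 ≤ C)
    (hb : ∀ ε > 0, ∫ y, bl ε (r y) * φ y ^ 2 ≤ C)
    (hle : ∀ η > 0, ∃ h' : Cn n → ℝ, Continuous h' ∧ BNull φ r h' ∧
      ∀ y ∈ tsupport φ, h y ≤ η + h' y) : BNull φ r h := by
  unfold BNull
  rw [Metric.tendsto_nhds]
  intro δ hδ
  obtain ⟨h', hc', hn', hl'⟩ := hle (δ / (2 * (C + 1))) (by positivity)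
  have h1 := (Metric.tendsto_nhds.mp hn') (δ / 2) (by positivity)
  filter_upwards [h1, self_mem_nhdsWithin] with ε h2 hε
  rw [dist_zero_right] at h2 ⊢
  have hw : ∀ y, 0 ≤ bl ε (r y) * φ y ^ 2 := fun y => mul_nonneg (bl_nonneg hε _) (sq_nonneg _)
  rw [norm_of_nonneg (integral_nonneg fun y => mul_nonneg (hw y) (h0 y))]
  have i1 : Integrable fun y => bl ε (r y) * φ y ^ 2 * (δ / (2 * (C + 1))) :=
    integrable_bl hφ hφc hr continuous_const ε
  have i2 := integrable_bl hφ hφc hr hc' ε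
  have h3 : ∫ y, bl ε (r y) * φ y ^ 2 * h y ≤
      (∫ y, bl ε (r y) * φ y ^ 2 * (δ / (2 * (C + 1)))) + ∫ y, bl ε (r y) * φ y ^ 2 * h' y := by
    rw [← integral_add i1 i2]
    refine integral_mono (integrable_bl hφ hφc hr hh ε) (i1.add i2) fun y => ?_
    by_cases hy : y ∈ tsupport φ
    · have := mul_le_mul_of_nonneg_left (hl' y hy) (hw y)
      linarith
    · simp [image_eq_zero_of_notMem_tsupport hy]
  have h4 : ∫ y, bl ε (r y) * φ y ^ 2 * (δ / (2 * (C + 1))) ≤ δ / 2 := by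
    rw [integral_mul_const]
    refine (mul_le_mul_of_nonneg_right (hb ε hε) (by positivity)).trans ?_
    rw [mul_div_assoc', div_le_iff₀ (by positivity)]
    nlinarith
  have h5 := (le_abs_self _).trans_lt h2
  linarith

lemma bNull_of_eq_zero (hφ : HasCompactSupport φ) (hφc : Continuous φ) (hr : Continuous r)
    (hh : Continuous h) (h0 : ∀ y, 0 ≤ h y) {C : ℝ} (hC : 0 ≤ C)
    (hb : ∀ ε > 0, ∫ y, bl ε (r y) * φ y ^ 2 ≤ C)
    (hz : ∀ y ∈ tsupport φ, r y = 0 → h y = 0) : BNull φ r h := by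
  refine bNull_of_le_add hφ hφc hr hh h0 hC hb fun η hη => ?_
  have hS : IsCompact (tsupport φ ∩ {y | η ≤ h y}) :=
    IsCompact.inter_right hφ (isClosed_le continuous_const hh)
  obtain ⟨K, hK⟩ : ∃ K, ∀ y ∈ tsupport φ ∩ {y | η ≤ h y}, ‖h y / |r y|‖ ≤ K := by
    refine hS.exists_bound_of_continuousOn ((hh.continuousOn).div hr.abs.continuousOn fun y hy => ?_)
    intro hy0
    have h1 := hz y hy.1 (abs_eq_zero.mp hy0)
    have h2 : η ≤ h y := hy.2
    linarith
  refine ⟨fun y => |K| * |r y|, by fun_prop, bNull_of_le_abs hφ hφc hr (by fun_prop) (C := |K|)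
    fun y _ _ => (by rw [abs_mul, abs_abs, abs_abs]), fun y hy => ?_⟩
  rcases le_or_gt η (h y) with h1 | h1
  · have h2 := hK y ⟨hy, h1⟩
    have h3 : 0 < |r y| := by
      rw [abs_pos]
      intro h4
      have := hz y hy h4
      linarith
    rw [norm_of_nonneg (div_nonneg (h0 y) h3.le), div_le_iff₀ h3] at h2
    have := mul_le_mul_of_nonneg_right (le_abs_self K) h3.le
    linarith
  · have := mul_nonneg (abs_nonneg K) (abs_nonneg (r y))
    linarith

lemma bNull_of_sq (hφ : HasCompactSupport φ) (hφc : Continuous φ) (hr : Continuous r)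
    (hh : Continuous h) (h0 : ∀ y, 0 ≤ h y) {C : ℝ} (hC : 0 ≤ C)
    (hb : ∀ ε > 0, ∫ y, bl ε (r y) * φ y ^ 2 ≤ C)
    (hn : BNull φ r fun y => h y ^ 2) : BNull φ r h := by
  refine bNull_of_le_add hφ hφc hr hh h0 hC hb fun η hη =>
    ⟨fun y => (4 * η)⁻¹ * h y ^ 2, by fun_prop, hn.const_mul _, fun y _ => ?_⟩
  have h1 : (4 * η)⁻¹ * h y ^ 2 = h y ^ 2 / (4 * η) := by rw [mul_comm, div_eq_mul_inv]
  beta_reduce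
  rw [h1, ← sub_nonneg]
  have h2 : η + h y ^ 2 / (4 * η) - h y = (2 * η - h y) ^ 2 / (4 * η) := by
    field_simp
    ring
  rw [h2]
  positivity

end BNull

/-! ### The boundary in a chart -/

section Boundary

variable (g ρ) in
/-- An invariant domain whose boundary is transversal to the action, with an adapted metric. -/
structure IsTransversalDomain : Prop extends IsInvariantDomain g ρ where
  trans : IsTransversal n ρ
  sign : ∀ x ∈ bdry ρ, dfun n ρ x (J n x (T n x)) < 0
  adapted : IsAdaptedMetric g ρ

lemma fderiv_comp_symm (hρ : IsInvariantDefiningFunction n ρ) (he : e ∈ 𝒰) {y : Cn n}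
    (hy : y ∈ e.target) (v : Cn n) :
    ð (fun y => ρ (e.symm y)) y v = dfun n ρ (e.symm y) (chD e y v) := by
  have h1 : HasMFDerivAt 𝓘(ℝ, Cn n) 𝓘(ℝ, ℝ) ρ (e.symm y) (dfun n ρ (e.symm y)) :=
    (hρ.smooth.mdifferentiable (by simp) _).hasMFDerivAt
  have h2 : HasMFDerivAt 𝓘(ℝ, Cn n) 𝓘(ℝ, Cn n) e.symm y (chD e y) :=
    (mdifferentiableAt_chart_symm he hy).hasMFDerivAt
  have h3 : HasFDerivAt (fun y => ρ (e.symm y))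
      ((dfun n ρ (e.symm y) : Cn n →L[ℝ] ℝ).comp (chD e y)) y := (h1.comp y h2).hasFDerivAt
  rw [h3.fderiv]
  rfl

variable (H : IsTransversalDomain g ρ)
include H

/-- On the boundary, vectors orthogonal to `JT` are tangent to the boundary. -/
lemma dfun_eq_zero {x : M'} (hx : x ∈ bdry ρ) {τ V : Cn n}
    (hτ : τ = T n x) (hV : inn g x V (î • τ) = 0) : dfun n ρ x V = 0 := by
  set L : Cn n →L[ℝ] ℝ := dfun n ρ x with hL
  have hB := isHerm_inn (g := g) H.herm x
  have hs : L (î • τ) < 0 := hτ ▸ H.sign x hx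
  obtain ⟨hT1, hTh⟩ := H.adapted x hx
  rw [← hτ] at hT1 hTh
  set s := L V / L (î • τ) with hsd
  have hV' : (V - s • î • τ : Cn n) ∈ tangentX n ρ x := by
    change L (V - s • î • τ) = 0
    rw [map_sub, map_smul, hsd, smul_eq_mul, div_mul_cancel₀ _ hs.ne, sub_self]
  rw [← (H.trans x hx).2] at hV'
  obtain ⟨a, h, hh, hsum⟩ : ∃ (a : ℝ) (h : Cn n), h ∈ holTangentX n ρ x ∧
      a • τ + h = V - s • î • τ := by
    obtain ⟨z, hz, h, hh, hsum⟩ := (Submodule.mem_sup (R := ℝ) (M := TS n x)).mp hV'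
    obtain ⟨a, rfl⟩ := (Submodule.mem_span_singleton (R := ℝ) (M := TS n x)).mp hz
    exact ⟨a, h, hh, hτ ▸ hsum⟩
  have hJh : (î • h : Cn n) ∈ holTangentX n ρ x := by
    refine ⟨hh.2, ?_⟩
    change L (î • î • h) = 0
    rw [smul_smul, I_mul_I, neg_one_smul, map_neg, neg_eq_zero]
    exact hh.1
  have h1 : inn g x τ (î • h) = 0 := hTh _ hJh
  have h2 : inn g x h (î • τ) = 0 := by
    have h3 := hB.inner_I_smul_left h τ
    rw [hB.symm, h1] at h3
    linarith
  have h3 : inn g x (a • τ + h) (î • τ) = 0 := by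
    rw [map_add, add_apply, h2, (inn g x).map_smul, smul_apply, hB.inner_I_smul_self, smul_zero,
      add_zero]
  rw [hsum, map_sub, sub_apply, hV, (inn g x).map_smul, smul_apply, hB.herm] at h3
  have h4 : inn g x τ τ = 1 := hT1
  rw [h4, smul_eq_mul, mul_one, zero_sub, neg_eq_zero] at h3
  have h5 : L V = s * L (î • τ) := by rw [hsd, div_mul_cancel₀ _ hs.ne]
  exact h5.trans (by rw [h3, zero_mul])

lemma fderiv_rho_eq_zero (he : e ∈ 𝒰) {y : Cn n} (hy : y ∈ e.target)
    (hr : ρ (e.symm y) = 0) {V : Cn n} (hV : metB g e y V (î • genT e y) = 0) :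
    ð (fun y => ρ (e.symm y)) y V = 0 := by
  rw [fderiv_comp_symm H.defining he hy]
  refine dfun_eq_zero H hr (chD_genT H.act he hy) ?_
  rw [← chD_I_smul he hy]
  exact hV

lemma fderiv_rho_I_genT (he : e ∈ 𝒰) {y : Cn n} (hy : y ∈ e.target) (hr : ρ (e.symm y) = 0) :
    ð (fun y => ρ (e.symm y)) y (î • genT e y) < 0 := by
  rw [fderiv_comp_symm H.defining he hy, chD_I_smul he hy, chD_genT H.act he hy]
  exact H.sign _ hr

/-- If the first vector of a unitary frame is parallel to `T`, the others are complex tangential on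
the boundary. -/
lemma tanSize_eq_zero (he : e ∈ 𝒰) {y : Cn n} (hy : y ∈ e.target)
    (hr : ρ (e.symm y) = 0) {E : Fin n → Cn n → Cn n} (hE : IsUnitary (metB g e y) fun a => E a y)
    {b a : Fin n} {s : ℝ} (hs : s ≠ 0) (hb : E b y = s • genT e y) (hab : a ≠ b) :
    tanSize (fun y => ρ (e.symm y)) (E a) y = 0 := by
  have hB := (isMet_metB g H.herm he).herm y hy
  have h1 : genT e y = s⁻¹ • E b y := by rw [hb, smul_smul, inv_mul_cancel₀ hs, one_smul]
  have h2 := (hE a b).1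
  have h3 := (hE a b).2
  rw [if_neg hab] at h2
  have h4 : metB g e y (E a y) (î • genT e y) = 0 := by
    rw [h1, smul_comm, map_smul, h3, smul_zero]
  have h5 : metB g e y (î • E a y) (î • genT e y) = 0 := by
    rw [hB.herm, h1, map_smul, h2, smul_zero]
  rw [tanSize, fderiv_rho_eq_zero H he hy hr h4, fderiv_rho_eq_zero H he hy hr h5]
  simp

end Boundary

/-! ### The a priori estimate on a coordinate ball -/

section Cutoff

variable {p : Cn n} {R : ℝ} (hR : 0 < R)

variable (p) in
/-- A bump function which is one on the ball of radius `R`. -/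
def bumpIn : ContDiffBump p := ⟨R, 3 / 2 * R, hR, by linarith⟩

variable (p) in
/-- A bump function which is one on a neighbourhood of the support of `bumpIn`. -/
def bumpOut : ContDiffBump p := ⟨2 * R, 3 * R, by linarith, by linarith⟩

variable (p) in
/-- Extension of a locally defined function to `ℂⁿ`. -/
def glob {F : Type*} [NormedAddCommGroup F] [NormedSpace ℝ F] (f : Cn n → F) (y : Cn n) : F :=
  bumpOut p hR y • f y

variable {F : Type*} [NormedAddCommGroup F] [NormedSpace ℝ F] {f : Cn n → F} {W : Set (Cn n)}

lemma tsupport_bumpIn : tsupport (bumpIn p hR) = Metric.closedBall p (3 / 2 * R) :=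
  ContDiffBump.tsupport_eq _

lemma contDiff_glob (hW : IsOpen W) (hpW : Metric.closedBall p (3 * R) ⊆ W)
    (hf : SmoothOn f W) : Smooth (glob p hR f) := by
  refine contDiff_of_tsupport hW ((bumpOut p hR).contDiff.contDiffOn.smul hf) ?_
  refine (tsupport_smul_subset_left _ _).trans ?_
  rw [ContDiffBump.tsupport_eq]
  exact hpW

lemma glob_eventuallyEq {y : Cn n} (hy : y ∈ Metric.closedBall p (3 / 2 * R)) :
    glob p hR f =ᶠ[𝓝 y] f := by
  have h1 : y ∈ Metric.ball p (2 * R) := by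
    rw [Metric.mem_closedBall] at hy
    rw [Metric.mem_ball]
    linarith
  filter_upwards [Metric.isOpen_ball.mem_nhds h1] with z hz
  rw [glob, (bumpOut p hR).one_of_mem_closedBall (Metric.ball_subset_closedBall hz), one_smul]

lemma bumpIn_le (y : Cn n) : |bumpIn p hR y| ≤ 1 := by
  rw [abs_of_nonneg (bumpIn p hR).nonneg]
  exact (bumpIn p hR).le_one

end Cutoff

variable (g ρ) in
/-- `‖ϑu‖²`, where `ϑu = 0` in degree zero. -/
def thetaN : {q : ℕ} → (𝓕 q) → ℝ
  | 0, _ => 0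
  | _ + 1, u => nSq g ρ (thetaG g u)

lemma nSq_nonneg (hgJ : IsHermitianMetric g) (u : 𝓕 q) :
    0 ≤ nSq g ρ u := integral_nonneg fun x => formNormSq_nonneg hgJ u x

lemma thetaN_nonneg (hgJ : IsHermitianMetric g) (u : 𝓕 q) : 0 ≤ thetaN g ρ u := by
  cases q with
  | zero => exact le_rfl
  | succ q => exact nSq_nonneg hgJ _

namespace IsInvariantDomain

variable (H : IsInvariantDomain g ρ)
include H

lemma exists_setIntegral_formNormSq_le (he : e ∈ 𝒰) {K : Set (Cn n)}
    (hK : IsCompact K) (hKt : K ⊆ e.target) : ∃ D > 0, ∀ (q : ℕ) (u : 𝓕 q),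
      IsSmoothForm u → IntegrableOn (fun y => formNormSq g (u (e.symm y))) (K ∩ e.symm ⁻¹' dom ρ) ∧
      ∫ y in K ∩ e.symm ⁻¹' dom ρ, formNormSq g (u (e.symm y)) ≤ D * nSq g ρ u := by
  obtain ⟨D, hD, h⟩ := H.exists_setIntegral_chart_le he hK hKt
  refine ⟨D, hD, fun q u hu => ?_⟩
  have hu2 := H.isL2Form hu
  exact h (fun x => formNormSq g (u x)) (fun x => formNormSq_nonneg H.herm u x) hu2.integrable
    (continuous_re.comp_aestronglyMeasurable (H.aesm_chart_formInner hu2 hu2 he))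

section

variable {W : Set (Cn n)} {E : Fin n → Cn n → Cn n} {p : Cn n} {R : ℝ} (hR : 0 < R)

lemma reg_glob_eq : reg (bumpIn p hR) (glob p hR fun y => ρ (e.symm y)) =
      Metric.closedBall p (3 / 2 * R) ∩ e.symm ⁻¹' dom ρ := by
  ext y
  rw [reg, tsupport_bumpIn, Set.inter_comm]
  refine and_congr_right fun hy => ?_
  change glob p hR (fun y => ρ (e.symm y)) y < 0 ↔ ρ (e.symm y) < 0
  rw [(glob_eventuallyEq hR hy).eq_of_nhds]

/-- Integrals over the regularized domain are controlled by norms on the domain. -/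
lemma setIntegral_reg_le {f : Cn n → ℝ} (hf : ∀ y, 0 ≤ f y) {q₁ q₂ : ℕ}
    {u : (x : M') → AltForm n q₁ x} {v : (x : M') → AltForm n q₂ x} {D a b : ℝ}
    (ha : 0 ≤ a) (hb : 0 ≤ b) (hu : IntegrableOn (fun y => formNormSq g (u (e.symm y)))
        (Metric.closedBall p (3 / 2 * R) ∩ e.symm ⁻¹' dom ρ) ∧
      ∫ y in Metric.closedBall p (3 / 2 * R) ∩ e.symm ⁻¹' dom ρ, formNormSq g (u (e.symm y)) ≤
        D * nSq g ρ u) (hv : IntegrableOn (fun y => formNormSq g (v (e.symm y)))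
        (Metric.closedBall p (3 / 2 * R) ∩ e.symm ⁻¹' dom ρ) ∧
      ∫ y in Metric.closedBall p (3 / 2 * R) ∩ e.symm ⁻¹' dom ρ, formNormSq g (v (e.symm y)) ≤
        D * nSq g ρ v) (hm : MeasurableSet (reg (bumpIn p hR) (glob p hR fun y => ρ (e.symm y))))
    (hle : ∀ y ∈ Metric.closedBall p (3 / 2 * R),
      f y ≤ a * formNormSq g (u (e.symm y)) + b * formNormSq g (v (e.symm y))) :
    ∫ y in reg (bumpIn p hR) (glob p hR fun y => ρ (e.symm y)), f y ≤
      D * (a * nSq g ρ u + b * nSq g ρ v) := by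
  rw [H.reg_glob_eq hR] at hm ⊢
  have h1 := integral_mono_of_nonneg (ae_of_all _ hf) ((hu.1.const_mul a).add (hv.1.const_mul b))
    ((ae_restrict_mem hm).mono fun y hy => hle y hy.1)
  refine h1.trans ?_
  simp only [Pi.add_apply]
  rw [integral_add (hu.1.const_mul a) (hv.1.const_mul b), integral_const_mul, integral_const_mul]
  have h2 := mul_le_mul_of_nonneg_left hu.2 ha
  have h3 := mul_le_mul_of_nonneg_left hv.2 hb
  linarith

set_option maxHeartbeats 800000 in
/-- The a priori estimate on a small ball, for forms satisfying the frame condition. -/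
lemma exists_estimate_of_frameCond (he : e ∈ 𝒰) (hW : IsOpen W) (hWt : W ⊆ e.target)
    (hE : ∀ a, SmoothOn (E a) W) (hEu : ∀ y ∈ W, IsUnitary (metB g e y) fun a => E a y)
    (hpW : Metric.closedBall p (3 * R) ⊆ W) (q : ℕ) (C₁ : ℝ) :
    ∃ C, 0 ≤ C ∧ ∀ u : 𝓕 q, IsSmoothForm u →
      FrameCond (bumpIn p hR) (glob p hR fun y => ρ (e.symm y)) (fun a => glob p hR (E a)) C₁
        (glob p hR (inChart e u)) →
      ∫ y in Metric.ball p R ∩ e.symm ⁻¹' dom ρ, ‖ð (inChart e u) y‖ ^ 2 ≤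
        C * (nSq g ρ (dbarG u) + thetaN g ρ u + nSq g ρ u) := by
  set K := Metric.closedBall p (3 / 2 * R) with hKdef
  have hK : IsCompact K := isCompact_closedBall p _
  have hKW : K ⊆ W := (Metric.closedBall_subset_closedBall (by linarith)).trans hpW
  have hKt : K ⊆ e.target := hKW.trans hWt
  set φ := bumpIn p hR with hφ
  set r := glob p hR fun y => ρ (e.symm y) with hr
  set E' : Fin n → Cn n → Cn n := fun a => glob p hR (E a) with hE'
  have hts : tsupport φ = K := tsupport_bumpIn hR
  have hB := isMet_metB g H.herm he
  have hρs : SmoothOn (fun y => ρ (e.symm y)) W :=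
    (contDiffOn_comp_symm he H.defining.smooth).mono hWt
  have hrs : Smooth r := contDiff_glob hR hW hpW hρs
  have hE's : ∀ a, Smooth (E' a) := fun a => contDiff_glob hR hW hpW (hE a)
  have hE'e : ∀ y ∈ K, ∀ a, E' a y = E a y := fun y hy a => (glob_eventuallyEq hR hy).eq_of_nhds
  have hE'u : ∀ y ∈ K, IsUnitary (metB g e y) fun a => E' a y := fun y hy => by
    simp only [hE'e y hy]
    exact hEu y (hKW hy)
  obtain ⟨C₂, -, hfr⟩ := hB.exists_frame_bound hK hKt (fun a => (hE's a).continuous.continuousOn)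
    hE'u q
  rw [← hts] at hfr
  obtain ⟨C₀, hC₀, hest⟩ := exists_local_estimate φ.contDiff φ.hasCompactSupport (bumpIn_le hR) hrs
    hE's q C₁ hfr
  obtain ⟨D, hD, hDu⟩ := H.exists_setIntegral_formNormSq_le he hK hKt
  obtain ⟨Cf, hCf, hf⟩ := hB.exists_fSq_bounds hK hKt q
  have hm : MeasurableSet (reg φ r) := measurableSet_reg hrs.continuous
  have hφ2 : ∀ y, φ y ^ 2 ≤ 1 := fun y => (sq_le_one_iff_abs_le_one _).mpr (bumpIn_le hR y)
  have hUsq : ∀ u : 𝓕 q, ∀ y ∈ K,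
      ‖inChart e u y‖ ^ 2 ≤ Cf * formNormSq g (u (e.symm y)) := fun u y hy => by
    rw [formNormSq_symm he (hKt hy)]
    exact (hf y hy _).1
  obtain ⟨Ct, hCt, ht⟩ : ∃ Ct, 0 ≤ Ct ∧ ∀ u : 𝓕 q, IsSmoothForm u →
      ∫ y in reg φ r, φ y ^ 2 * thetaSq E' (glob p hR (inChart e u)) y ≤
        Ct * (thetaN g ρ u + nSq g ρ u) := by
    cases q with
    | zero =>
      refine ⟨1, zero_le_one, fun u hu => ?_⟩
      simp only [thetaSq, mul_zero, integral_zero, thetaN, zero_add, one_mul]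
      exact nSq_nonneg H.herm u
    | succ q =>
      obtain ⟨Ct, hCt, ht⟩ := hB.exists_thetaSq_le hK hKt q
      refine ⟨D * (Ct + Ct * Cf), by positivity, fun u hu => ?_⟩
      have h1 := H.setIntegral_reg_le (f := fun y => φ y ^ 2 * thetaSq E'
        (glob p hR (inChart e u)) y) hR (fun y => mul_nonneg (sq_nonneg _) (thetaSq_nonneg _ _))
        hCt (b := Ct * Cf) (by positivity) (hDu _ _ (isSmoothForm_thetaG H.act H.herm H.inv hu))
        (hDu _ u hu) hm (fun y hy => ?_)
      · refine h1.trans ?_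
        have h2 := nSq_nonneg (ρ := ρ) H.herm u
        have h3 := nSq_nonneg (ρ := ρ) H.herm (thetaG g u)
        have h4 : 0 ≤ D * (Ct * Cf) * nSq g ρ (thetaG g u) := by positivity
        have h5 : 0 ≤ D * Ct * nSq g ρ u := by positivity
        simp only [thetaN]
        nlinarith
      · have h2 : thetaSq E' (glob p hR (inChart e u)) y = thetaSq E' (inChart e u) y := by
          simp only [thetaSq, compB, (glob_eventuallyEq hR hy).fderiv_eq]
        have h3 := ht _ (hu.smooth e he) (fun z hz => hu.isT0 he hz) E' y hy (hE'u y hy)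
        have h4 := mul_le_mul_of_nonneg_left (hUsq u y hy) hCt
        have h5 : fSq (gramB (metB g e y)) (theta (metB g e) (inChart e u) y) =
            formNormSq g (thetaG g u (e.symm y)) := by
          rw [formNormSq_symm he (hKt hy), inChart_thetaG H.act H.herm H.inv hu he (hKt hy)]
        rw [h2]
        refine (mul_le_of_le_one_left (thetaSq_nonneg _ _) (hφ2 y)).trans (h3.trans ?_)
        rw [h5]
        linarith
  refine ⟨C₀ * (D * (cq (q + 1))⁻¹ + Ct + D * Cf), ?_, fun u hu hF => ?_⟩
  · have := cq_pos (q + 1)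
    positivity
  set U := glob p hR (inChart e u) with hU
  have hUs : Smooth U := contDiff_glob hR hW hpW ((hu.smooth e he).mono hWt)
  have hUd : ∀ y ∈ K, ð U y = ð (inChart e u) y := fun y hy =>
    (glob_eventuallyEq hR hy).fderiv_eq
  have hU0 : ∀ y ∈ (Set.univ : Set (Cn n)), IsT0 (U y) := by
    intro y _
    by_cases hy : y ∈ Metric.closedBall p (3 * R)
    · exact (t0Sub n q).smul_mem (bumpOut p hR y : ℂ) (hu.isT0 he (hWt (hpW hy)))
    · have h1 : bumpOut p hR y = 0 := (bumpOut p hR).zero_of_le_dist (by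
        rw [Metric.mem_closedBall, not_le] at hy
        exact hy.le)
      have h2 : U y = 0 := by
        rw [hU, glob, h1]
        exact zero_smul ℝ _
      rw [h2]
      exact (t0Sub n q).zero_mem
  have h1 := hest U hUs (fun y v => isT0_fderiv isOpen_univ hU0 trivial
    (hUs.differentiable (by simp) y) v) hF
  have hn0 := nSq_nonneg (ρ := ρ) H.herm u
  have hn1 := nSq_nonneg (ρ := ρ) H.herm (dbarG u)
  have hn2 := thetaN_nonneg (ρ := ρ) H.herm u
  have h2 : ∫ y in reg φ r, φ y ^ 2 * dbarSq E' U y ≤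
      D * ((cq (q + 1))⁻¹ * nSq g ρ (dbarG u) + 0 * nSq g ρ u) := by
    have hc := cq_pos (q + 1)
    refine H.setIntegral_reg_le hR (fun y => mul_nonneg (sq_nonneg _) (dbarSq_nonneg _ _))
      (by positivity) le_rfl (hDu _ _ (isSmoothForm_dbarG H.act hu)) (hDu _ u hu) hm fun y hy => ?_
    refine (mul_le_of_le_one_left (dbarSq_nonneg _ _) (hφ2 y)).trans ?_
    have h3 : dbarSq E' U y = dbarSq E' (inChart e u) y := by
      simp only [dbarSq, hUd y hy]
    rw [h3, dbarSq_eq (hB.herm y (hKt hy)) (hE'u y hy) (fun v => isT0_fderiv e.open_target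
      (fun z hz => hu.isT0 he hz) (hKt hy) (((hu.smooth e he).contDiffAt
        (e.open_target.mem_nhds (hKt hy))).differentiableAt (by simp)) v),
      formNormSq_symm he (hKt hy), inChart_dbarG H.act hu he (hKt hy), zero_mul, add_zero]
  have h3 : ∫ y in reg φ r, ‖U y‖ ^ 2 ≤ D * (Cf * nSq g ρ u + 0 * nSq g ρ u) := by
    refine H.setIntegral_reg_le hR (fun y => sq_nonneg _) hCf.le le_rfl (hDu _ u hu)
      (hDu _ u hu) hm fun y hy => ?_
    have h4 : U y = inChart e u y := (glob_eventuallyEq hR hy).eq_of_nhds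
    rw [h4, zero_mul, add_zero]
    exact hUsq u y hy
  have h4 : ∫ y in Metric.ball p R ∩ e.symm ⁻¹' dom ρ, ‖ð (inChart e u) y‖ ^ 2 ≤
      ∫ y in reg φ r, φ y ^ 2 * ‖ð U y‖ ^ 2 := by
    have hsub : Metric.ball p R ∩ e.symm ⁻¹' dom ρ ⊆ reg φ r := by
      rw [hφ, hr, H.reg_glob_eq hR]
      exact inter_subset_inter_left _ (Metric.ball_subset_closedBall.trans
        (Metric.closedBall_subset_closedBall (by linarith)))
    have hmb : MeasurableSet (Metric.ball p R ∩ e.symm ⁻¹' dom ρ) := by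
      have h5 : Metric.ball p R ∩ e.symm ⁻¹' dom ρ = Metric.ball p R ∩ reg φ r := by
        refine Set.Subset.antisymm (fun y hy => ⟨hy.1, hsub hy⟩) fun y hy => ⟨hy.1, ?_⟩
        have h6 := hy.2
        rw [hφ, hr, H.reg_glob_eq hR] at h6
        exact h6.2
      rw [h5]
      exact Metric.isOpen_ball.measurableSet.inter hm
    have h5 : ∫ y in Metric.ball p R ∩ e.symm ⁻¹' dom ρ, ‖ð (inChart e u) y‖ ^ 2 =
        ∫ y in Metric.ball p R ∩ e.symm ⁻¹' dom ρ, φ y ^ 2 * ‖ð U y‖ ^ 2 := by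
      refine setIntegral_congr_fun hmb fun y hy => ?_
      have h6 : φ y = 1 := φ.one_of_mem_closedBall (Metric.ball_subset_closedBall hy.1)
      have h7 : y ∈ K := (Metric.ball_subset_closedBall.trans
        (Metric.closedBall_subset_closedBall (by linarith))) hy.1
      beta_reduce
      rw [h6, hUd y h7, one_pow, one_mul]
    rw [h5]
    have hc1 := continuous_norm_fderiv hUs
    have hc2 : Continuous φ := φ.continuous
    exact setIntegral_mono_set (integrableOn_reg φ.hasCompactSupport (by fun_prop))
      (ae_of_all _ fun y => mul_nonneg (sq_nonneg _) (sq_nonneg _)) hsub.eventuallyLE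
  have h5 := ht u hu
  refine h4.trans (h1.trans ?_)
  rw [mul_assoc]
  refine mul_le_mul_of_nonneg_left ?_ hC₀
  have hc : 0 ≤ D * (cq (q + 1))⁻¹ := by
    have := cq_pos (q + 1)
    positivity
  have hd : 0 ≤ D * Cf := by positivity
  nlinarith [mul_nonneg hc hn0, mul_nonneg hc hn2, mul_nonneg hCt hn1, mul_nonneg hd hn1,
    mul_nonneg hd hn2]

end

end IsInvariantDomain

/-! ### The boundary condition in a frame -/

lemma two_mul_norm_covBar_le (ξ : Cn n →L[ℝ] ℝ) (v : Cn n) :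
    2 * ‖covBar ξ v‖ ≤ |ξ v| + |ξ (î • v)| := by
  rw [covBar, norm_mul]
  have h1 := norm_add_le ((ξ v : ℝ) : ℂ) (î * (ξ (î • v) : ℝ))
  rw [norm_mul, norm_I, one_mul, norm_real, norm_real, norm_eq_abs, norm_eq_abs] at h1
  norm_num
  linarith

lemma abs_le_two_mul_norm_covBar (ξ : Cn n →L[ℝ] ℝ) (v : Cn n) :
    |ξ (î • v)| ≤ 2 * ‖covBar ξ v‖ := by
  have h1 := Complex.abs_im_le_norm (2 * covBar ξ v)
  rw [norm_mul, Complex.norm_ofNat] at h1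
  refine le_trans (le_of_eq ?_) h1
  simp [covBar]

/-- The components of `U` with an index `b` are controlled by the contraction of `U` with a covector
which is noncharacteristic only in the direction `b`. -/
lemma mul_norm_apply_le {E : Fin n → Cn n} {ξ : Cn n →L[ℝ] ℝ} {U : Form n (q + 1)} {w : Form n q}
    (hw : w = (2 : ℂ) • ∑ a, conj (covBar ξ (E a)) • U.curryLeft (E a)) {M : ℝ}
    (hM : 0 ≤ M) (hE : ∀ a, ‖E a‖ ≤ M) {δ : ℝ} {I : Fin (q + 1) → Fin n} {s : Fin (q + 1)}
    (hδ : δ ≤ |ξ (î • E (I s))|) : δ * ‖U fun j => E (I j)‖ ≤ M ^ q * ‖w‖ +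
      (∑ a ∈ Finset.univ.erase (I s), (|ξ (E a)| + |ξ (î • E a)|)) * (M ^ (q + 1) * ‖U‖) := by
  set b := I s with hb
  set K : Fin q → Cn n := fun j => E (I (s.succAbove j)) with hK
  set z : Fin n → ℂ := fun a => U (Matrix.vecCons (E a) K) with hz
  have h1 : ‖U fun j => E (I j)‖ = ‖z b‖ := by
    have h2 : (fun j => E (I j)) = s.insertNth (E b) K := by
      rw [Fin.eq_insertNth_iff]
      exact ⟨rfl, rfl⟩
    rw [h2, ContinuousAlternatingMap.map_insertNth, norm_smul, norm_pow, norm_neg, norm_one,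
      one_pow, one_mul]
  have h2 : w K = 2 * ∑ a, conj (covBar ξ (E a)) * z a := by
    rw [hw, ContinuousAlternatingMap.smul_apply, ContinuousAlternatingMap.sum_apply _ _]
    rfl
  have hzM : ∀ a, ‖z a‖ ≤ M ^ (q + 1) * ‖U‖ := fun a =>
    norm_form_apply_le U _ hM fun j => by
      refine Fin.cases ?_ (fun j => ?_) j
      · exact hE a
      · exact hE _
  rw [← Finset.add_sum_erase _ _ (mem_univ b)] at h2
  have h3 : 2 * ‖covBar ξ (E b)‖ * ‖z b‖ ≤ ‖w K‖ +
      ∑ a ∈ Finset.univ.erase b, 2 * ‖covBar ξ (E a)‖ * ‖z a‖ := by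
    have h4 : 2 * (conj (covBar ξ (E b)) * z b) = w K -
        ∑ a ∈ Finset.univ.erase b, 2 * (conj (covBar ξ (E a)) * z a) := by
      rw [h2, ← mul_sum]
      ring
    have h5 : ∀ a, ‖2 * (conj (covBar ξ (E a)) * z a)‖ = 2 * ‖covBar ξ (E a)‖ * ‖z a‖ := fun a => by
      rw [norm_mul, norm_mul, RCLike.norm_conj, Complex.norm_ofNat, mul_assoc]
    rw [← h5, h4]
    refine (norm_sub_le _ _).trans (add_le_add le_rfl ((norm_sum_le _ _).trans (le_of_eq ?_)))
    exact sum_congr rfl fun a _ => h5 a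
  rw [h1, sum_mul]
  have h4 := mul_le_mul_of_nonneg_right (hδ.trans (abs_le_two_mul_norm_covBar ξ _))
    (norm_nonneg (z b))
  refine h4.trans (h3.trans (add_le_add (norm_form_apply_le w K hM fun j => hE _)
    (sum_le_sum fun a _ => ?_)))
  exact mul_le_mul (two_mul_norm_covBar_le ξ _) (hzM a) (norm_nonneg _) (by positivity)

section Local

variable (g ρ) in
/-- The first boundary condition of the `∂̄`-Neumann problem, in a weak form. -/
def BdryCond : {q : ℕ} → (𝓕 q) → Prop
  | 0, _ => True
  | _ + 1, u => Tendsto (fun ε => ∫ x in dom ρ, bl ε (ρ x) * formNormSq g (bdryForm g ρ u x) ∂(vol g))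
      (𝓝[>] 0) (𝓝 0)

variable {W : Set (Cn n)} {E : Fin n → Cn n → Cn n} {p : Cn n} {R : ℝ} (hR : 0 < R)

lemma bNull_bdryForm (H : IsInvariantDomain g ρ) (he : e ∈ 𝒰) (hW : IsOpen W)
    (hWt : W ⊆ e.target) (hpW : Metric.closedBall p (3 * R) ⊆ W)
    {u : 𝓕 (q + 1)} (hu : IsFourierForm m u) (hb : BdryCond g ρ u) :
    BNull (bumpIn p hR) (glob p hR fun y => ρ (e.symm y))
      fun y => ‖glob p hR (inChart e (bdryForm g ρ u)) y‖ ^ 2 := by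
  set K := Metric.closedBall p (3 / 2 * R) with hKdef
  have hK : IsCompact K := isCompact_closedBall p _
  have hKt : K ⊆ e.target :=
    ((Metric.closedBall_subset_closedBall (by linarith)).trans hpW).trans hWt
  have hρs : SmoothOn (fun y => ρ (e.symm y)) W :=
    (contDiffOn_comp_symm he H.defining.smooth).mono hWt
  have hrs := contDiff_glob hR hW hpW hρs
  have hw := H.isFourierForm_bdryForm hu
  have hw2 := H.isL2Form hw.toIsSmoothForm
  set w := bdryForm g ρ u with hwd
  set φ := bumpIn p hR with hφ
  set r := glob p hR fun y => ρ (e.symm y) with hr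
  obtain ⟨D, hD, hDb⟩ := H.exists_setIntegral_chart_le he hK hKt
  obtain ⟨C, hC, hf⟩ := (isMet_metB g H.herm he).exists_fSq_bounds hK hKt q
  have hm : MeasurableSet (reg φ r) := measurableSet_reg hrs.continuous
  have hlim := Tendsto.const_mul (C * D) hb
  rw [mul_zero] at hlim
  refine squeeze_zero' ?_ ?_ hlim
  · filter_upwards [self_mem_nhdsWithin] with ε hε
    exact integral_nonneg fun y =>
      mul_nonneg (mul_nonneg (bl_nonneg hε _) (sq_nonneg _)) (sq_nonneg _)
  filter_upwards [self_mem_nhdsWithin] with ε hε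
  have hε' : 0 < ε := hε
  have hcb : Continuous fun x => (bl ε (ρ x) : ℂ) * formInner g (w x) (w x) := by
    have h1 := continuous_formInner H.herm hw.toIsSmoothForm hw.toIsSmoothForm
    have h2 : Continuous fun x => (bl ε (ρ x) : ℂ) :=
      continuous_ofReal.comp ((contDiff_bl ε).continuous.comp H.defining.smooth.continuous)
    exact h2.mul h1
  have hint : IntegrableOn (fun x => bl ε (ρ x) * formNormSq g (w x)) (dom ρ) (vol g) := by
    refine (H.integrableOn_of_continuous hcb).re.congr (ae_of_all _ fun x => ?_)
    exact re_ofReal_mul _ _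
  have hmeas : AEStronglyMeasurable
      (fun y => bl ε (ρ (e.symm y)) * formNormSq g (w (e.symm y)))
      (volume.restrict (e.target ∩ e.symm ⁻¹' dom ρ)) := by
    refine AEStronglyMeasurable.mul ?_ (continuous_re.comp_aestronglyMeasurable
      (H.aesm_chart_formInner hw2 hw2 he))
    have h1 : ContinuousOn (fun y => bl ε (ρ (e.symm y))) e.target :=
      (contDiff_bl ε).continuous.comp_continuousOn
        (H.defining.smooth.continuous.comp_continuousOn e.continuousOn_symm)
    exact (h1.aestronglyMeasurable e.open_target.measurableSet).mono_measure
      (Measure.restrict_mono inter_subset_left le_rfl)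
  have h1 := hDb _ (fun x => mul_nonneg (bl_nonneg hε' _) (formNormSq_nonneg H.herm w x)) hint hmeas
  have h2 : ∫ y, bl ε (r y) * φ y ^ 2 * ‖glob p hR (inChart e w) y‖ ^ 2 =
      ∫ y in reg φ r, bl ε (r y) * φ y ^ 2 * ‖glob p hR (inChart e w) y‖ ^ 2 := by
    refine (setIntegral_eq_integral_of_forall_compl_eq_zero fun y hy => ?_).symm
    by_cases hyφ : y ∈ tsupport φ
    · have h3 : ¬ r y < 0 := fun h => hy ⟨h, hyφ⟩
      rw [bl_eq_zero_of_gt hε' (by push Not at h3; linarith), zero_mul, zero_mul]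
    · rw [image_eq_zero_of_notMem_tsupport hyφ]
      ring
  rw [h2]
  have h3 := H.reg_glob_eq (p := p) (e := e) hR
  rw [h3] at hm ⊢
  have h4 := integral_mono_of_nonneg (f := fun y => bl ε (r y) * φ y ^ 2 *
      ‖glob p hR (inChart e w) y‖ ^ 2) (ae_of_all _ fun y =>
      mul_nonneg (mul_nonneg (bl_nonneg hε' _) (sq_nonneg _)) (sq_nonneg _)) (h1.1.const_mul C)
    ((ae_restrict_mem hm).mono fun y hy => ?_)
  · refine h4.trans ?_
    rw [integral_const_mul, mul_assoc]
    exact mul_le_mul_of_nonneg_left h1.2 hC.le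
  · have h5 : r y = ρ (e.symm y) := (glob_eventuallyEq hR hy.1).eq_of_nhds
    have h6 : glob p hR (inChart e w) y = inChart e w y := (glob_eventuallyEq hR hy.1).eq_of_nhds
    have h7 := (hf y hy.1 (inChart e w y)).1
    rw [← formNormSq_symm he (hKt hy.1)] at h7
    have h8 : φ y ^ 2 ≤ 1 := (sq_le_one_iff_abs_le_one _).mpr (bumpIn_le hR y)
    beta_reduce
    rw [h5, h6]
    have h9 := bl_nonneg hε' (ρ (e.symm y))
    calc bl ε (ρ (e.symm y)) * φ y ^ 2 * ‖inChart e w y‖ ^ 2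
        ≤ bl ε (ρ (e.symm y)) * 1 * (C * formNormSq g (w (e.symm y))) := by gcongr
      _ = C * (bl ε (ρ (e.symm y)) * formNormSq g (w (e.symm y))) := by ring

/-- The frame condition near a boundary point. -/
lemma exists_frameCond (H : IsTransversalDomain g ρ) (he : e ∈ 𝒰) (hW : IsOpen W)
    (hWt : W ⊆ e.target) (hE : ∀ a, SmoothOn (E a) W)
    (hEu : ∀ y ∈ W, IsUnitary (metB g e y) fun a => E a y)
    (hpW : Metric.closedBall p (3 * R) ⊆ W) {b : Fin n} {s : Cn n → ℝ} (hs : ContinuousOn s W)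
    (hEb : ∀ y ∈ W, E b y = s y • genT e y) {N : Cn n} {c δ : ℝ} (hc : 0 < c) (hδ : 0 < δ)
    (hN : ∀ y ∈ W, c ≤ ð (fun y => ρ (e.symm y)) y N)
    (hIb : ∀ y ∈ W, δ ≤ |ð (fun y => ρ (e.symm y)) y (î • E b y)|) (q : ℕ) (m : ℤ) :
    ∃ C₁, ∀ u : 𝓕 q, IsFourierForm m u → BdryCond g ρ u →
      FrameCond (bumpIn p hR) (glob p hR fun y => ρ (e.symm y)) (fun a => glob p hR (E a)) C₁
        (glob p hR (inChart e u)) := by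
  have H' := H.toIsInvariantDomain
  set K := Metric.closedBall p (3 / 2 * R) with hKdef
  have hK : IsCompact K := isCompact_closedBall p _
  have hKW : K ⊆ W := (Metric.closedBall_subset_closedBall (by linarith)).trans hpW
  have hKt : K ⊆ e.target := hKW.trans hWt
  have hρs : SmoothOn (fun y => ρ (e.symm y)) W :=
    (contDiffOn_comp_symm he H.defining.smooth).mono hWt
  have hrs := contDiff_glob hR hW hpW hρs
  have hE's : ∀ a, Smooth (glob p hR (E a)) := fun a => contDiff_glob hR hW hpW (hE a)
  set φ := bumpIn p hR with hφ
  set r := glob p hR fun y => ρ (e.symm y) with hr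
  set E' : Fin n → Cn n → Cn n := fun a => glob p hR (E a) with hE'
  have hts : tsupport φ = K := tsupport_bumpIn hR
  have hφc := φ.hasCompactSupport
  have hφn : Continuous φ := φ.continuous
  have hrn : Continuous r := hrs.continuous
  have hre : ∀ y ∈ K, r y = ρ (e.symm y) := fun y hy => (glob_eventuallyEq hR hy).eq_of_nhds
  have hrd : ∀ y ∈ K, ð r y = ð (fun y => ρ (e.symm y)) y := fun y hy =>
    (glob_eventuallyEq hR hy).fderiv_eq
  have hE'e : ∀ y ∈ K, ∀ a, E' a y = E a y := fun y hy a => (glob_eventuallyEq hR hy).eq_of_nhds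
  have htan : ∀ y ∈ K, ∀ a, tanSize r (E' a) y = tanSize (fun y => ρ (e.symm y)) (E a) y :=
    fun y hy a => by rw [tanSize, tanSize, hrd y hy, hE'e y hy]
  have htanc : ∀ a, Continuous (tanSize r (E' a)) := fun a => by
    have h1 := hrs.continuous_fderiv (by simp)
    have h2 := (hE's a).continuous
    have h3 : Continuous fun y => î • E' a y := h2.const_smul î
    exact (h1.clm_apply h2).abs.add (h1.clm_apply h3).abs
  have htan0 : ∀ a ≠ b, ∀ y ∈ K, r y = 0 → tanSize r (E' a) y = 0 := fun a hab y hy h0 => by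
    rw [htan y hy]
    have h1 : s y ≠ 0 := by
      intro h2
      have h3 := (hEu y (hKW hy) b b).1
      beta_reduce at h3
      rw [if_pos rfl, hEb y (hKW hy), h2, zero_smul, map_zero] at h3
      exact zero_ne_one h3
    exact tanSize_eq_zero H he (hKt hy) (by rw [← hre y hy, h0]) (hEu y (hKW hy)) h1
      (hEb y (hKW hy)) hab
  obtain ⟨Cb, hCb, hbl⟩ := exists_integral_bl_le φ.contDiff hφc hrs hc (N := N) fun y hy => by
    rw [hts] at hy
    rw [hrd y hy]
    exact hN y (hKW hy)
  choose Mb hMb using fun a => hK.exists_bound_of_continuousOn (hE's a).continuous.continuousOn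
  set M := ∑ a, |Mb a| with hM
  have hM0 : 0 ≤ M := sum_nonneg fun a _ => abs_nonneg _
  have hEM : ∀ y ∈ K, ∀ a, ‖E' a y‖ ≤ M := fun y hy a => ((hMb a y hy).trans (le_abs_self _)).trans
    (single_le_sum (f := fun a => |Mb a|) (fun _ _ => abs_nonneg _) (mem_univ a))
  obtain ⟨Cs, hCs⟩ := hK.exists_bound_of_continuousOn (hs.mono hKW)
  obtain ⟨Cg, hCg, hg⟩ := exists_fderiv_genT_le H.act he hK hKt q m
  refine ⟨M ^ q * (|Cs| * Cg), fun u hu hbc a => ?_⟩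
  set U := glob p hR (inChart e u) with hU
  have hUs : Smooth U := contDiff_glob hR hW hpW ((hu.smooth e he).mono hWt)
  have hUe : ∀ y ∈ K, U y = inChart e u y := fun y hy => (glob_eventuallyEq hR hy).eq_of_nhds
  have hUd : ∀ y ∈ K, ð U y = ð (inChart e u) y := fun y hy =>
    (glob_eventuallyEq hR hy).fderiv_eq
  by_cases hab : a ≠ b
  · refine Or.inl (bNull_of_eq_zero hφc hφn hrn (htanc a)
      (fun y => add_nonneg (abs_nonneg _) (abs_nonneg _)) hCb hbl fun y hy h0 => ?_)
    rw [hts] at hy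
    exact htan0 a hab y hy h0
  push Not at hab
  subst hab
  refine Or.inr ⟨fun I j hI => ?_, fun y hy I => ?_⟩
  · cases q with
    | zero => exact j.elim0
    | succ q =>
      have hw := H'.isFourierForm_bdryForm hu
      set w := glob p hR (inChart e (bdryForm g ρ u)) with hwd
      have hws : Smooth w := contDiff_glob hR hW hpW ((hw.smooth e he).mono hWt)
      have hwn : Continuous fun y => ‖w y‖ := continuous_norm.comp hws.continuous
      have hUn : Continuous fun y => ‖U y‖ := continuous_norm.comp hUs.continuous
      have n1 : BNull φ r fun y => ‖w y‖ :=
        bNull_of_sq hφc hφn hrn hwn (fun y => norm_nonneg _) hCb hbl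
          (bNull_bdryForm hR H' he hW hWt hpW hu hbc)
      have hsc : Continuous fun y => ∑ a ∈ Finset.univ.erase (I j), tanSize r (E' a) y :=
        continuous_finsetSum _ fun a _ => htanc a
      have hts0 : ∀ a y, 0 ≤ tanSize r (E' a) y := fun a y =>
        add_nonneg (abs_nonneg _) (abs_nonneg _)
      have n2 : BNull φ r fun y => (∑ a ∈ Finset.univ.erase (I j), tanSize r (E' a) y) *
          (M ^ (q + 1) * ‖U y‖) := by
        refine bNull_of_eq_zero hφc hφn hrn (by fun_prop) (fun y => mul_nonneg
          (sum_nonneg fun a _ => hts0 a y)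
          (mul_nonneg (by positivity) (norm_nonneg _))) hCb hbl fun y hy h0 => ?_
        rw [hts] at hy
        rw [sum_eq_zero fun a ha => htan0 a (hI ▸ Finset.ne_of_mem_erase ha) y hy h0, zero_mul]
      have n3 := ((n1.const_mul (M ^ q)).add hφc hφn hrn (by fun_prop) (by fun_prop) n2).const_mul
        δ⁻¹
      have hUE : Continuous fun y => ‖U y fun s => E' (I s) y‖ := by
        have h1 := contDiffOn_form_apply hUs.contDiffOn (s := Set.univ)
          (fun s => (hE's (I s)).contDiffOn)
        exact (continuousOn_univ.mp h1.continuousOn).norm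
      refine BNull.mono hφc hφn hrn hUE (by fun_prop) (fun y => norm_nonneg _) (fun y hy => ?_) n3
      rw [hts] at hy
      rw [inv_mul_eq_div, le_div_iff₀ hδ, mul_comm]
      refine mul_norm_apply_le (ξ := ð r y) (E := fun a => E' a y) ?_ hM0 (hEM y hy) ?_
      · have h1 : w y = inChart e (bdryForm g ρ u) y := (glob_eventuallyEq hR hy).eq_of_nhds
        simp only [h1, hrd y hy, hUe y hy, hE'e y hy]
        rw [H'.inChart_bdryForm hu.toIsSmoothForm he (hKt hy)]
        exact (isMet_metB g H.herm he).theta_smul_eq (hu.smooth e he) (fun z hz => hu.isT0 he hz)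
          (contDiffOn_comp_symm he H.defining.smooth) (hKt hy) (hEu y (hKW hy))
      · simp only [hrd y hy, hE'e y hy, hI]
        exact hIb y (hKW hy)
  · have hyK : y ∈ K := hts ▸ hy.2
    have h1 : compB E' U a I y = (ð U y (E' a y) fun s => E' (I s) y) - compA E' U a I y := by
      simp only [compA, compB, holPart, conjPart_apply, ContinuousAlternatingMap.smul_apply,
        ContinuousAlternatingMap.sub_apply, ContinuousAlternatingMap.add_apply, smul_eq_mul]
      ring
    have h2 : ‖ð U y (E' a y)‖ ≤ |Cs| * Cg * ‖U y‖ := by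
      rw [hUd y hyK, hE'e y hyK, hEb y (hKW hyK), hUe y hyK,
        (ð (inChart e u) y).map_smul, mul_assoc]
      refine (norm_smul (β := Form n q) _ _).le.trans ?_
      exact mul_le_mul ((hCs y hyK).trans (le_abs_self _)) (hg u hu y hyK)
        (norm_nonneg (E := Form n q) _) (abs_nonneg _)
    rw [h1, add_comm]
    refine (norm_sub_le _ _).trans (add_le_add ?_ le_rfl)
    refine (norm_form_apply_le _ _ hM0 fun j => hEM y hyK _).trans ?_
    rw [mul_assoc]
    exact mul_le_mul_of_nonneg_left h2 (by positivity)

end Local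

/-! ### The a priori estimate -/

lemma genT_ne_zero (H : IsTransversalDomain g ρ) (he : e ∈ 𝒰) {p : Cn n}
    (hp : p ∈ e.target) (h0 : ρ (e.symm p) = 0) : genT e p ≠ 0 := by
  intro h
  have h1 := fderiv_rho_I_genT H he hp h0
  rw [h, smul_zero, map_zero] at h1
  exact lt_irrefl _ h1

/-- A unitary frame near a boundary point, adapted to the boundary. -/
lemma exists_adapted_frame (H : IsTransversalDomain g ρ) (hn : 0 < n) (he : e ∈ 𝒰)
    {p : Cn n} (hp : p ∈ e.target) (h0 : ρ (e.symm p) = 0) :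
    ∃ (W : Set (Cn n)) (E : Fin n → Cn n → Cn n) (s : Cn n → ℝ) (N : Cn n) (c δ : ℝ), IsOpen W ∧
      p ∈ W ∧ W ⊆ e.target ∧ (∀ a, SmoothOn (E a) W) ∧
      (∀ y ∈ W, IsUnitary (metB g e y) fun a => E a y) ∧ ContinuousOn s W ∧
      (∀ y ∈ W, E ⟨0, hn⟩ y = s y • genT e y) ∧ 0 < c ∧ 0 < δ ∧
      (∀ y ∈ W, c ≤ ð (fun y => ρ (e.symm y)) y N) ∧
      ∀ y ∈ W, δ ≤ |ð (fun y => ρ (e.symm y)) y (î • E ⟨0, hn⟩ y)| := by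
  have hB := isMet_metB g H.herm he
  have hτ := contDiffOn_genT H.act he
  have hτp := genT_ne_zero H he hp h0
  obtain ⟨W, E, hWo, hpW, hWt, hE, hEu, hE0⟩ := exists_unitary_frame hn e.open_target hB.smooth
    hB.herm hp (genT e) hτ hτp
  set s : Cn n → ℝ := fun y => (Real.sqrt (metB g e y (genT e y) (genT e y)))⁻¹ with hs
  have hs0 : ∀ y ∈ W, s y ≠ 0 := fun y hy h => by
    have h3 := (hEu y hy ⟨0, hn⟩ ⟨0, hn⟩).1
    beta_reduce at h3
    rw [if_pos rfl, hE0 y hy, show (Real.sqrt (metB g e y (genT e y) (genT e y)))⁻¹ = 0 from h,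
      zero_smul, map_zero] at h3
    exact zero_ne_one h3
  have hsc : ContinuousOn s W := by
    refine ContinuousOn.inv₀ (ContinuousOn.sqrt ?_) fun y hy h => hs0 y hy (by rw [hs]; simp [h])
    exact (((hB.smooth.clm_apply hτ).clm_apply hτ).continuousOn).mono hWt
  have hDr : ContinuousOn (fun y => ð (fun y => ρ (e.symm y)) y) W :=
    (((contDiffOn_comp_symm he H.defining.smooth).fderiv_of_isOpen e.open_target
      (m := ∞) (by simp)).continuousOn).mono hWt
  have h1 := fderiv_rho_I_genT H he hp h0
  set ξ := ð (fun y => ρ (e.symm y)) with hξ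
  set N := -(î • genT e p) with hN
  have hNp : 0 < ξ p N := by rw [hN, map_neg]; linarith
  have hEp : 0 < |ξ p (î • E ⟨0, hn⟩ p)| := by
    rw [hE0 p hpW, smul_comm, map_smul, smul_eq_mul, abs_pos]
    exact mul_ne_zero (hs0 p hpW) h1.ne
  have k1 : ∀ᶠ y in 𝓝 p, ξ p N / 2 < ξ y N :=
    ((hDr.clm_apply continuousOn_const).continuousAt (hWo.mem_nhds hpW)).eventually_const_lt
      (half_lt_self hNp)
  have hEI : ContinuousOn (fun y => î • E ⟨0, hn⟩ y) W :=
    (hE ⟨0, hn⟩).continuousOn.const_smul î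
  have k2 : ∀ᶠ y in 𝓝 p, |ξ p (î • E ⟨0, hn⟩ p)| / 2 < |ξ y (î • E ⟨0, hn⟩ y)| :=
    ((hDr.clm_apply hEI).abs.continuousAt (hWo.mem_nhds hpW)).eventually_const_lt
      (half_lt_self hEp)
  obtain ⟨V, hVs, hVo, hpV⟩ := eventually_nhds_iff.mp (k1.and k2)
  exact ⟨W ∩ V, E, s, N, _, _, hWo.inter hVo, ⟨hpW, hpV⟩, inter_subset_left.trans hWt,
    fun a => (hE a).mono inter_subset_left, fun y hy => hEu y hy.1,
    hsc.mono inter_subset_left, fun y hy => hE0 y hy.1, half_pos hNp, half_pos hEp,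
    fun y hy => (hVs y hy.2).1.le, fun y hy => (hVs y hy.2).2.le⟩

lemma exists_closedBall_subset {W : Set (Cn n)} (hW : IsOpen W) {p : Cn n} (hp : p ∈ W) :
    ∃ R > 0, Metric.closedBall p (3 * R) ⊆ W := by
  obtain ⟨R, hR, h⟩ := Metric.nhds_basis_closedBall.mem_iff.mp (hW.mem_nhds hp)
  exact ⟨R / 3, by positivity, by rwa [mul_div_cancel₀ _ three_ne_zero]⟩

/-- The a priori estimate near a point. -/
lemma exists_estimate_ball (H : IsTransversalDomain g ρ) (hn : 0 < n) (he : e ∈ 𝒰)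
    {p : Cn n} (hp : p ∈ e.target) (q : ℕ) (m : ℤ) :
    ∃ R > 0, Metric.closedBall p R ⊆ e.target ∧ ∃ C, 0 ≤ C ∧ ∀ u : 𝓕 q,
      IsFourierForm m u → BdryCond g ρ u →
      ∫ y in Metric.ball p R ∩ e.symm ⁻¹' dom ρ, ‖ð (inChart e u) y‖ ^ 2 ≤
        C * (nSq g ρ (dbarG u) + thetaN g ρ u + nSq g ρ u) := by
  have H' := H.toIsInvariantDomain
  by_cases h0 : ρ (e.symm p) = 0
  · obtain ⟨W, E, s, N, c, δ, hWo, hpW, hWt, hE, hEu, hs, hE0, hc, hδ, hN, hI⟩ :=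
      exists_adapted_frame H hn he hp h0
    obtain ⟨R, hR, hRW⟩ := exists_closedBall_subset hWo hpW
    obtain ⟨C₁, h1⟩ := exists_frameCond hR H he hWo hWt hE hEu hRW hs hE0 hc hδ hN hI q m
    obtain ⟨C, hC, h2⟩ := H'.exists_estimate_of_frameCond hR he hWo hWt hE hEu hRW q C₁
    exact ⟨R, hR, ((Metric.closedBall_subset_closedBall (by linarith)).trans hRW).trans hWt, C, hC,
      fun u hu hb => h2 u hu.toIsSmoothForm (h1 u hu hb)⟩
  · have hV : IsOpen (e.target ∩ (fun y => ρ (e.symm y)) ⁻¹' {0}ᶜ) :=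
      (contDiffOn_comp_symm he H.defining.smooth).continuousOn.isOpen_inter_preimage e.open_target
        isOpen_compl_singleton
    have hB := isMet_metB g H.herm he
    have hv : EuclideanSpace.single (⟨0, hn⟩ : Fin n) (1 : ℂ) ≠ 0 := by simp
    obtain ⟨W, E, hWo, hpW, hWt, hE, hEu, -⟩ := exists_unitary_frame hn hV
      (hB.smooth.mono inter_subset_left) (fun y hy => hB.herm y hy.1) ⟨hp, h0⟩
      (fun _ => EuclideanSpace.single (⟨0, hn⟩ : Fin n) (1 : ℂ)) contDiffOn_const hv
    have hWt' : W ⊆ e.target := hWt.trans inter_subset_left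
    obtain ⟨R, hR, hRW⟩ := exists_closedBall_subset hWo hpW
    obtain ⟨C, hC, h2⟩ := H'.exists_estimate_of_frameCond hR he hWo hWt' hE hEu hRW q 0
    refine ⟨R, hR, ((Metric.closedBall_subset_closedBall (by linarith)).trans hRW).trans hWt', C, hC,
      fun u hu _ => h2 u hu.toIsSmoothForm fun a => Or.inl ?_⟩
    have hrs := contDiff_glob hR hWo hRW ((contDiffOn_comp_symm he H.defining.smooth).mono hWt')
    refine bNull_of_forall_ne (bumpIn p hR).hasCompactSupport hrs.continuous fun y hy => ?_
    rw [tsupport_bumpIn] at hy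
    rw [(glob_eventuallyEq hR hy).eq_of_nhds]
    exact (hWt (hRW (Metric.closedBall_subset_closedBall (by linarith) hy))).2

lemma setIntegral_union_le {f : Cn n → ℝ} (hf : ∀ y, 0 ≤ f y) {S T : Set (Cn n)}
    (hS : IntegrableOn f S) (hT : IntegrableOn f T) :
    ∫ y in S ∪ T, f y ≤ (∫ y in S, f y) + ∫ y in T, f y := by
  rw [← integral_add_measure hS hT]
  exact integral_mono_measure (Measure.restrict_union_le _ _) (ae_of_all _ hf)
    (Integrable.add_measure hS hT)

/-- The a priori estimate on a compact subset of a chart. -/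
lemma exists_estimate_compact (H : IsTransversalDomain g ρ) (hn : 0 < n)
    (he : e ∈ 𝒰) {K : Set (Cn n)} (hK : IsCompact K) (hKt : K ⊆ e.target) (q : ℕ) (m : ℤ) :
    ∃ C, 0 ≤ C ∧ ∀ u : 𝓕 q, IsFourierForm m u → BdryCond g ρ u →
      IntegrableOn (fun y => ‖ð (inChart e u) y‖ ^ 2) (K ∩ e.symm ⁻¹' dom ρ) ∧
      ∫ y in K ∩ e.symm ⁻¹' dom ρ, ‖ð (inChart e u) y‖ ^ 2 ≤
        C * (nSq g ρ (dbarG u) + thetaN g ρ u + nSq g ρ u) := by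
  refine hK.induction_on (p := fun S => ∃ C, 0 ≤ C ∧ ∀ u : 𝓕 q, IsFourierForm m u → BdryCond g ρ u →
      IntegrableOn (fun y => ‖ð (inChart e u) y‖ ^ 2) (S ∩ e.symm ⁻¹' dom ρ) ∧
      ∫ y in S ∩ e.symm ⁻¹' dom ρ, ‖ð (inChart e u) y‖ ^ 2 ≤
        C * (nSq g ρ (dbarG u) + thetaN g ρ u + nSq g ρ u)) ?_ ?_ ?_ ?_
  · exact ⟨0, le_rfl, fun u _ _ => by simp⟩
  · rintro S T hST ⟨C, hC, h⟩
    refine ⟨C, hC, fun u hu hb => ?_⟩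
    have hsub := inter_subset_inter_left (e.symm ⁻¹' dom ρ) hST
    exact ⟨(h u hu hb).1.mono_set hsub, (setIntegral_mono_set (h u hu hb).1
      (ae_of_all _ fun y => sq_nonneg _) hsub.eventuallyLE).trans (h u hu hb).2⟩
  · rintro S T ⟨C, hC, h⟩ ⟨D, hD, h'⟩
    refine ⟨C + D, add_nonneg hC hD, fun u hu hb => ?_⟩
    rw [Set.union_inter_distrib_right]
    refine ⟨(h u hu hb).1.union (h' u hu hb).1, (setIntegral_union_le (fun y => sq_nonneg _)
      (h u hu hb).1 (h' u hu hb).1).trans ?_⟩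
    rw [add_mul]
    exact add_le_add (h u hu hb).2 (h' u hu hb).2
  · intro p hp
    obtain ⟨R, hR, hRt, C, hC, h⟩ := exists_estimate_ball H hn he (hKt hp) q m
    refine ⟨Metric.ball p R, mem_nhdsWithin_of_mem_nhds (Metric.ball_mem_nhds p hR), C, hC,
      fun u hu hb => ⟨?_, h u hu hb⟩⟩
    have h1 : ContinuousOn (fun y => ð (inChart e u) y) e.target :=
      ((hu.smooth e he).fderiv_of_isOpen e.open_target (m := ∞) (by simp)).continuousOn
    have h2 : ContinuousOn (fun y => ‖ð (inChart e u) y‖) e.target :=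
      (continuous_norm (E := Cn n →L[ℝ] Form n q)).comp_continuousOn h1
    have h3 : ContinuousOn (fun y => ‖ð (inChart e u) y‖ ^ 2) (Metric.closedBall p R) :=
      (h2.pow 2).mono hRt
    exact (h3.integrableOn_compact (isCompact_closedBall p R)).mono_set
      (inter_subset_left.trans Metric.ball_subset_closedBall)

section

variable {χ : M' → ℝ}

/-- The components of a local coefficient and its derivative. -/
lemma localCoeff_sq_le (he : e ∈ 𝒰) (hχ : ContMDiff 𝓘(ℝ, Cn n) 𝓘(ℝ, ℝ) ∞ χ)
    {u : 𝓕 q} (hu : IsSmoothForm u) {y : Cn n} (hy : y ∈ e.target) {D : ℝ}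
    (h1 : |χ (e.symm y)| ≤ 1) (hD : ‖ð (fun y => χ (e.symm y)) y‖ ≤ D)
    (I : Fin q → Fin n × Fin 2) (a : Fin n × Fin 2) :
    ‖localCoeff e χ u I y‖ ^ 2 ≤ ‖inChart e u y‖ ^ 2 ∧ ‖ð (localCoeff e χ u I) y (rb n a)‖ ^ 2 ≤
      2 * D ^ 2 * ‖inChart e u y‖ ^ 2 + 2 * ‖ð (inChart e u) y‖ ^ 2 := by
  have hrb : ∀ a, ‖rb n a‖ ≤ 1 := fun a => by
    rw [rb, norm_smul]
    split_ifs <;> simp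
  have hev : ∀ α : Form n q, ‖α fun s => rb n (I s)‖ ≤ ‖α‖ := fun α => by
    simpa using norm_form_apply_le α (fun s => rb n (I s)) zero_le_one fun s => hrb _
  refine ⟨?_, ?_⟩
  · rw [localCoeff, norm_mul, norm_real, norm_eq_abs]
    exact pow_le_pow_left₀ (by positivity) ((mul_le_of_le_one_left (norm_nonneg _) h1).trans
      (hev _)) 2
  · have hf : HasFDerivAt (fun y => χ (e.symm y)) (ð (fun y => χ (e.symm y)) y) y :=
      (((contDiffOn_comp_symm he hχ).contDiffAt (e.open_target.mem_nhds hy)).differentiableAt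
        (by simp)).hasFDerivAt
    have hU : HasFDerivAt (inChart e u) (ð (inChart e u) y) y :=
      (((hu.smooth e he).contDiffAt (e.open_target.mem_nhds hy)).differentiableAt
        (by simp)).hasFDerivAt
    have hV : HasFDerivAt (fun y => inChart e u y fun s => rb n (I s))
        ((evL fun s => rb n (I s)).comp
          (ð (inChart e u) y)) y :=
      (evL fun s => rb n (I s)).hasFDerivAt.comp y hU
    have hL : HasFDerivAt (localCoeff e χ u I) _ y := hf.smul hV
    have h2 : ð (localCoeff e χ u I) y (rb n a) =
        χ (e.symm y) • (ð (inChart e u) y (rb n a) fun s => rb n (I s)) +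
        ð (fun y => χ (e.symm y)) y (rb n a) • (inChart e u y fun s => rb n (I s)) := by
      rw [hL.fderiv]
      rfl
    have h3 : ‖ð (inChart e u) y (rb n a) fun s => rb n (I s)‖ ≤ ‖ð (inChart e u) y‖ := by
      refine (hev _).trans (((ð (inChart e u) y).le_opNorm _).trans ?_)
      exact mul_le_of_le_one_right (ContinuousLinearMap.opNorm_nonneg _) (hrb a)
    have h4 : ‖ð (fun y => χ (e.symm y)) y (rb n a)‖ ≤ D :=
      (ContinuousLinearMap.le_opNorm _ _).trans
        ((mul_le_of_le_one_right (norm_nonneg _) (hrb a)).trans hD)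
    have h5 : ‖ð (localCoeff e χ u I) y (rb n a)‖ ≤ ‖ð (inChart e u) y‖ + D * ‖inChart e u y‖ := by
      rw [h2]
      refine (norm_add_le _ _).trans (add_le_add ?_ ?_)
      · rw [norm_smul, norm_eq_abs]
        exact (mul_le_of_le_one_left (norm_nonneg _) h1).trans h3
      · rw [norm_smul]
        exact mul_le_mul h4 (hev _) (norm_nonneg _) ((norm_nonneg _).trans h4)
    refine (pow_le_pow_left₀ (norm_nonneg _) h5 2).trans ?_
    nlinarith [sq_nonneg (‖ð (inChart e u) y‖ - D * ‖inChart e u y‖)]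

/-- One term of the Sobolev norm is controlled by the derivatives on a compact set. -/
lemma exists_localSobolevSq_le (H : IsTransversalDomain g ρ) (hn : 0 < n)
    (he : e ∈ 𝒰) (hχ : ContMDiff 𝓘(ℝ, Cn n) 𝓘(ℝ, ℝ) ∞ χ) (h1 : ∀ x, |χ x| ≤ 1)
    (hs : tsupport χ ⊆ e.source) (q : ℕ) (m : ℤ) :
    ∃ C, 0 ≤ C ∧ ∀ u : 𝓕 q, IsFourierForm m u → BdryCond g ρ u → localSobolevSq g (dom ρ) e χ u ≤
        C * (nSq g ρ (dbarG u) + thetaN g ρ u + nSq g ρ u) := by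
  have H' := H.toIsInvariantDomain
  set K := e '' (tsupport χ ∩ closure (dom ρ)) with hKd
  have hK : IsCompact K := (H.cpt.inter_left (isClosed_tsupport χ)).image_of_continuousOn
    (e.continuousOn.mono (inter_subset_left.trans hs))
  have hKt : K ⊆ e.target := by
    rintro _ ⟨x, hx, rfl⟩
    exact e.map_source (hs hx.1)
  obtain ⟨Cd, hCd, hd⟩ := exists_estimate_compact H hn he hK hKt q m
  obtain ⟨D, hD, hDu⟩ := H'.exists_setIntegral_formNormSq_le he hK hKt
  obtain ⟨Cf, hCf, hf⟩ := (isMet_metB g H.herm he).exists_fSq_bounds hK hKt q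
  obtain ⟨B, hB, hBd⟩ := exists_dens_bounds H.herm he hK hKt
  obtain ⟨L, hL⟩ := hK.exists_bound_of_continuousOn
    (((contDiffOn_comp_symm he hχ).fderiv_of_isOpen e.open_target (m := ∞)
      (by simp)).continuousOn.mono hKt)
  set A : ℝ := ((Fintype.card (Fin n × Fin 2) : ℕ) : ℝ) with hA
  set A' : ℝ := ((Fintype.card (Fin q → Fin n × Fin 2) : ℕ) : ℝ) with hA'
  have hA0 : 0 ≤ A := Nat.cast_nonneg _
  refine ⟨A' * (B * ((1 + A * (2 * L ^ 2)) * Cf * D + A * 2 * Cd)), by positivity,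
    fun u hu hb => ?_⟩
  have n1 := nSq_nonneg (ρ := ρ) H.herm u
  have n2 := nSq_nonneg (ρ := ρ) H.herm (dbarG u)
  have n3 := thetaN_nonneg (ρ := ρ) H.herm u
  have hmΩ : MeasurableSet (e.target ∩ e.symm ⁻¹' dom ρ) := H'.isOpen_chart_dom.measurableSet
  have hsub : K ∩ e.symm ⁻¹' dom ρ ⊆ e.target ∩ e.symm ⁻¹' dom ρ :=
    inter_subset_inter_left _ hKt
  have hmK : MeasurableSet (K ∩ e.symm ⁻¹' dom ρ) := by
    have : K ∩ e.symm ⁻¹' dom ρ = K ∩ (e.target ∩ e.symm ⁻¹' dom ρ) := by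
      rw [← Set.inter_assoc, Set.inter_eq_self_of_subset_left hKt]
    rw [this]
    exact hK.measurableSet.inter hmΩ
  have key : ∀ I : Fin q → Fin n × Fin 2, ∫ x in dom ρ ∩ e.source, (‖localCoeff e χ u I (e x)‖ ^ 2 +
        ∑ a : Fin n × Fin 2, ‖ð (localCoeff e χ u I) (e x) (rb n a)‖ ^ 2) ∂(vol g) ≤
      B * ((1 + A * (2 * L ^ 2)) * Cf * D + A * 2 * Cd) *
        (nSq g ρ (dbarG u) + thetaN g ρ u + nSq g ρ u) := by
    intro I
    set F : Cn n → ℝ := fun y => ‖localCoeff e χ u I y‖ ^ 2 +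
        ∑ a : Fin n × Fin 2, ‖ð (localCoeff e χ u I) y (rb n a)‖ ^ 2 with hF
    have hF0 : ∀ y, 0 ≤ F y := fun y => by positivity
    have hlc : SmoothOn (localCoeff e χ u I) e.target :=
      (ofRealCLM.contDiff.comp_contDiffOn (contDiffOn_comp_symm he hχ)).mul
        (contDiffOn_form_apply_const (hu.smooth e he) _)
    have hFc : ContinuousOn F e.target := by
      have h2 := (hlc.fderiv_of_isOpen e.open_target (m := ∞) (by simp)).continuousOn
      exact (hlc.continuousOn.norm.pow 2).add (continuousOn_finsetSum _ fun a _ =>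
        (h2.clm_apply continuousOn_const).norm.pow 2)
    have hFe : Set.EqOn (fun y => F (e (e.symm y))) F (e.target ∩ e.symm ⁻¹' dom ρ) :=
      fun y hy => congrArg F (e.right_inv hy.1)
    have hm : AEStronglyMeasurable (fun y => F (e (e.symm y)))
        (volume.restrict (e.target ∩ e.symm ⁻¹' dom ρ)) :=
      ((hFc.mono inter_subset_left).congr hFe).aestronglyMeasurable hmΩ
    have h2 := setIntegral_chart H.act H.inv H.herm he H'.measurableSet_dom
      (h := fun x => F (e x)) hm
    refine (le_of_eq h2).trans ?_
    have h3 : ∫ y in e.target ∩ e.symm ⁻¹' dom ρ, dens (metB g e y) • F (e (e.symm y)) =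
        ∫ y in K ∩ e.symm ⁻¹' dom ρ, dens (metB g e y) • F (e (e.symm y)) := by
      refine setIntegral_eq_of_subset_of_forall_sdiff_eq_zero hmΩ hsub fun y hy => ?_
      have h4 : e.symm y ∉ tsupport χ := fun h5 => hy.2
        ⟨⟨e.symm y, ⟨h5, subset_closure hy.1.2⟩, e.right_inv hy.1.1⟩, hy.1.2⟩
      have h5 : localCoeff e χ u I =ᶠ[𝓝 y] fun _ => 0 := by
        filter_upwards [(e.symm.continuousAt hy.1.1).preimage_mem_nhds
          ((isClosed_tsupport χ).isOpen_compl.mem_nhds h4)] with z hz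
        rw [localCoeff, image_eq_zero_of_notMem_tsupport hz, ofReal_zero, zero_mul]
      rw [e.right_inv hy.1.1, hF]
      beta_reduce
      rw [h5.fderiv_eq, h5.eq_of_nhds]
      simp
    rw [h3]
    obtain ⟨d1, d2⟩ := hd u hu hb
    obtain ⟨f1, f2⟩ := hDu q u hu.toIsSmoothForm
    have h4 := integral_mono_of_nonneg (f := fun y => dens (metB g e y) • F (e (e.symm y)))
      ((ae_restrict_mem hmK).mono fun y hy => smul_nonneg
        ((isMet_metB g H.herm he).herm y (hKt hy.1)).dens_pos.le (hF0 _))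
      ((f1.const_mul (B * ((1 + A * (2 * L ^ 2)) * Cf))).add (d1.const_mul (B * (A * 2))))
      ((ae_restrict_mem hmK).mono fun y hy => ?_)
    · refine h4.trans ?_
      simp only [Pi.add_apply]
      rw [integral_add (f1.const_mul _) (d1.const_mul _), integral_const_mul, integral_const_mul]
      have h5 := mul_le_mul_of_nonneg_left f2
        (show 0 ≤ B * ((1 + A * (2 * L ^ 2)) * Cf) by positivity)
      have h6 := mul_le_mul_of_nonneg_left d2 (show 0 ≤ B * (A * 2) by positivity)
      have h7 : 0 ≤ B * ((1 + A * (2 * L ^ 2)) * Cf) * D * (nSq g ρ (dbarG u) + thetaN g ρ u) := by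
        positivity
      nlinarith
    · have hyt := hKt hy.1
      have h5 := fun a => localCoeff_sq_le he hχ hu.toIsSmoothForm hyt (h1 _) (hL y hy.1) I a
      have h6 : F y ≤ (1 + A * (2 * L ^ 2)) * ‖inChart e u y‖ ^ 2 +
          A * 2 * ‖ð (inChart e u) y‖ ^ 2 := by
        have h7 : ∑ a : Fin n × Fin 2, ‖ð (localCoeff e χ u I) y (rb n a)‖ ^ 2 ≤
            ∑ _a : Fin n × Fin 2, (2 * L ^ 2 * ‖inChart e u y‖ ^ 2 +
              2 * ‖ð (inChart e u) y‖ ^ 2) := sum_le_sum fun a _ => (h5 a).2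
        rw [sum_const, card_univ, nsmul_eq_mul, ← hA] at h7
        have h8 := (h5 (⟨0, hn⟩, 0)).1
        simp only [hF]
        linarith
      have h7 := (hf y hy.1 (inChart e u y)).1
      rw [← formNormSq_symm he hyt] at h7
      have h8 := mul_le_mul_of_nonneg_left h7 (show 0 ≤ 1 + A * (2 * L ^ 2) by positivity)
      have h9 : dens (metB g e y) * F y ≤ B * F y :=
        mul_le_mul_of_nonneg_right (hBd y hy.1).2 (hF0 y)
      have h10 := mul_le_mul_of_nonneg_left (h6.trans (add_le_add_left h8 _)) hB.le
      simp only [Pi.add_apply, e.right_inv hyt, smul_eq_mul]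
      linarith
  rw [localSobolevSq]
  refine (sum_le_sum fun I _ => key I).trans (le_of_eq ?_)
  rw [sum_const, card_univ, nsmul_eq_mul, ← hA']
  ring

end

/-! ### The energy of a form in the domain of the Laplacian -/

lemma two_mul_re_formInner_le (hgJ : IsHermitianMetric g) (u v : 𝓕 q) (x : M') :
    2 * (formInner g (u x) (v x)).re ≤ formNormSq g (u x) + formNormSq g (v x) :=
  two_mul_re_fInner_le (isHerm_inn hgJ x) (frm u x) (frm v x)

lemma re_formInner_add (hgJ : IsHermitianMetric g) (u d b : 𝓕 q) (x : M') :
    (formInner g (u x) (d x + b x)).re = (formInner g (d x) (u x)).re +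
      (formInner g (u x) (b x)).re := by
  have h1 : formInner g (u x) (d x + b x) = formInner g (u x) (d x) + formInner g (u x) (b x) :=
    fInner_add_right (frm u x) (frm d x) (frm b x)
  have h2 := congrArg Complex.re (fInner_conj_symm (isHerm_inn hgJ x) (frm u x) (frm d x))
  rw [h1, add_re]
  rw [conj_re] at h2
  exact congrArg (· + _) h2

lemma formNormSq_add (hgJ : IsHermitianMetric g) (d b : 𝓕 q) (x : M') :
    formNormSq g (d x + b x) = formNormSq g (d x) + formNormSq g (b x) +
      2 * (formInner g (d x) (b x)).re := by
  have h2 := congrArg Complex.re (fInner_conj_symm (isHerm_inn hgJ x) (frm d x) (frm b x))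
  rw [conj_re] at h2
  have h3 : formNormSq g (d x + b x) = (fInner (gramB (inn g x)) (frm d x + frm b x)
    (frm d x + frm b x)).re := rfl
  have h4 : formNormSq g (d x) = (fInner (gramB (inn g x)) (frm d x) (frm d x)).re := rfl
  have h5 : formNormSq g (b x) = (fInner (gramB (inn g x)) (frm b x) (frm b x)).re := rfl
  rw [h3, h4, h5, formInner_eq, fInner_add_left, fInner_add_right, fInner_add_right]
  simp only [add_re]
  linarith

namespace IsInvariantDomain

variable (H : IsInvariantDomain g ρ)
include H

lemma re_l2Inner {a b : 𝓕 q} (ha : IsL2Form g (dom ρ) a) (hb : IsL2Form g (dom ρ) b) :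
    (l2Inner g (dom ρ) a b).re = ∫ x in dom ρ, (formInner g (a x) (b x)).re ∂(vol g) :=
  (integral_re (H.integrableOn_formInner ha hb)).symm

/-- `2 Re (u | f) ≤ ‖u‖² + ‖f‖²` where `f = d + b` almost everywhere. -/
lemma two_mul_re_add_le {u d b f : 𝓕 q} (hu : IsL2Form g (dom ρ) u)
    (hd : IsL2Form g (dom ρ) d) (hb : IsL2Form g (dom ρ) b)
    (hf : ∀ᵐ x ∂((vol g).restrict (dom ρ)), f x = d x + b x) :
    2 * ((l2Inner g (dom ρ) d u).re + (l2Inner g (dom ρ) u b).re) ≤ nSq g ρ u + nSq g ρ f := by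
  have i1 : Integrable (fun x => (formInner g (d x) (u x)).re) ((vol g).restrict (dom ρ)) :=
    (H.integrableOn_formInner hd hu).re
  have i2 : Integrable (fun x => (formInner g (u x) (b x)).re) ((vol g).restrict (dom ρ)) :=
    (H.integrableOn_formInner hu hb).re
  have i3 : Integrable (fun x => (formInner g (d x) (b x)).re) ((vol g).restrict (dom ρ)) :=
    (H.integrableOn_formInner hd hb).re
  have h1 : nSq g ρ f = ∫ x in dom ρ, (formNormSq g (d x) + formNormSq g (b x) +
      2 * (formInner g (d x) (b x)).re) ∂(vol g) := by
    refine integral_congr_ae (hf.mono fun x hx => ?_)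
    beta_reduce
    rw [hx, formNormSq_add H.herm]
  have i4 : Integrable (fun x => formNormSq g (d x) + formNormSq g (b x) +
      2 * (formInner g (d x) (b x)).re) ((vol g).restrict (dom ρ)) :=
    (hd.integrable.add hb.integrable).add (i3.const_mul 2)
  rw [h1, nSq, ← integral_add hu.integrable i4, H.re_l2Inner hd hu, H.re_l2Inner hu hb, ← integral_add i1 i2,
    ← integral_const_mul]
  refine integral_mono ((i1.add i2).const_mul 2) (hu.integrable.add i4) fun x => ?_
  have h2 := two_mul_re_formInner_le H.herm u (fun x => (d x + b x : AltForm n q x)) x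
  rw [re_formInner_add H.herm, formNormSq_add H.herm] at h2
  exact h2

lemma nSq_dbarG {u : 𝓕 q} (hu : IsSmoothForm u) {a : 𝓕 (q + 1)} (ha : DbarGraph g (dom ρ) m u a) :
    nSq g ρ (dbarG u) = nSq g ρ a := by
  refine integral_congr_ae ((H.ae_eq_dbarG hu ha.2.1.toIsL2Form ha.2.2).mono fun x hx => ?_)
  exact congrArg (fSq (gramB (inn g x))) hx.symm

lemma nSq_eq_re {a : 𝓕 q} (ha : IsL2Form g (dom ρ) a) :
    nSq g ρ a = (l2Inner g (dom ρ) a a).re := (H.re_l2Inner ha ha).symm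

/-- The energy of a form in the domain of the Laplacian. -/
lemma energy_le (hec : ∀ i, ec i ∈ 𝒰) (hχ : χ.IsSubordinate fun i => (ec i).source) {u f : 𝓕 q}
    (hu : IsFourierForm m u) (hf : BoxGraph g (dom ρ) m q u f) :
    BdryCond g ρ u ∧ 2 * (nSq g ρ (dbarG u) + thetaN g ρ u) ≤ nSq g ρ u + nSq g ρ f := by
  have hu2 := H.isL2Form hu.toIsSmoothForm
  cases q with
  | zero =>
    obtain ⟨a, b, ha, hb, hfb⟩ := hf
    refine ⟨trivial, ?_⟩
    have h0 := H.isL2Form (hu.toIsSmoothForm.sub hu.toIsSmoothForm)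
    have h1 := H.two_mul_re_add_le (f := f) hu2 h0 hb.2.1.toIsL2Form (hfb.mono fun x hx => by
      rw [hx, sub_self, zero_add])
    have h2 : l2Inner g (dom ρ) (fun x => (u x - u x : AltForm n 0 x)) u = 0 :=
      integral_eq_zero_of_ae (ae_of_all _ fun x =>
        (fInner_sub_left (G := gramB (inn g x)) (frm u x) (frm u x) (frm u x)).trans (sub_self _))
    rw [h2, ← hb.2.2 u a ha, ← H.nSq_eq_re hb.1.toIsL2Form, Complex.zero_re, zero_add] at h1
    rw [H.nSq_dbarG hu.toIsSmoothForm ha, thetaN, add_zero]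
    exact h1
  | succ q =>
    obtain ⟨a, b, c, d, ha, hb, hc, hd, hfd⟩ := hf
    refine ⟨H.tendsto_bdryForm hu hc, ?_⟩
    have h1 := H.two_mul_re_add_le hu2 hd.2.1.toIsL2Form hb.2.1.toIsL2Form hfd
    rw [hc.2.2 c d hd, ← hb.2.2 u a ha, ← H.nSq_eq_re hb.1.toIsL2Form,
      ← H.nSq_eq_re hd.1.toIsL2Form] at h1
    have h2 := H.nSq_thetaG_le hec hχ hu hc
    rw [H.nSq_dbarG hu.toIsSmoothForm ha, thetaN]
    linarith

end IsInvariantDomain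

end DbarNeumann

end

theorem mainTheorem7 (n : ℕ) (M' : Type*) [TopologicalSpace M'] [T2Space M']
    [SecondCountableTopology M'] [ChartedSpace (DbarNeumann.Cn n) M']
    [IsManifold 𝓘(ℂ, DbarNeumann.Cn n) ω M'] [MeasurableSpace M'] [BorelSpace M']
    [MulAction Circle M'] (haction : DbarNeumann.IsHolomorphicCircleAction n M')
    -- the domain `M = {ρ < 0}` and its boundary `X = {ρ = 0}`
    (ρ : M' → ℝ) (hρ : DbarNeumann.IsInvariantDefiningFunction n ρ)
    (hM : IsCompact (closure (DbarNeumann.dom ρ)))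
    (hX : IsConnected (DbarNeumann.bdry ρ))
    (hXreg : ∃ x ∈ DbarNeumann.bdry ρ, ∀ θ ∈ Set.Ioo (0 : ℝ) (2 * Real.pi), Circle.exp θ • x ≠ x)
    (htrans : DbarNeumann.IsTransversal n ρ)
    (hsign : ∀ x ∈ DbarNeumann.bdry ρ,
      DbarNeumann.dfun n ρ x (DbarNeumann.J n x (DbarNeumann.T n x)) < 0)
    -- the Hermitian metric
    (g : DbarNeumann.RMetric n M') (hgJ : DbarNeumann.IsHermitianMetric g)
    (hginv : DbarNeumann.IsInvariantMetric g) (hgX : DbarNeumann.IsAdaptedMetric g ρ)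
    -- the coordinate patches and the partition of unity used for the Sobolev norm
    (ι : Type) [Fintype ι] (e : ι → OpenPartialHomeomorph M' (DbarNeumann.Cn n))
    (he : ∀ i, e i ∈ atlas (DbarNeumann.Cn n) M')
    (χ : SmoothPartitionOfUnity ι 𝓘(ℝ, DbarNeumann.Cn n) M' (closure (DbarNeumann.dom ρ)))
    (hχ : χ.IsSubordinate (fun i => (e i).source))
    (q : ℕ) (hq : q < n) (m : ℤ) :
    ∃ C : ℝ, 0 < C ∧ ∀ u f : (x : M') → DbarNeumann.AltForm n q x,
      DbarNeumann.IsFourierForm m u →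
      DbarNeumann.BoxGraph g (DbarNeumann.dom ρ) m q u f →
      DbarNeumann.sobolevNorm g (DbarNeumann.dom ρ) e (fun i => χ i) u ≤
        C * (DbarNeumann.l2Norm g (DbarNeumann.dom ρ) f +
          DbarNeumann.l2Norm g (DbarNeumann.dom ρ) u) := by
  have H : DbarNeumann.IsTransversalDomain g ρ :=
    { act := haction, defining := hρ, cpt := hM, herm := hgJ, inv := hginv, trans := htrans,
      sign := hsign, adapted := hgX }
  have hn : 0 < n := lt_of_le_of_lt (Nat.zero_le q) hq
  have h1 := fun i => DbarNeumann.exists_localSobolevSq_le H hn (he i) (χ i).contMDiff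
    (fun x => (abs_of_nonneg (χ.nonneg i x)).trans_le (χ.le_one i x)) (hχ i) q m
  choose C hC h2 using h1
  have hS : 0 ≤ ∑ i, C i := Finset.sum_nonneg fun i _ => hC i
  refine ⟨2 * (∑ i, C i) + 1, by positivity, fun u f hu hf => ?_⟩
  obtain ⟨hb, hE⟩ := H.toIsInvariantDomain.energy_le he hχ hu hf
  have n1 := DbarNeumann.nSq_nonneg (ρ := ρ) hgJ u
  have n2 := DbarNeumann.nSq_nonneg (ρ := ρ) hgJ f
  set a := Real.sqrt (DbarNeumann.nSq g ρ u) with ha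
  set b := Real.sqrt (DbarNeumann.nSq g ρ f) with hbd
  have ha2 : a ^ 2 = DbarNeumann.nSq g ρ u := Real.sq_sqrt n1
  have hb2 : b ^ 2 = DbarNeumann.nSq g ρ f := Real.sq_sqrt n2
  have ha0 : 0 ≤ a := Real.sqrt_nonneg _
  have hb0 : 0 ≤ b := Real.sqrt_nonneg _
  change Real.sqrt _ ≤ (2 * (∑ i, C i) + 1) * (b + a)
  refine Real.sqrt_le_iff.mpr ⟨by positivity, ?_⟩
  refine (Finset.sum_le_sum fun i _ => h2 i u hu hb).trans ?_
  rw [← Finset.sum_mul]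
  have h3 : DbarNeumann.nSq g ρ (DbarNeumann.dbarG u) + DbarNeumann.thetaN g ρ u +
      DbarNeumann.nSq g ρ u ≤ 2 * (b + a) ^ 2 := by
    have h4 : (b + a) ^ 2 = b ^ 2 + 2 * (a * b) + a ^ 2 := by ring
    rw [ha2, hb2] at h4
    have h5 := mul_nonneg ha0 hb0
    linarith
  refine (mul_le_mul_of_nonneg_left h3 hS).trans ?_
  nlinarith [mul_nonneg hS (sq_nonneg (b + a)), sq_nonneg (b + a),
    mul_nonneg (sq_nonneg (∑ i, C i)) (sq_nonneg (b + a))]
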